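/- **Setting.** Fix $q>0$ and $\lambda\in\mathbb R$. Let $G(s)=\sqrt{s(s-1)}+\ln(\sqrt s+\sqrt{s-1})$ for $s\ge 1$, let $H=G^{-1}:[0,\infty)\to[1,\infty)$, and for $\theta\in\mathbb R$, $a>0$ put $R(\theta,a)=\frac{q}{a^2}H\big(\frac{a^2|\theta|}{q}\big)$. Let $L^2_{\theta,a}$ be the real $L^2$ space of $\{(\theta,a):\theta\in\mathbb R,\ a>0\}$ with the measure $d\theta\,da$, and $\Vert\cdot\Vert$ its norm (equal to $+\infty$ for functions outside the space). Write $\langle t\rangle=\sqrt{1+t^2}$. The equation is $$\partial_t\gamma=\lambda\{\widetilde\Psi,\gamma\},\qquad \{f,g\}=\partial_af\,\partial_\theta g-\partial_\theta f\,\partial_ag,\qquad \widetilde\Psi(\theta,a,t)=\iint\frac{\gamma^2(\vartheta,\alpha,t)\,d\vartheta\,d\alpha}{\max\{R(\theta+ta,a),R(\vartheta+t\alpha,\alpha)\}}.\tag{1}$$ A solution of (1) on $[0,T]$ is a differentiable curve $t\mapsto\gamma(t)\in L^2_{\theta,a}$, $0\le t\le T$, such that each $\gamma(t)$ has locally integrable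 weak derivatives $\partial_\theta\gamma(t)$, $\partial_a\gamma(t)$ and the derivative of the curve at $t$ is $\lambda\{\widetilde\Psi,\gamma\}(t)\in L^2_{\theta,a}$. **(A)** There is $\varepsilon^\ast>0$, depending only on $q,\lambda$, such that for all $0<\varepsilon_0\le\varepsilon_1\le\delta<\varepsilon^\ast$ and all $T\ge0$ the following holds. If $\gamma$ is a solution of (1) on $[0,T]$ and $$\Vert(a^{-20}+\theta^{20}+a^{20})\gamma(0)\Vert+\Vert(a+a^{-1})\partial_\theta\gamma(0)\Vert+\Vert a\partial_a\gamma(0)\Vert\le\varepsilon_0,$$ $$\Vert(a^{-20}+\theta^{20}+a^{20})\gamma(t)\Vert+\Vert(a+a^{-1})\partial_\theta\gamma(t)\Vert+\Vert a\partial_a\gamma(t)\Vert\le\varepsilon_1\langle t\rangle^\delta\qquad(0\le t\le T),$$ then for all $0\le t\le T$ $$\Vert(a^{-20}+a^{20})\gamma(t)\Vert+\Vert(a+a^{-1})\partial_\theta\gamma(t)\Vert\le\varepsilon_0+\varepsilon_1^{3/2},\qquad \Vert\theta^{20}\gamma(t)\Vert+\Vert a\partial_a\gamma(t)\Vert\le\varepsilon_0+\varepsilon_1^{3/2}t^\delta.$$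 **(B)** For $p\in\mathbb N_0$, $s\in\mathbb R$ let $\omega_{p,s}=\theta^pa^s$, $\omega^{(1)}_{p,s}=(a+a^{-1})\omega_{p,s}$, $\omega^{(2)}_{p,s}=a\,\omega_{p,s}$. A set $\mathcal I$ of such weights is called compatible if $\omega_{p,s}\in\mathcal I$ with $p\ge1$ implies $\omega_{p-1,s-3},\omega_{p-1,s}\in\mathcal I$. For every $(p,s)$ there are $\varepsilon^\ast>0$ and $C>0$, depending only on $q,\lambda,p,s$, such that for every compatible $\mathcal I$ containing the weight $1=\omega_{0,0}$ and $\omega_{p,s}$, all $0<\varepsilon_0\le\varepsilon_1\le\delta<\varepsilon^\ast$ and all $T\ge0$ the following holds. If $\gamma$ is a solution of (1) on $[0,T]$ such that for every $\omega_{m,r}\in\mathcal I$ and all $0\le t\le T$ $$\Vert\omega^{(1)}_{m,r}\partial_\theta\gamma(0)\Vert+\Vert\omega^{(2)}_{m,r}\partial_a\gamma(0)\Vert+\Vert(a^{20}+a^{-20}+\theta^{20})\gamma(0)\Vert\le\varepsilon_0,$$ $$\Vert(a^{20}+a^{-20}+\theta^{20})\gamma(t)\Vert\le\varepsilon_1\langle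 t\rangle^\delta,\qquad \Vert\omega^{(1)}_{m,r}\partial_\theta\gamma(t)\Vert+\Vert\omega^{(2)}_{m,r}\partial_a\gamma(t)\Vert\le\varepsilon_1\langle t\rangle^{(m+1)\delta},$$ then for all $0\le t\le T$ $$\Vert\omega^{(1)}_{p,s}\partial_\theta\gamma(t)\Vert\le C\big(\varepsilon_0+\varepsilon_1^{3/2}\langle t\rangle^{p\delta}\big),\qquad \Vert\omega^{(2)}_{p,s}\partial_a\gamma(t)\Vert\le C\big(\varepsilon_0+\varepsilon_1^{3/2}\langle t\rangle^{(p+1)\delta}\big).$$ -/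

import Mathlib

open MeasureTheory Set
open scoped ENNReal ContDiff

noncomputable section

namespace PointCharge

/-- The structure function `G(s) = √(s(s-1)) + ln(√s + √(s-1))`, relevant for `1 ≤ s`. -/
def G (s : ℝ) : ℝ := √(s * (s - 1)) + Real.log (√s + √(s - 1))

/-- `H = G⁻¹`, the inverse of the increasing bijection `G : [1,∞) → [0,∞)`,
relevant for `0 ≤ x`. -/
def H (x : ℝ) : ℝ := Function.invFunOn G (Ici 1) x

/-- The periapsis `r_min(a) = q / a²`. -/
def rMin (q a : ℝ) : ℝ := q / a ^ 2

/-- The physical radius in action-angle coordinates, `R(θ,a) = r_min H(|θ| / r_min)`. -/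
def R (q θ a : ℝ) : ℝ := rMin q a * H (|θ| / rMin q a)

/-- The phase space of the points `(θ, a)` with `θ ∈ ℝ` and `a > 0`. -/
def phaseSpace : Set (ℝ × ℝ) := univ ×ˢ Ioi 0

/-- Lebesgue measure `dθ da` on the phase space. -/
def phaseMeasure : Measure (ℝ × ℝ) := (volume : Measure (ℝ × ℝ)).restrict phaseSpace

/-- The real Hilbert space `L²_{θ,a}`. -/
abbrev L2 : Type := Lp ℝ 2 phaseMeasure

/-- The self-consistent potential at time `t`,
`Ψ(θ,a) = ∬ γ²(ϑ,α) / max{R(θ+ta,a), R(ϑ+tα,α)} dϑ dα`. -/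
def potential (q : ℝ) (γ : L2) (t θ a : ℝ) : ℝ :=
  ∫ w, (max (R q (θ + t * a) a) (R q (w.1 + t * w.2) w.2))⁻¹ * γ w ^ 2 ∂phaseMeasure

/-- `g` is the weak derivative of `f` on the phase space in the direction `e`. -/
def HasWeakPartial (e : ℝ × ℝ) (f g : ℝ × ℝ → ℝ) : Prop :=
  LocallyIntegrableOn f phaseSpace volume ∧ LocallyIntegrableOn g phaseSpace volume ∧
    ∀ φ : ℝ × ℝ → ℝ, ContDiff ℝ ∞ φ → HasCompactSupport φ → tsupport φ ⊆ phaseSpace →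
      ∫ z, f z * fderiv ℝ φ z e ∂phaseMeasure = -∫ z, g z * φ z ∂phaseMeasure

/-- The Poisson bracket `{Ψ, γ} = ∂_aΨ ∂_θγ - ∂_θΨ ∂_aγ` of the potential of `γ` with `γ`, where
`γθ` and `γa` are the weak derivatives of `γ`. (The potential itself is continuously
differentiable in `(θ, a)` for every `γ ∈ L²`.) -/
def bracket (q : ℝ) (γ : L2) (γθ γa : ℝ × ℝ → ℝ) (t : ℝ) (z : ℝ × ℝ) : ℝ :=
  deriv (fun a => potential q γ t z.1 a) z.2 * γθ z
    - deriv (fun θ => potential q γ t θ z.2) z.1 * γa z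

/-- `γ` is a strong solution of `∂_tγ = lam {Ψ, γ}` on `[0,T]`, with first weak derivatives
`γθ = ∂_θγ` and `γa = ∂_aγ`: the curve `t ↦ γ(t) ∈ L²` is differentiable on `[0,T]` and its
derivative is `lam {Ψ, γ}`. -/
structure IsSolution (q lam T : ℝ) (γ : ℝ → L2) (γθ γa : ℝ → ℝ × ℝ → ℝ) : Prop where
  weak_theta : ∀ t ∈ Icc 0 T, HasWeakPartial (1, 0) (γ t) (γθ t)
  weak_action : ∀ t ∈ Icc 0 T, HasWeakPartial (0, 1) (γ t) (γa t)
  evolution : ∀ t ∈ Icc 0 T, ∃ D : L2,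
    (D =ᵐ[phaseMeasure] fun z => lam * bracket q (γ t) (γθ t) (γa t) t z) ∧
      HasDerivWithinAt γ D (Icc 0 T) t

/-- The weighted norm `‖w f‖_{L²_{θ,a}} ∈ [0,∞]`. -/
def wNorm (w : ℝ → ℝ → ℝ) (f : ℝ × ℝ → ℝ) : ℝ≥0∞ :=
  eLpNorm (fun z => w z.1 z.2 * f z) 2 phaseMeasure

/-- `⟨t⟩ = √(1 + t²)`. -/
def japanese (t : ℝ) : ℝ := √(1 + t ^ 2)

/-- The moment weight `a^{-20} + θ^{20} + a^{20}`. -/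
def momentWeight (θ a : ℝ) : ℝ := a ^ (-20 : ℤ) + θ ^ 20 + a ^ 20

/-- `ω_{p,s}(θ,a) = θ^p a^s`. -/
def omega (p : ℕ) (s : ℝ) (θ a : ℝ) : ℝ := θ ^ p * a ^ s

/-- `ω^{(1)} = (a + a⁻¹) ω`. -/
def omegaOne (p : ℕ) (s : ℝ) (θ a : ℝ) : ℝ := (a + a⁻¹) * omega p s θ a

/-- `ω^{(2)} = a ω`. -/
def omegaTwo (p : ℕ) (s : ℝ) (θ a : ℝ) : ℝ := a * omega p s θ a

/-- A set of weights `ω_{p,s}`, given by the pairs `(p, s)`, is compatible if for `p ≥ 1` it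
contains `ω_{p-1,s-3}` and `ω_{p-1,s}` together with `ω_{p,s}`. -/
def IsCompatible (I : Set (ℕ × ℝ)) : Prop :=
  ∀ (p : ℕ) (s : ℝ), (p + 1, s) ∈ I → (p, s - 3) ∈ I ∧ (p, s) ∈ I

end PointCharge

end

/-! The radius is made explicit first. With `s = cosh² u` the function `G` becomes `u + sinh u cosh
u`, so `H(|x|)` is an even smooth function `K` on the whole line with `K'² = 1 - 1/K` and `K'' =
1/(2K²)`, the energy and force laws of the repulsive Kepler problem. Along the free flow the radius
is `ρ(θ,a) = (q/a²) K(a²(θ+ta)/q)`, and all its derivatives up to order two are explicit.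

The potential depends on `(θ,a)` only through `ρ`, and as a function of the radius it has derivative
`-m(r)/r²`, where `m(r)` is the mass in `{ρ ≤ r}`. First derivatives of the potential need only `m`;
second derivatives need `m'`, formally a surface integral of `γ²`. It is turned into a volume
integral by a vector field `Y` with `Yρ = 1`: the divergence theorem gives `m'(r) = ∫_{ρ ≤ r} div(γ²
Y)`, which involves one derivative of `γ` (`StaticBound.mass_eq`, `StaticBound.hasDerivAt_mass`).
Let `X_f = (f_a, -f_θ)` and let `v = aK'` be the velocity. As `(ρ,v)` are canonical, `X_v ρ = 1`;
the field is `Y = X_v - g(a) X_ρ`, whose divergence is only `g'(a) ρ_θ`. The factor `g` is chosen to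
cancel the leading part of `v_a`, so that `Y` and its divergence are of size `1/(1+t)` up to
weights.

Decay comes from a dichotomy. Where `|θ-a|/a ≤ (1+t)/2`, the particle is outgoing and `ρ ≥
a(1+t)/4`. Elsewhere `1+t` is bounded by a power of `max(|θ|,a,1/a)`, and powers of `1+t` are paid
for by moments. This gives `m ρ^{-k} ≲ (1+t)^{-k}` and `|m'| ρ^{-k} ≲ (1+t)^{-k-1}`. Hence `Ψ_θ`,
`Ψ_θθ`, `Ψ_θa` decay like `(1+t)^{-3/2}`, while `Ψ_a` and `Ψ_aa` decay only like `(1+t)^{-1}`, with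
suitable weights in `a`.

Energy estimates use that the Hamiltonian field of the potential is divergence free: transport only
acts on the weight. Weights are made compactly supported by cutoffs with small logarithmic
derivatives. Since only first weak derivatives of `γ` exist, derivatives are estimated through
difference quotients, which are bounded operators applied to the curve; the step tends to `0` before
the cutoff is removed (`DerivativeBound.energy_le`).

The bootstrap is closed in order. Action moments have an integrable rate and stay bounded
(`Bootstrap.actionWeight_le`); this bounds the decay norm uniformly in time
(`Bootstrap.staticBound`). Then `θ^20` has a rate of order `ε³(1+t)^{δ-1}`, whose integral
`ε³((1+t)^δ-1)/δ` is at most `ε²((1+t)^δ-1)` because `ε ≤ δ`. For derivatives, `∂_θγ` is forced by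
integrable coefficients, with additional growth only from a positive power of `θ` in the weight. Its
improved bound is inserted into the equation for `∂_aγ`, whose coupling through `Ψ_aa` has critical
decay. Finally `ε² ≤ ε^{3/2}`; for (A), smallness also absorbs the constant. -/

noncomputable section

namespace PointCharge

/-! ### The radius function in hyperbolic parametrisation -/

/-- The time function `x(u) = u + sinh u cosh u` of the hyperbolic parametrisation. -/
def kTime (u : ℝ) : ℝ := u + Real.sinh u * Real.cosh u

theorem hasDerivAt_kTime (u : ℝ) : HasDerivAt kTime (2 * Real.cosh u ^ 2) u := by
  have h := (hasDerivAt_id u).add ((Real.hasDerivAt_sinh u).mul (Real.hasDerivAt_cosh u))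
  refine h.congr_deriv ?_
  have := Real.cosh_sq u
  nlinarith

theorem strictMono_kTime : StrictMono kTime := by
  apply strictMono_of_deriv_pos
  intro u
  rw [(hasDerivAt_kTime u).deriv]
  have := Real.cosh_pos u
  positivity

theorem continuous_kTime : Continuous kTime := by unfold kTime; fun_prop

theorem le_kTime {u : ℝ} (hu : 0 ≤ u) : u ≤ kTime u := by
  have h1 : 0 ≤ Real.sinh u := Real.sinh_nonneg_iff.2 hu
  have := Real.cosh_pos u
  unfold kTime
  nlinarith [mul_nonneg h1 this.le]

theorem kTime_neg (u : ℝ) : kTime (-u) = -kTime u := by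
  simp [kTime]; ring

theorem surjective_kTime : Function.Surjective kTime := by
  apply continuous_kTime.surjective
  · refine Filter.tendsto_atTop_mono' _ ?_ Filter.tendsto_id
    filter_upwards [Filter.eventually_ge_atTop 0] with u hu using le_kTime hu
  · refine Filter.tendsto_atBot_mono' _ ?_ Filter.tendsto_id
    filter_upwards [Filter.eventually_le_atBot 0] with u hu
    have := le_kTime (u := -u) (by linarith)
    rw [kTime_neg] at this
    simpa using this

/-- `kTime` as a homeomorphism of the line. -/
def kHomeo : ℝ ≃ₜ ℝ :=
  (StrictMono.orderIsoOfSurjective kTime strictMono_kTime surjective_kTime).toHomeomorph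

/-- The inverse of `kTime`. -/
def kU (x : ℝ) : ℝ := kHomeo.symm x

theorem kTime_kU (x : ℝ) : kTime (kU x) = x := kHomeo.apply_symm_apply x

theorem kU_kTime (u : ℝ) : kU (kTime u) = u := kHomeo.symm_apply_apply u

theorem contDiff_kU : ContDiff ℝ ∞ kU := by
  refine kHomeo.contDiff_symm_deriv (f' := fun u => 2 * Real.cosh u ^ 2)
    (fun u => ?_) hasDerivAt_kTime ?_
  · have := Real.cosh_pos u
    positivity
  · change ContDiff ℝ ∞ kTime
    unfold kTime
    exact contDiff_id.add (Real.contDiff_sinh.mul Real.contDiff_cosh)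

theorem hasDerivAt_kU (x : ℝ) : HasDerivAt kU (2 * Real.cosh (kU x) ^ 2)⁻¹ x := by
  have hc := Real.cosh_pos (kU x)
  exact HasDerivAt.of_local_left_inverse contDiff_kU.continuous.continuousAt
    (hasDerivAt_kTime _) (by positivity) (Filter.Eventually.of_forall kTime_kU)

theorem kU_neg (x : ℝ) : kU (-x) = -kU x := by
  apply strictMono_kTime.injective
  rw [kTime_neg, kTime_kU, kTime_kU]

theorem kU_nonneg {x : ℝ} (hx : 0 ≤ x) : 0 ≤ kU x := by
  by_contra! h
  have := strictMono_kTime h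
  rw [kTime_kU] at this
  simp [kTime] at this
  linarith

/-- The even smooth extension `K(x) = H(|x|)` of `H`. -/
def K (x : ℝ) : ℝ := Real.cosh (kU x) ^ 2

/-- The derivative of `K`. -/
def Kd (x : ℝ) : ℝ := Real.sinh (kU x) / Real.cosh (kU x)

theorem contDiff_K : ContDiff ℝ ∞ K := (Real.contDiff_cosh.comp contDiff_kU).pow 2

theorem contDiff_Kd : ContDiff ℝ ∞ Kd :=
  (Real.contDiff_sinh.comp contDiff_kU).div (Real.contDiff_cosh.comp contDiff_kU)
    fun _ => (Real.cosh_pos _).ne'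

theorem hasDerivAt_K (x : ℝ) : HasDerivAt K (Kd x) x := by
  have h := ((Real.hasDerivAt_cosh (kU x)).comp x (hasDerivAt_kU x)).pow 2
  refine h.congr_deriv ?_
  have hc := (Real.cosh_pos (kU x)).ne'
  simp [Kd]; field_simp

/-- The derivative of `tanh` is `1/cosh²`, and `kU` contributes another `1/(2cosh²)`. This is the
radial equation of motion under the repulsive inverse-square force. -/
theorem hasDerivAt_Kd (x : ℝ) : HasDerivAt Kd (1 / (2 * K x ^ 2)) x := by
  have hc := (Real.cosh_pos (kU x)).ne'
  have h := ((Real.hasDerivAt_sinh (kU x)).comp x (hasDerivAt_kU x)).div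
    ((Real.hasDerivAt_cosh (kU x)).comp x (hasDerivAt_kU x)) hc
  refine h.congr_deriv ?_
  have hs := Real.cosh_sq (kU x)
  simp only [Function.comp, K]
  field_simp
  linarith

theorem one_le_K (x : ℝ) : 1 ≤ K x := by
  have := Real.one_le_cosh (kU x)
  unfold K; nlinarith

theorem K_pos (x : ℝ) : 0 < K x := lt_of_lt_of_le one_pos (one_le_K x)

/-- Conservation of energy for the radial motion, which here is just `tanh² = 1 - 1/cosh²`. -/
theorem Kd_sq (x : ℝ) : Kd x ^ 2 = 1 - 1 / K x := by
  have hc := (Real.cosh_pos (kU x)).ne'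
  have hs := Real.cosh_sq (kU x)
  unfold Kd K
  field_simp
  linarith

theorem abs_Kd_le (x : ℝ) : |Kd x| ≤ 1 := by
  rw [← sq_le_one_iff_abs_le_one, Kd_sq]
  have := K_pos x
  have : 0 < 1 / K x := by positivity
  linarith

theorem Kd_nonneg {x : ℝ} (hx : 0 ≤ x) : 0 ≤ Kd x :=
  div_nonneg (Real.sinh_nonneg_iff.2 (kU_nonneg hx)) (Real.cosh_pos _).le

theorem K_neg (x : ℝ) : K (-x) = K x := by simp [K, kU_neg]

theorem Kd_neg (x : ℝ) : Kd (-x) = -Kd x := by simp [Kd, kU_neg, neg_div]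

/-- For `u ≥ 0` one has `u ≤ sinh u < cosh u`, so both summands of `u + sinh u cosh u` are at most
`cosh² u`. This is the source of every linear lower bound on the radius. -/
theorem abs_le_two_mul_K (x : ℝ) : |x| ≤ 2 * K x := by
  wlog hx : 0 ≤ x generalizing x
  · have := this (-x) (by linarith)
    rwa [abs_neg, K_neg] at this
  rw [abs_of_nonneg hx]
  have hu := kU_nonneg hx
  have h1 : kU x ≤ Real.sinh (kU x) := Real.self_le_sinh_iff.2 hu
  have h2 := Real.sinh_lt_cosh (kU x)
  have h3 := Real.one_le_cosh (kU x)
  have h4 := kTime_kU x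
  unfold kTime at h4
  unfold K
  nlinarith

theorem abs_K : ∀ x, K |x| = K x := by
  intro x
  rcases abs_choice x with h | h <;> rw [h]
  exact K_neg x

/-- At `s = cosh² u` the square roots become `cosh u` and `sinh u`, and the logarithm of `cosh u +
sinh u = exp u` is `u`. -/
theorem G_cosh_sq {u : ℝ} (hu : 0 ≤ u) : G (Real.cosh u ^ 2) = kTime u := by
  have hs : 0 ≤ Real.sinh u := Real.sinh_nonneg_iff.2 hu
  have hc := Real.cosh_pos u
  have h1 : Real.cosh u ^ 2 - 1 = Real.sinh u ^ 2 := by rw [Real.cosh_sq]; ring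
  unfold G
  rw [h1, ← mul_pow, Real.sqrt_sq (by positivity), Real.sqrt_sq hc.le, Real.sqrt_sq hs,
    Real.cosh_add_sinh, Real.log_exp, kTime]
  ring

theorem exists_cosh_sq {s : ℝ} (hs : 1 ≤ s) : ∃ u, 0 ≤ u ∧ Real.cosh u ^ 2 = s := by
  refine ⟨Real.arsinh (√(s - 1)), Real.arsinh_nonneg_iff.2 (Real.sqrt_nonneg _), ?_⟩
  rw [Real.cosh_sq, Real.sinh_arsinh, Real.sq_sqrt (by linarith)]
  ring

theorem injOn_G : InjOn G (Ici 1) := by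
  intro s hs s' hs' h
  obtain ⟨u, hu, rfl⟩ := exists_cosh_sq hs
  obtain ⟨u', hu', rfl⟩ := exists_cosh_sq hs'
  rw [G_cosh_sq hu, G_cosh_sq hu'] at h
  rw [strictMono_kTime.injective h]

/-- `H` is known only as a chosen inverse on `[1,∞)`; injectivity of `G` there pins down its value.
Evenness of `K` removes the absolute value and with it the apparent singularity at `0`. -/
theorem H_abs (x : ℝ) : H |x| = K x := by
  rw [← abs_K x]
  have h0 : 0 ≤ |x| := abs_nonneg x
  generalize |x| = y at h0
  have h1 : G (K y) = y := by
    unfold K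
    rw [G_cosh_sq (kU_nonneg h0), kTime_kU]
  unfold H
  conv_lhs => rw [← h1]
  exact injOn_G.leftInvOn_invFunOn (show K y ∈ Ici 1 from one_le_K y)

theorem R_eq {q : ℝ} (hq : 0 < q) (θ a : ℝ) : R q θ a = q / a ^ 2 * K (a ^ 2 * θ / q) := by
  have h : |θ| / rMin q a = |a ^ 2 * θ / q| := by
    rw [rMin, abs_div, abs_mul, abs_of_pos hq, abs_of_nonneg (sq_nonneg a), div_div_eq_mul_div]
    ring
  rw [R, h, H_abs, rMin]

/-- `L(x) = x K'(x) - K(x) + 1`. -/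
def L (x : ℝ) : ℝ := x * Kd x - K x + 1

theorem contDiff_L : ContDiff ℝ ∞ L := ((contDiff_id.mul contDiff_Kd).sub contDiff_K).add contDiff_const

theorem hasDerivAt_L (x : ℝ) : HasDerivAt L (x / (2 * K x ^ 2)) x := by
  have h := (((hasDerivAt_id x).mul (hasDerivAt_Kd x)).sub (hasDerivAt_K x)).add_const 1
  refine h.congr_deriv ?_
  simp; ring

theorem L_neg (x : ℝ) : L (-x) = L x := by simp [L, K_neg, Kd_neg]

theorem L_zero : L 0 = 0 := by
  have : kU 0 = 0 := by
    have := kU_kTime 0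
    simpa [kTime] using this
  simp [L, K, this]

theorem L_nonneg (x : ℝ) : 0 ≤ L x := by
  wlog hx : 0 ≤ x generalizing x
  · rw [← L_neg]; exact this (-x) (by linarith)
  have hm : MonotoneOn L (Ici 0) := by
    apply monotoneOn_of_deriv_nonneg (convex_Ici 0) contDiff_L.continuous.continuousOn
    · exact fun y _ => (hasDerivAt_L y).differentiableAt.differentiableWithinAt
    · intro y hy
      rw [interior_Ici] at hy
      rw [(hasDerivAt_L y).deriv]
      have := K_pos y
      have : 0 < y := hy
      positivity
  have := hm (mem_Ici.2 le_rfl) (mem_Ici.2 hx) hx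
  rwa [L_zero] at this

theorem L_le_abs (x : ℝ) : L x ≤ |x| := by
  have h1 : x * Kd x ≤ |x| := by
    refine (le_abs_self _).trans ?_
    rw [abs_mul]
    exact mul_le_of_le_one_right (abs_nonneg x) (abs_Kd_le x)
  have := one_le_K x
  unfold L; linarith

/-- From `K(z) ≥ z/2` follows `L'(z) = z/(2K²) ≤ 2/z ≤ 4/y` on `[y/2,∞)`: the function `L` grows
only logarithmically. -/
theorem abs_L_sub_le {x y : ℝ} (hy : 0 < y) (hx : y / 2 ≤ x) :
    |L x - L y| ≤ 4 / y * |x - y| := by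
  have := (convex_Ici (y / 2)).norm_image_sub_le_of_norm_hasDerivWithin_le (f := L)
    (f' := fun x => x / (2 * K x ^ 2)) (C := 4 / y) (x := y) (y := x)
    (fun z _ => (hasDerivAt_L z).hasDerivWithinAt) ?_ (mem_Ici.2 (by linarith)) (mem_Ici.2 hx)
  · simpa [Real.norm_eq_abs] using this
  intro z hz
  have hz' : y / 2 ≤ z := hz
  have hz0 : 0 < z := by linarith
  have hK := abs_le_two_mul_K z
  have hKp := K_pos z
  rw [abs_of_pos hz0] at hK
  rw [Real.norm_eq_abs, abs_of_nonneg (by positivity), div_le_div_iff₀ (by positivity) hy]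
  nlinarith

/-- The energy law factors as `(1-K')(1+K') = 1/K`, and `1+K' ≥ 1` for `x ≥ 0`. -/
theorem one_sub_Kd_le {x : ℝ} (hx : 0 ≤ x) : 1 - Kd x ≤ 1 / K x := by
  have h1 := Kd_sq x
  have h2 := Kd_nonneg hx
  have h3 := (abs_le.1 (abs_Kd_le x)).2
  nlinarith

/-! ### The radius along the free flow -/

/-- The argument of `K` in the radius along the free flow. -/
def arg (q t θ a : ℝ) : ℝ := a ^ 2 * (θ + t * a) / q

/-- The derivative of `arg` in the action variable. -/
def argA (q t θ a : ℝ) : ℝ := 2 * arg q t θ a / a + a ^ 2 * t / q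

/-- The radius `ρ(θ,a) = R(θ+ta,a)` along the free flow. -/
def rho (q t θ a : ℝ) : ℝ := q / a ^ 2 * K (arg q t θ a)

/-- `∂_θ ρ`. -/
def rhoT (q t θ a : ℝ) : ℝ := Kd (arg q t θ a)

/-- `∂_a ρ`. -/
def rhoA (q t θ a : ℝ) : ℝ := t * Kd (arg q t θ a) + 2 * q / a ^ 3 * (L (arg q t θ a) - 1)

/-- `∂_θ² ρ`. -/
def rhoTT (q t θ a : ℝ) : ℝ := a ^ 2 / q * (1 / (2 * K (arg q t θ a) ^ 2))

/-- `∂_θ ∂_a ρ`. -/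
def rhoTA (q t θ a : ℝ) : ℝ := 1 / (2 * K (arg q t θ a) ^ 2) * argA q t θ a

/-- `∂_a² ρ`. -/
def rhoAA (q t θ a : ℝ) : ℝ :=
  t * rhoTA q t θ a - 6 * q / a ^ 4 * (L (arg q t θ a) - 1)
    + 2 * q / a ^ 3 * (arg q t θ a * rhoTA q t θ a)

theorem rho_eq_R {q : ℝ} (hq : 0 < q) (t θ a : ℝ) : R q (θ + t * a) a = rho q t θ a :=
  R_eq hq _ _

theorem hasDerivAt_arg_theta (q t θ a : ℝ) :
    HasDerivAt (fun θ => arg q t θ a) (a ^ 2 / q) θ := by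
  have h := (((hasDerivAt_id θ).add_const (t * a)).const_mul (a ^ 2)).div_const q
  exact h.congr_deriv (by ring)

theorem hasDerivAt_arg_action {q : ℝ} (t θ : ℝ) {a : ℝ} (ha : 0 < a) :
    HasDerivAt (fun a => arg q t θ a) (argA q t θ a) a := by
  have h := ((((hasDerivAt_id a).pow 2)).mul
    (((hasDerivAt_id a).const_mul t).const_add θ)).div_const q
  refine h.congr_deriv ?_
  simp [argA, arg]
  field_simp

section
variable {q t θ a : ℝ}

theorem hasDerivAt_rho_theta (hq : 0 < q) (ha : 0 < a) :
    HasDerivAt (fun θ => rho q t θ a) (rhoT q t θ a) θ := by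
  have h := ((hasDerivAt_K _).comp θ (hasDerivAt_arg_theta q t θ a)).const_mul (q / a ^ 2)
  refine h.congr_deriv ?_
  unfold rhoT; field_simp

theorem hasDerivAt_inv_pow (n : ℕ) (c : ℝ) (ha : 0 < a) :
    HasDerivAt (fun a : ℝ => c / a ^ n) (-(n * c) / a ^ (n + 1)) a := by
  have h := ((hasDerivAt_pow n a).inv (by positivity)).const_mul c
  simp only [div_eq_mul_inv]
  refine h.congr_deriv ?_
  rcases n with _ | n
  · simp
  · simp; field_simp; ring

/-- The derivative of the prefactor and the term `2x/a` of `argA` combine to `(2q/a³)(xK'-K)`.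
Writing this through `L`, which is nonnegative and of slow growth, isolates the free part `tK'`. -/
theorem hasDerivAt_rho_action (hq : 0 < q) (ha : 0 < a) :
    HasDerivAt (fun a => rho q t θ a) (rhoA q t θ a) a := by
  have h := (hasDerivAt_inv_pow 2 q ha).mul
    ((hasDerivAt_K _).comp a (hasDerivAt_arg_action (q := q) t θ ha))
  refine h.congr_deriv ?_
  simp only [rhoA, L, argA, Function.comp]
  field_simp
  push_cast
  ring

theorem hasDerivAt_rhoT_theta : HasDerivAt (fun θ => rhoT q t θ a) (rhoTT q t θ a) θ := by
  have h := (hasDerivAt_Kd _).comp θ (hasDerivAt_arg_theta q t θ a)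
  refine h.congr_deriv ?_
  simp only [rhoTT]; ring

theorem hasDerivAt_rhoT_action (ha : 0 < a) :
    HasDerivAt (fun a => rhoT q t θ a) (rhoTA q t θ a) a :=
  (hasDerivAt_Kd _).comp a (hasDerivAt_arg_action t θ ha)

theorem hasDerivAt_rhoA_theta (hq : 0 < q) (ha : 0 < a) :
    HasDerivAt (fun θ => rhoA q t θ a) (rhoTA q t θ a) θ := by
  have h := (((hasDerivAt_Kd _).comp θ (hasDerivAt_arg_theta q t θ a)).const_mul t).add
    ((((hasDerivAt_L _).comp θ (hasDerivAt_arg_theta q t θ a)).sub_const 1).const_mul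
      (2 * q / a ^ 3))
  refine h.congr_deriv ?_
  have := (K_pos (arg q t θ a)).ne'
  simp only [rhoTA, argA]
  field_simp
  ring

theorem hasDerivAt_rhoA_action (ha : 0 < a) :
    HasDerivAt (fun a => rhoA q t θ a) (rhoAA q t θ a) a := by
  have hA := hasDerivAt_arg_action (q := q) t θ ha
  have h := (((hasDerivAt_Kd _).comp a hA).const_mul t).add
    ((hasDerivAt_inv_pow 3 (2 * q) ha).mul (((hasDerivAt_L _).comp a hA).sub_const 1))
  refine h.congr_deriv ?_
  have := (K_pos (arg q t θ a)).ne'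
  simp only [rhoAA, rhoTA, Function.comp]
  push_cast
  field_simp
  ring

theorem rho_pos (hq : 0 < q) (ha : 0 < a) : 0 < rho q t θ a :=
  mul_pos (by positivity) (K_pos _)

theorem le_rho (hq : 0 < q) : q / a ^ 2 ≤ rho q t θ a :=
  le_mul_of_one_le_right (by positivity) (one_le_K _)

theorem abs_rhoT_le : |rhoT q t θ a| ≤ 1 := abs_Kd_le _

theorem abs_L_sub_one_le (x : ℝ) : |L x - 1| ≤ 2 * K x := by
  have h1 := L_nonneg x
  have h2 := (L_le_abs x).trans (abs_le_two_mul_K x)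
  have h3 := one_le_K x
  rw [abs_le]; constructor <;> linarith

theorem abs_rhoA_le (hq : 0 < q) (ha : 0 < a) (ht : 0 ≤ t) :
    |rhoA q t θ a| ≤ t + 4 * (rho q t θ a / a) := by
  unfold rhoA
  refine (abs_add_le _ _).trans (add_le_add ?_ ?_)
  · rw [abs_mul, abs_of_nonneg ht]
    exact mul_le_of_le_one_right ht (abs_Kd_le _)
  · rw [abs_mul, abs_of_pos (by positivity)]
    refine (mul_le_mul_of_nonneg_left (abs_L_sub_one_le _) (by positivity)).trans (le_of_eq ?_)
    unfold rho; field_simp; ring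

theorem rhoTT_nonneg (hq : 0 < q) : 0 ≤ rhoTT q t θ a := by
  unfold rhoTT; positivity

/-- One of the two factors `1/K` is discarded, because only `1/ρ` is needed and `K ≥ 1`. -/
theorem rhoTT_le (hq : 0 < q) (ha : 0 < a) : rhoTT q t θ a ≤ 1 / (2 * rho q t θ a) := by
  have h1 := one_le_K (arg q t θ a)
  have h : 1 / (2 * rho q t θ a) = a ^ 2 / q * (1 / (2 * K (arg q t θ a))) := by
    unfold rho; field_simp
  rw [h]
  unfold rhoTT
  gcongr
  nlinarith

theorem abs_rhoTA_le (hq : 0 < q) (ha : 0 < a) (ht : 0 ≤ t) :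
    |rhoTA q t θ a| ≤ 2 / a + t / (2 * rho q t θ a) := by
  have h1 := one_le_K (arg q t θ a)
  have h2 := abs_le_two_mul_K (arg q t θ a)
  have h0 := K_pos (arg q t θ a)
  unfold rhoTA argA rho
  generalize arg q t θ a = x at *
  generalize K x = k at *
  rw [abs_mul, abs_of_pos (by positivity)]
  have h3 : |2 * x / a + a ^ 2 * t / q| ≤ 4 * k / a + a ^ 2 * t / q := by
    refine (abs_add_le _ _).trans (add_le_add ?_ (abs_of_nonneg (by positivity)).le)
    rw [abs_div, abs_mul, abs_of_pos ha, abs_two]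
    exact div_le_div_of_nonneg_right (by linarith) ha.le
  refine (mul_le_mul_of_nonneg_left h3 (by positivity)).trans ?_
  rw [mul_add]
  refine add_le_add ?_ ?_
  · rw [div_mul_div_comm, one_mul, div_le_div_iff₀ (by positivity) ha]
    nlinarith [mul_nonneg (mul_pos ha h0).le (sub_nonneg.2 h1)]
  · have : t / (2 * (q / a ^ 2 * k)) = 1 / (2 * k) * (a ^ 2 * t / q) := by field_simp
    rw [this]
    refine mul_le_mul_of_nonneg_right ?_ (by positivity)
    rw [div_le_div_iff₀ (by positivity) (by positivity)]
    nlinarith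

theorem abs_rhoAA_le (hq : 0 < q) (ha : 0 < a) (ht : 0 ≤ t) :
    |rhoAA q t θ a| ≤ 22 * (t ^ 2 / rho q t θ a + rho q t θ a / a ^ 2) := by
  have hTA := abs_rhoTA_le (q := q) (t := t) (θ := θ) hq ha ht
  have hr := rho_pos (q := q) (t := t) (θ := θ) hq ha
  set r := rho q t θ a with hrdef
  have e1 : |t * rhoTA q t θ a| ≤ t * (2 / a + t / (2 * r)) := by
    rw [abs_mul, abs_of_nonneg ht]; gcongr
  have e2 : |6 * q / a ^ 4 * (L (arg q t θ a) - 1)| ≤ 12 * (r / a ^ 2) := by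
    rw [abs_mul, abs_of_pos (by positivity)]
    refine (mul_le_mul_of_nonneg_left (abs_L_sub_one_le _) (by positivity)).trans (le_of_eq ?_)
    rw [hrdef]; unfold rho; field_simp; ring
  have e3 : |2 * q / a ^ 3 * (arg q t θ a * rhoTA q t θ a)|
      ≤ 4 * (r / a) * (2 / a + t / (2 * r)) := by
    rw [← mul_assoc, abs_mul]
    gcongr
    rw [abs_mul, abs_of_pos (by positivity)]
    refine (mul_le_mul_of_nonneg_left (abs_le_two_mul_K _) (by positivity)).trans (le_of_eq ?_)
    rw [hrdef]; unfold rho; field_simp; ring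
  have e : |rhoAA q t θ a| ≤ t * (2 / a + t / (2 * r)) + 12 * (r / a ^ 2)
      + 4 * (r / a) * (2 / a + t / (2 * r)) := by
    unfold rhoAA
    exact (abs_add_le _ _).trans (add_le_add ((abs_sub _ _).trans (add_le_add e1 e2)) e3)
  refine e.trans ?_
  have : t * (2 / a + t / (2 * r)) + 12 * (r / a ^ 2) + 4 * (r / a) * (2 / a + t / (2 * r))
      = 4 * (t / a) + t ^ 2 / r / 2 + 20 * (r / a ^ 2) := by field_simp; ring
  rw [this]
  -- The mixed term is absorbed by completing the square in `t` and `ρ/a`.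
  have h4 : 2 * (t / a) ≤ t ^ 2 / r + r / a ^ 2 := by
    have : t ^ 2 / r + r / a ^ 2 - 2 * (t / a) = (t - r / a) ^ 2 / r := by field_simp; ring
    have : 0 ≤ (t - r / a) ^ 2 / r := by positivity
    linarith
  have : 0 ≤ t ^ 2 / r := by positivity
  linarith

/-! ### A vector field transversal to the level sets of the radius -/

/-- The derivative in `θ` of the velocity `a K'`. -/
def vT (q t θ a : ℝ) : ℝ := a ^ 3 / (2 * q) * (1 / K (arg q t θ a) ^ 2)

/-- The derivative in `a` of the velocity `a K'`. -/
def vA (q t θ a : ℝ) : ℝ :=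
  Kd (arg q t θ a) + arg q t θ a * (1 / K (arg q t θ a) ^ 2) + t * vT q t θ a

/-- The mixed second derivative of the velocity `a K'`. -/
def vTA (q t θ a : ℝ) : ℝ :=
  3 * a ^ 2 / (2 * q) * (1 / K (arg q t θ a) ^ 2)
    + a ^ 3 / (2 * q) * (-(2 * Kd (arg q t θ a)) / K (arg q t θ a) ^ 3 * argA q t θ a)

theorem hasDerivAt_inv_K_sq (x : ℝ) :
    HasDerivAt (fun x => 1 / K x ^ 2) (-(2 * Kd x) / K x ^ 3) x := by
  have hk := (K_pos x).ne'
  have h := ((hasDerivAt_K x).pow 2).inv (pow_ne_zero 2 hk)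
  simp only [one_div]
  refine h.congr_deriv ?_
  simp; field_simp

theorem hasDerivAt_vT_theta : HasDerivAt (fun θ => vT q t θ a)
    (a ^ 3 / (2 * q) * (-(2 * Kd (arg q t θ a)) / K (arg q t θ a) ^ 3 * (a ^ 2 / q))) θ :=
  ((hasDerivAt_inv_K_sq _).comp θ (hasDerivAt_arg_theta q t θ a)).const_mul _

theorem hasDerivAt_vT_action (ha : 0 < a) :
    HasDerivAt (fun a => vT q t θ a) (vTA q t θ a) a := by
  have h := (((hasDerivAt_pow 3 a)).div_const (2 * q)).mul
    ((hasDerivAt_inv_K_sq _).comp a (hasDerivAt_arg_action (q := q) t θ ha))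
  refine h.congr_deriv ?_
  simp [vTA]

/-- The result `vTA` is also the `a`-derivative of `vT`. This equality of mixed derivatives makes
the Hamiltonian field of the velocity divergence free. -/
theorem hasDerivAt_vA_theta (hq : 0 < q) (ha : 0 < a) :
    HasDerivAt (fun θ => vA q t θ a) (vTA q t θ a) θ := by
  have hA := hasDerivAt_arg_theta q t θ a
  have h := (((hasDerivAt_Kd _).comp θ hA).add
    (hA.mul ((hasDerivAt_inv_K_sq _).comp θ hA))).add ((hasDerivAt_vT_theta (q := q) (t := t) (θ := θ) (a := a)).const_mul t)
  refine h.congr_deriv ?_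
  have hk := (K_pos (arg q t θ a)).ne'
  simp only [vTA, argA, Function.comp]
  field_simp
  ring

/-- The slowly varying factor `ℓ(a)` in the transversal field. -/
def ell (q t a : ℝ) : ℝ := 2 * q / a ^ 3 * L (a ^ 3 * (1 + t) / q)

/-- The derivative of `ell`. -/
def ellA (q t a : ℝ) : ℝ :=
  -(3 * (2 * q)) / a ^ 4 * L (a ^ 3 * (1 + t) / q)
    + 2 * q / a ^ 3 * (a ^ 3 * (1 + t) / q / (2 * K (a ^ 3 * (1 + t) / q) ^ 2)
        * (3 * a ^ 2 * (1 + t) / q))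

/-- The coefficient of the Hamiltonian field of `ρ` in the transversal field. -/
def gY (q t a : ℝ) : ℝ := (1 + t + ell q t a)⁻¹

/-- The derivative of `gY`. -/
def gYA (q t a : ℝ) : ℝ := -ellA q t a / (1 + t + ell q t a) ^ 2

theorem ell_nonneg (hq : 0 < q) (ha : 0 < a) : 0 ≤ ell q t a :=
  mul_nonneg (by positivity) (L_nonneg _)

theorem hasDerivAt_gY (hq : 0 < q) (ha : 0 < a) (ht : 0 ≤ t) :
    HasDerivAt (fun a => gY q t a) (gYA q t a) a := by
  have hy : HasDerivAt (fun a => a ^ 3 * (1 + t) / q) (3 * a ^ 2 * (1 + t) / q) a := by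
    have h := ((hasDerivAt_pow 3 a).mul_const (1 + t)).div_const q
    simpa using h
  have hl : HasDerivAt (fun a => ell q t a) (ellA q t a) a := by
    have h := (hasDerivAt_inv_pow 3 (2 * q) ha).mul ((hasDerivAt_L _).comp a hy)
    refine h.congr_deriv ?_
    simp [ellA]
  have h := (hl.const_add (1 + t)).inv (by have := ell_nonneg (t := t) hq ha; positivity)
  exact h

/-- The `θ`-component of the transversal field. -/
def YT (q t θ a : ℝ) : ℝ := vA q t θ a - gY q t a * rhoA q t θ a

/-- The `a`-component of the transversal field. -/
def YA (q t θ a : ℝ) : ℝ := gY q t a * rhoT q t θ a - vT q t θ a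

/-- The divergence of the transversal field. -/
def divY (q t θ a : ℝ) : ℝ := gYA q t a * rhoT q t θ a

theorem hasDerivAt_YT (hq : 0 < q) (ha : 0 < a) : HasDerivAt (fun θ => YT q t θ a)
    (vTA q t θ a - gY q t a * rhoTA q t θ a) θ :=
  (hasDerivAt_vA_theta hq ha).sub ((hasDerivAt_rhoA_theta hq ha).const_mul _)

/-- Added to the `θ`-derivative of `YT`, everything cancels except `divY`: the Hamiltonian fields of
velocity and radius have no divergence, and `g` depends on `a` alone, so only `g'(a) ρ_θ` survives.
-/
theorem hasDerivAt_YA (hq : 0 < q) (ha : 0 < a) (ht : 0 ≤ t) : HasDerivAt (fun a => YA q t θ a)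
    (divY q t θ a - (vTA q t θ a - gY q t a * rhoTA q t θ a)) a := by
  have h := ((hasDerivAt_gY hq ha ht).mul (hasDerivAt_rhoT_action (q := q) (t := t) (θ := θ) ha)).sub
    (hasDerivAt_vT_action (q := q) (t := t) (θ := θ) ha)
  refine h.congr_deriv ?_
  simp only [divY]; ring

/-- Radius and velocity are canonical coordinates, so the Hamiltonian field of the velocity
differentiates `ρ` to `1`; the multiple of the Hamiltonian field of `ρ` is tangent to its level sets
and drops out. Concretely the identity is the energy law `K'² + 1/K = 1`. -/
theorem YT_mul_add_YA_mul (hq : 0 < q) (ha : 0 < a) :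
    YT q t θ a * rhoT q t θ a + YA q t θ a * rhoA q t θ a = 1 := by
  have hk := (K_pos (arg q t θ a)).ne'
  have h := Kd_sq (arg q t θ a)
  have : YT q t θ a * rhoT q t θ a + YA q t θ a * rhoA q t θ a
      = Kd (arg q t θ a) ^ 2 + 1 / K (arg q t θ a) := by
    simp only [YT, YA, vA, vT, rhoT, rhoA, L]
    field_simp
    ring
  rw [this, h]; ring

theorem gY_pos (hq : 0 < q) (ha : 0 < a) (ht : 0 ≤ t) : 0 < gY q t a := by
  have := ell_nonneg (t := t) hq ha
  unfold gY; positivity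

theorem gY_le (hq : 0 < q) (ha : 0 < a) (ht : 0 ≤ t) : gY q t a ≤ 1 / (1 + t) := by
  have := ell_nonneg (t := t) hq ha
  rw [gY, ← one_div]
  exact one_div_le_one_div_of_le (by positivity) (by linarith)

theorem vT_eq (hq : 0 < q) (ha : 0 < a) : vT q t θ a = q / (2 * a * rho q t θ a ^ 2) := by
  have hk := (K_pos (arg q t θ a)).ne'
  unfold vT rho; field_simp

theorem abs_YA_le (hq : 0 < q) (ha : 0 < a) (ht : 0 ≤ t) :
    |YA q t θ a| ≤ 1 / (1 + t) + q / (2 * a * rho q t θ a ^ 2) := by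
  unfold YA
  refine (abs_sub _ _).trans (add_le_add ?_ ?_)
  · rw [abs_mul, abs_of_pos (gY_pos hq ha ht)]
    exact (mul_le_of_le_one_right (gY_pos hq ha ht).le abs_rhoT_le).trans (gY_le hq ha ht)
  · rw [vT_eq hq ha, abs_of_pos]
    have := rho_pos (t := t) (θ := θ) hq ha
    positivity

/-- Here `|g'| = |ℓ'|/(1+t+ℓ)²` with `|ℓ'| ≤ 3ℓ/a + 12q/a⁴`. The factor `ℓ` does not cost decay
because `ℓ(1+t) ≤ (1+t+ℓ)²`. -/
theorem abs_divY_le (hq : 0 < q) (ha : 0 < a) (ht : 0 ≤ t) :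
    |divY q t θ a| ≤ 3 / (a * (1 + t)) + 12 * q / (a ^ 4 * (1 + t) ^ 2) := by
  have hl := ell_nonneg (t := t) hq ha
  have hA : |ellA q t a| ≤ 3 / a * ell q t a + 12 * q / a ^ 4 := by
    unfold ellA ell
    refine (abs_add_le _ _).trans (add_le_add (le_of_eq ?_) ?_)
    · rw [abs_mul, abs_of_nonneg (L_nonneg _), abs_div, abs_neg, abs_of_pos (by positivity),
        abs_of_pos (by positivity)]
      field_simp
    · set y := a ^ 3 * (1 + t) / q with hy
      have hy0 : 0 < y := by positivity
      have hk := abs_le_two_mul_K y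
      have hkp := K_pos y
      rw [abs_of_pos hy0] at hk
      have e : 2 * q / a ^ 3 * (y / (2 * K y ^ 2) * (3 * a ^ 2 * (1 + t) / q))
          = 3 * q / a ^ 4 * (y ^ 2 / K y ^ 2) := by
        rw [hy]; field_simp
      rw [e, abs_of_pos (by positivity)]
      have : y ^ 2 / K y ^ 2 ≤ 4 := by
        rw [div_le_iff₀ (by positivity)]; nlinarith
      calc 3 * q / a ^ 4 * (y ^ 2 / K y ^ 2) ≤ 3 * q / a ^ 4 * 4 := by gcongr
        _ = _ := by ring
  have hd : |divY q t θ a| ≤ |ellA q t a| / (1 + t + ell q t a) ^ 2 := by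
    rw [divY, abs_mul, gYA, abs_div, abs_neg, abs_of_pos (a := (1 + t + ell q t a) ^ 2)
      (by positivity)]
    exact mul_le_of_le_one_right (by positivity) abs_rhoT_le
  refine hd.trans ((div_le_div_of_nonneg_right hA (by positivity)).trans ?_)
  rw [add_div]
  refine add_le_add ?_ ?_
  · rw [div_le_div_iff₀ (by positivity) (by positivity)]
    have : 3 / a * ell q t a * (a * (1 + t)) = 3 * (ell q t a * (1 + t)) := by field_simp
    rw [this]
    nlinarith [mul_nonneg hl (by positivity : 0 ≤ 1 + t), sq_nonneg (ell q t a), sq_nonneg (1 + t)]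
  · rw [div_div]
    have : (1 + t) ^ 2 ≤ (1 + t + ell q t a) ^ 2 :=
      pow_le_pow_left₀ (by positivity) (by linarith) 2
    gcongr

/-- The distance of `θ` from `a` relative to `a`; it is large where the free flow is not yet
outgoing. -/
def relDist (θ a : ℝ) : ℝ := |θ - a| / a

/-- The reference point is `θ = a`, where the argument of `K` equals `a³(1+t)/q`. Centring there
replaces `t` by `1+t` and avoids a degeneracy at `t = 0`. -/
theorem abs_arg_sub (hq : 0 < q) (ha : 0 < a) (ht : 0 ≤ t) :
    |arg q t θ a - a ^ 3 * (1 + t) / q| = a ^ 3 * (1 + t) / q * (relDist θ a / (1 + t)) := by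
  have : arg q t θ a - a ^ 3 * (1 + t) / q = a ^ 2 / q * (θ - a) := by
    unfold arg; field_simp; ring
  rw [this, abs_mul, abs_of_pos (by positivity), relDist]
  field_simp

theorem half_le_arg (hq : 0 < q) (ha : 0 < a) (ht : 0 ≤ t) (h : relDist θ a / (1 + t) ≤ 1 / 2) :
    a ^ 3 * (1 + t) / q / 2 ≤ arg q t θ a := by
  have h1 := abs_arg_sub (θ := θ) hq ha ht
  have hy : 0 < a ^ 3 * (1 + t) / q := by positivity
  have h2 := (abs_le.1 h1.le).1
  nlinarith

theorem le_rho_of_bulk (hq : 0 < q) (ha : 0 < a) (ht : 0 ≤ t)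
    (h : relDist θ a / (1 + t) ≤ 1 / 2) : a * (1 + t) / 4 ≤ rho q t θ a := by
  have h1 := half_le_arg hq ha ht h
  have h2 := abs_le_two_mul_K (arg q t θ a)
  have h3 := le_abs_self (arg q t θ a)
  have : a * (1 + t) / 4 = q / a ^ 2 * (a ^ 3 * (1 + t) / q / 4) := by field_simp
  rw [this, rho]
  gcongr
  linarith

/-- For outgoing particles `v_a ≈ 1` and `ρ_a ≈ 1+t+ℓ(a)`, hence `g ρ_a ≈ 1` and the two parts of
`YT` cancel. What remains is the discrepancy between `t` and `1+t`, the variation of `L` between the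
true argument and the reference point, and the tails of `K'` and `1/K²`. -/
theorem abs_YT_le_of_bulk (hq : 0 < q) (ha : 0 < a) (ht : 0 ≤ t)
    (h : relDist θ a / (1 + t) ≤ 1 / 2) :
    |YT q t θ a| ≤ 1 / (1 + t) + 62 * q / (a ^ 3 * (1 + t)) := by
  have h1 := half_le_arg hq ha ht h
  have h2 := abs_arg_sub (θ := θ) hq ha ht
  have hy : 0 < a ^ 3 * (1 + t) / q := by positivity
  have hgy : gY q t a = (1 + t)⁻¹ * (1 + 2 * L (a ^ 3 * (1 + t) / q) / (a ^ 3 * (1 + t) / q))⁻¹ := by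
    rw [gY, ← mul_inv, ell]; congr 1; field_simp
  have htv : t * vT q t θ a ≤ a ^ 3 * (1 + t) / q * (1 / (2 * K (arg q t θ a) ^ 2)) := by
    have : a ^ 3 * (1 + t) / q * (1 / (2 * K (arg q t θ a) ^ 2)) = (1 + t) * vT q t θ a := by
      unfold vT; field_simp
    rw [this]
    have : 0 ≤ vT q t θ a := by unfold vT; positivity
    nlinarith
  have htv0 : 0 ≤ t * vT q t θ a := by unfold vT; positivity
  have hra : rhoA q t θ a = t * Kd (arg q t θ a)
      + 2 * (1 + t) / (a ^ 3 * (1 + t) / q) * (L (arg q t θ a) - 1) := by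
    unfold rhoA; congr 2; field_simp
  have hbd : 62 * q / (a ^ 3 * (1 + t)) = 62 / (a ^ 3 * (1 + t) / q) := by field_simp
  unfold YT vA
  rw [hgy, hra, hbd]
  generalize t * vT q t θ a = w at *
  generalize arg q t θ a = x at *
  generalize a ^ 3 * (1 + t) / q = y at *
  have hLy0 := L_nonneg y
  have hLy := L_le_abs y
  rw [abs_of_pos hy] at hLy
  set s := 1 + 2 * L y / y with hs
  have hs1 : 1 ≤ s := by
    have : 0 ≤ 2 * L y / y := by positivity
    linarith
  have hs3 : s ≤ 3 := by
    have : 2 * L y / y ≤ 2 := by rw [div_le_iff₀ hy]; linarith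
    linarith
  have hx0 : 0 < x := by linarith
  have hK := abs_le_two_mul_K x
  have hKp := K_pos x
  rw [abs_of_pos hx0] at hK
  have hKy : y / 4 ≤ K x := by linarith
  have hKd0 := Kd_nonneg hx0.le
  have hKd1 := (abs_le.1 (abs_Kd_le x)).2
  -- Since `1/g = (1+t)s`, factoring out `1/s` exposes the cancellation: `s K' = K' + 2L(y)K'/y`
  -- meets the terms of `ρ_a` and leaves differences that are each of size `1/(1+t)` or `1/y`.
  have key : Kd x + x * (1 / K x ^ 2) + w
      - (1 + t)⁻¹ * s⁻¹ * (t * Kd x + 2 * (1 + t) / y * (L x - 1))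
      = s⁻¹ * (Kd x * (1 / (1 + t))
        + 2 / y * ((L y - L x) - L y * (1 - Kd x) + 1)
        + s * (x * (1 / K x ^ 2) + w)) := by
    have hs0 : s ≠ 0 := by positivity
    have hsy : s * y = y + 2 * L y := by rw [hs]; field_simp
    have ht1 : 1 + t ≠ 0 := by positivity
    have e : s * Kd x = Kd x + 2 / y * L y * Kd x := by rw [hs]; field_simp
    rw [eq_inv_mul_iff_mul_eq₀ hs0]
    have e2 : s * (Kd x + x * (1 / K x ^ 2) + w
      - (1 + t)⁻¹ * s⁻¹ * (t * Kd x + 2 * (1 + t) / y * (L x - 1))) =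
      s * Kd x + s * (x * (1 / K x ^ 2) + w)
        - ((1 + t)⁻¹ * (t * Kd x) + 2 / y * (L x - 1)) := by
      field_simp
      ring
    rw [e2, e]
    field_simp
    ring
  rw [key, abs_mul, abs_of_pos (by positivity)]
  have hsi : s⁻¹ ≤ 1 := inv_le_one_of_one_le₀ hs1
  refine (mul_le_of_le_one_left (abs_nonneg _) hsi).trans ?_
  have b1 : |Kd x * (1 / (1 + t))| ≤ 1 / (1 + t) := by
    rw [abs_of_nonneg (by positivity)]
    exact mul_le_of_le_one_left (by positivity) hKd1
  have b2 : |2 / y * ((L y - L x) - L y * (1 - Kd x) + 1)| ≤ 14 / y := by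
    rw [abs_mul, abs_of_pos (by positivity)]
    have c1 : |L y - L x| ≤ 2 := by
      rw [abs_sub_comm]
      refine (abs_L_sub_le hy h1).trans ?_
      rw [h2]
      calc 4 / y * (y * (relDist θ a / (1 + t))) = 4 * (relDist θ a / (1 + t)) := by field_simp
        _ ≤ 2 := by linarith
    have c2 : |L y * (1 - Kd x)| ≤ 4 := by
      rw [abs_of_nonneg (mul_nonneg hLy0 (by linarith))]
      have d1 : 1 - Kd x ≤ 4 / y := by
        refine (one_sub_Kd_le hx0.le).trans ?_
        rw [div_le_div_iff₀ hKp hy]; linarith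
      calc L y * (1 - Kd x) ≤ y * (4 / y) := by
            apply mul_le_mul hLy d1 (by linarith) hy.le
        _ = 4 := by field_simp
    have c3 : |(L y - L x) - L y * (1 - Kd x) + 1| ≤ 7 := by
      rw [abs_le] at c1 c2 ⊢
      constructor <;> linarith
    calc 2 / y * |(L y - L x) - L y * (1 - Kd x) + 1| ≤ 2 / y * 7 := by gcongr
      _ = 14 / y := by ring
  have b3 : |s * (x * (1 / K x ^ 2) + w)| ≤ 48 / y := by
    rw [abs_of_nonneg (by positivity)]
    have c1 : x * (1 / K x ^ 2) ≤ 8 / y := by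
      rw [mul_one_div, div_le_div_iff₀ (by positivity) hy]
      nlinarith
    have c2 : w ≤ 8 / y := by
      refine htv.trans ?_
      rw [mul_one_div, div_le_div_iff₀ (by positivity) hy]
      nlinarith
    calc s * (x * (1 / K x ^ 2) + w) ≤ 3 * (8 / y + 8 / y) := by gcongr
      _ = 48 / y := by ring
  refine (abs_add_le _ _).trans ((add_le_add ((abs_add_le _ _).trans (add_le_add b1 b2)) b3).trans ?_)
  rw [add_assoc, ← add_div]
  norm_num

/-- A crude bound without cancellation, possibly growing in time. It is used outside the outgoing
region, where moments pay for powers of `1+t`. -/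
theorem abs_YT_le (hq : 0 < q) (ha : 0 < a) (ht : 0 ≤ t) :
    |YT q t θ a| ≤ 6 + a ^ 3 * (1 + t) / q + 2 * q / (a ^ 3 * (1 + t))
      + 2 * (relDist θ a / (1 + t)) := by
  have h2 := abs_arg_sub (θ := θ) hq ha ht
  have hg := gY_le hq ha ht
  have hg0 := gY_pos hq ha ht
  have hy : 0 < a ^ 3 * (1 + t) / q := by positivity
  set y := a ^ 3 * (1 + t) / q with hydef
  set x := arg q t θ a with hx
  have hk := one_le_K x
  have hkx := abs_le_two_mul_K x
  have e1 : |Kd x| ≤ 1 := abs_Kd_le x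
  have e2 : |x * (1 / K x ^ 2)| ≤ 2 := by
    rw [abs_mul, abs_of_pos (a := 1 / K x ^ 2) (by positivity), mul_one_div,
      div_le_iff₀ (by positivity)]
    nlinarith
  have e3 : |t * vT q t θ a| ≤ y := by
    have h0 : 0 ≤ vT q t θ a := by unfold vT; positivity
    have h1 : vT q t θ a ≤ a ^ 3 / q := by
      unfold vT
      rw [← hx]
      calc a ^ 3 / (2 * q) * (1 / K x ^ 2) ≤ a ^ 3 / (2 * q) * 1 := by
            refine mul_le_mul_of_nonneg_left ?_ (by positivity)
            rw [div_le_one (by positivity)]; nlinarith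
        _ ≤ a ^ 3 / q := by rw [mul_one]; gcongr; linarith
    rw [abs_of_nonneg (by positivity)]
    calc t * vT q t θ a ≤ (1 + t) * (a ^ 3 / q) := by gcongr; linarith
      _ = y := by rw [hydef]; ring
  have e4 : |gY q t a * rhoA q t θ a| ≤ 3 + 2 / y + 2 * (relDist θ a / (1 + t)) := by
    rw [abs_mul, abs_of_pos hg0]
    have f1 : |L x - 1| ≤ y + y * (relDist θ a / (1 + t)) + 1 := by
      have g1 := L_nonneg x
      have g2 := L_le_abs x
      have g3 : |x| ≤ y + |x - y| := by
        have := abs_add_le y (x - y)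
        rw [abs_of_pos hy] at this
        simpa using this
      rw [abs_le]; constructor <;> nlinarith [abs_nonneg (x - y)]
    have f2 : |rhoA q t θ a| ≤ t + 2 * q / a ^ 3 * (y + y * (relDist θ a / (1 + t)) + 1) := by
      unfold rhoA
      refine (abs_add_le _ _).trans (add_le_add ?_ ?_)
      · rw [abs_mul, abs_of_nonneg ht]
        exact mul_le_of_le_one_right ht (abs_Kd_le _)
      · rw [abs_mul, abs_of_pos (by positivity)]
        gcongr
    calc gY q t a * |rhoA q t θ a|
        ≤ 1 / (1 + t) * (t + 2 * q / a ^ 3 * (y + y * (relDist θ a / (1 + t)) + 1)) := by gcongr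
      _ = t / (1 + t) + 2 + 2 / y + 2 * (relDist θ a / (1 + t)) := by
          rw [hydef]; field_simp; ring
      _ ≤ _ := by
          have : t / (1 + t) ≤ 1 := by rw [div_le_one (by positivity)]; linarith
          linarith
  have : 2 * q / (a ^ 3 * (1 + t)) = 2 / y := by rw [hydef]; field_simp
  rw [this]
  unfold YT vA
  rw [← hx]
  have := (abs_sub (Kd x + x * (1 / K x ^ 2) + t * vT q t θ a) (gY q t a * rhoA q t θ a))
  have h3 := abs_add_le (Kd x + x * (1 / K x ^ 2)) (t * vT q t θ a)
  have h4 := abs_add_le (Kd x) (x * (1 / K x ^ 2))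
  linarith

end

/-! ### Approximation of weakly differentiable functions -/

theorem eLpNorm_two_sq {X : Type*} [MeasurableSpace X] (μ : Measure X) (f : X → ℝ) :
    eLpNorm f 2 μ ^ 2 = ∫⁻ x, ‖f x‖ₑ ^ 2 ∂μ := by
  have := eLpNorm_nnreal_pow_eq_lintegral (μ := μ) (f := f) (p := 2) (by norm_num)
  simpa using this

theorem sq_lintegral_le {X : Type*} [MeasurableSpace X] (ν : Measure X) (hν : ν univ ≤ 1)
    {f : X → ℝ≥0∞} (hf : AEMeasurable f ν) : (∫⁻ x, f x ∂ν) ^ 2 ≤ ∫⁻ x, f x ^ 2 ∂ν := by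
  have h := ENNReal.lintegral_mul_le_Lp_mul_Lq ν Real.HolderConjugate.two_two hf
    (g := fun _ => 1) aemeasurable_const
  have h1 : ∫⁻ x, f x ∂ν ≤ (∫⁻ x, f x ^ 2 ∂ν) ^ (1 / 2 : ℝ) := by
    refine (le_of_eq (by simp)).trans (h.trans ?_)
    simp only [ENNReal.rpow_two, one_pow, lintegral_const, one_mul]
    refine (mul_le_of_le_one_right (zero_le) ?_)
    exact ENNReal.rpow_le_one hν (by norm_num)
  calc (∫⁻ x, f x ∂ν) ^ 2 ≤ ((∫⁻ x, f x ^ 2 ∂ν) ^ (1 / 2 : ℝ)) ^ 2 := by gcongr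
    _ = _ := by
      rw [← ENNReal.rpow_natCast, ← ENNReal.rpow_mul]; norm_num

/-- Minkowski's inequality for averages: Cauchy–Schwarz in the averaging variable, whose measure has
mass at most one, followed by Tonelli. -/
theorem eLpNorm_integral_le {Ω X : Type*} [MeasurableSpace Ω] [MeasurableSpace X]
    (ν : Measure Ω) (μ : Measure X) [SFinite ν] [SFinite μ] (hν : ν univ ≤ 1) {Φ : Ω → X → ℝ}
    (hΦ : AEStronglyMeasurable (Function.uncurry Φ) (ν.prod μ)) {M : ℝ≥0∞}
    (hM : ∀ᵐ w ∂ν, eLpNorm (Φ w) 2 μ ≤ M) :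
    eLpNorm (fun z => ∫ w, Φ w z ∂ν) 2 μ ≤ M := by
  rw [← ENNReal.pow_le_pow_left_iff (n := 2) two_ne_zero, eLpNorm_two_sq]
  have hm : AEMeasurable (fun p : Ω × X => ‖Φ p.1 p.2‖ₑ ^ 2) (ν.prod μ) := by
    have := hΦ.enorm.pow_const 2
    exact this
  calc ∫⁻ z, ‖∫ w, Φ w z ∂ν‖ₑ ^ 2 ∂μ ≤ ∫⁻ z, ∫⁻ w, ‖Φ w z‖ₑ ^ 2 ∂ν ∂μ := by
        apply lintegral_mono_ae
        filter_upwards [hΦ.prod_swap.prodMk_left] with z hz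
        refine (pow_le_pow_left' (enorm_integral_le_lintegral_enorm _) 2).trans ?_
        exact sq_lintegral_le ν hν hz.enorm
    _ = ∫⁻ w, ∫⁻ z, ‖Φ w z‖ₑ ^ 2 ∂μ ∂ν := (lintegral_lintegral_swap hm).symm
    _ ≤ ∫⁻ w, M ^ 2 ∂ν := by
        apply lintegral_mono_ae
        filter_upwards [hM] with w hw
        rw [← eLpNorm_two_sq]
        gcongr
    _ ≤ M ^ 2 := by
        rw [lintegral_const]
        exact mul_le_of_le_one_right zero_le hν

theorem exists_eLpNorm_translate_le {F : ℝ × ℝ → ℝ} (hF : MemLp F 2 volume) {ε : ℝ≥0∞}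
    (hε : ε ≠ 0) : ∃ r > 0, ∀ w : ℝ × ℝ, ‖w‖ < r →
      eLpNorm (fun z => F (z - w) - F z) 2 volume ≤ ε := by
  let g : C(ℝ × ℝ, C(ℝ × ℝ, ℝ × ℝ)) :=
    (ContinuousMap.mk (fun p : (ℝ × ℝ) × (ℝ × ℝ) => p.2 - p.1) (by fun_prop)).curry
  have hg : ∀ w, MeasurePreserving (g w) (volume : Measure (ℝ × ℝ)) volume :=
    fun w => measurePreserving_sub_right volume w
  have hc : Continuous fun w : ℝ × ℝ => Lp.compMeasurePreserving (g w) (hg w) (hF.toLp F) :=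
    Continuous.compMeasurePreservingLp continuous_const g.continuous hg (by norm_num)
  have h0 := hc.tendsto 0
  rw [EMetric.tendsto_nhds] at h0
  have h1 := h0 ε (pos_iff_ne_zero.2 hε)
  rw [Metric.eventually_nhds_iff] at h1
  obtain ⟨r, hr, h⟩ := h1
  refine ⟨r, hr, fun w hw => ?_⟩
  have h2 := (h (y := w) (by simpa using hw)).le
  rw [Lp.edist_def] at h2
  refine (le_of_eq (eLpNorm_congr_ae ?_)).trans h2
  have e1 := Lp.coeFn_compMeasurePreserving (hF.toLp F) (hg w)
  have e2 := Lp.coeFn_compMeasurePreserving (hF.toLp F) (hg 0)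
  have e3 := (hg w).quasiMeasurePreserving.ae_eq_comp hF.coeFn_toLp
  have e4 := (hg 0).quasiMeasurePreserving.ae_eq_comp hF.coeFn_toLp
  filter_upwards [e1, e2, e3, e4] with z h1 h2 h3 h4
  simp only [Pi.sub_apply]
  rw [h1, h2, h3, h4]
  simp [g]

open scoped Convolution in
-- The error of mollification is the average of `F(·-w) - F` over `w` with respect to the
-- probability measure of density `φ.normed`, so the averaged Minkowski inequality applies.
theorem eLpNorm_convolution_sub_le {F : ℝ × ℝ → ℝ} (hF : MemLp F 2 volume)
    (φ : ContDiffBump (0 : ℝ × ℝ)) {ε : ℝ≥0∞}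
    (h : ∀ w : ℝ × ℝ, ‖w‖ ≤ φ.rOut → eLpNorm (fun z => F (z - w) - F z) 2 volume ≤ ε) :
    eLpNorm (fun z => (φ.normed volume ⋆[ContinuousLinearMap.lsmul ℝ ℝ, volume] F) z - F z) 2
      volume ≤ ε := by
  have hφi : Integrable (φ.normed volume) (volume : Measure (ℝ × ℝ)) := φ.integrable_normed
  have hφm : Measurable fun w => (φ.normed (volume : Measure (ℝ × ℝ)) w).toNNReal :=
    φ.continuous_normed.measurable.real_toNNReal
  set ν : Measure (ℝ × ℝ) :=
    volume.withDensity fun w => ((φ.normed volume w).toNNReal : ℝ≥0∞) with hν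
  have hν1 : ν univ = 1 := by
    rw [hν, withDensity_apply _ MeasurableSet.univ, setLIntegral_univ]
    change ∫⁻ w, ENNReal.ofReal (φ.normed volume w) = 1
    rw [← ofReal_integral_eq_lintegral_ofReal hφi
      (Filter.Eventually.of_forall φ.nonneg_normed), φ.integral_normed, ENNReal.ofReal_one]
  have : IsFiniteMeasure ν := ⟨by rw [hν1]; exact ENNReal.one_lt_top⟩
  have hac : ν ≪ volume := withDensity_absolutelyContinuous _ _
  have hm : AEStronglyMeasurable (Function.uncurry fun w z : ℝ × ℝ => F (z - w) - F z)
      (ν.prod volume) := by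
    refine AEStronglyMeasurable.sub ?_ hF.1.comp_snd
    refine AEStronglyMeasurable.mono_ac (hac.prod Measure.AbsolutelyContinuous.rfl) ?_
    exact hF.1.comp_quasiMeasurePreserving
      ((quasiMeasurePreserving_sub_of_right_invariant (volume : Measure (ℝ × ℝ)) volume).comp
        Measure.measurePreserving_swap.quasiMeasurePreserving)
  refine (le_of_eq (eLpNorm_congr_ae ?_)).trans
    (eLpNorm_integral_le ν volume hν1.le hm (M := ε) ?_)
  · refine Filter.Eventually.of_forall fun z => ?_
    change (φ.normed volume ⋆[ContinuousLinearMap.lsmul ℝ ℝ, volume] F) z - F z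
      = ∫ w, (F (z - w) - F z) ∂ν
    rw [hν, integral_withDensity_eq_integral_smul hφm, convolution_def]
    have e0 : ∀ w, (φ.normed volume w).toNNReal • (F (z - w) - F z)
        = φ.normed volume w * F (z - w) - φ.normed volume w * F z := by
      intro w
      rw [NNReal.smul_def, Real.coe_toNNReal _ (φ.nonneg_normed w), smul_eq_mul, mul_sub]
    simp_rw [e0]
    rw [integral_sub ?_ (hφi.mul_const _), integral_mul_const, φ.integral_normed, one_mul]
    · simp
    · have hL : LocallyIntegrable F volume := hF.locallyIntegrable (by norm_num)
      exact (φ.hasCompactSupport_normed.convolutionExists_left (ContinuousLinearMap.lsmul ℝ ℝ)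
        φ.continuous_normed hL z)
  · have hs : ∀ᵐ w ∂ν, w ∈ Metric.closedBall (0 : ℝ × ℝ) φ.rOut := by
      rw [hν, ae_withDensity_iff (by exact hφm.coe_nnreal_ennreal)]
      refine Filter.Eventually.of_forall fun w hw => ?_
      have : w ∈ Function.support (φ.normed volume) := by
        intro h0; simp [h0] at hw
      rw [φ.support_normed_eq] at this
      exact Metric.ball_subset_closedBall this
    filter_upwards [hs] with w hw
    exact h w (by simpa using hw)

theorem isOpen_phaseSpace : IsOpen phaseSpace := isOpen_univ.prod isOpen_Ioi

theorem measurableSet_phaseSpace : MeasurableSet phaseSpace := isOpen_phaseSpace.measurableSet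

theorem mem_phaseSpace {z : ℝ × ℝ} : z ∈ phaseSpace ↔ 0 < z.2 := by
  simp [phaseSpace]

theorem integral_phaseMeasure_eq {f : ℝ × ℝ → ℝ} (hf : Function.support f ⊆ phaseSpace) :
    ∫ z, f z ∂phaseMeasure = ∫ z, f z := by
  exact setIntegral_eq_integral_of_forall_compl_eq_zero fun z hz => by
    by_contra h; exact hz (hf h)

/-- `f` is square integrable on the compact subsets of the phase space. -/
def LocL2 (f : ℝ × ℝ → ℝ) : Prop :=
  ∀ C : Set (ℝ × ℝ), IsCompact C → C ⊆ phaseSpace → MemLp f 2 (volume.restrict C)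

open scoped Convolution in
-- Both `f` and `g` are cut to a compact neighbourhood of `C` and mollified at a scale below its
-- thickness. Seen from `C` the cutting is invisible, so the weak derivative identity turns the
-- derivative of the mollified `f` into the mollified `g`.
theorem exists_smooth_approx {e : ℝ × ℝ} {f g : ℝ × ℝ → ℝ} (h : HasWeakPartial e f g)
    (hf : LocL2 f) (hg : LocL2 g) {C : Set (ℝ × ℝ)} (hC : IsCompact C) (hCs : C ⊆ phaseSpace)
    {ε : ℝ≥0∞} (hε : ε ≠ 0) :
    ∃ φ : ℝ × ℝ → ℝ, ContDiff ℝ ∞ φ ∧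
      eLpNorm (fun z => φ z - f z) 2 (volume.restrict C) ≤ ε ∧
      eLpNorm (fun z => fderiv ℝ φ z e - g z) 2 (volume.restrict C) ≤ ε := by
  obtain ⟨d, hd, hsub⟩ := hC.exists_cthickening_subset_open isOpen_phaseSpace hCs
  set C' := Metric.cthickening d C with hC'
  have hC'c : IsCompact C' := hC.cthickening
  have hmem : ∀ {f}, LocL2 f → MemLp (C'.indicator f) 2 volume := fun hf =>
    (memLp_indicator_iff_restrict hC'c.measurableSet).2 (hf C' hC'c hsub)
  set F := C'.indicator f
  set Γ := C'.indicator g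
  have hF : MemLp F 2 volume := hmem hf
  have hΓ : MemLp Γ 2 volume := hmem hg
  obtain ⟨r1, hr1, h1⟩ := exists_eLpNorm_translate_le hF hε
  obtain ⟨r2, hr2, h2⟩ := exists_eLpNorm_translate_le hΓ hε
  set r := min d (min r1 r2) / 2 with hr
  have hr0 : 0 < r := by positivity
  have hrd : r < d := by
    have := min_le_left d (min r1 r2); linarith
  have hrr1 : r < r1 := by
    have := (min_le_right d (min r1 r2)).trans (min_le_left _ _); linarith
  have hrr2 : r < r2 := by
    have := (min_le_right d (min r1 r2)).trans (min_le_right _ _); linarith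
  let φ : ContDiffBump (0 : ℝ × ℝ) := ⟨r / 2, r, by positivity, by linarith⟩
  have hFl : LocallyIntegrable F volume := hF.locallyIntegrable (by norm_num)
  have hcs : HasCompactSupport (φ.normed volume) := φ.hasCompactSupport_normed
  have hcd : ContDiff ℝ ∞ (φ.normed (volume : Measure (ℝ × ℝ))) := φ.contDiff_normed
  have hagree : ∀ z ∈ C, ∀ w, φ.normed volume (z - w) ≠ 0 → w ∈ C' := by
    intro z hz w hw
    have : z - w ∈ Function.support (φ.normed volume) := hw
    rw [φ.support_normed_eq] at this
    have h3 : dist w z ≤ d := by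
      rw [mem_ball_zero_iff] at this
      rw [dist_comm, dist_eq_norm]
      exact this.le.trans hrd.le
    exact Metric.mem_cthickening_of_dist_le w z d C hz h3
  refine ⟨φ.normed volume ⋆[ContinuousLinearMap.lsmul ℝ ℝ, volume] F,
    hcs.contDiff_convolution_left _ hcd hFl, ?_, ?_⟩
  · refine (eLpNorm_restrict_le _ _ _ C |>.trans' (le_of_eq ?_)).trans
      (eLpNorm_convolution_sub_le hF φ fun w hw => h1 w (lt_of_le_of_lt hw hrr1))
    refine eLpNorm_congr_ae ?_
    filter_upwards [ae_restrict_mem hC.measurableSet] with z hz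
    have : F z = f z := indicator_of_mem (Metric.self_subset_cthickening C hz) f
    rw [this]
  · refine (eLpNorm_restrict_le _ _ _ C |>.trans' (le_of_eq ?_)).trans
      (eLpNorm_convolution_sub_le hΓ φ fun w hw => h2 w (lt_of_le_of_lt hw hrr2))
    refine eLpNorm_congr_ae ?_
    filter_upwards [ae_restrict_mem hC.measurableSet] with z hz
    have hΓz : Γ z = g z := indicator_of_mem (Metric.self_subset_cthickening C hz) g
    rw [hΓz]
    congr 1
    have hd1 := hcs.hasFDerivAt_convolution_left (ContinuousLinearMap.lsmul ℝ ℝ)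
      (hcd.of_le (by exact_mod_cast le_top)) hFl z
    have hone : ContDiff ℝ 1 (φ.normed (volume : Measure (ℝ × ℝ))) :=
      hcd.of_le (by exact_mod_cast le_top)
    have hi := (hcs.fderiv ℝ).convolutionExists_left
      ((ContinuousLinearMap.lsmul ℝ ℝ).precompL (ℝ × ℝ)) (hone.continuous_fderiv (by norm_num)) hFl z
    have hder : ∀ w, fderiv ℝ (fun w => φ.normed volume (z - w)) w e
        = -fderiv ℝ (φ.normed volume) (z - w) e := by
      intro w
      have h3 := ((hone.differentiable (by norm_num)) (z - w)).hasFDerivAt.comp w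
        ((hasFDerivAt_id w).const_sub z)
      have h4 : fderiv ℝ (fun w => φ.normed volume (z - w)) w = _ := h3.fderiv
      rw [h4]
      simp
    have hts : tsupport (fun w => φ.normed volume (z - w)) ⊆ C' := by
      refine closure_minimal (fun w hw => hagree z hz w hw) Metric.isClosed_cthickening
    -- The reflected translate of the mollifier is an admissible test function: its support lies in
    -- the compact neighbourhood `C'`, inside the phase space.
    have hweak := h.2.2 (fun w => φ.normed volume (z - w))
      (hcd.comp (contDiff_const.sub contDiff_id))
      (HasCompactSupport.intro hC'c fun w hw => by
        by_contra h0; exact hw (hagree z hz w h0)) (hts.trans hsub)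
    have hsup1 : Function.support (fun w => f w * fderiv ℝ (fun w => φ.normed volume (z - w)) w e)
        ⊆ C' := by
      intro w hw
      apply hts
      apply support_fderiv_subset ℝ
      intro h0
      apply hw
      simp [h0]
    have hsup2 : Function.support (fun w => g w * φ.normed volume (z - w)) ⊆ C' := by
      intro w hw
      exact hagree z hz w (right_ne_zero_of_mul hw)
    rw [integral_phaseMeasure_eq (hsup1.trans hsub),
      integral_phaseMeasure_eq (hsup2.trans hsub)] at hweak
    rw [hd1.fderiv, convolution_def, ContinuousLinearMap.integral_apply hi, convolution_def,
      ← integral_sub_left_eq_self _ volume z,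
      ← integral_sub_left_eq_self (fun w => (ContinuousLinearMap.lsmul ℝ ℝ)
        (φ.normed volume w) (Γ (z - w))) volume z]
    simp only [ContinuousLinearMap.precompL_apply, ContinuousLinearMap.lsmul_apply, smul_eq_mul,
      sub_sub_cancel]
    have e1 : ∀ w, fderiv ℝ (φ.normed volume) (z - w) e * F w
        = -(f w * fderiv ℝ (fun w => φ.normed volume (z - w)) w e) := by
      intro w
      by_cases hw : w ∈ C'
      · rw [hder, show F w = f w from indicator_of_mem hw f]; ring
      · have h5 : f w * fderiv ℝ (fun w => φ.normed volume (z - w)) w e = 0 := by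
          by_contra h6; exact hw (hsup1 h6)
        rw [h5, show F w = 0 from indicator_of_notMem hw f]; simp
    have e2 : ∀ w, φ.normed volume (z - w) * Γ w = g w * φ.normed volume (z - w) := by
      intro w
      by_cases hw : w ∈ C'
      · rw [show Γ w = g w from indicator_of_mem hw g]; ring
      · have h5 : g w * φ.normed volume (z - w) = 0 := by
          by_contra h6; exact hw (hsup2 h6)
        rw [h5, show Γ w = 0 from indicator_of_notMem hw g]; simp
    rw [integral_congr_ae (Filter.Eventually.of_forall e1),
      integral_congr_ae (Filter.Eventually.of_forall e2)]
    rw [integral_neg, hweak, neg_neg]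

/-! ### Integration by parts and difference quotients -/

theorem tendsto_integral_mul {X : Type*} [MeasurableSpace X] {ν : Measure X}
    {φ ψ : ℕ → X → ℝ} {f g : X → ℝ} (hφ : ∀ n, MemLp (φ n) 2 ν) (hψ : ∀ n, MemLp (ψ n) 2 ν)
    (hf : MemLp f 2 ν) (hg : MemLp g 2 ν)
    (h1 : Filter.Tendsto (fun n => eLpNorm (fun x => φ n x - f x) 2 ν) Filter.atTop (nhds 0))
    (h2 : Filter.Tendsto (fun n => eLpNorm (fun x => ψ n x - g x) 2 ν) Filter.atTop (nhds 0)) :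
    Filter.Tendsto (fun n => ∫ x, φ n x * ψ n x ∂ν) Filter.atTop (nhds (∫ x, f x * g x ∂ν)) := by
  have key : ∀ {a b : X → ℝ} (ha : MemLp a 2 ν) (hb : MemLp b 2 ν),
      ∫ x, a x * b x ∂ν = inner ℝ (ha.toLp a) (hb.toLp b) := by
    intro a b ha hb
    rw [L2.inner_def]
    apply integral_congr_ae
    filter_upwards [ha.coeFn_toLp, hb.coeFn_toLp] with x h1 h2
    rw [h1, h2]; simp [mul_comm]
  have t1 : Filter.Tendsto (fun n => (hφ n).toLp (φ n)) Filter.atTop (nhds (hf.toLp f)) :=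
    (Lp.tendsto_Lp_iff_tendsto_eLpNorm'' _ hφ _ hf).2 h1
  have t2 : Filter.Tendsto (fun n => (hψ n).toLp (ψ n)) Filter.atTop (nhds (hg.toLp g)) :=
    (Lp.tendsto_Lp_iff_tendsto_eLpNorm'' _ hψ _ hg).2 h2
  rw [key hf hg]
  exact (t1.inner t2).congr fun n => (key (hφ n) (hψ n)).symm

theorem memLp_of_continuous {C : Set (ℝ × ℝ)} (hC : IsCompact C) {v : ℝ × ℝ → ℝ}
    (hv : Continuous v) : MemLp v 2 (volume.restrict C) := by
  have : IsFiniteMeasure (volume.restrict C) := ⟨by simpa using hC.measure_lt_top⟩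
  obtain ⟨M, hM⟩ := hC.exists_bound_of_continuousOn hv.continuousOn
  refine MemLp.of_bound hv.aestronglyMeasurable M ?_
  filter_upwards [ae_restrict_mem hC.measurableSet] with z hz using hM z hz

theorem eLpNorm_bounded_mul_le {X : Type*} [MeasurableSpace X] {ν : Measure X} {v f : X → ℝ}
    {M : ℝ} (hM : ∀ᵐ x ∂ν, |v x| ≤ M) :
    eLpNorm (fun x => v x * f x) 2 ν ≤ ENNReal.ofReal M * eLpNorm f 2 ν := by
  refine eLpNorm_le_mul_eLpNorm_of_ae_le_mul (c := M) ?_ 2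
  filter_upwards [hM] with x hx
  rw [Real.norm_eq_abs, abs_mul]
  exact mul_le_mul_of_nonneg_right hx (abs_nonneg _)

theorem tendsto_eLpNorm_bounded_mul {X : Type*} [MeasurableSpace X] {ν : Measure X} {v : X → ℝ}
    {M : ℝ} (hM : ∀ᵐ x ∂ν, |v x| ≤ M) {φ : ℕ → X → ℝ} {f : X → ℝ}
    (h : Filter.Tendsto (fun n => eLpNorm (fun x => φ n x - f x) 2 ν) Filter.atTop (nhds 0)) :
    Filter.Tendsto (fun n => eLpNorm (fun x => v x * φ n x - v x * f x) 2 ν) Filter.atTop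
      (nhds 0) := by
  have h1 := ENNReal.Tendsto.const_mul h (Or.inr (ENNReal.ofReal_ne_top (r := M)))
  rw [mul_zero] at h1
  refine tendsto_of_tendsto_of_tendsto_of_le_of_le tendsto_const_nhds h1 (fun _ => zero_le)
    fun n => ?_
  simp_rw [← mul_sub]
  exact eLpNorm_bounded_mul_le hM

theorem tsupport_fderiv_apply_subset (u : ℝ × ℝ → ℝ) (e : ℝ × ℝ) :
    Function.support (fun z => fderiv ℝ u z e) ⊆ tsupport u := by
  intro z hz
  apply support_fderiv_subset ℝ
  intro h0
  apply hz
  simp [h0]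

theorem exists_smooth_seq {e : ℝ × ℝ} {f g : ℝ × ℝ → ℝ} (h : HasWeakPartial e f g)
    (hf : LocL2 f) (hg : LocL2 g) {C : Set (ℝ × ℝ)} (hC : IsCompact C) (hCs : C ⊆ phaseSpace) :
    ∃ φ : ℕ → ℝ × ℝ → ℝ, (∀ n, ContDiff ℝ ∞ (φ n)) ∧
      Filter.Tendsto (fun n => eLpNorm (fun z => φ n z - f z) 2 (volume.restrict C))
        Filter.atTop (nhds 0) ∧
      Filter.Tendsto (fun n => eLpNorm (fun z => fderiv ℝ (φ n) z e - g z) 2 (volume.restrict C))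
        Filter.atTop (nhds 0) := by
  have h0 : ∀ n : ℕ, ((n : ℝ≥0∞) + 1)⁻¹ ≠ 0 := fun n => by
    simp [ENNReal.add_eq_top]
  choose φ h1 h2 h3 using fun n : ℕ => exists_smooth_approx h hf hg hC hCs (h0 n)
  have ht : Filter.Tendsto (fun n : ℕ => ((n : ℝ≥0∞) + 1)⁻¹) Filter.atTop (nhds 0) := by
    have := ENNReal.tendsto_inv_nat_nhds_zero.comp (Filter.tendsto_add_atTop_nat 1)
    refine this.congr fun n => ?_
    simp
  exact ⟨φ, h1, tendsto_of_tendsto_of_tendsto_of_le_of_le tendsto_const_nhds ht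
    (fun _ => zero_le) h2, tendsto_of_tendsto_of_tendsto_of_le_of_le tendsto_const_nhds ht
    (fun _ => zero_le) h3⟩

/-- This is integration by parts with the chain rule `∂(f²) = 2fg`. Smooth approximations on the
support of `u` converge together with their derivatives in `L²`, so both sides pass to the limit as
scalar products. -/
theorem integral_fderiv_mul_sq {e : ℝ × ℝ} {f g u : ℝ × ℝ → ℝ} (h : HasWeakPartial e f g)
    (hf : LocL2 f) (hg : LocL2 g) (hu : ContDiff ℝ 1 u) (hc : HasCompactSupport u)
    (hs : tsupport u ⊆ phaseSpace) :
    ∫ z, fderiv ℝ u z e * f z ^ 2 ∂phaseMeasure = -(2 * ∫ z, u z * (f z * g z) ∂phaseMeasure) := by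
  set C := tsupport u with hCdef
  have hC : IsCompact C := hc
  obtain ⟨φ, hφ, t1, t2⟩ := exists_smooth_seq h hf hg hC hs
  have hucont : Continuous u := hu.continuous
  have hdu : Continuous fun z => fderiv ℝ u z e :=
    (hu.continuous_fderiv (by norm_num)).clm_apply continuous_const
  have hφc : ∀ n, Continuous (φ n) := fun n => (hφ n).continuous
  have hφdc : ∀ n, Continuous fun z => fderiv ℝ (φ n) z e := fun n =>
    ((hφ n).continuous_fderiv (by norm_num)).clm_apply continuous_const
  have hcdu : HasCompactSupport fun z => fderiv ℝ u z e :=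
    HasCompactSupport.intro hC fun z hz => by
      by_contra h0; exact hz (tsupport_fderiv_apply_subset u e h0)
  have hbd : ∀ {v : ℝ × ℝ → ℝ}, Continuous v → ∃ M, ∀ᵐ z ∂volume.restrict C, |v z| ≤ M := by
    intro v hv
    obtain ⟨M, hM⟩ := hC.exists_bound_of_continuousOn hv.continuousOn
    exact ⟨M, by filter_upwards [ae_restrict_mem hC.measurableSet] with z hz using hM z hz⟩
  obtain ⟨M1, hM1⟩ := hbd hucont
  obtain ⟨M2, hM2⟩ := hbd hdu
  have hfC := hf C hC hs
  have hgC := hg C hC hs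
  have hmul : ∀ {v k : ℝ × ℝ → ℝ} {M : ℝ}, Continuous v →
      (∀ᵐ z ∂volume.restrict C, |v z| ≤ M) → MemLp k 2 (volume.restrict C) →
      MemLp (fun z => v z * k z) 2 (volume.restrict C) := by
    intro v k M hv hM hk
    refine ⟨hv.aestronglyMeasurable.mul hk.1, ?_⟩
    refine (eLpNorm_bounded_mul_le hM).trans_lt ?_
    exact ENNReal.mul_lt_top ENNReal.ofReal_lt_top hk.2
  have L1 := tendsto_integral_mul (ν := volume.restrict C)
    (φ := fun n z => fderiv ℝ u z e * φ n z) (ψ := φ)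
    (fun n => memLp_of_continuous hC (hdu.mul (hφc n))) (fun n => memLp_of_continuous hC (hφc n))
    (hmul hdu hM2 hfC) hfC (tendsto_eLpNorm_bounded_mul hM2 t1) t1
  have L2 := tendsto_integral_mul (ν := volume.restrict C)
    (φ := fun n z => u z * φ n z) (ψ := fun n z => fderiv ℝ (φ n) z e)
    (fun n => memLp_of_continuous hC (hucont.mul (hφc n)))
    (fun n => memLp_of_continuous hC (hφdc n))
    (hmul hucont hM1 hfC) hgC (tendsto_eLpNorm_bounded_mul hM1 t1) t2
  have hglob : ∀ {k : ℝ × ℝ → ℝ}, Function.support k ⊆ C → ∫ z in C, k z = ∫ z, k z :=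
    fun hk => setIntegral_eq_integral_of_forall_compl_eq_zero fun z hz => by
      by_contra h0; exact hz (hk h0)
  have hsub1 : ∀ k : ℝ × ℝ → ℝ, Function.support (fun z => fderiv ℝ u z e * k z) ⊆ C :=
    fun k z hz => tsupport_fderiv_apply_subset u e (left_ne_zero_of_mul hz)
  have hsub2 : ∀ k : ℝ × ℝ → ℝ, Function.support (fun z => u z * k z) ⊆ C :=
    fun k z hz => subset_tsupport u (left_ne_zero_of_mul hz)
  have hparts : ∀ n, ∫ z in C, fderiv ℝ u z e * φ n z * φ n z
      = -(2 * ∫ z in C, u z * φ n z * fderiv ℝ (φ n) z e) := by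
    intro n
    have hd2 : ∀ z, fderiv ℝ (fun z => φ n z ^ 2) z e = 2 * (φ n z * fderiv ℝ (φ n) z e) := by
      intro z
      have := (((hφ n).differentiable (by norm_num)) z).hasFDerivAt.pow 2
      rw [this.fderiv]
      simp; ring
    have hp := integral_mul_fderiv_eq_neg_fderiv_mul_of_integrable (𝕜 := ℝ) (μ := volume)
      (f := fun z => φ n z ^ 2) (g := u) (v := e) ?_ ?_ ?_
      (fun z _ => (((hφ n).pow 2).differentiable (by norm_num)) z)
      (fun z _ => (hu.differentiable (by norm_num)) z)
    · simp_rw [mul_assoc]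
      rw [hglob (hsub1 fun z => φ n z * φ n z), hglob (hsub2 fun z => φ n z * fderiv ℝ (φ n) z e),
        ← integral_const_mul, ← integral_neg]
      rw [← integral_neg] at hp
      calc ∫ z, fderiv ℝ u z e * (φ n z * φ n z) = ∫ z, φ n z ^ 2 * fderiv ℝ u z e := by
            congr 1; ext z; ring
        _ = _ := hp
        _ = _ := by congr 1; ext z; rw [hd2]; ring
    · simp_rw [hd2]
      exact ((continuous_const.mul ((hφc n).mul (hφdc n))).mul hucont).integrable_of_hasCompactSupport
        (hc.mul_left)
    · exact (((hφc n).pow 2).mul hdu).integrable_of_hasCompactSupport hcdu.mul_left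
    · exact (((hφc n).pow 2).mul hucont).integrable_of_hasCompactSupport hc.mul_left
  have L3 := (L2.const_mul 2).neg
  have huniq := tendsto_nhds_unique L1 (L3.congr fun n => (hparts n).symm)
  rw [integral_phaseMeasure_eq ((hsub1 _).trans hs), integral_phaseMeasure_eq ((hsub2 _).trans hs)]
  simp_rw [mul_assoc] at huniq
  rw [hglob (hsub1 fun z => f z * f z), hglob (hsub2 fun z => f z * g z)] at huniq
  simp_rw [sq]
  exact huniq

/-- The difference quotient of `f` in the direction `e` with step `h`. -/
def dq (e : ℝ × ℝ) (h : ℝ) (f : ℝ × ℝ → ℝ) (z : ℝ × ℝ) : ℝ := (f (z + h • e) - f z) / h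

theorem eLpNorm_mul_comp_add_le {C C' : Set (ℝ × ℝ)} (hC' : IsCompact C') {u k : ℝ × ℝ → ℝ}
    {v : ℝ × ℝ} (hsub : ∀ z ∈ C, z + v ∈ C') (hu : Function.support u ⊆ C) {M : ℝ}
    (hM : ∀ z, |u z| ≤ M) (hk : AEStronglyMeasurable k (volume.restrict C')) :
    eLpNorm (fun z => u z * k (z + v)) 2 volume
      ≤ ENNReal.ofReal M * eLpNorm k 2 (volume.restrict C') := by
  have hmp : MeasurePreserving (fun z : ℝ × ℝ => z + v) volume volume :=
    measurePreserving_add_right volume v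
  have h0 : eLpNorm ((C'.indicator k) ∘ fun z => z + v) 2 volume
      = eLpNorm k 2 (volume.restrict C') := by
    rw [eLpNorm_comp_measurePreserving
      ((aestronglyMeasurable_indicator_iff hC'.measurableSet).2 hk) hmp,
      eLpNorm_indicator_eq_eLpNorm_restrict hC'.measurableSet]
  rw [← h0]
  refine eLpNorm_le_mul_eLpNorm_of_ae_le_mul (c := M) (Filter.Eventually.of_forall fun z => ?_) 2
  rw [Real.norm_eq_abs, abs_mul, Real.norm_eq_abs, Function.comp]
  by_cases hz : u z = 0
  · rw [hz, abs_zero, zero_mul]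
    exact mul_nonneg ((abs_nonneg _).trans (hM z)) (abs_nonneg _)
  · rw [indicator_of_mem (hsub z (hu hz))]
    exact mul_le_mul_of_nonneg_right (hM z) (abs_nonneg _)

theorem phaseSpace_add_smul {e : ℝ × ℝ} (he : 0 ≤ e.2) {s : ℝ} (hs : 0 ≤ s) {z : ℝ × ℝ}
    (hz : z ∈ phaseSpace) : z + s • e ∈ phaseSpace := by
  rw [mem_phaseSpace] at *
  have := mul_nonneg hs he
  simp; linarith

/-- A difference quotient is the average of the derivative over the segment from `z` to `z + he`, so
a bound uniform over shifts passes to it. The identity is used for smooth approximations, and these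
converge at fixed step `h`. The condition `0 ≤ e.2` keeps the segment in the half plane. -/
theorem eLpNorm_mul_dq_sub_le {e : ℝ × ℝ} (he : 0 ≤ e.2) {f g k u : ℝ × ℝ → ℝ}
    (hw : HasWeakPartial e f g) (hf : LocL2 f) (hg : LocL2 g)
    (hu : Continuous u) (hc : HasCompactSupport u) (hs : tsupport u ⊆ phaseSpace)
    (hk : LocL2 k) {h : ℝ} (hh : 0 < h) {M : ℝ≥0∞}
    (hM : ∀ s ∈ Icc 0 h, eLpNorm (fun z => u z * (g (z + s • e) - k z)) 2 volume ≤ M) :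
    eLpNorm (fun z => u z * (dq e h f z - k z)) 2 volume ≤ M := by
  set C := tsupport u with hCdef
  have hC : IsCompact C := hc
  set C' := (fun p : (ℝ × ℝ) × ℝ => p.1 + p.2 • e) '' (C ×ˢ Icc 0 h) with hC'def
  have hC' : IsCompact C' := (hC.prod isCompact_Icc).image (by fun_prop)
  have hC's : C' ⊆ phaseSpace := by
    rintro _ ⟨⟨z, s⟩, ⟨hz, hs'⟩, rfl⟩
    exact phaseSpace_add_smul he hs'.1 (hs hz)
  have hsub : ∀ s ∈ Icc 0 h, ∀ z ∈ C, z + s • e ∈ C' := fun s hs' z hz =>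
    ⟨(z, s), ⟨hz, hs'⟩, rfl⟩
  have hsub0 : ∀ z ∈ C, z + (0 : ℝ × ℝ) ∈ C' := fun z hz => by
    have := hsub 0 ⟨le_rfl, hh.le⟩ z hz
    simpa using this
  have hsup : Function.support u ⊆ C := subset_tsupport u
  obtain ⟨B, hB⟩ := hu.bounded_above_of_compact_support hc
  replace hB : ∀ z, |u z| ≤ B := hB
  obtain ⟨φ, hφ, t1, t2⟩ := exists_smooth_seq hw hf hg hC' hC's
  have hφc : ∀ n, Continuous (φ n) := fun n => (hφ n).continuous
  have hφdc : ∀ n, Continuous fun z => fderiv ℝ (φ n) z e := fun n =>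
    ((hφ n).continuous_fderiv (by norm_num)).clm_apply continuous_const
  have hfm := (hf C' hC' hC's).1
  have hgm := (hg C' hC' hC's).1
  set A := ENNReal.ofReal B
  -- measurability of products with functions only controlled near the support of `u`
  have hmeas : ∀ {k : ℝ × ℝ → ℝ} {v : ℝ × ℝ}, (∀ z ∈ C, z + v ∈ C') →
      AEStronglyMeasurable k (volume.restrict C') →
      AEStronglyMeasurable (fun z => u z * k (z + v)) volume := by
    intro k v hv hk
    have h1 : (fun z => u z * k (z + v)) = fun z => u z * (C'.indicator k) (z + v) := by
      ext z
      by_cases hz : u z = 0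
      · simp [hz]
      · rw [indicator_of_mem (hv z (hsup hz))]
    rw [h1]
    exact hu.aestronglyMeasurable.mul
      (((aestronglyMeasurable_indicator_iff hC'.measurableSet).2 hk).comp_measurePreserving
        (measurePreserving_add_right volume v))
  have hkm := (hk C' hC' hC's).1
  have hmeas0 : ∀ {k : ℝ × ℝ → ℝ}, AEStronglyMeasurable k (volume.restrict C') →
      AEStronglyMeasurable (fun z => u z * k z) volume := fun hk => by
    simpa using hmeas hsub0 hk
  have smooth : ∀ n, eLpNorm (fun z => u z * (dq e h (φ n) z - k z)) 2 volume
      ≤ M + A * eLpNorm (fun z => fderiv ℝ (φ n) z e - g z) 2 (volume.restrict C') := by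
    intro n
    set ν : Measure ℝ := volume.restrict (Ioc 0 1) with hν
    have hν1 : ν univ ≤ 1 := by simp [hν]
    have hjc : Continuous fun p : ℝ × (ℝ × ℝ) => fderiv ℝ (φ n) (p.2 + (p.1 * h) • e) e :=
      (hφdc n).comp (by fun_prop)
    have hjm : AEStronglyMeasurable (Function.uncurry fun (s : ℝ) (z : ℝ × ℝ) =>
        u z * (fderiv ℝ (φ n) (z + (s * h) • e) e - k z)) (ν.prod volume) := by
      have e1 : (Function.uncurry fun (s : ℝ) (z : ℝ × ℝ) =>
        u z * (fderiv ℝ (φ n) (z + (s * h) • e) e - k z)) = fun p : ℝ × (ℝ × ℝ) =>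
          u p.2 * fderiv ℝ (φ n) (p.2 + (p.1 * h) • e) e - u p.2 * k p.2 := by
        ext p; simp [Function.uncurry, mul_sub]
      rw [e1]
      exact ((hu.comp continuous_snd).mul hjc).aestronglyMeasurable.sub (hmeas0 hkm).comp_snd
    -- Parametrising the segment by `s ∈ (0,1]` with step `s h` makes the averaging measure have
    -- mass one.
    have hft : ∀ z, dq e h (φ n) z = ∫ s in Ioc (0 : ℝ) 1, fderiv ℝ (φ n) (z + (s * h) • e) e := by
      intro z
      rw [← intervalIntegral.integral_of_le zero_le_one]
      have hder : ∀ s ∈ uIcc (0 : ℝ) 1, HasDerivAt (fun s : ℝ => φ n (z + (s * h) • e) / h)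
          (fderiv ℝ (φ n) (z + (s * h) • e) e) s := by
        intro s _
        have hl : HasDerivAt (fun s : ℝ => z + (s * h) • e) (h • e) s := by
          have := (((hasDerivAt_id s).mul_const h).smul_const e).const_add z
          simpa using this
        have := ((((hφ n).differentiable (by norm_num)) _).hasFDerivAt.comp_hasDerivAt s hl).div_const h
        refine this.congr_deriv ?_
        rw [map_smul, smul_eq_mul]; field_simp
      rw [intervalIntegral.integral_eq_sub_of_hasDerivAt hder
        (Continuous.intervalIntegrable ((hφdc n).comp (by fun_prop)) _ _)]
      simp [dq, sub_div]
    refine (le_of_eq (eLpNorm_congr_ae (Filter.Eventually.of_forall fun z => ?_))).trans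
      (eLpNorm_integral_le ν volume hν1 hjm ?_)
    · change u z * (dq e h (φ n) z - k z)
        = ∫ s in Ioc (0 : ℝ) 1, u z * (fderiv ℝ (φ n) (z + (s * h) • e) e - k z)
      rw [integral_const_mul, integral_sub, ← hft]
      · simp
      · exact (Continuous.integrableOn_Icc ((hφdc n).comp (by fun_prop))).mono_set
          Ioc_subset_Icc_self
      · exact integrable_const _
    · filter_upwards [ae_restrict_mem measurableSet_Ioc] with s hs'
      have hsh : s * h ∈ Icc 0 h := ⟨mul_nonneg hs'.1.le hh.le, by nlinarith [hs'.2]⟩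
      have hsplit : (fun z => u z * (fderiv ℝ (φ n) (z + (s * h) • e) e - k z))
          = (fun z => u z * (g (z + (s * h) • e) - k z))
            + fun z => u z * (fderiv ℝ (φ n) (z + (s * h) • e) e - g (z + (s * h) • e)) := by
        ext z; simp; ring
      rw [hsplit]
      refine (eLpNorm_add_le ?_ ?_ (by norm_num)).trans (add_le_add (hM _ hsh) ?_)
      · simp_rw [mul_sub]
        exact (hmeas (hsub _ hsh) hgm).sub (hmeas0 hkm)
      · exact hmeas (k := fun z => fderiv ℝ (φ n) z e - g z) (hsub _ hsh)
          ((hφdc n).aestronglyMeasurable.sub hgm)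
      · exact eLpNorm_mul_comp_add_le (k := fun z => fderiv ℝ (φ n) z e - g z) hC' (hsub _ hsh)
          hsup hB ((hφdc n).aestronglyMeasurable.sub hgm)
  have hhm : h ∈ Icc 0 h := ⟨hh.le, le_rfl⟩
  have full : ∀ n, eLpNorm (fun z => u z * (dq e h f z - k z)) 2 volume
      ≤ (M + A * eLpNorm (fun z => fderiv ℝ (φ n) z e - g z) 2 (volume.restrict C'))
        + ENNReal.ofReal (1 / h) * (A * eLpNorm (fun z => φ n z - f z) 2 (volume.restrict C')
          + A * eLpNorm (fun z => φ n z - f z) 2 (volume.restrict C')) := by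
    intro n
    have hdm : AEStronglyMeasurable (fun z => φ n z - f z) (volume.restrict C') :=
      (hφc n).aestronglyMeasurable.sub hfm
    have hsplit : (fun z => u z * (dq e h f z - k z))
        = (fun z => u z * (dq e h (φ n) z - k z))
          + fun z => (-(1 / h)) * (u z * (φ n (z + h • e) - f (z + h • e))
            - u z * (φ n z - f z)) := by
      ext z; simp [dq]; field_simp; ring
    rw [hsplit]
    have m1 := hmeas (k := fun z => φ n z - f z) (hsub _ hhm) hdm
    have m2 := hmeas0 (k := fun z => φ n z - f z) hdm
    refine (eLpNorm_add_le ?_ ((m1.sub m2).const_mul _) (by norm_num)).trans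
      (add_le_add (smooth n) ?_)
    · have : Continuous (dq e h (φ n)) := by
        unfold dq
        exact (((hφc n).comp (by fun_prop)).sub (hφc n)).div_const h
      simp_rw [mul_sub]
      exact (hu.mul this).aestronglyMeasurable.sub (hmeas0 hkm)
    · refine (eLpNorm_bounded_mul_le (M := 1 / h) (Filter.Eventually.of_forall fun z => ?_)).trans ?_
      · rw [abs_neg, abs_of_pos (by positivity)]
      · gcongr
        refine (eLpNorm_sub_le m1 m2 (by norm_num)).trans (add_le_add ?_ ?_)
        · exact eLpNorm_mul_comp_add_le (k := fun z => φ n z - f z) hC' (hsub _ hhm) hsup hB hdm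
        · have := eLpNorm_mul_comp_add_le (k := fun z => φ n z - f z) hC' hsub0 hsup hB hdm
          simpa using this
  have hA : A ≠ ⊤ := ENNReal.ofReal_ne_top
  have lim : Filter.Tendsto (fun n =>
      (M + A * eLpNorm (fun z => fderiv ℝ (φ n) z e - g z) 2 (volume.restrict C'))
        + ENNReal.ofReal (1 / h) * (A * eLpNorm (fun z => φ n z - f z) 2 (volume.restrict C')
          + A * eLpNorm (fun z => φ n z - f z) 2 (volume.restrict C'))) Filter.atTop
      (nhds ((M + A * 0) + ENNReal.ofReal (1 / h) * (A * 0 + A * 0))) := by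
    have a1 := ENNReal.Tendsto.const_mul t1 (Or.inr hA)
    have a2 := ENNReal.Tendsto.const_mul t2 (Or.inr hA)
    exact (tendsto_const_nhds.add a2).add
      (ENNReal.Tendsto.const_mul (a1.add a1) (Or.inr ENNReal.ofReal_ne_top))
  have := ge_of_tendsto' lim full
  simpa using this

theorem eLpNorm_phaseMeasure_eq {f : ℝ × ℝ → ℝ} (hf : Function.support f ⊆ phaseSpace) :
    eLpNorm f 2 phaseMeasure = eLpNorm f 2 volume :=
  eLpNorm_restrict_eq_of_support_subset hf

/-- Shifting a compactly supported weight against the direction `e` costs a multiple of `h a`. -/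
theorem exists_shift_bound {e : ℝ × ℝ} (he : 0 ≤ e.2) {u : ℝ × ℝ → ℝ} (hu : ContDiff ℝ 1 u)
    (hc : HasCompactSupport u) (hs : tsupport u ⊆ phaseSpace) :
    ∃ c, 0 ≤ c ∧ ∀ h s : ℝ, 0 ≤ s → s ≤ h → ∀ z ∈ phaseSpace,
      |u (z - s • e)| ≤ |u z| + c * h * z.2 := by
  obtain ⟨Lc, hL⟩ := hu.lipschitzWith_of_hasCompactSupport hc (by norm_num)
  by_cases hne : (tsupport u).Nonempty
  swap
  · refine ⟨0, le_rfl, fun h s _ _ z _ => ?_⟩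
    have : u = 0 := by
      rw [Set.not_nonempty_iff_eq_empty, tsupport_eq_empty_iff] at hne; exact hne
    simp [this]
  obtain ⟨z0, hz0, hmin⟩ := IsCompact.exists_isMinOn hc hne continuous_snd.continuousOn
  have hm : 0 < z0.2 := mem_phaseSpace.1 (hs hz0)
  refine ⟨Lc * ‖e‖ / z0.2, by positivity, fun h s hs0 hsh z hz => ?_⟩
  have hzp := mem_phaseSpace.1 hz
  have hh : 0 ≤ h := hs0.trans hsh
  by_cases h0 : u (z - s • e) = 0
  · rw [h0, abs_zero]; positivity
  have h1 : z0.2 ≤ (z - s • e).2 := hmin (subset_tsupport u h0)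
  have h2 : z0.2 ≤ z.2 := by
    have := mul_nonneg hs0 he
    simp at h1; linarith
  have h3 : |u (z - s • e) - u z| ≤ Lc * (s * ‖e‖) := by
    have := hL.dist_le_mul (z - s • e) z
    rw [Real.dist_eq, dist_eq_norm] at this
    simpa [norm_smul, abs_of_nonneg hs0] using this
  have h4 : |u (z - s • e)| ≤ |u z| + Lc * (s * ‖e‖) := by
    have := abs_add_le (u z) (u (z - s • e) - u z)
    rw [add_sub_cancel] at this
    linarith
  refine h4.trans (add_le_add le_rfl ?_)
  calc (Lc : ℝ) * (s * ‖e‖) ≤ Lc * (h * ‖e‖) := by gcongr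
    _ = Lc * ‖e‖ * h * 1 := by ring
    _ ≤ Lc * ‖e‖ * h * (z.2 / z0.2) := by
        gcongr
        rwa [one_le_div hm]
    _ = _ := by ring

/-- A change of variables moves the shift from `k` to the weight `u`, where regularity of `u`
controls its effect. The error carries a factor `a`, the weight under which all derivatives of the
solution are square integrable. -/
theorem eLpNorm_mul_shift_le {e : ℝ × ℝ} {u k : ℝ × ℝ → ℝ} (hu : Continuous u)
    (hs : tsupport u ⊆ phaseSpace) {c h s : ℝ} (hc0 : 0 ≤ c) (hh : 0 ≤ h)
    (he : 0 ≤ e.2) (hs0 : 0 ≤ s)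
    (hc : ∀ z ∈ phaseSpace, |u (z - s • e)| ≤ |u z| + c * h * z.2)
    (hk : AEStronglyMeasurable k phaseMeasure) :
    eLpNorm (fun z => u z * k (z + s • e)) 2 volume
      ≤ eLpNorm (fun z => u z * k z) 2 phaseMeasure
        + ENNReal.ofReal (c * h) * eLpNorm (fun z => z.2 * k z) 2 phaseMeasure := by
  have hmp : MeasurePreserving (fun z : ℝ × ℝ => z + s • e) volume volume :=
    measurePreserving_add_right volume _
  have hkm : AEStronglyMeasurable (phaseSpace.indicator k) volume :=
    (aestronglyMeasurable_indicator_iff measurableSet_phaseSpace).2 hk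
  have hum : AEStronglyMeasurable u phaseMeasure := hu.aestronglyMeasurable
  have hush : Continuous fun z => u (z - s • e) := hu.comp (by fun_prop)
  have h1 : (fun z => u z * k (z + s • e))
      = (fun z => u (z - s • e) * phaseSpace.indicator k z) ∘ fun z => z + s • e := by
    ext z
    simp only [Function.comp, add_sub_cancel_right]
    by_cases hz : u z = 0
    · simp [hz]
    · rw [indicator_of_mem (phaseSpace_add_smul he hs0 (hs (subset_tsupport u hz)))]
  rw [h1, eLpNorm_comp_measurePreserving (g := fun z => u (z - s • e) * phaseSpace.indicator k z)
    (hush.aestronglyMeasurable.mul hkm) hmp]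
  have h2 : (fun z => u (z - s • e) * phaseSpace.indicator k z)
      = phaseSpace.indicator fun z => u (z - s • e) * k z := by
    ext z
    by_cases hz : z ∈ phaseSpace <;> simp [hz]
  rw [h2, eLpNorm_indicator_eq_eLpNorm_restrict measurableSet_phaseSpace]
  change eLpNorm _ 2 phaseMeasure ≤ _
  have h3 : eLpNorm (fun z => c * h * (z.2 * k z)) 2 phaseMeasure
      ≤ ENNReal.ofReal (c * h) * eLpNorm (fun z => z.2 * k z) 2 phaseMeasure :=
    eLpNorm_bounded_mul_le (Filter.Eventually.of_forall fun z => by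
      rw [abs_of_nonneg (by positivity)])
  refine le_trans ?_ (add_le_add le_rfl h3)
  have hm3 : AEStronglyMeasurable (fun z : ℝ × ℝ => z.2 * k z) phaseMeasure :=
    continuous_snd.aestronglyMeasurable.mul hk
  have h4 := eLpNorm_add_le (p := 2) (μ := phaseMeasure) (f := fun z => ‖u z * k z‖)
    (g := fun z => ‖c * h * (z.2 * k z)‖) (hum.mul hk).norm (hm3.const_mul _).norm (by norm_num)
  rw [eLpNorm_norm (fun z => u z * k z), eLpNorm_norm (fun z : ℝ × ℝ => c * h * (z.2 * k z))] at h4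
  refine le_trans ?_ h4
  refine eLpNorm_mono_ae_real ?_
  filter_upwards [ae_restrict_mem measurableSet_phaseSpace] with z hz
  have := mul_le_mul_of_nonneg_right (hc z hz) (abs_nonneg (k z))
  rw [Real.norm_eq_abs, abs_mul]
  refine this.trans (le_of_eq ?_)
  have hz2 := (mem_phaseSpace.1 hz).le
  simp only [Pi.add_apply, Real.norm_eq_abs, abs_mul, abs_of_nonneg hc0, abs_of_nonneg hh,
    abs_of_nonneg hz2]
  ring

/-! ### Weights -/

/-- The part of the moment weight which only involves the action variable. -/
def actionWeight (a : ℝ) : ℝ := a ^ (-20 : ℤ) + a ^ 20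

/-- The time dependent weight used to measure decay. -/
def decayWeight (t θ a : ℝ) : ℝ := actionWeight a + momentWeight θ a / (1 + t)

/-- `max (|θ|, a, 1/a)`. -/
def size (θ a : ℝ) : ℝ := max |θ| (max a a⁻¹)

section
variable {q t θ a : ℝ}

theorem one_le_size (ha : 0 < a) : 1 ≤ size θ a := by
  unfold size
  rcases le_total 1 a with h | h
  · exact le_max_of_le_right (le_max_of_le_left h)
  · exact le_max_of_le_right (le_max_of_le_right ((one_le_inv₀ ha).2 h))

theorem le_size : a ≤ size θ a := le_max_of_le_right (le_max_left _ _)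

theorem inv_le_size : a⁻¹ ≤ size θ a := le_max_of_le_right (le_max_right _ _)

theorem abs_le_size : |θ| ≤ size θ a := le_max_left _ _

theorem actionWeight_nonneg (ha : 0 < a) : 0 ≤ actionWeight a := by
  unfold actionWeight; positivity

theorem momentWeight_nonneg (ha : 0 < a) : 0 ≤ momentWeight θ a := by
  unfold momentWeight
  have : 0 ≤ θ ^ 20 := Even.pow_nonneg (by decide) θ
  positivity

theorem size_pow_le (ha : 0 < a) {k : ℕ} (hk : k ≤ 20) : size θ a ^ k ≤ momentWeight θ a := by
  refine (pow_le_pow_right₀ (one_le_size ha) hk).trans ?_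
  have h1 : 0 ≤ θ ^ 20 := Even.pow_nonneg (by decide) θ
  have h2 : 0 < a ^ (-20 : ℤ) := by positivity
  have h3 : 0 < a ^ 20 := by positivity
  have h4 : a⁻¹ ^ 20 = a ^ (-20 : ℤ) := by
    rw [inv_pow, zpow_neg]; norm_cast
  have h5 : |θ| ^ 20 = θ ^ 20 := Even.pow_abs (by decide) θ
  unfold momentWeight
  rcases max_cases |θ| (max a a⁻¹) with h | h
  · rw [size, h.1, h5]; linarith
  · rw [size, h.1]
    rcases max_cases a a⁻¹ with h' | h'
    · rw [h'.1]; linarith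
    · rw [h'.1, h4]; linarith

theorem pow_le_actionWeight (ha : 0 < a) {k : ℕ} (hk : k ≤ 20) : a ^ k ≤ actionWeight a := by
  have h2 : 0 < a ^ (-20 : ℤ) := by positivity
  have h3 : 0 < a ^ 20 := by positivity
  have h4 : (a ^ 20)⁻¹ = a ^ (-20 : ℤ) := by rw [zpow_neg]; norm_cast
  unfold actionWeight
  rcases le_total 1 a with h | h
  · exact (pow_le_pow_right₀ h hk).trans (by linarith)
  · have h5 : a ^ k ≤ 1 := pow_le_one₀ ha.le h
    have h6 : 1 ≤ (a ^ 20)⁻¹ := (one_le_inv₀ h3).2 (pow_le_one₀ ha.le h)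
    linarith

/-- `actionWeight` is invariant under `a ↦ 1/a`. -/
theorem inv_pow_le_actionWeight (ha : 0 < a) {k : ℕ} (hk : k ≤ 20) :
    (1 / a) ^ k ≤ actionWeight a := by
  have h := pow_le_actionWeight (a := a⁻¹) (by positivity) hk
  have e : actionWeight a⁻¹ = actionWeight a := by
    unfold actionWeight
    rw [inv_zpow, ← zpow_neg, neg_neg, inv_pow, zpow_neg, add_comm]
    norm_cast
  rwa [e, ← one_div] at h

theorem one_le_actionWeight (ha : 0 < a) : 1 ≤ actionWeight a := by
  simpa using pow_le_actionWeight ha (Nat.zero_le 20)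

theorem actionWeight_le_decayWeight (ha : 0 < a) (ht : 0 ≤ t) :
    actionWeight a ≤ decayWeight t θ a := by
  have := momentWeight_nonneg (θ := θ) ha
  have : 0 ≤ momentWeight θ a / (1 + t) := by positivity
  unfold decayWeight; linarith

theorem momentWeight_div_le_decayWeight (ha : 0 < a) :
    momentWeight θ a / (1 + t) ≤ decayWeight t θ a := by
  have := actionWeight_nonneg ha
  unfold decayWeight; linarith

theorem one_le_decayWeight (ha : 0 < a) (ht : 0 ≤ t) : 1 ≤ decayWeight t θ a :=
  (one_le_actionWeight ha).trans (actionWeight_le_decayWeight ha ht)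

theorem relDist_nonneg (ha : 0 < a) : 0 ≤ relDist θ a := by
  unfold relDist; positivity

theorem relDist_le (ha : 0 < a) : relDist θ a ≤ 2 * size θ a ^ 2 := by
  have h1 := abs_le_size (θ := θ) (a := a)
  have h2 := le_size (θ := θ) (a := a)
  have h3 := inv_le_size (θ := θ) (a := a)
  have h0 := one_le_size (θ := θ) ha
  have h4 : |θ - a| ≤ 2 * size θ a := by
    refine (abs_sub _ _).trans ?_
    rw [abs_of_pos ha]; linarith
  calc relDist θ a = |θ - a| * a⁻¹ := rfl
    _ ≤ 2 * size θ a * size θ a := by gcongr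
    _ = _ := by ring

/-- Where the free flow is not outgoing, powers of `τ` can be traded for weights. -/
theorem one_le_of_not_bulk (ha : 0 < a) (ht : 0 ≤ t) (h : ¬ relDist θ a / (1 + t) ≤ 1 / 2)
    (j : ℕ) : 1 ≤ (4 * size θ a ^ 2) ^ j / (1 + t) ^ j := by
  rw [← div_pow]
  apply one_le_pow₀
  push Not at h
  have h1 := relDist_le (θ := θ) ha
  rw [lt_div_iff₀ (by positivity)] at h
  rw [le_div_iff₀ (by positivity)]
  linarith

/-- The constant in the decay estimates. -/
def decayConst (q : ℝ) : ℝ := (4 * (1 + 1 / q)) ^ 5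

theorem one_le_decayConst (hq : 0 < q) : 1 ≤ decayConst q := by
  apply one_le_pow₀
  have : 0 < 1 / q := by positivity
  linarith

theorem decayConst_nonneg (hq : 0 < q) : 0 ≤ decayConst q :=
  zero_le_one.trans (one_le_decayConst hq)

theorem le_mul_of_le_of_one_le' {x y c : ℝ} (h : x ≤ y) (hc : 1 ≤ c) (hy : 0 ≤ y) : x ≤ y * c :=
  h.trans (le_mul_of_one_le_right hy hc)

theorem inv_rho_le (hq : 0 < q) (ha : 0 < a) : 1 / rho q t θ a ≤ a ^ 2 / q := by
  have h := le_rho (t := t) (θ := θ) (a := a) hq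
  have h2 := one_div_le_one_div_of_le (by positivity) h
  rwa [one_div_div] at h2

/-- The constant in the estimates of the transversal field. -/
def fieldConst (q : ℝ) : ℝ := (100 + 100 * q + 1 / q) * 1024 * (1 + 1 / q) ^ 2

theorem fieldConst_nonneg (hq : 0 < q) : 0 ≤ fieldConst q := by
  unfold fieldConst; positivity

/-- In the outgoing region `1/ρ ≤ 4/(a(1+t))` gives the decay directly. Elsewhere `1/ρ ≤ a²/q` gives
none, and `1+t ≤ 4 size²` buys the powers of `1+t` with moments. -/
theorem inv_rho_pow_mul_le (hq : 0 < q) (ha : 0 < a) (ht : 0 ≤ t) {k i : ℕ} (hk : k ≤ 4)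
    (hki : 4 * k + 2 + i ≤ 20) :
    (1 / rho q t θ a) ^ k * (1 / a) ^ i ≤ decayConst q * decayWeight t θ a / (1 + t) ^ k := by
  have hr := rho_pos (t := t) (θ := θ) hq ha
  have hq' : 0 < 1 / q := by positivity
  have hbase : 1 ≤ 4 * (1 + 1 / q) := by linarith
  have hD := one_le_decayWeight (t := t) (θ := θ) ha ht
  have hD0 : 0 ≤ decayWeight t θ a := zero_le_one.trans hD
  have hc0 := decayConst_nonneg hq
  have hf0 := fieldConst_nonneg hq
  by_cases h : relDist θ a / (1 + t) ≤ 1 / 2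
  · have h1 := le_rho_of_bulk hq ha ht h
    have h2 : 1 / rho q t θ a ≤ 4 * (1 / a) / (1 + t) := by
      refine (one_div_le_one_div_of_le (by positivity) h1).trans (le_of_eq ?_)
      field_simp
    calc (1 / rho q t θ a) ^ k * (1 / a) ^ i ≤ (4 * (1 / a) / (1 + t)) ^ k * (1 / a) ^ i := by
          gcongr
      _ = 4 ^ k * (1 / a) ^ (k + i) / (1 + t) ^ k := by
          rw [div_pow, mul_pow, pow_add]; ring
      _ ≤ decayConst q * decayWeight t θ a / (1 + t) ^ k := by
          gcongr
          · calc (4 : ℝ) ^ k ≤ (4 * (1 + 1 / q)) ^ k := by gcongr; linarith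
              _ ≤ _ := pow_le_pow_right₀ hbase (by omega)
          · exact (inv_pow_le_actionWeight ha (by omega)).trans (actionWeight_le_decayWeight ha ht)
  -- One power more than the target is bought, because `decayWeight` contains the full moment weight
  -- only divided by `1+t`. The total exponent of `size` is `2k + i + 2(k+1)`, which is the
  -- hypothesis `hki`.
  · have h1 := one_le_of_not_bulk ha ht h (k + 1)
    have hs := one_le_size (θ := θ) ha
    have h2 : 1 / rho q t θ a ≤ 1 / q * size θ a ^ 2 := by
      refine (inv_rho_le hq ha).trans ?_
      rw [div_eq_mul_one_div, mul_comm]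
      gcongr
      exact le_size
    calc (1 / rho q t θ a) ^ k * (1 / a) ^ i
        ≤ (1 / q * size θ a ^ 2) ^ k * size θ a ^ i
          * ((4 * size θ a ^ 2) ^ (k + 1) / (1 + t) ^ (k + 1)) := by
          refine le_mul_of_le_of_one_le' ?_ h1 (by positivity)
          gcongr
          rw [one_div]; exact inv_le_size
      _ = ((1 / q) ^ k * 4 ^ (k + 1)) * (size θ a ^ (4 * k + 2 + i) / (1 + t)) / (1 + t) ^ k := by
          rw [mul_pow, mul_pow, ← pow_mul, ← pow_mul, pow_succ (1 + t)]
          field_simp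
          ring
      _ ≤ decayConst q * decayWeight t θ a / (1 + t) ^ k := by
          gcongr
          · calc (1 / q) ^ k * 4 ^ (k + 1) ≤ (1 + 1 / q) ^ (k + 1) * 4 ^ (k + 1) := by
                  gcongr
                  calc (1 / q) ^ k ≤ (1 + 1 / q) ^ k := by gcongr; linarith
                    _ ≤ _ := pow_le_pow_right₀ (by linarith) (by omega)
              _ = (4 * (1 + 1 / q)) ^ (k + 1) := by rw [mul_pow, mul_comm]
              _ ≤ _ := pow_le_pow_right₀ hbase (by omega)
          · exact (div_le_div_of_nonneg_right (size_pow_le ha hki) (by positivity)).trans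
              (momentWeight_div_le_decayWeight ha)

theorem inv_rho_pow_mul_YT_le (hq : 0 < q) (ha : 0 < a) (ht : 0 ≤ t) {k : ℕ} (hk : k ≤ 2) :
    (1 / rho q t θ a) ^ k * |YT q t θ a|
      ≤ fieldConst q * decayWeight t θ a / (1 + t) ^ (k + 1) := by
  have hr := rho_pos (t := t) (θ := θ) hq ha
  have hq' : 0 < 1 / q := by positivity
  have hD := one_le_decayWeight (t := t) (θ := θ) ha ht
  have hD0 : 0 ≤ decayWeight t θ a := zero_le_one.trans hD
  have hc0 := decayConst_nonneg hq
  have hf0 := fieldConst_nonneg hq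
  by_cases h : relDist θ a / (1 + t) ≤ 1 / 2
  · have h1 := le_rho_of_bulk hq ha ht h
    have h2 : 1 / rho q t θ a ≤ 4 * (1 / a) / (1 + t) := by
      refine (one_div_le_one_div_of_le (by positivity) h1).trans (le_of_eq ?_)
      field_simp
    have h3 := abs_YT_le_of_bulk hq ha ht h
    have g1 : (1 / a) ^ k ≤ decayWeight t θ a :=
      (inv_pow_le_actionWeight ha (by omega)).trans (actionWeight_le_decayWeight ha ht)
    have g2 : (1 / a) ^ (k + 3) ≤ decayWeight t θ a :=
      (inv_pow_le_actionWeight ha (by omega)).trans (actionWeight_le_decayWeight ha ht)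
    calc (1 / rho q t θ a) ^ k * |YT q t θ a|
        ≤ (4 * (1 / a) / (1 + t)) ^ k * (1 / (1 + t) + 62 * q / (a ^ 3 * (1 + t))) := by gcongr
      _ = 4 ^ k * ((1 / a) ^ k + 62 * q * (1 / a) ^ (k + 3)) / (1 + t) ^ (k + 1) := by
          rw [div_pow, mul_pow, pow_add, pow_succ (1 + t)]
          field_simp
      _ ≤ 4 ^ 2 * (decayWeight t θ a + 62 * q * decayWeight t θ a) / (1 + t) ^ (k + 1) := by
          gcongr
          norm_num
      _ = (4 ^ 2 * (1 + 62 * q)) * decayWeight t θ a / (1 + t) ^ (k + 1) := by ring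
      _ ≤ fieldConst q * decayWeight t θ a / (1 + t) ^ (k + 1) := by
          gcongr
          unfold fieldConst
          have : 1 ≤ (1 + 1 / q) ^ 2 := one_le_pow₀ (by linarith)
          nlinarith
  -- Three powers beyond `k`: one in the target exponent `k+1`, one for the growth of the crude
  -- bound on `YT`, and one for the division by `1+t` in `decayWeight`.
  · have h1 := one_le_of_not_bulk ha ht h (k + 3)
    have hs := one_le_size (θ := θ) ha
    set M := size θ a with hM
    have h2 : 1 / rho q t θ a ≤ 1 / q * M ^ 2 := by
      refine (inv_rho_le hq ha).trans ?_
      rw [div_eq_mul_one_div, mul_comm]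
      gcongr
      exact le_size
    have h3 : |YT q t θ a| ≤ (100 + 100 * q + 1 / q) * (1 + t) * M ^ 3 := by
      refine (abs_YT_le hq ha ht).trans ?_
      have hM3 : 1 ≤ M ^ 3 := one_le_pow₀ hs
      have hx : 1 ≤ (1 + t) * M ^ 3 := by nlinarith
      have e1 : a ^ 3 * (1 + t) / q ≤ 1 / q * ((1 + t) * M ^ 3) := by
        rw [div_eq_mul_one_div, mul_comm (1 / q), mul_comm (1 + t)]
        gcongr
        exact le_size
      have e2 : 2 * q / (a ^ 3 * (1 + t)) ≤ 2 * q * ((1 + t) * M ^ 3) := by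
        have : 2 * q / (a ^ 3 * (1 + t)) = 2 * q * (a⁻¹ ^ 3 / (1 + t)) := by field_simp
        rw [this]
        gcongr
        calc a⁻¹ ^ 3 / (1 + t) ≤ M ^ 3 / 1 := by
              gcongr
              · exact inv_le_size
              · linarith
          _ ≤ (1 + t) * M ^ 3 := by nlinarith
      have e3 : 2 * (relDist θ a / (1 + t)) ≤ 4 * ((1 + t) * M ^ 3) := by
        have : relDist θ a / (1 + t) ≤ relDist θ a / 1 := by
          gcongr
          · exact relDist_nonneg ha
          · linarith
        have h5 := relDist_le (θ := θ) ha
        rw [← hM] at h5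
        have h6 : M ^ 2 ≤ M ^ 3 := pow_le_pow_right₀ hs (by norm_num)
        nlinarith
      nlinarith
    calc (1 / rho q t θ a) ^ k * |YT q t θ a|
        ≤ (1 / q * M ^ 2) ^ k * ((100 + 100 * q + 1 / q) * (1 + t) * M ^ 3)
          * ((4 * M ^ 2) ^ (k + 3) / (1 + t) ^ (k + 3)) := by
          refine le_mul_of_le_of_one_le' ?_ h1 (by positivity)
          gcongr
      _ = ((100 + 100 * q + 1 / q) * 4 ^ (k + 3) * (1 / q) ^ k) * (M ^ (4 * k + 9) / (1 + t))
          / (1 + t) ^ (k + 1) := by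
          rw [mul_pow, mul_pow, ← pow_mul, ← pow_mul, pow_add (1 + t) k 3, pow_add (1 + t) k 1]
          field_simp
          ring
      _ ≤ fieldConst q * decayWeight t θ a / (1 + t) ^ (k + 1) := by
          gcongr
          · unfold fieldConst
            have g1 : (4 : ℝ) ^ (k + 3) ≤ 1024 := by
              calc (4 : ℝ) ^ (k + 3) ≤ 4 ^ 5 := pow_le_pow_right₀ (by norm_num) (by omega)
                _ = 1024 := by norm_num
            have g2 : (1 / q) ^ k ≤ (1 + 1 / q) ^ 2 := by
              calc (1 / q) ^ k ≤ (1 + 1 / q) ^ k := by gcongr; linarith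
                _ ≤ _ := pow_le_pow_right₀ (by linarith) hk
            gcongr
          · exact (div_le_div_of_nonneg_right (size_pow_le ha (by omega)) (by positivity)).trans
              (momentWeight_div_le_decayWeight ha)

theorem inv_rho_pow_mul_YA_le (hq : 0 < q) (ha : 0 < a) (ht : 0 ≤ t) {k : ℕ} (hk : k ≤ 2) :
    (1 / rho q t θ a) ^ k * (|YA q t θ a| / a)
      ≤ (decayConst q * (1 + q)) * decayWeight t θ a / (1 + t) ^ (k + 1) := by
  have hr := rho_pos (t := t) (θ := θ) hq ha
  have hD := one_le_decayWeight (t := t) (θ := θ) ha ht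
  have hD0 : 0 ≤ decayWeight t θ a := zero_le_one.trans hD
  have hc0 := decayConst_nonneg hq
  have hf0 := fieldConst_nonneg hq
  have hc := one_le_decayConst hq
  have h1 := inv_rho_pow_mul_le (θ := θ) hq ha ht (k := k) (i := 1) (by omega) (by omega)
  -- The velocity part of `YA` is of size `q/(aρ²)` and costs two further powers of `1/ρ`; this is
  -- why negative powers up to four are controlled.
  have h2 := inv_rho_pow_mul_le (θ := θ) hq ha ht (k := k + 2) (i := 2) (by omega) (by omega)
  calc (1 / rho q t θ a) ^ k * (|YA q t θ a| / a)
      ≤ (1 / rho q t θ a) ^ k * ((1 / (1 + t) + q / (2 * a * rho q t θ a ^ 2)) / a) := by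
        gcongr
        exact abs_YA_le hq ha ht
    _ = (1 / rho q t θ a) ^ k * (1 / a) ^ 1 / (1 + t)
        + q / 2 * ((1 / rho q t θ a) ^ (k + 2) * (1 / a) ^ 2) := by
        rw [pow_add]; field_simp
    _ ≤ decayConst q * decayWeight t θ a / (1 + t) ^ k / (1 + t)
        + q / 2 * (decayConst q * decayWeight t θ a / (1 + t) ^ (k + 2)) := by gcongr
    _ ≤ decayConst q * decayWeight t θ a / (1 + t) ^ (k + 1)
        + q * (decayConst q * decayWeight t θ a / (1 + t) ^ (k + 1)) := by
        rw [div_div, ← pow_succ]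
        gcongr
        · linarith
        · linarith
        · norm_num
    _ = _ := by ring

theorem inv_rho_pow_mul_divY_le (hq : 0 < q) (ha : 0 < a) (ht : 0 ≤ t) {k : ℕ} (hk : k ≤ 2) :
    (1 / rho q t θ a) ^ k * |divY q t θ a|
      ≤ (decayConst q * (3 + 12 * q)) * decayWeight t θ a / (1 + t) ^ (k + 1) := by
  have hr := rho_pos (t := t) (θ := θ) hq ha
  have hD := one_le_decayWeight (t := t) (θ := θ) ha ht
  have hD0 : 0 ≤ decayWeight t θ a := zero_le_one.trans hD
  have hc0 := decayConst_nonneg hq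
  have hf0 := fieldConst_nonneg hq
  have hc := one_le_decayConst hq
  have h1 := inv_rho_pow_mul_le (θ := θ) hq ha ht (k := k) (i := 1) (by omega) (by omega)
  have h2 := inv_rho_pow_mul_le (θ := θ) hq ha ht (k := k) (i := 4) (by omega) (by omega)
  calc (1 / rho q t θ a) ^ k * |divY q t θ a|
      ≤ (1 / rho q t θ a) ^ k * (3 / (a * (1 + t)) + 12 * q / (a ^ 4 * (1 + t) ^ 2)) := by
        gcongr
        exact abs_divY_le hq ha ht
    _ = 3 * ((1 / rho q t θ a) ^ k * (1 / a) ^ 1) / (1 + t)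
        + 12 * q * ((1 / rho q t θ a) ^ k * (1 / a) ^ 4) / (1 + t) ^ 2 := by
        field_simp
    _ ≤ 3 * (decayConst q * decayWeight t θ a / (1 + t) ^ k) / (1 + t)
        + 12 * q * (decayConst q * decayWeight t θ a / (1 + t) ^ k) / (1 + t) ^ 1 := by
        gcongr
        · linarith
        · norm_num
    _ = _ := by rw [pow_succ]; field_simp; ring

end

/-! ### Cutoffs -/

/-- A smooth function on the line equal to `1` on `[-1,1]` and supported in `[-2,2]`. -/
def lineBump : ContDiffBump (0 : ℝ) := ⟨1, 2, one_pos, one_lt_two⟩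

/-- A cutoff in the phase space, logarithmic in the action variable. -/
def cutoff (N n : ℝ) : ℝ × ℝ → ℝ :=
  phaseSpace.indicator fun z => lineBump (z.1 / N) * lineBump (Real.log z.2 / n)

section
variable {N n : ℝ}

theorem support_cutoff_subset (hN : 0 < N) (hn : 0 < n) : Function.support (cutoff N n)
    ⊆ Icc (-(2 * N)) (2 * N) ×ˢ Icc (Real.exp (-(2 * n))) (Real.exp (2 * n)) := by
  have hb : ∀ x, lineBump x ≠ 0 → |x| < 2 := by
    intro x hx
    have : x ∈ Function.support lineBump := hx
    rw [lineBump.support_eq] at this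
    simpa [lineBump] using this
  intro z hz
  have hzp : z ∈ phaseSpace := by
    by_contra h; exact hz (indicator_of_notMem h _)
  have hz2 := mem_phaseSpace.1 hzp
  have hz' : lineBump (z.1 / N) * lineBump (Real.log z.2 / n) ≠ 0 := by
    have : cutoff N n z ≠ 0 := hz
    rwa [cutoff, indicator_of_mem hzp] at this
  have h1 := hb _ (left_ne_zero_of_mul hz')
  have h2 := hb _ (right_ne_zero_of_mul hz')
  rw [abs_div, abs_of_pos hN, div_lt_iff₀ hN, abs_lt] at h1
  rw [abs_div, abs_of_pos hn, div_lt_iff₀ hn, abs_lt] at h2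
  refine ⟨⟨by linarith, by linarith⟩, ?_, ?_⟩
  · rw [← Real.le_log_iff_exp_le hz2]; linarith
  · rw [← Real.log_le_iff_le_exp hz2]; linarith

theorem box_subset_phaseSpace : Icc (-(2 * N)) (2 * N) ×ˢ Icc (Real.exp (-(2 * n))) (Real.exp (2 * n))
    ⊆ phaseSpace := by
  rintro z ⟨_, h2⟩
  exact mem_phaseSpace.2 (lt_of_lt_of_le (Real.exp_pos _) h2.1)

theorem tsupport_cutoff_subset_box (hN : 0 < N) (hn : 0 < n) : tsupport (cutoff N n)
    ⊆ Icc (-(2 * N)) (2 * N) ×ˢ Icc (Real.exp (-(2 * n))) (Real.exp (2 * n)) :=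
  closure_minimal (support_cutoff_subset hN hn) (isClosed_Icc.prod isClosed_Icc)

theorem hasCompactSupport_cutoff (hN : 0 < N) (hn : 0 < n) : HasCompactSupport (cutoff N n) :=
  (isCompact_Icc.prod isCompact_Icc).of_isClosed_subset (isClosed_tsupport _)
    (tsupport_cutoff_subset_box hN hn)

theorem contDiff_of_contDiffOn_mul {u : ℝ × ℝ → ℝ} (hu : ContDiffOn ℝ 1 u phaseSpace)
    (hs : tsupport u ⊆ phaseSpace) : ContDiff ℝ 1 u := by
  rw [contDiff_iff_contDiffAt]
  intro z
  by_cases hz : z ∈ tsupport u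
  · exact hu.contDiffAt (isOpen_phaseSpace.mem_nhds (hs hz))
  · have : u =ᶠ[nhds z] fun _ => 0 := notMem_tsupport_iff_eventuallyEq.1 hz
    exact contDiffAt_const.congr_of_eventuallyEq this

theorem contDiff_cutoff (hN : 0 < N) (hn : 0 < n) : ContDiff ℝ 1 (cutoff N n) := by
  apply contDiff_of_contDiffOn_mul _ ((tsupport_cutoff_subset_box hN hn).trans box_subset_phaseSpace)
  have : ContDiffOn ℝ 1 (fun z : ℝ × ℝ => lineBump (z.1 / N) * lineBump (Real.log z.2 / n))
      phaseSpace := by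
    refine ContDiffOn.mul ?_ ?_
    · exact (lineBump.contDiff.comp (contDiff_fst.div_const N)).contDiffOn
    · refine lineBump.contDiff.comp_contDiffOn ?_
      refine ContDiffOn.div_const (ContDiffOn.log contDiff_snd.contDiffOn fun z hz => ?_) n
      exact (mem_phaseSpace.1 hz).ne'
  exact this.congr fun z hz => indicator_of_mem hz _

theorem exists_abs_deriv_lineBump_le : ∃ c : ℝ, 0 ≤ c ∧ ∀ x, |deriv lineBump x| ≤ c := by
  have h1 : Continuous (deriv lineBump) :=
    (lineBump.contDiff (n := 1)).continuous_deriv (by norm_num)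
  obtain ⟨c, hc⟩ := h1.bounded_above_of_compact_support lineBump.hasCompactSupport.deriv
  exact ⟨c, (norm_nonneg _).trans (hc 0), hc⟩

theorem hasDerivAt_of_contDiff_theta {u : ℝ × ℝ → ℝ} {z : ℝ × ℝ} (hu : DifferentiableAt ℝ u z) :
    HasDerivAt (fun θ => u (θ, z.2)) (fderiv ℝ u z (1, 0)) z.1 := by
  have h : HasDerivAt (fun θ : ℝ => (θ, z.2)) ((1 : ℝ), (0 : ℝ)) z.1 :=
    (hasDerivAt_id z.1).prodMk (hasDerivAt_const z.1 z.2)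
  exact hu.hasFDerivAt.comp_hasDerivAt z.1 h

theorem hasDerivAt_of_contDiff_action {u : ℝ × ℝ → ℝ} {z : ℝ × ℝ} (hu : DifferentiableAt ℝ u z) :
    HasDerivAt (fun a => u (z.1, a)) (fderiv ℝ u z (0, 1)) z.2 := by
  have h : HasDerivAt (fun a : ℝ => (z.1, a)) ((0 : ℝ), (1 : ℝ)) z.2 :=
    (hasDerivAt_const z.2 z.1).prodMk (hasDerivAt_id z.2)
  exact hu.hasFDerivAt.comp_hasDerivAt z.2 h

/-- The cutoff in `a` acts on the scale of `log a`, so `a ∂_a ζ` is of order `1/n` throughout. These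
are exactly the quantities against which `Ψ_a ≲ 1 + 1/a` and `Ψ_θ ≲ a` are paired, so cutoff errors
vanish in the limit. -/
theorem exists_cutoff_seq : ∃ (c : ℝ) (ζ : ℕ → ℝ × ℝ → ℝ), 0 ≤ c ∧
    (∀ n, ContDiff ℝ 1 (ζ n)) ∧ (∀ n, HasCompactSupport (ζ n)) ∧
    (∀ n, tsupport (ζ n) ⊆ phaseSpace) ∧ (∀ n z, 0 ≤ ζ n z) ∧ (∀ n z, ζ n z ≤ 1) ∧
    (∀ z ∈ phaseSpace, ∀ᶠ n in Filter.atTop, ζ n z = 1) ∧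
    (∀ n, ∀ z ∈ phaseSpace, |fderiv ℝ (ζ n) z (1, 0)| * (1 + 1 / z.2) ≤ c / (n + 1)) ∧
    (∀ n, ∀ z ∈ phaseSpace, |fderiv ℝ (ζ n) z (0, 1)| * z.2 ≤ c / (n + 1)) := by
  obtain ⟨c, hc0, hc⟩ := exists_abs_deriv_lineBump_le
  have hn : ∀ n : ℕ, (0 : ℝ) < n + 1 := fun n => by positivity
  -- The scale in `θ` is taken exponentially large because `1/a` can reach `exp(2(n+1))` on the
  -- support; then even `(1 + 1/a) ∂_θ ζ` is of order `1/n`.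
  set N : ℕ → ℝ := fun n => (n + 1) * (1 + Real.exp (2 * (n + 1))) with hNdef
  have hN : ∀ n, 0 < N n := fun n => by
    have := Real.exp_pos (2 * ((n : ℝ) + 1)); simp only [hNdef]; positivity
  have hb1 : ∀ x, |lineBump x| ≤ 1 := fun x => by
    rw [abs_of_nonneg lineBump.nonneg]; exact lineBump.le_one
  have hbd : ∀ x, HasDerivAt lineBump (deriv lineBump x) x := fun x =>
    ((lineBump.contDiff (n := 1)).differentiable (by norm_num) x).hasDerivAt
  refine ⟨c, fun n => cutoff (N n) (n + 1), hc0, fun n => contDiff_cutoff (hN n) (hn n),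
    fun n => hasCompactSupport_cutoff (hN n) (hn n),
    fun n => (tsupport_cutoff_subset_box (hN n) (hn n)).trans box_subset_phaseSpace,
    fun n z => indicator_nonneg (fun _ _ => mul_nonneg lineBump.nonneg lineBump.nonneg) z,
    fun n z => indicator_le' (f := fun z : ℝ × ℝ =>
      lineBump (z.1 / N n) * lineBump (Real.log z.2 / (n + 1))) (g := fun _ => (1 : ℝ))
      (fun _ _ => mul_le_one₀ lineBump.le_one lineBump.nonneg
      lineBump.le_one) (fun _ _ => zero_le_one) z, ?_, ?_, ?_⟩
  · intro z hz
    have h1 : ∀ᶠ n : ℕ in Filter.atTop, max |z.1| |Real.log z.2| ≤ n :=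
      tendsto_natCast_atTop_atTop.eventually_ge_atTop _
    filter_upwards [h1] with n h
    have hone : ∀ x, |x| ≤ 1 → lineBump x = 1 := fun x hx =>
      lineBump.one_of_mem_closedBall (by simpa [lineBump] using hx)
    rw [cutoff, indicator_of_mem hz, hone, hone, one_mul]
    · rw [abs_div, abs_of_pos (hn n), div_le_one (hn n)]
      have := (le_max_right _ _).trans h
      linarith
    · rw [abs_div, abs_of_pos (hN n), div_le_one (hN n)]
      have h2 := (le_max_left _ _).trans h
      have := Real.exp_pos (2 * ((n : ℝ) + 1))
      simp only [hNdef]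
      nlinarith [hn n]
  · intro n z hz
    have hz2 := mem_phaseSpace.1 hz
    by_cases hsup : z ∈ tsupport (cutoff (N n) (n + 1))
    · have hbox := tsupport_cutoff_subset_box (hN n) (hn n) hsup
      have hd := hasDerivAt_of_contDiff_theta
        (((contDiff_cutoff (hN n) (hn n)).differentiable (by norm_num)) z)
      have hd2 : HasDerivAt (fun θ => cutoff (N n) (n + 1) (θ, z.2))
          (deriv lineBump (z.1 / N n) * (1 / N n) * lineBump (Real.log z.2 / (n + 1))) z.1 := by
        have := ((hbd _).comp z.1 ((hasDerivAt_id z.1).div_const (N n))).mul_const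
          (lineBump (Real.log z.2 / (n + 1)))
        refine this.congr_of_eventuallyEq (Filter.Eventually.of_forall fun θ => ?_)
        have : (θ, z.2) ∈ phaseSpace := mem_phaseSpace.2 hz2
        simp [cutoff, indicator_of_mem this]
      rw [hd.unique hd2]
      have h3 : 1 + 1 / z.2 ≤ N n / (n + 1) := by
        have : 1 / z.2 ≤ Real.exp (2 * (n + 1)) := by
          have h4 := one_div_le_one_div_of_le (Real.exp_pos _) hbox.2.1
          rwa [Real.exp_neg, one_div, one_div, inv_inv, ← one_div] at h4
        simp only [hNdef]
        rw [mul_comm, mul_div_assoc, div_self (hn n).ne', mul_one]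
        linarith
      have h4 : |deriv lineBump (z.1 / N n) * (1 / N n) * lineBump (Real.log z.2 / (n + 1))|
          ≤ c * (1 / N n) * 1 := by
        rw [abs_mul, abs_mul, abs_of_pos (a := 1 / N n) (by have := hN n; positivity)]
        have := hN n
        gcongr
        · exact hc _
        · exact hb1 _
      calc _ ≤ c * (1 / N n) * 1 * (N n / (n + 1)) := by
            have := hN n
            gcongr
        _ = c / (n + 1) := by have := (hN n).ne'; field_simp
    · have : fderiv ℝ (cutoff (N n) (n + 1)) z = 0 := by
        by_contra h0
        exact hsup (support_fderiv_subset ℝ h0)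
      rw [this]
      simp; positivity
  · intro n z hz
    have hz2 := mem_phaseSpace.1 hz
    have hd := hasDerivAt_of_contDiff_action
      (((contDiff_cutoff (hN n) (hn n)).differentiable (by norm_num)) z)
    have hd2 : HasDerivAt (fun a => cutoff (N n) (n + 1) (z.1, a))
        (lineBump (z.1 / N n) * (deriv lineBump (Real.log z.2 / (n + 1)) * (z.2⁻¹ / (n + 1)))) z.2 := by
      have := ((hbd _).comp z.2 ((Real.hasDerivAt_log hz2.ne').div_const ((n : ℝ) + 1))).const_mul
        (lineBump (z.1 / N n))
      refine this.congr_of_eventuallyEq ?_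
      filter_upwards [lt_mem_nhds hz2] with a ha
      have : (z.1, a) ∈ phaseSpace := mem_phaseSpace.2 ha
      simp [cutoff, indicator_of_mem this]
    rw [hd.unique hd2, abs_mul, abs_mul, abs_of_pos (a := z.2⁻¹ / ((n : ℝ) + 1)) (by positivity)]
    calc _ ≤ 1 * (c * (z.2⁻¹ / (n + 1))) * z.2 := by
          gcongr
          · exact hb1 _
          · exact hc _
      _ = c / (n + 1) := by field_simp

end

/-! ### The mass function -/

theorem integrable_of_le_mul {X : Type*} [MeasurableSpace X] {ν : Measure X} {F f g : X → ℝ}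
    (hF : AEStronglyMeasurable F ν) (hf : AEStronglyMeasurable f ν)
    (hg : AEStronglyMeasurable g ν) {A B c : ℝ} (hA : 0 ≤ A) (hB : 0 ≤ B) (hc : 0 ≤ c)
    (hfA : eLpNorm f 2 ν ≤ ENNReal.ofReal A) (hgB : eLpNorm g 2 ν ≤ ENNReal.ofReal B)
    (h : ∀ᵐ x ∂ν, |F x| ≤ c * (|f x| * |g x|)) :
    Integrable F ν ∧ ∫ x, |F x| ∂ν ≤ c * (A * B) := by
  have key : ∫⁻ x, ‖F x‖ₑ ∂ν ≤ ENNReal.ofReal (c * (A * B)) := by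
    have e : ∀ k : X → ℝ, (∫⁻ x, ‖k x‖ₑ ^ (2 : ℝ) ∂ν) ^ (1 / 2 : ℝ) = eLpNorm k 2 ν := by
      intro k
      have h1 := eLpNorm_two_sq ν k
      have h2 : ∫⁻ x, ‖k x‖ₑ ^ (2 : ℝ) ∂ν = eLpNorm k 2 ν ^ 2 := by
        rw [h1]; simp
      rw [h2, ← ENNReal.rpow_natCast, ← ENNReal.rpow_mul]; norm_num
    calc ∫⁻ x, ‖F x‖ₑ ∂ν ≤ ∫⁻ x, ENNReal.ofReal c * (‖f x‖ₑ * ‖g x‖ₑ) ∂ν := by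
          apply lintegral_mono_ae
          filter_upwards [h] with x hx
          rw [← ofReal_norm, ← ofReal_norm, ← ofReal_norm, ← ENNReal.ofReal_mul (norm_nonneg _),
            ← ENNReal.ofReal_mul hc]
          exact ENNReal.ofReal_le_ofReal hx
      _ = ENNReal.ofReal c * ∫⁻ x, ‖f x‖ₑ * ‖g x‖ₑ ∂ν :=
          lintegral_const_mul' _ _ ENNReal.ofReal_ne_top
      _ ≤ ENNReal.ofReal c * (ENNReal.ofReal A * ENNReal.ofReal B) := by
          gcongr
          have := ENNReal.lintegral_mul_le_Lp_mul_Lq ν Real.HolderConjugate.two_two hf.enorm hg.enorm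
          rw [e, e] at this
          exact this.trans (mul_le_mul' hfA hgB)
      _ = _ := by rw [ENNReal.ofReal_mul hc, ENNReal.ofReal_mul hA]
  have hi : Integrable F ν := ⟨hF, key.trans_lt ENNReal.ofReal_lt_top⟩
  refine ⟨hi, ?_⟩
  have h1 : ∫ x, |F x| ∂ν = (∫⁻ x, ‖F x‖ₑ ∂ν).toReal := integral_norm_eq_lintegral_enorm hF
  rw [h1]
  exact ENNReal.toReal_le_of_le_ofReal (by positivity) key

/-- The radius along the free flow as a function on the phase space. -/
def rhoZ (q t : ℝ) (z : ℝ × ℝ) : ℝ := rho q t z.1 z.2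

theorem K_eq_iff {x y : ℝ} (h : K x = K y) : x = y ∨ x = -y := by
  unfold K at h
  have h1 : Real.cosh (kU x) = Real.cosh (kU y) :=
    (pow_left_inj₀ (Real.cosh_pos _).le (Real.cosh_pos _).le two_ne_zero).1 h
  have h2 : |kU x| = |kU y| := by
    apply le_antisymm
    · exact Real.cosh_le_cosh.1 h1.le
    · exact Real.cosh_le_cosh.1 h1.ge
  rcases abs_eq_abs.1 h2 with h3 | h3
  · left
    rw [← kTime_kU x, h3, kTime_kU]
  · right
    rw [← kTime_kU x, h3, kTime_neg, kTime_kU]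

theorem measurable_rhoZ (q t : ℝ) : Measurable (rhoZ q t) := by
  have hK := contDiff_K.continuous.measurable
  unfold rhoZ rho arg
  exact (measurable_const.div (measurable_snd.pow_const 2)).mul
    (hK.comp (((measurable_snd.pow_const 2).mul
      (measurable_fst.add (measurable_snd.const_mul t))).div_const q))

theorem ae_mem_phaseSpace : ∀ᵐ z ∂phaseMeasure, z ∈ phaseSpace :=
  ae_restrict_mem measurableSet_phaseSpace

/-- For fixed `a`, a level of `K` is attained at most at two opposite arguments, so each slice of a
level set has at most two points. Thus the indicator of `{ρ ≤ r}` is almost everywhere locally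
constant in `r`, as needed for differentiating under the integral. -/
theorem ae_rhoZ_ne {q : ℝ} (hq : 0 < q) (t r : ℝ) : ∀ᵐ z ∂phaseMeasure, rhoZ q t z ≠ r := by
  have hm : MeasurableSet ({z | rhoZ q t z = r} ∩ phaseSpace) :=
    ((measurable_rhoZ q t) (measurableSet_singleton r)).inter measurableSet_phaseSpace
  have h0 : volume ({z | rhoZ q t z = r} ∩ phaseSpace) = 0 := by
    rw [Measure.volume_eq_prod, Measure.prod_apply_symm hm, lintegral_eq_zero_iff']
    · refine Filter.Eventually.of_forall fun a => ?_
      by_cases ha : 0 < a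
      · apply Set.Countable.measure_zero
        by_cases hne : ((fun θ => (θ, a)) ⁻¹' ({z | rhoZ q t z = r} ∩ phaseSpace)).Nonempty
        · obtain ⟨θ0, h1, _⟩ := hne
          refine ((Set.countable_singleton (q / a ^ 2 * -arg q t θ0 a - t * a)).insert θ0).mono ?_
          rintro θ ⟨h2, _⟩
          have h3 : K (arg q t θ a) = K (arg q t θ0 a) := by
            have h4 : rho q t θ a = rho q t θ0 a := (show rhoZ q t (θ, a) = _ from h2).trans h1.symm
            unfold rho at h4
            exact mul_left_cancel₀ (by positivity) h4
          have hθ : ∀ θ, θ = q / a ^ 2 * arg q t θ a - t * a := by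
            intro θ; unfold arg; field_simp; ring
          rcases K_eq_iff h3 with h5 | h5
          · left
            rw [hθ θ, h5, ← hθ θ0]
          · right
            rw [mem_singleton_iff, hθ θ, h5]
        · rw [Set.not_nonempty_iff_eq_empty] at hne
          rw [hne]; exact countable_empty
      · have : (fun θ => (θ, a)) ⁻¹' ({z | rhoZ q t z = r} ∩ phaseSpace) = ∅ := by
          ext θ
          simp only [mem_preimage, mem_inter_iff, mem_empty_iff_false, iff_false, not_and]
          intro _ h
          exact ha (mem_phaseSpace.1 h)
        change volume ((fun θ => (θ, a)) ⁻¹' ({z | rhoZ q t z = r} ∩ phaseSpace)) = 0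
        rw [this, measure_empty]
    · exact (measurable_measure_prodMk_right hm).aemeasurable
  rw [ae_iff, phaseMeasure, Measure.restrict_apply' measurableSet_phaseSpace]
  simpa using h0

/-! ### Regularity of the coefficients on the phase space -/

section
variable {q t : ℝ}

theorem contDiffOn_arg : ContDiffOn ℝ 1 (fun z : ℝ × ℝ => arg q t z.1 z.2) phaseSpace := by
  unfold arg
  exact ContDiff.contDiffOn (by fun_prop)

theorem snd_pow_ne {z : ℝ × ℝ} (hz : z ∈ phaseSpace) (n : ℕ) : z.2 ^ n ≠ 0 :=
  pow_ne_zero n (mem_phaseSpace.1 hz).ne'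

theorem contDiffOn_comp_arg {f : ℝ → ℝ} (hf : ContDiff ℝ ∞ f) :
    ContDiffOn ℝ 1 (fun z : ℝ × ℝ => f (arg q t z.1 z.2)) phaseSpace :=
  (hf.of_le (by exact_mod_cast le_top)).comp_contDiffOn contDiffOn_arg

theorem contDiffOn_div_pow (c : ℝ) (n : ℕ) :
    ContDiffOn ℝ 1 (fun z : ℝ × ℝ => c / z.2 ^ n) phaseSpace :=
  ContDiffOn.div contDiffOn_const (contDiff_snd.pow n).contDiffOn fun _ hz => snd_pow_ne hz n

theorem contDiffOn_rhoZ : ContDiffOn ℝ 1 (rhoZ q t) phaseSpace :=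
  (contDiffOn_div_pow q 2).mul (contDiffOn_comp_arg contDiff_K)

theorem contDiffOn_rhoT : ContDiffOn ℝ 1 (fun z : ℝ × ℝ => rhoT q t z.1 z.2) phaseSpace :=
  contDiffOn_comp_arg contDiff_Kd

theorem contDiffOn_rhoA : ContDiffOn ℝ 1 (fun z : ℝ × ℝ => rhoA q t z.1 z.2) phaseSpace :=
  (contDiffOn_const.mul (contDiffOn_comp_arg contDiff_Kd)).add
    ((contDiffOn_div_pow (2 * q) 3).mul ((contDiffOn_comp_arg contDiff_L).sub contDiffOn_const))

theorem contDiffOn_vT : ContDiffOn ℝ 1 (fun z : ℝ × ℝ => vT q t z.1 z.2) phaseSpace := by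
  unfold vT
  refine ContDiffOn.mul (ContDiff.contDiffOn (by fun_prop)) ?_
  exact ContDiffOn.div contDiffOn_const ((contDiffOn_comp_arg contDiff_K).pow 2)
    fun z _ => pow_ne_zero 2 (K_pos _).ne'

theorem contDiffOn_vA : ContDiffOn ℝ 1 (fun z : ℝ × ℝ => vA q t z.1 z.2) phaseSpace := by
  refine ((contDiffOn_comp_arg contDiff_Kd).add (contDiffOn_arg.mul ?_)).add
    (contDiffOn_const.mul contDiffOn_vT)
  exact ContDiffOn.div contDiffOn_const ((contDiffOn_comp_arg contDiff_K).pow 2)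
    fun z _ => pow_ne_zero 2 (K_pos _).ne'

theorem contDiffOn_gY (hq : 0 < q) (ht : 0 ≤ t) :
    ContDiffOn ℝ 1 (fun z : ℝ × ℝ => gY q t z.2) phaseSpace := by
  unfold gY
  refine ContDiffOn.inv (contDiffOn_const.add ((contDiffOn_div_pow (2 * q) 3).mul ?_))
    fun z hz => ?_
  · refine (contDiff_L.of_le (by exact_mod_cast le_top)).comp_contDiffOn ?_
    exact ContDiff.contDiffOn (by fun_prop)
  · have := ell_nonneg (t := t) hq (mem_phaseSpace.1 hz)
    positivity

theorem contDiffOn_YT (hq : 0 < q) (ht : 0 ≤ t) :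
    ContDiffOn ℝ 1 (fun z : ℝ × ℝ => YT q t z.1 z.2) phaseSpace :=
  contDiffOn_vA.sub ((contDiffOn_gY hq ht).mul contDiffOn_rhoA)

theorem contDiffOn_YA (hq : 0 < q) (ht : 0 ≤ t) :
    ContDiffOn ℝ 1 (fun z : ℝ × ℝ => YA q t z.1 z.2) phaseSpace :=
  ((contDiffOn_gY hq ht).mul contDiffOn_rhoT).sub contDiffOn_vT

theorem aestronglyMeasurable_of_contDiffOn {f : ℝ × ℝ → ℝ} (hf : ContDiffOn ℝ 1 f phaseSpace) :
    AEStronglyMeasurable f phaseMeasure :=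
  hf.continuousOn.aestronglyMeasurable measurableSet_phaseSpace

theorem measurable_gYA : Measurable fun a => gYA q t a := by
  have hL := contDiff_L.continuous.measurable
  have hK := contDiff_K.continuous.measurable
  unfold gYA ellA ell
  fun_prop

theorem measurable_divY : Measurable fun z : ℝ × ℝ => divY q t z.1 z.2 := by
  have hK := contDiff_Kd.continuous.measurable
  have := measurable_gYA (q := q) (t := t)
  unfold divY rhoT arg
  fun_prop

end

/-- Bounds for a density and its weak derivatives at a fixed time. -/
structure StaticBound (q t : ℝ) (γ γθ γa : ℝ × ℝ → ℝ) (S D : ℝ) : Prop where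
  q_pos : 0 < q
  t_nonneg : 0 ≤ t
  S_nonneg : 0 ≤ S
  D_nonneg : 0 ≤ D
  memLp : MemLp γ 2 phaseMeasure
  weak_theta : HasWeakPartial (1, 0) γ γθ
  weak_action : HasWeakPartial (0, 1) γ γa
  decay : wNorm (decayWeight t) γ ≤ ENNReal.ofReal S
  norm_theta : wNorm (fun _ a => a + a⁻¹) γθ ≤ ENNReal.ofReal D
  norm_action : wNorm (fun _ a => a) γa ≤ ENNReal.ofReal D

/-- The density whose integral over `{ρ ≤ r}` is the derivative of the mass in `{ρ ≤ r}`. -/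
def jac (q t : ℝ) (γ γθ γa : ℝ × ℝ → ℝ) (z : ℝ × ℝ) : ℝ :=
  divY q t z.1 z.2 * γ z ^ 2
    + 2 * (γ z * (YT q t z.1 z.2 * γθ z + YA q t z.1 z.2 * γa z))

theorem HasWeakPartial.aestronglyMeasurable {e : ℝ × ℝ} {f g : ℝ × ℝ → ℝ}
    (h : HasWeakPartial e f g) : AEStronglyMeasurable g phaseMeasure :=
  h.2.1.aestronglyMeasurable

/-- The action variable is bounded below on compact subsets of the phase space. This is what is
known about `∂_aγ`, which is square integrable only with weight `a`. -/
theorem locL2_of_eLpNorm_lt_top {k : ℝ × ℝ → ℝ} (hk : AEStronglyMeasurable k phaseMeasure)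
    (h : eLpNorm (fun z => z.2 * k z) 2 phaseMeasure < ⊤) : LocL2 k := by
  intro C hC hCs
  have hle : volume.restrict C ≤ phaseMeasure := Measure.restrict_mono hCs le_rfl
  refine ⟨hk.mono_measure hle, ?_⟩
  by_cases hne : C.Nonempty
  · obtain ⟨z0, hz0, hmin⟩ := IsCompact.exists_isMinOn hC hne continuous_snd.continuousOn
    have hm : 0 < z0.2 := mem_phaseSpace.1 (hCs hz0)
    have h1 : eLpNorm k 2 (volume.restrict C)
        ≤ ENNReal.ofReal (1 / z0.2) * eLpNorm (fun z => z.2 * k z) 2 (volume.restrict C) := by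
      refine eLpNorm_le_mul_eLpNorm_of_ae_le_mul (c := 1 / z0.2) ?_ 2
      filter_upwards [ae_restrict_mem hC.measurableSet] with z hz
      have h2 : z0.2 ≤ z.2 := hmin hz
      rw [norm_mul, ← mul_assoc]
      refine le_mul_of_one_le_left (norm_nonneg _) ?_
      rw [Real.norm_eq_abs, abs_of_pos (by linarith), div_mul_eq_mul_div, one_mul]
      exact (one_le_div hm).2 h2
    refine h1.trans_lt (ENNReal.mul_lt_top ENNReal.ofReal_lt_top ?_)
    exact (eLpNorm_mono_measure _ hle).trans_lt h
  · rw [Set.not_nonempty_iff_eq_empty] at hne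
    simp [hne]

theorem locL2_of_memLp {k : ℝ × ℝ → ℝ} (hk : MemLp k 2 phaseMeasure) : LocL2 k :=
  fun _ _ hCs => hk.mono_measure (Measure.restrict_mono hCs le_rfl)

/-- The mass in `{ρ ≤ r}`. -/
def mass (q t : ℝ) (γ : ℝ × ℝ → ℝ) (r : ℝ) : ℝ :=
  ∫ z, {z | rhoZ q t z ≤ r}.indicator (fun z => γ z ^ 2) z ∂phaseMeasure

/-- The derivative of the mass in `{ρ ≤ r}`. -/
def massD (q t : ℝ) (γ γθ γa : ℝ × ℝ → ℝ) (r : ℝ) : ℝ :=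
  ∫ z, {z | rhoZ q t z ≤ r}.indicator (jac q t γ γθ γa) z ∂phaseMeasure

theorem measurableSet_rhoZ_le (q t r : ℝ) : MeasurableSet {z | rhoZ q t z ≤ r} :=
  measurable_rhoZ q t measurableSet_Iic

/-- The constant in the bound of the derivative of the mass. -/
def massConst (q : ℝ) : ℝ :=
  decayConst q * (3 + 12 * q) + 2 * fieldConst q + 2 * (decayConst q * (1 + q))

theorem massConst_nonneg {q : ℝ} (hq : 0 < q) : 0 ≤ massConst q := by
  have := decayConst_nonneg hq
  have := fieldConst_nonneg hq
  unfold massConst; positivity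


/-! ### Decay of the mass and of its candidate derivative -/

section
variable {q t S D : ℝ} {γ γθ γa : ℝ × ℝ → ℝ}

/-- The sum of the absolute values of a density and its weighted weak derivatives. -/
def gradSum (γ γθ γa : ℝ × ℝ → ℝ) (z : ℝ × ℝ) : ℝ := |γ z| + |γθ z| + z.2 * |γa z|

namespace StaticBound

theorem aesm (hb : StaticBound q t γ γθ γa S D) : AEStronglyMeasurable γ phaseMeasure :=
  hb.memLp.1

theorem aesm_theta (hb : StaticBound q t γ γθ γa S D) : AEStronglyMeasurable γθ phaseMeasure :=
  hb.weak_theta.aestronglyMeasurable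

theorem aesm_action (hb : StaticBound q t γ γθ γa S D) : AEStronglyMeasurable γa phaseMeasure :=
  hb.weak_action.aestronglyMeasurable

theorem aesm_decay (hb : StaticBound q t γ γθ γa S D) :
    AEStronglyMeasurable (fun z => decayWeight t z.1 z.2 * γ z) phaseMeasure := by
  refine AEStronglyMeasurable.mul (Measurable.aestronglyMeasurable ?_) hb.aesm
  unfold decayWeight actionWeight momentWeight
  fun_prop

theorem aesm_gradSum (hb : StaticBound q t γ γθ γa S D) :
    AEStronglyMeasurable (gradSum γ γθ γa) phaseMeasure :=
  (hb.aesm.norm.add hb.aesm_theta.norm).add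
    (measurable_snd.aestronglyMeasurable.mul hb.aesm_action.norm)

theorem eLpNorm_le (hb : StaticBound q t γ γθ γa S D) :
    eLpNorm γ 2 phaseMeasure ≤ ENNReal.ofReal S := by
  refine (eLpNorm_mono_ae ?_).trans hb.decay
  filter_upwards [ae_mem_phaseSpace] with z hz
  have h := one_le_decayWeight (θ := z.1) (mem_phaseSpace.1 hz) hb.t_nonneg
  rw [norm_mul, Real.norm_of_nonneg (zero_le_one.trans h)]
  exact le_mul_of_one_le_left (norm_nonneg _) h

theorem eLpNorm_theta_le (hb : StaticBound q t γ γθ γa S D) :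
    eLpNorm γθ 2 phaseMeasure ≤ ENNReal.ofReal D := by
  refine (eLpNorm_mono_ae ?_).trans hb.norm_theta
  filter_upwards [ae_mem_phaseSpace] with z hz
  have ha : 0 < z.2 := mem_phaseSpace.1 hz
  have h : 1 ≤ z.2 + z.2⁻¹ := by
    rcases le_total 1 z.2 with h | h
    · have : 0 < z.2⁻¹ := by positivity
      linarith
    · have := (one_le_inv₀ ha).2 h
      linarith
  rw [norm_mul, Real.norm_of_nonneg (zero_le_one.trans h)]
  exact le_mul_of_one_le_left (norm_nonneg _) h

theorem eLpNorm_gradSum_le (hb : StaticBound q t γ γθ γa S D) :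
    eLpNorm (gradSum γ γθ γa) 2 phaseMeasure ≤ ENNReal.ofReal (S + 2 * D) := by
  have h1 : AEStronglyMeasurable (fun z => z.2 * |γa z|) phaseMeasure :=
    measurable_snd.aestronglyMeasurable.mul hb.aesm_action.norm
  have h2 : eLpNorm (fun z => z.2 * |γa z|) 2 phaseMeasure ≤ ENNReal.ofReal D := by
    refine (eLpNorm_mono_ae (Filter.Eventually.of_forall fun z => ?_)).trans hb.norm_action
    simp
  have h3 : eLpNorm (fun z => |γ z|) 2 phaseMeasure ≤ ENNReal.ofReal S :=
    (eLpNorm_norm γ).trans_le hb.eLpNorm_le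
  have h4 : eLpNorm (fun z => |γθ z|) 2 phaseMeasure ≤ ENNReal.ofReal D :=
    (eLpNorm_norm γθ).trans_le hb.eLpNorm_theta_le
  have h5 := (eLpNorm_add_le (hb.aesm.norm.add hb.aesm_theta.norm) h1 (p := 2) (by norm_num)).trans
    (add_le_add ((eLpNorm_add_le hb.aesm.norm hb.aesm_theta.norm (by norm_num)).trans
      (add_le_add h3 h4)) h2)
  rw [← ENNReal.ofReal_add hb.S_nonneg hb.D_nonneg,
    ← ENNReal.ofReal_add (add_nonneg hb.S_nonneg hb.D_nonneg) hb.D_nonneg] at h5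
  refine le_trans (le_of_eq rfl) (h5.trans (ENNReal.ofReal_le_ofReal (by linarith)))

/-- Cauchy–Schwarz with the whole decay weight placed on one factor `γ`; the other factor carries no
time dependent weight. Hence the derivative norm `D` enters linearly, and only multiplied by `S`. -/
theorem integrable_of_le (hb : StaticBound q t γ γθ γa S D) {F : ℝ × ℝ → ℝ} {c : ℝ} (hc : 0 ≤ c)
    (hF : AEStronglyMeasurable F phaseMeasure)
    (h : ∀ z ∈ phaseSpace, |F z| ≤ c * (decayWeight t z.1 z.2 * |γ z| * gradSum γ γθ γa z)) :
    Integrable F phaseMeasure ∧ ∫ z, |F z| ∂phaseMeasure ≤ c * (S * (S + 2 * D)) := by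
  refine integrable_of_le_mul hF hb.aesm_decay hb.aesm_gradSum hb.S_nonneg
    (by linarith [hb.S_nonneg, hb.D_nonneg]) hc hb.decay hb.eLpNorm_gradSum_le ?_
  filter_upwards [ae_mem_phaseSpace] with z hz
  have h1 := one_le_decayWeight (θ := z.1) (mem_phaseSpace.1 hz) hb.t_nonneg
  rw [abs_mul (decayWeight t z.1 z.2), abs_of_nonneg (by linarith : 0 ≤ decayWeight t z.1 z.2)]
  refine (h z hz).trans ?_
  gcongr
  exact le_abs_self _

theorem integrable_sq (hb : StaticBound q t γ γθ γa S D) :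
    Integrable (fun z => γ z ^ 2) phaseMeasure := hb.memLp.integrable_sq

theorem aesm_jac (hb : StaticBound q t γ γθ γa S D) :
    AEStronglyMeasurable (jac q t γ γθ γa) phaseMeasure := by
  have h1 := aestronglyMeasurable_of_contDiffOn (contDiffOn_YT hb.q_pos hb.t_nonneg)
  have h2 := aestronglyMeasurable_of_contDiffOn (contDiffOn_YA hb.q_pos hb.t_nonneg)
  exact ((measurable_divY.aestronglyMeasurable).mul (hb.aesm.pow 2)).add
    ((hb.aesm.mul ((h1.mul hb.aesm_theta).add (h2.mul hb.aesm_action))).const_mul 2)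

theorem abs_le_gradSum {z : ℝ × ℝ} (hz : z ∈ phaseSpace) : |γ z| ≤ gradSum γ γθ γa z := by
  have := mem_phaseSpace.1 hz
  unfold gradSum
  nlinarith [abs_nonneg (γθ z), abs_nonneg (γa z), mul_nonneg this.le (abs_nonneg (γa z))]

/-- The splitting `YA ∂_aγ = (YA/a)(a ∂_aγ)` matches the available norm of `∂_aγ`, while `YT` needs
no extra weight. -/
theorem inv_rho_pow_mul_jac_le (hb : StaticBound q t γ γθ γa S D) {k : ℕ} (hk : k ≤ 2)
    {z : ℝ × ℝ} (hz : z ∈ phaseSpace) :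
    (1 / rhoZ q t z) ^ k * |jac q t γ γθ γa z| ≤ massConst q / (1 + t) ^ (k + 1)
      * (decayWeight t z.1 z.2 * |γ z| * gradSum γ γθ γa z) := by
  have ha := mem_phaseSpace.1 hz
  have ht := hb.t_nonneg
  have hr : 0 < rhoZ q t z := rho_pos hb.q_pos ha
  have h1 := inv_rho_pow_mul_divY_le (θ := z.1) hb.q_pos ha ht hk
  have h2 := inv_rho_pow_mul_YT_le (θ := z.1) hb.q_pos ha ht hk
  have h3 := inv_rho_pow_mul_YA_le (θ := z.1) hb.q_pos ha ht hk
  have c1 : 0 ≤ decayConst q * (3 + 12 * q) := by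
    have := decayConst_nonneg hb.q_pos; have := hb.q_pos; positivity
  have c2 := fieldConst_nonneg hb.q_pos
  have c3 : 0 ≤ decayConst q * (1 + q) := by
    have := decayConst_nonneg hb.q_pos; have := hb.q_pos; positivity
  have hΩ := one_le_decayWeight (θ := z.1) ha ht
  have hP : 0 ≤ (1 / rhoZ q t z) ^ k := by positivity
  have hτ : 0 < (1 + t) ^ (k + 1) := by positivity
  change (1 / rhoZ q t z) ^ k * _ ≤ _ at h1 h2 h3
  set X := (1 / rhoZ q t z) ^ k
  set w := decayWeight t z.1 z.2
  have e1 : |jac q t γ γθ γa z| ≤ |divY q t z.1 z.2| * (|γ z| * |γ z|)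
      + 2 * (|γ z| * (|YT q t z.1 z.2| * |γθ z| + |YA q t z.1 z.2| / z.2 * (z.2 * |γa z|))) := by
    unfold jac
    refine (abs_add_le _ _).trans ?_
    rw [abs_mul, abs_mul 2, abs_mul (γ z), abs_pow, abs_two, sq, div_mul_eq_mul_div,
      mul_div_assoc, mul_div_cancel_left₀ _ ha.ne', ← abs_mul (YT _ _ _ _), ← abs_mul (YA _ _ _ _)]
    gcongr
    exact abs_add_le _ _
  have g0 := abs_nonneg (γ z)
  have g1 := abs_nonneg (γθ z)
  have g2 : 0 ≤ z.2 * |γa z| := mul_nonneg ha.le (abs_nonneg _)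
  have hG : 0 ≤ gradSum γ γθ γa z := g0.trans (abs_le_gradSum hz)
  calc X * |jac q t γ γθ γa z|
      ≤ X * (|divY q t z.1 z.2| * (|γ z| * |γ z|)
      + 2 * (|γ z| * (|YT q t z.1 z.2| * |γθ z| + |YA q t z.1 z.2| / z.2 * (z.2 * |γa z|)))) := by
        gcongr
    _ = (X * |divY q t z.1 z.2|) * (|γ z| * |γ z|) + 2 * (X * |YT q t z.1 z.2|) * (|γ z| * |γθ z|)
        + 2 * (X * (|YA q t z.1 z.2| / z.2)) * (|γ z| * (z.2 * |γa z|)) := by ring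
    _ ≤ (decayConst q * (3 + 12 * q) * w / (1 + t) ^ (k + 1)) * (|γ z| * gradSum γ γθ γa z)
        + 2 * (fieldConst q * w / (1 + t) ^ (k + 1)) * (|γ z| * gradSum γ γθ γa z)
        + 2 * (decayConst q * (1 + q) * w / (1 + t) ^ (k + 1))
          * (|γ z| * gradSum γ γθ γa z) := by
        have w0 : 0 ≤ w := by linarith
        gcongr <;> unfold gradSum <;> linarith
    _ = _ := by unfold massConst; ring

theorem integrable_inv_pow_mul_jac (hb : StaticBound q t γ γθ γa S D) {k : ℕ} (hk : k ≤ 2) :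
    Integrable (fun z => (1 / rhoZ q t z) ^ k * |jac q t γ γθ γa z|) phaseMeasure ∧
      ∫ z, (1 / rhoZ q t z) ^ k * |jac q t γ γθ γa z| ∂phaseMeasure
        ≤ massConst q / (1 + t) ^ (k + 1) * (S * (S + 2 * D)) := by
  have ht := hb.t_nonneg
  have hm := massConst_nonneg hb.q_pos
  have hme : AEStronglyMeasurable (fun z => (1 / rhoZ q t z) ^ k * |jac q t γ γθ γa z|)
      phaseMeasure :=
    (((measurable_rhoZ q t).const_div 1).pow_const k).aestronglyMeasurable.mul hb.aesm_jac.norm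
  have hpos : ∀ z ∈ phaseSpace, 0 ≤ (1 / rhoZ q t z) ^ k * |jac q t γ γθ γa z| := by
    intro z hz
    have : 0 < rhoZ q t z := rho_pos hb.q_pos (mem_phaseSpace.1 hz)
    positivity
  have h := hb.integrable_of_le (c := massConst q / (1 + t) ^ (k + 1)) (by positivity) hme
    fun z hz => by
      rw [abs_of_nonneg (hpos z hz)]
      exact hb.inv_rho_pow_mul_jac_le hk hz
  refine ⟨h.1, le_trans (le_of_eq ?_) h.2⟩
  refine integral_congr_ae ?_
  filter_upwards [ae_mem_phaseSpace] with z hz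
  exact (abs_of_nonneg (hpos z hz)).symm

theorem integrable_jac (hb : StaticBound q t γ γθ γa S D) :
    Integrable (jac q t γ γθ γa) phaseMeasure := by
  have h := (hb.integrable_inv_pow_mul_jac (k := 0) (by norm_num)).1
  simp only [pow_zero, one_mul] at h
  exact (integrable_norm_iff hb.aesm_jac).1 h

theorem integrable_inv_pow_mul_sq (hb : StaticBound q t γ γθ γa S D) {k : ℕ} (hk : k ≤ 4) :
    Integrable (fun z => (1 / rhoZ q t z) ^ k * γ z ^ 2) phaseMeasure ∧
      ∫ z, (1 / rhoZ q t z) ^ k * γ z ^ 2 ∂phaseMeasure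
        ≤ decayConst q / (1 + t) ^ k * (S * S) := by
  have ht := hb.t_nonneg
  have hm := decayConst_nonneg hb.q_pos
  have hme : AEStronglyMeasurable (fun z => (1 / rhoZ q t z) ^ k * γ z ^ 2) phaseMeasure :=
    (((measurable_rhoZ q t).const_div 1).pow_const k).aestronglyMeasurable.mul (hb.aesm.pow 2)
  have hpos : ∀ z ∈ phaseSpace, 0 ≤ (1 / rhoZ q t z) ^ k * γ z ^ 2 := by
    intro z hz
    have : 0 < rhoZ q t z := rho_pos hb.q_pos (mem_phaseSpace.1 hz)
    positivity
  have h := integrable_of_le_mul (c := decayConst q / (1 + t) ^ k) hme hb.aesm_decay hb.aesm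
    hb.S_nonneg hb.S_nonneg (by positivity) hb.decay hb.eLpNorm_le (by
      filter_upwards [ae_mem_phaseSpace] with z hz
      have ha := mem_phaseSpace.1 hz
      have h1 := inv_rho_pow_mul_le (θ := z.1) (i := 0) hb.q_pos ha ht hk (by omega)
      have h2 := one_le_decayWeight (θ := z.1) ha ht
      rw [abs_of_nonneg (hpos z hz), abs_mul, abs_of_nonneg (by linarith : 0 ≤ decayWeight t z.1 z.2),
        ← sq_abs]
      rw [pow_zero, mul_one] at h1
      calc (1 / rhoZ q t z) ^ k * |γ z| ^ 2
          ≤ (decayConst q * decayWeight t z.1 z.2 / (1 + t) ^ k) * |γ z| ^ 2 := by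
            gcongr; exact h1
        _ = _ := by ring)
  refine ⟨h.1, le_trans (le_of_eq ?_) h.2⟩
  refine integral_congr_ae ?_
  filter_upwards [ae_mem_phaseSpace] with z hz
  exact (abs_of_nonneg (hpos z hz)).symm

theorem mass_nonneg (r : ℝ) : 0 ≤ mass q t γ r :=
  integral_nonneg fun z => Set.indicator_nonneg (fun _ _ => sq_nonneg _) z

/-- A Chebyshev argument: on `{ρ ≤ r}` one has `1/r ≤ 1/ρ`, so decay of weighted integrals becomes
decay of the mass relative to powers of `r`. -/
theorem indicator_mul_le {f : ℝ × ℝ → ℝ} (hf : ∀ z, 0 ≤ f z) (hq : 0 < q) {r : ℝ} (hr : 0 < r)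
    (k : ℕ) {z : ℝ × ℝ} (hz : z ∈ phaseSpace) :
    {y | rhoZ q t y ≤ r}.indicator f z * (1 / r) ^ k ≤ (1 / rhoZ q t z) ^ k * f z := by
  have hρ : 0 < rhoZ q t z := rho_pos hq (mem_phaseSpace.1 hz)
  by_cases h : rhoZ q t z ≤ r
  · rw [indicator_of_mem (show z ∈ {z | rhoZ q t z ≤ r} from h), mul_comm]
    have := hf z
    gcongr
  · rw [indicator_of_notMem (show z ∉ {z | rhoZ q t z ≤ r} from h), zero_mul]
    have := hf z
    positivity

theorem mass_mul_le (hb : StaticBound q t γ γθ γa S D) {k : ℕ} (hk : k ≤ 4) {r : ℝ} (hr : 0 < r) :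
    mass q t γ r * (1 / r) ^ k ≤ decayConst q / (1 + t) ^ k * (S * S) := by
  have h := hb.integrable_inv_pow_mul_sq hk
  refine le_trans ?_ h.2
  unfold mass
  rw [← integral_mul_const]
  refine integral_mono_ae ((hb.integrable_sq.indicator (measurableSet_rhoZ_le q t r)).mul_const _)
    h.1 ?_
  filter_upwards [ae_mem_phaseSpace] with z hz
  exact indicator_mul_le (fun z => sq_nonneg (γ z)) hb.q_pos hr k hz

theorem abs_massD_mul_le (hb : StaticBound q t γ γθ γa S D) {k : ℕ} (hk : k ≤ 2) {r : ℝ}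
    (hr : 0 < r) : |massD q t γ γθ γa r| * (1 / r) ^ k
      ≤ massConst q / (1 + t) ^ (k + 1) * (S * (S + 2 * D)) := by
  have h := hb.integrable_inv_pow_mul_jac hk
  refine le_trans ?_ h.2
  unfold massD
  have hi := hb.integrable_jac.norm.indicator (measurableSet_rhoZ_le q t r)
  have h1 : |∫ z, {z | rhoZ q t z ≤ r}.indicator (jac q t γ γθ γa) z ∂phaseMeasure|
      ≤ ∫ z, {z | rhoZ q t z ≤ r}.indicator (fun z => |jac q t γ γθ γa z|) z ∂phaseMeasure := by
    refine (norm_integral_le_integral_norm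
      ({z | rhoZ q t z ≤ r}.indicator (jac q t γ γθ γa))).trans (le_of_eq ?_)
    refine integral_congr_ae (Filter.Eventually.of_forall fun z => ?_)
    exact norm_indicator_eq_indicator_norm _ _
  refine (mul_le_mul_of_nonneg_right h1 (by positivity)).trans ?_
  rw [← integral_mul_const]
  refine integral_mono_ae (hi.mul_const _) h.1 ?_
  filter_upwards [ae_mem_phaseSpace] with z hz
  exact indicator_mul_le (fun z => abs_nonneg (jac q t γ γθ γa z)) hb.q_pos hr k hz

end StaticBound
end

/-! ### The divergence theorem along the transversal field -/

section
variable {q t S D : ℝ} {γ γθ γa : ℝ × ℝ → ℝ}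

namespace StaticBound

theorem hasDerivAt_unique_fderiv_theta {u : ℝ × ℝ → ℝ} {z : ℝ × ℝ} {d : ℝ} (hu : ContDiff ℝ 1 u)
    (h : HasDerivAt (fun θ => u (θ, z.2)) d z.1) : fderiv ℝ u z (1, 0) = d :=
  (hasDerivAt_of_contDiff_theta (hu.differentiable (by norm_num) z)).unique h

theorem hasDerivAt_unique_fderiv_action {u : ℝ × ℝ → ℝ} {z : ℝ × ℝ} {d : ℝ} (hu : ContDiff ℝ 1 u)
    (h : HasDerivAt (fun a => u (z.1, a)) d z.2) : fderiv ℝ u z (0, 1) = d :=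
  (hasDerivAt_of_contDiff_action (hu.differentiable (by norm_num) z)).unique h

theorem integrable_mul_sq (hb : StaticBound q t γ γθ γa S D) {v : ℝ × ℝ → ℝ} (hv : Continuous v)
    (hc : HasCompactSupport v) : Integrable (fun z => v z * γ z ^ 2) phaseMeasure := by
  obtain ⟨M, hM⟩ := hv.bounded_above_of_compact_support hc
  exact hb.integrable_sq.bdd_mul hv.aestronglyMeasurable (Filter.Eventually.of_forall hM)

theorem memLp_theta (hb : StaticBound q t γ γθ γa S D) : MemLp γθ 2 phaseMeasure :=
  ⟨hb.aesm_theta, hb.eLpNorm_theta_le.trans_lt ENNReal.ofReal_lt_top⟩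

theorem locL2_action (hb : StaticBound q t γ γθ γa S D) : LocL2 γa :=
  locL2_of_eLpNorm_lt_top hb.aesm_action (hb.norm_action.trans_lt ENNReal.ofReal_lt_top)

/-- The integral of `div(ζ φ(ρ) γ² Y)` vanishes by compact support. The derivative of `φ(ρ)` along
`Y` is `φ'(ρ)`, and `div(γ² Y)` is the function `jac`. -/
theorem divergence_cutoff (hb : StaticBound q t γ γθ γa S D) {φ : ℝ → ℝ} (hφ : ContDiff ℝ 1 φ)
    {M : ℝ} (hM : ∀ s, 0 < s → |φ s| ≤ M) {ζ : ℝ × ℝ → ℝ} (hζ : ContDiff ℝ 1 ζ)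
    (hζc : HasCompactSupport ζ) (hζs : tsupport ζ ⊆ phaseSpace) :
    ∫ z, (φ (rhoZ q t z) * (fderiv ℝ ζ z (1, 0) * YT q t z.1 z.2
        + fderiv ℝ ζ z (0, 1) * YA q t z.1 z.2) * γ z ^ 2
      + ζ z * (deriv φ (rhoZ q t z) * γ z ^ 2 + φ (rhoZ q t z) * jac q t γ γθ γa z))
        ∂phaseMeasure = 0 := by
  have hq := hb.q_pos
  have ht := hb.t_nonneg
  have hφd : ∀ s, HasDerivAt φ (deriv φ s) s := fun s =>
    (hφ.differentiable (by norm_num) s).hasDerivAt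
  have build : ∀ Y : ℝ × ℝ → ℝ, ContDiffOn ℝ 1 Y phaseSpace →
      tsupport (fun z => ζ z * (φ (rhoZ q t z) * Y z)) ⊆ phaseSpace ∧
      HasCompactSupport (fun z => ζ z * (φ (rhoZ q t z) * Y z)) ∧
      ContDiff ℝ 1 (fun z => ζ z * (φ (rhoZ q t z) * Y z)) := by
    intro Y hY
    have h1 : tsupport (fun z => ζ z * (φ (rhoZ q t z) * Y z)) ⊆ phaseSpace :=
      (tsupport_mul_subset_left (f := ζ)).trans hζs
    refine ⟨h1, hζc.mul_right, contDiff_of_contDiffOn_mul ?_ h1⟩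
    exact hζ.contDiffOn.mul ((hφ.comp_contDiffOn contDiffOn_rhoZ).mul hY)
  obtain ⟨s1, c1, d1⟩ := build _ (contDiffOn_YT hq ht)
  obtain ⟨s2, c2, d2⟩ := build _ (contDiffOn_YA hq ht)
  set u1 := fun z : ℝ × ℝ => ζ z * (φ (rhoZ q t z) * YT q t z.1 z.2) with hu1
  set u2 := fun z : ℝ × ℝ => ζ z * (φ (rhoZ q t z) * YA q t z.1 z.2) with hu2
  have i1 := integral_fderiv_mul_sq hb.weak_theta (locL2_of_memLp hb.memLp) (locL2_of_memLp hb.memLp_theta) d1 c1 s1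
  have i2 := integral_fderiv_mul_sq hb.weak_action (locL2_of_memLp hb.memLp) hb.locL2_action d2 c2 s2
  obtain ⟨Z, hZ⟩ := hζ.continuous.bounded_above_of_compact_support hζc
  have hZ0 : 0 ≤ Z := (norm_nonneg _).trans (hZ 0)
  have hM0 : 0 ≤ M := (abs_nonneg _).trans (hM 1 one_pos)
  have hu : ∀ z ∈ phaseSpace, ∀ Y : ℝ, |ζ z * (φ (rhoZ q t z) * Y)| ≤ Z * M * |Y| := by
    intro z hz Y
    rw [abs_mul, abs_mul, ← mul_assoc]
    have h1 := hM (rhoZ q t z) (rho_pos hq (mem_phaseSpace.1 hz))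
    have h2 : |ζ z| ≤ Z := hZ z
    gcongr
  have j1 : Integrable (fun z => u1 z * (γ z * γθ z)) phaseMeasure := by
    refine (hb.integrable_of_le (c := Z * M * fieldConst q / (1 + t)) ?_ ?_ ?_).1
    · have := fieldConst_nonneg hq; positivity
    · exact d1.continuous.aestronglyMeasurable.mul (hb.aesm.mul hb.aesm_theta)
    · intro z hz
      have ha := mem_phaseSpace.1 hz
      have h1 := inv_rho_pow_mul_YT_le (θ := z.1) (k := 0) hq ha ht (by norm_num)
      simp only [pow_zero, one_mul, zero_add, pow_one] at h1
      have h2 : |γθ z| ≤ gradSum γ γθ γa z := by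
        unfold gradSum
        have := mul_nonneg ha.le (abs_nonneg (γa z))
        linarith [abs_nonneg (γ z)]
      have h3 := (hu z hz (YT q t z.1 z.2)).trans (mul_le_mul_of_nonneg_left h1 (by positivity))
      have h4 := one_le_decayWeight (θ := z.1) ha ht
      rw [abs_mul, abs_mul (γ z)]
      calc |u1 z| * (|γ z| * |γθ z|)
          ≤ (Z * M * (fieldConst q * decayWeight t z.1 z.2 / (1 + t)))
            * (|γ z| * gradSum γ γθ γa z) := by
            have := (abs_nonneg _).trans h3
            gcongr
        _ = _ := by ring
  have j2 : Integrable (fun z => u2 z * (γ z * γa z)) phaseMeasure := by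
    refine (hb.integrable_of_le (c := Z * M * (decayConst q * (1 + q)) / (1 + t)) ?_ ?_ ?_).1
    · have := decayConst_nonneg hq; positivity
    · exact d2.continuous.aestronglyMeasurable.mul (hb.aesm.mul hb.aesm_action)
    · intro z hz
      have ha := mem_phaseSpace.1 hz
      have h1 := inv_rho_pow_mul_YA_le (θ := z.1) (k := 0) hq ha ht (by norm_num)
      simp only [pow_zero, one_mul, zero_add, pow_one] at h1
      have h2 : z.2 * |γa z| ≤ gradSum γ γθ γa z := by
        unfold gradSum
        linarith [abs_nonneg (γ z), abs_nonneg (γθ z)]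
      have h4 := one_le_decayWeight (θ := z.1) ha ht
      have h5 : |u2 z| / z.2 ≤ Z * M * (decayConst q * (1 + q) * decayWeight t z.1 z.2 / (1 + t)) := by
        refine le_trans ?_ (mul_le_mul_of_nonneg_left h1 (by positivity))
        rw [← mul_div_assoc]
        exact div_le_div_of_nonneg_right (hu z hz (YA q t z.1 z.2)) ha.le
      rw [abs_mul, abs_mul (γ z)]
      calc |u2 z| * (|γ z| * |γa z|) = (|u2 z| / z.2) * (|γ z| * (z.2 * |γa z|)) := by
            field_simp
        _ ≤ (Z * M * (decayConst q * (1 + q) * decayWeight t z.1 z.2 / (1 + t)))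
            * (|γ z| * gradSum γ γθ γa z) := by
            have h6 : 0 ≤ |u2 z| / z.2 := by positivity
            have := h6.trans h5
            gcongr
        _ = _ := by ring
  have k1 := hb.integrable_mul_sq (v := fun z => fderiv ℝ u1 z (1, 0))
    ((d1.continuous_fderiv (by norm_num)).clm_apply continuous_const) (c1.fderiv_apply ℝ _)
  have k2 := hb.integrable_mul_sq (v := fun z => fderiv ℝ u2 z (0, 1))
    ((d2.continuous_fderiv (by norm_num)).clm_apply continuous_const) (c2.fderiv_apply ℝ _)
  have hsum : ∫ z, ((fderiv ℝ u1 z (1, 0) * γ z ^ 2 + fderiv ℝ u2 z (0, 1) * γ z ^ 2)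
      + (2 * (u1 z * (γ z * γθ z)) + 2 * (u2 z * (γ z * γa z)))) ∂phaseMeasure = 0 := by
    have l1 := integral_add (k1.add k2) ((j1.const_mul 2).add (j2.const_mul 2))
    have l2 := integral_add (j1.const_mul 2) (j2.const_mul 2)
    simp only [Pi.add_apply] at l1 l2
    rw [l1, integral_add k1 k2, l2, i1, i2, integral_const_mul,
      integral_const_mul]
    ring
  refine Eq.trans (integral_congr_ae ?_) hsum
  filter_upwards [ae_mem_phaseSpace] with z hz
  have ha := mem_phaseSpace.1 hz
  have e1 : fderiv ℝ u1 z (1, 0) = fderiv ℝ ζ z (1, 0) * (φ (rhoZ q t z) * YT q t z.1 z.2)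
      + ζ z * (deriv φ (rhoZ q t z) * rhoT q t z.1 z.2 * YT q t z.1 z.2
        + φ (rhoZ q t z) * (vTA q t z.1 z.2 - gY q t z.2 * rhoTA q t z.1 z.2)) := by
    refine hasDerivAt_unique_fderiv_theta d1 ?_
    have h1 := hasDerivAt_of_contDiff_theta (hζ.differentiable (by norm_num) z)
    have h2 := (hφd (rhoZ q t z)).comp z.1 (hasDerivAt_rho_theta (θ := z.1) (t := t) hq ha)
    exact h1.mul (h2.mul (hasDerivAt_YT hq ha))
  have e2 : fderiv ℝ u2 z (0, 1) = fderiv ℝ ζ z (0, 1) * (φ (rhoZ q t z) * YA q t z.1 z.2)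
      + ζ z * (deriv φ (rhoZ q t z) * rhoA q t z.1 z.2 * YA q t z.1 z.2
        + φ (rhoZ q t z) * (divY q t z.1 z.2
          - (vTA q t z.1 z.2 - gY q t z.2 * rhoTA q t z.1 z.2))) := by
    refine hasDerivAt_unique_fderiv_action d2 ?_
    have h1 := hasDerivAt_of_contDiff_action (hζ.differentiable (by norm_num) z)
    have h2 := (hφd (rhoZ q t z)).comp z.2 (hasDerivAt_rho_action (θ := z.1) (t := t) hq ha)
    exact h1.mul (h2.mul (hasDerivAt_YA hq ha ht))
  have e3 := YT_mul_add_YA_mul (t := t) (θ := z.1) hq ha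
  rw [e1, e2]
  simp only [hu1, hu2, jac]
  -- The only nontrivial relation is `Yρ = 1`; the mixed derivatives of `Y` have already cancelled.
  linear_combination (-(ζ z * deriv φ (rhoZ q t z) * γ z ^ 2)) * e3

/-- The cutoff is removed by dominated convergence. Its derivatives are paired as `∂_θζ · YT` and
`(a ∂_aζ)(YA/a)`, both tending to zero pointwise and dominated through the decay weight. -/
theorem divergence (hb : StaticBound q t γ γθ γa S D) {φ : ℝ → ℝ} (hφ : ContDiff ℝ 1 φ)
    {M : ℝ} (hM : ∀ s, 0 < s → |φ s| ≤ M) (hM' : ∀ s, 0 < s → |deriv φ s| ≤ M) :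
    ∫ z, (deriv φ (rhoZ q t z) * γ z ^ 2 + φ (rhoZ q t z) * jac q t γ γθ γa z)
        ∂phaseMeasure = 0 := by
  have hq := hb.q_pos
  have ht := hb.t_nonneg
  have hM0 : 0 ≤ M := (abs_nonneg _).trans (hM 1 one_pos)
  obtain ⟨c, ζ, hc, h1, h2, h3, h4', h5, h6, h7, h8⟩ := exists_cutoff_seq
  have hlim := tendsto_integral_of_dominated_convergence (μ := phaseMeasure)
    (F := fun n z => φ (rhoZ q t z) * (fderiv ℝ (ζ n) z (1, 0) * YT q t z.1 z.2
        + fderiv ℝ (ζ n) z (0, 1) * YA q t z.1 z.2) * γ z ^ 2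
      + ζ n z * (deriv φ (rhoZ q t z) * γ z ^ 2 + φ (rhoZ q t z) * jac q t γ γθ γa z))
    (f := fun z => deriv φ (rhoZ q t z) * γ z ^ 2 + φ (rhoZ q t z) * jac q t γ γθ γa z)
    (fun z => M * c * ((fieldConst q + decayConst q * (1 + q)) / (1 + t))
        * (decayWeight t z.1 z.2 * |γ z| * gradSum γ γθ γa z)
      + (M * γ z ^ 2 + M * |jac q t γ γθ γa z|)) ?_ ?_ ?_ ?_
  · simp_rw [fun n => hb.divergence_cutoff hφ hM (h1 n) (h2 n) (h3 n)] at hlim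
    exact tendsto_nhds_unique hlim tendsto_const_nhds
  · intro n
    have m1 := aestronglyMeasurable_of_contDiffOn (contDiffOn_YT hq ht)
    have m2 := aestronglyMeasurable_of_contDiffOn (contDiffOn_YA hq ht)
    have m3 : AEStronglyMeasurable (fun z => φ (rhoZ q t z)) phaseMeasure :=
      (hφ.continuous.measurable.comp (measurable_rhoZ q t)).aestronglyMeasurable
    have m4 : AEStronglyMeasurable (fun z => deriv φ (rhoZ q t z)) phaseMeasure :=
      ((measurable_deriv φ).comp (measurable_rhoZ q t)).aestronglyMeasurable
    have m5 : ∀ e, AEStronglyMeasurable (fun z => fderiv ℝ (ζ n) z e) phaseMeasure := fun e =>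
      (((h1 n).continuous_fderiv (by norm_num)).clm_apply continuous_const).aestronglyMeasurable
    exact ((m3.mul (((m5 _).mul m1).add ((m5 _).mul m2))).mul (hb.aesm.pow 2)).add
      ((h1 n).continuous.aestronglyMeasurable.mul
        ((m4.mul (hb.aesm.pow 2)).add (m3.mul hb.aesm_jac)))
  · refine Integrable.add ?_ ((hb.integrable_sq.const_mul M).add (hb.integrable_jac.norm.const_mul M))
    refine Integrable.const_mul ?_ _
    refine (hb.integrable_of_le zero_le_one ?_ fun z hz => ?_).1
    · have := hb.aesm_decay.norm.mul hb.aesm_gradSum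
      refine this.congr ?_
      filter_upwards [ae_mem_phaseSpace] with z hz
      have h4 := one_le_decayWeight (θ := z.1) (mem_phaseSpace.1 hz) ht
      simp only [Pi.mul_apply, norm_mul, Real.norm_eq_abs]
      rw [abs_of_nonneg (zero_le_one.trans h4)]
    · have h4 := one_le_decayWeight (θ := z.1) (mem_phaseSpace.1 hz) ht
      have h5 : 0 ≤ gradSum γ γθ γa z := (abs_nonneg _).trans (abs_le_gradSum hz)
      rw [one_mul, abs_of_nonneg (by positivity)]
  · intro n
    filter_upwards [ae_mem_phaseSpace] with z hz
    have ha := mem_phaseSpace.1 hz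
    have hρ : 0 < rhoZ q t z := rho_pos hq ha
    have b1 := inv_rho_pow_mul_YT_le (θ := z.1) (k := 0) hq ha ht (by norm_num)
    have b2 := inv_rho_pow_mul_YA_le (θ := z.1) (k := 0) hq ha ht (by norm_num)
    simp only [pow_zero, one_mul, zero_add, pow_one] at b1 b2
    have hcn : c / (n + 1 : ℝ) ≤ c := div_le_self hc (by linarith [Nat.cast_nonneg (α := ℝ) n])
    have b3 : |fderiv ℝ (ζ n) z (1, 0)| ≤ c := by
      refine le_trans ?_ ((h7 n z hz).trans hcn)
      refine le_mul_of_one_le_right (abs_nonneg _) ?_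
      have : 0 < 1 / z.2 := by positivity
      linarith
    have b4 : |fderiv ℝ (ζ n) z (0, 1)| * z.2 ≤ c := (h8 n z hz).trans hcn
    have h4 := one_le_decayWeight (θ := z.1) ha ht
    have hγ := abs_le_gradSum (γ := γ) (γθ := γθ) (γa := γa) hz
    have b5 : |fderiv ℝ (ζ n) z (1, 0) * YT q t z.1 z.2
        + fderiv ℝ (ζ n) z (0, 1) * YA q t z.1 z.2|
          ≤ c * ((fieldConst q + decayConst q * (1 + q)) / (1 + t)) * decayWeight t z.1 z.2 := by
      refine (abs_add_le _ _).trans ?_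
      rw [abs_mul, abs_mul]
      calc _ = |fderiv ℝ (ζ n) z (1, 0)| * |YT q t z.1 z.2|
            + (|fderiv ℝ (ζ n) z (0, 1)| * z.2) * (|YA q t z.1 z.2| / z.2) := by
              field_simp
        _ ≤ c * (fieldConst q * decayWeight t z.1 z.2 / (1 + t))
            + c * (decayConst q * (1 + q) * decayWeight t z.1 z.2 / (1 + t)) := by gcongr
        _ = _ := by ring
    rw [Real.norm_eq_abs]
    refine (abs_add_le _ _).trans (add_le_add ?_ ?_)
    · rw [abs_mul, abs_mul, abs_pow]
      calc _ ≤ (M * (c * ((fieldConst q + decayConst q * (1 + q)) / (1 + t))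
            * decayWeight t z.1 z.2)) * (|γ z| * gradSum γ γθ γa z) := by
            have := (abs_nonneg _).trans b5
            have := hM _ hρ
            rw [sq]
            gcongr
        _ = _ := by ring
    · rw [abs_mul]
      have b6 : |ζ n z| ≤ 1 := abs_le.2 ⟨by linarith [h4' n z], h5 n z⟩
      refine (mul_le_of_le_one_left (abs_nonneg _) b6).trans ?_
      refine (abs_add_le _ _).trans ?_
      rw [abs_mul, abs_mul, abs_pow, sq_abs]
      have := hM _ hρ
      have := hM' _ hρ
      gcongr
  · filter_upwards [ae_mem_phaseSpace] with z hz
    have ha := mem_phaseSpace.1 hz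
    have l0 : Filter.Tendsto (fun n : ℕ => c / (n + 1 : ℝ)) Filter.atTop (nhds 0) := by
      have := (tendsto_one_div_add_atTop_nhds_zero_nat (𝕜 := ℝ)).const_mul c
      simpa [mul_one_div, div_eq_mul_inv] using this
    have l1 : Filter.Tendsto (fun n => fderiv ℝ (ζ n) z (1, 0)) Filter.atTop (nhds 0) := by
      refine squeeze_zero_norm (fun n => ?_) l0
      refine le_trans ?_ (h7 n z hz)
      refine le_mul_of_one_le_right (abs_nonneg _) ?_
      have : 0 < 1 / z.2 := by positivity
      linarith
    have l2 : Filter.Tendsto (fun n => fderiv ℝ (ζ n) z (0, 1)) Filter.atTop (nhds 0) := by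
      refine squeeze_zero_norm (fun n => ?_) (a := fun n : ℕ => c / (n + 1 : ℝ) * (1 / z.2))
        (by simpa using l0.mul_const (1 / z.2))
      rw [mul_one_div, le_div_iff₀ ha]
      exact h8 n z hz
    have l3 : Filter.Tendsto (fun n => ζ n z) Filter.atTop (nhds 1) :=
      tendsto_const_nhds.congr' ((h6 z hz).mono fun n hn => hn.symm)
    have := ((((l1.mul_const (YT q t z.1 z.2)).add (l2.mul_const (YA q t z.1 z.2))).const_mul
      (φ (rhoZ q t z))).mul_const (γ z ^ 2)).add (l3.mul_const
        (deriv φ (rhoZ q t z) * γ z ^ 2 + φ (rhoZ q t z) * jac q t γ γθ γa z))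
    simpa using this

end StaticBound

/-- A smooth approximation of the positive part. -/
def smoothPos (ε x : ℝ) : ℝ := (x + √(x ^ 2 + ε ^ 2)) / 2

section
variable {ε : ℝ}

theorem sq_add_sq_pos (hε : 0 < ε) (x : ℝ) : 0 < x ^ 2 + ε ^ 2 := by positivity

theorem contDiff_smoothPos (hε : 0 < ε) : ContDiff ℝ 1 (smoothPos ε) := by
  have : ContDiff ℝ 1 fun x : ℝ => √(x ^ 2 + ε ^ 2) :=
    ContDiff.sqrt (by fun_prop) fun x => (sq_add_sq_pos hε x).ne'
  exact (contDiff_id.add this).div_const 2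

theorem hasDerivAt_smoothPos (hε : 0 < ε) (x : ℝ) :
    HasDerivAt (smoothPos ε) ((1 + x / √(x ^ 2 + ε ^ 2)) / 2) x := by
  have h := (((hasDerivAt_id x).pow 2).add_const (ε ^ 2)).sqrt (sq_add_sq_pos hε x).ne'
  refine (((hasDerivAt_id x).add h).div_const 2).congr_deriv ?_
  simp only [id_eq, Pi.pow_apply]
  field_simp
  norm_num
  ring

theorem abs_smoothPos_le (hε : 0 < ε) (hε1 : ε ≤ 1) {x r : ℝ} (hr : 0 ≤ r) (hx : x ≤ r) :
    |smoothPos ε x| ≤ r + 1 := by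
  have h1 : √(x ^ 2 + ε ^ 2) ≤ |x| + ε := by
    rw [Real.sqrt_le_left (by positivity), add_sq, sq_abs]
    have : 0 ≤ 2 * |x| * ε := by positivity
    linarith
  have h2 : |x| ≤ √(x ^ 2 + ε ^ 2) := by
    rw [← Real.sqrt_sq_eq_abs]
    exact Real.sqrt_le_sqrt (by nlinarith)
  unfold smoothPos
  rcases abs_cases x with ⟨h, _⟩ | ⟨h, _⟩ <;> rw [abs_le] <;> constructor <;> linarith

theorem abs_deriv_smoothPos_le (hε : 0 < ε) (x : ℝ) :
    |(1 + x / √(x ^ 2 + ε ^ 2)) / 2| ≤ 1 := by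
  have h2 : |x| ≤ √(x ^ 2 + ε ^ 2) := by
    rw [← Real.sqrt_sq_eq_abs]
    exact Real.sqrt_le_sqrt (by nlinarith)
  have h3 : 0 < √(x ^ 2 + ε ^ 2) := Real.sqrt_pos.2 (sq_add_sq_pos hε x)
  have h4 : |x / √(x ^ 2 + ε ^ 2)| ≤ 1 := by
    rw [abs_div, abs_of_pos h3]
    exact (div_le_one h3).2 h2
  have := abs_le.1 h4
  rw [abs_le]; constructor <;> linarith

theorem tendsto_sqrt_sq_add_sq (x : ℝ) :
    Filter.Tendsto (fun n : ℕ => √(x ^ 2 + (1 / (n + 1 : ℝ)) ^ 2)) Filter.atTop (nhds |x|) := by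
  have h := (tendsto_one_div_add_atTop_nhds_zero_nat (𝕜 := ℝ)).pow 2
  have h2 := (h.const_add (x ^ 2)).sqrt
  simpa [Real.sqrt_sq_eq_abs] using h2

theorem tendsto_smoothPos (x : ℝ) :
    Filter.Tendsto (fun n : ℕ => smoothPos (1 / (n + 1 : ℝ)) x) Filter.atTop
      (nhds (max x 0)) := by
  have h := ((tendsto_sqrt_sq_add_sq x).const_add x).div_const 2
  have e : (x + |x|) / 2 = max x 0 := by
    rcases le_total 0 x with h | h
    · rw [abs_of_nonneg h, max_eq_left h]; ring
    · rw [abs_of_nonpos h, max_eq_right h]; ring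
  rwa [e] at h

theorem tendsto_deriv_smoothPos {x : ℝ} (hx : x ≠ 0) :
    Filter.Tendsto (fun n : ℕ => (1 + x / √(x ^ 2 + (1 / (n + 1 : ℝ)) ^ 2)) / 2) Filter.atTop
      (nhds (if 0 < x then 1 else 0)) := by
  have h := (((tendsto_const_nhds (x := x)).div (tendsto_sqrt_sq_add_sq x)
    (abs_ne_zero.2 hx)).const_add 1).div_const 2
  have e : (1 + x / |x|) / 2 = if 0 < x then 1 else 0 := by
    rcases hx.lt_or_gt with h | h
    · rw [abs_of_neg h, if_neg h.not_gt, div_neg, div_self hx]; norm_num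
    · rw [abs_of_pos h, if_pos h, div_self hx]; norm_num
  rwa [e] at h

end

namespace StaticBound

/-- Take `φ(s) = (r-s)_+` in the divergence identity: `φ'` is minus the indicator of `s < r`, which
yields the mass. The kink is smoothed by `smoothPos`, and the level set `{ρ = r}` is null. -/
theorem mass_eq (hb : StaticBound q t γ γθ γa S D) {r : ℝ} (hr : 0 ≤ r) :
    mass q t γ r = ∫ z, max (r - rhoZ q t z) 0 * jac q t γ γθ γa z ∂phaseMeasure := by
  have hq := hb.q_pos
  have hεpos : ∀ n : ℕ, 0 < 1 / (n + 1 : ℝ) := fun n => Nat.one_div_pos_of_nat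
  have hε1 : ∀ n : ℕ, 1 / (n + 1 : ℝ) ≤ 1 := fun n => by
    rw [div_le_one (by positivity)]; linarith [Nat.cast_nonneg (α := ℝ) n]
  have hd : ∀ n : ℕ, ∀ s, HasDerivAt (fun s => smoothPos (1 / (n + 1 : ℝ)) (r - s))
      (-((1 + (r - s) / √((r - s) ^ 2 + (1 / (n + 1 : ℝ)) ^ 2)) / 2)) s := by
    intro n s
    have := (hasDerivAt_smoothPos (hεpos n) (r - s)).comp s ((hasDerivAt_id s).const_sub r)
    simpa [Function.comp_def] using this
  have key : ∀ n : ℕ, ∫ z, (-((1 + (r - rhoZ q t z)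
        / √((r - rhoZ q t z) ^ 2 + (1 / (n + 1 : ℝ)) ^ 2)) / 2) * γ z ^ 2
      + smoothPos (1 / (n + 1 : ℝ)) (r - rhoZ q t z) * jac q t γ γθ γa z) ∂phaseMeasure = 0 := by
    intro n
    -- The bound `r + 1` comes from `φ ≤ r` for positive `s`, with one unit for the smoothing error;
    -- it also dominates the derivative, which is at most one.
    have h := hb.divergence (φ := fun s => smoothPos (1 / (n + 1 : ℝ)) (r - s)) (M := r + 1)
      ((contDiff_smoothPos (hεpos n)).comp (contDiff_const.sub contDiff_id))
      (fun s hs => abs_smoothPos_le (hεpos n) (hε1 n) hr (by linarith))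
      (fun s hs => by
        rw [(hd n s).deriv, abs_neg]
        exact (abs_deriv_smoothPos_le (hεpos n) _).trans (by linarith))
    simpa only [(hd n _).deriv] using h
  have hmeas := measurable_rhoZ q t
  have hlim := tendsto_integral_of_dominated_convergence (μ := phaseMeasure)
    (F := fun n : ℕ => fun z => -((1 + (r - rhoZ q t z)
        / √((r - rhoZ q t z) ^ 2 + (1 / (n + 1 : ℝ)) ^ 2)) / 2) * γ z ^ 2
      + smoothPos (1 / (n + 1 : ℝ)) (r - rhoZ q t z) * jac q t γ γθ γa z)
    (f := fun z => -({z | rhoZ q t z ≤ r}.indicator (fun z => γ z ^ 2) z)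
      + max (r - rhoZ q t z) 0 * jac q t γ γθ γa z)
    (fun z => γ z ^ 2 + (r + 1) * |jac q t γ γθ γa z|)
    (fun n => by
      refine (AEStronglyMeasurable.mul (Measurable.aestronglyMeasurable ?_) (hb.aesm.pow 2)).add
        (AEStronglyMeasurable.mul (Measurable.aestronglyMeasurable ?_) hb.aesm_jac)
      · fun_prop
      · exact (contDiff_smoothPos (hεpos n)).continuous.measurable.comp (hmeas.const_sub r))
    (hb.integrable_sq.add (hb.integrable_jac.norm.const_mul _))
    (fun n => by
      filter_upwards [ae_mem_phaseSpace] with z hz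
      have hρ : 0 < rhoZ q t z := rho_pos hq (mem_phaseSpace.1 hz)
      refine (norm_add_le _ _).trans (add_le_add ?_ ?_)
      · rw [Real.norm_eq_abs, abs_mul, abs_neg, abs_of_nonneg (sq_nonneg (γ z))]
        exact mul_le_of_le_one_left (sq_nonneg _) (abs_deriv_smoothPos_le (hεpos n) _)
      · rw [Real.norm_eq_abs, abs_mul]
        gcongr
        exact abs_smoothPos_le (hεpos n) (hε1 n) hr (by linarith))
    (by
      filter_upwards [ae_rhoZ_ne hq t r] with z hz
      have hx : r - rhoZ q t z ≠ 0 := sub_ne_zero.2 hz.symm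
      have h := ((tendsto_deriv_smoothPos hx).neg.mul_const (γ z ^ 2)).add
        ((tendsto_smoothPos (r - rhoZ q t z)).mul_const (jac q t γ γθ γa z))
      have e : -(if 0 < r - rhoZ q t z then (1 : ℝ) else 0) * γ z ^ 2
          = -({z | rhoZ q t z ≤ r}.indicator (fun z => γ z ^ 2) z) := by
        by_cases h : rhoZ q t z ≤ r
        · rw [if_pos (by linarith [lt_of_le_of_ne h hz]),
            indicator_of_mem (show z ∈ {z | rhoZ q t z ≤ r} from h)]
          ring
        · rw [if_neg (by linarith), indicator_of_notMem (show z ∉ {z | rhoZ q t z ≤ r} from h)]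
          ring
      rwa [e] at h)
  simp_rw [key] at hlim
  have h0 := tendsto_nhds_unique hlim tendsto_const_nhds
  have i1 := hb.integrable_sq.indicator (measurableSet_rhoZ_le q t r)
  have i2 : Integrable (fun z => max (r - rhoZ q t z) 0 * jac q t γ γθ γa z) phaseMeasure := by
    refine hb.integrable_jac.bdd_mul (c := r) ?_ ?_
    · exact ((hmeas.const_sub r).max measurable_const).aestronglyMeasurable
    · filter_upwards [ae_mem_phaseSpace] with z hz
      have hρ : 0 < rhoZ q t z := rho_pos hq (mem_phaseSpace.1 hz)
      rw [Real.norm_of_nonneg (le_max_right _ _)]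
      exact max_le (by linarith) hr
  have h1 := integral_add i1.neg i2
  simp only [Pi.neg_apply] at h1
  rw [h1, integral_neg] at h0
  unfold mass
  linarith

/-- In the representation `∫ (r-ρ)_+ jac` the dependence on `r` is Lipschitz with integrable
constant, although originally it sat in an indicator function. Differentiation under the integral
then applies. -/
theorem hasDerivAt_mass (hb : StaticBound q t γ γθ γa S D) {r : ℝ} (hr : 0 < r) :
    HasDerivAt (mass q t γ) (massD q t γ γθ γa r) r := by
  have hq := hb.q_pos
  have hmeas := measurable_rhoZ q t
  have h := hasDerivAt_integral_of_dominated_loc_of_lip (μ := phaseMeasure)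
    (F := fun r z => max (r - rhoZ q t z) 0 * jac q t γ γθ γa z)
    (F' := {z | rhoZ q t z ≤ r}.indicator (jac q t γ γθ γa)) (x₀ := r)
    (bound := fun z => |jac q t γ γθ γa z|) (s := univ) Filter.univ_mem
    (Filter.Eventually.of_forall fun r =>
      ((hmeas.const_sub r).max measurable_const).aestronglyMeasurable.mul hb.aesm_jac)
    (by
      refine hb.integrable_jac.bdd_mul (c := r) ?_ ?_
      · exact ((hmeas.const_sub r).max measurable_const).aestronglyMeasurable
      · filter_upwards [ae_mem_phaseSpace] with z hz
        have hρ : 0 < rhoZ q t z := rho_pos hq (mem_phaseSpace.1 hz)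
        rw [Real.norm_of_nonneg (le_max_right _ _)]
        exact max_le (by linarith) hr.le)
    (hb.aesm_jac.indicator (measurableSet_rhoZ_le q t r))
    (by
      refine Filter.Eventually.of_forall fun z => ?_
      refine LipschitzOnWith.of_dist_le_mul fun x _ y _ => ?_
      rw [Real.dist_eq, Real.dist_eq, ← sub_mul, abs_mul, Real.coe_nnabs, abs_abs, mul_comm]
      refine mul_le_mul_of_nonneg_left ((abs_max_sub_max_le_abs _ _ _).trans (le_of_eq ?_))
        (abs_nonneg _)
      rw [sub_sub_sub_cancel_right])
    hb.integrable_jac.norm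
    (by
      filter_upwards [ae_rhoZ_ne hq t r] with z hz
      by_cases h : rhoZ q t z ≤ r
      · have h' := lt_of_le_of_ne h hz
        rw [indicator_of_mem (show z ∈ {z | rhoZ q t z ≤ r} from h)]
        have h1 := ((hasDerivAt_id r).sub_const (rhoZ q t z)).mul_const (jac q t γ γθ γa z)
        rw [one_mul] at h1
        refine h1.congr_of_eventuallyEq ?_
        filter_upwards [lt_mem_nhds h'] with x hx
        rw [max_eq_left (by linarith)]; rfl
      · rw [indicator_of_notMem (show z ∉ {z | rhoZ q t z ≤ r} from h)]
        refine (hasDerivAt_const r (0 : ℝ)).congr_of_eventuallyEq ?_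
        filter_upwards [gt_mem_nhds (not_le.1 h)] with x hx
        rw [max_eq_right (by linarith), zero_mul])
  refine h.2.congr_of_eventuallyEq ?_
  filter_upwards [lt_mem_nhds hr] with x hx
  exact hb.mass_eq hx.le

theorem continuousAt_massD (hb : StaticBound q t γ γθ γa S D) (r : ℝ) :
    ContinuousAt (massD q t γ γθ γa) r := by
  refine continuousAt_of_dominated (bound := fun z => |jac q t γ γθ γa z|)
    (Filter.Eventually.of_forall fun r => hb.aesm_jac.indicator (measurableSet_rhoZ_le q t r))
    (Filter.Eventually.of_forall fun r => Filter.Eventually.of_forall fun z =>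
      norm_indicator_le_norm_self _ _) hb.integrable_jac.norm ?_
  filter_upwards [ae_rhoZ_ne hb.q_pos t r] with z hz
  by_cases h : rhoZ q t z ≤ r
  · have h' := lt_of_le_of_ne h hz
    refine (continuousAt_const (y := jac q t γ γθ γa z)).congr ?_
    filter_upwards [lt_mem_nhds h'] with x hx
    exact (indicator_of_mem (show z ∈ {z | rhoZ q t z ≤ x} from hx.le) _).symm
  · refine (continuousAt_const (y := (0 : ℝ))).congr ?_
    filter_upwards [gt_mem_nhds (not_le.1 h)] with x hx
    exact (indicator_of_notMem (show z ∉ {z | rhoZ q t z ≤ x} from not_le.2 hx) _).symm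

end StaticBound

/-- The potential as a function of the radius. -/
def radialPotential (q t : ℝ) (γ : ℝ × ℝ → ℝ) (r : ℝ) : ℝ :=
  ∫ z, (max r (rhoZ q t z))⁻¹ * γ z ^ 2 ∂phaseMeasure

theorem abs_inv_max_sub_le {r x y s : ℝ} (hr : 0 < r) (hx : r / 2 < x) (hy : r / 2 < y) :
    |(max x s)⁻¹ - (max y s)⁻¹| ≤ 4 / r ^ 2 * |x - y| := by
  have h1 : r / 2 ≤ max x s := hx.le.trans (le_max_left _ _)
  have h2 : r / 2 ≤ max y s := hy.le.trans (le_max_left _ _)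
  have h1' : 0 < max x s := by linarith
  have h2' : 0 < max y s := by linarith
  rw [inv_sub_inv h1'.ne' h2'.ne', abs_div, abs_of_pos (mul_pos h1' h2'), abs_sub_comm]
  have h3 : |max x s - max y s| ≤ |x - y| := abs_max_sub_max_le_abs _ _ _
  rw [div_le_iff₀ (mul_pos h1' h2')]
  have h4 : r / 2 * (r / 2) ≤ max x s * max y s := mul_le_mul h1 h2 (by linarith) h1'.le
  calc |max x s - max y s| ≤ |x - y| := h3
    _ = 4 / r ^ 2 * |x - y| * (r / 2 * (r / 2)) := by field_simp; norm_num
    _ ≤ _ := by gcongr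

namespace StaticBound

/-- Newton's shell theorem: `1/max(r,ρ)` has derivative `-1/r²` where `ρ < r` and `0` where `ρ > r`,
so only the enclosed mass exerts a force. -/
theorem hasDerivAt_radialPotential (hb : StaticBound q t γ γθ γa S D) {r : ℝ} (hr : 0 < r) :
    HasDerivAt (radialPotential q t γ) (-(mass q t γ r) / r ^ 2) r := by
  have hq := hb.q_pos
  have hmeas := measurable_rhoZ q t
  have h := hasDerivAt_integral_of_dominated_loc_of_lip (μ := phaseMeasure)
    (F := fun r z => (max r (rhoZ q t z))⁻¹ * γ z ^ 2)
    (F' := fun z => {z | rhoZ q t z ≤ r}.indicator (fun z => γ z ^ 2) z * (-1 / r ^ 2)) (x₀ := r)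
    (bound := fun z => 4 / r ^ 2 * γ z ^ 2) (s := Ioi (r / 2)) (Ioi_mem_nhds (by linarith))
    (Filter.Eventually.of_forall fun r =>
      (measurable_const.max hmeas).inv.aestronglyMeasurable.mul (hb.aesm.pow 2))
    (by
      refine hb.integrable_sq.bdd_mul (c := r⁻¹) ?_ (Filter.Eventually.of_forall fun z => ?_)
      · exact (measurable_const.max hmeas).inv.aestronglyMeasurable
      · have h1 : r ≤ max r (rhoZ q t z) := le_max_left _ _
        rw [Real.norm_of_nonneg (inv_nonneg.2 (hr.le.trans h1))]
        exact inv_anti₀ hr h1)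
    (((hb.aesm.pow 2).indicator (measurableSet_rhoZ_le q t r)).mul_const _)
    (by
      refine Filter.Eventually.of_forall fun z => ?_
      refine LipschitzOnWith.of_dist_le_mul fun x hx y hy => ?_
      rw [Real.dist_eq, Real.dist_eq, ← sub_mul, abs_mul, Real.coe_nnabs,
        abs_of_nonneg (sq_nonneg (γ z)), abs_of_nonneg (by positivity : 0 ≤ 4 / r ^ 2 * γ z ^ 2)]
      refine (mul_le_mul_of_nonneg_right (abs_inv_max_sub_le hr hx hy) (sq_nonneg _)).trans
        (le_of_eq ?_)
      ring)
    (hb.integrable_sq.const_mul _)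
    (by
      filter_upwards [ae_rhoZ_ne hq t r] with z hz
      by_cases h : rhoZ q t z ≤ r
      · have h' := lt_of_le_of_ne h hz
        rw [indicator_of_mem (show z ∈ {z | rhoZ q t z ≤ r} from h)]
        have h1 := ((hasDerivAt_id r).inv hr.ne').mul_const (γ z ^ 2)
        rw [mul_comm (γ z ^ 2)]
        refine h1.congr_of_eventuallyEq ?_
        filter_upwards [lt_mem_nhds h'] with x hx
        rw [max_eq_left hx.le]; rfl
      · rw [indicator_of_notMem (show z ∉ {z | rhoZ q t z ≤ r} from h), zero_mul]
        refine (hasDerivAt_const r ((rhoZ q t z)⁻¹ * γ z ^ 2)).congr_of_eventuallyEq ?_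
        filter_upwards [gt_mem_nhds (not_le.1 h)] with x hx
        rw [max_eq_right hx.le])
  refine h.2.congr_deriv ?_
  rw [integral_mul_const]
  unfold mass
  ring

end StaticBound
end

/-! ### The potential and its derivatives -/

section
variable {q t S D θ a : ℝ} {γ γθ γa : ℝ × ℝ → ℝ}

/-- The `θ`-derivative of the potential. -/
def psiT (q t : ℝ) (γ : ℝ × ℝ → ℝ) (θ a : ℝ) : ℝ :=
  -(mass q t γ (rho q t θ a)) / rho q t θ a ^ 2 * rhoT q t θ a

/-- The `a`-derivative of the potential. -/
def psiA (q t : ℝ) (γ : ℝ × ℝ → ℝ) (θ a : ℝ) : ℝ :=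
  -(mass q t γ (rho q t θ a)) / rho q t θ a ^ 2 * rhoA q t θ a

/-- The second derivative of the radial potential. -/
def radialD2 (q t : ℝ) (γ γθ γa : ℝ × ℝ → ℝ) (r : ℝ) : ℝ :=
  -(massD q t γ γθ γa r) / r ^ 2 + 2 * mass q t γ r / r ^ 3

/-- The second `θ`-derivative of the potential. -/
def psiTT (q t : ℝ) (γ γθ γa : ℝ × ℝ → ℝ) (θ a : ℝ) : ℝ :=
  radialD2 q t γ γθ γa (rho q t θ a) * rhoT q t θ a * rhoT q t θ a
    + -(mass q t γ (rho q t θ a)) / rho q t θ a ^ 2 * rhoTT q t θ a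

/-- The mixed second derivative of the potential. -/
def psiTA (q t : ℝ) (γ γθ γa : ℝ × ℝ → ℝ) (θ a : ℝ) : ℝ :=
  radialD2 q t γ γθ γa (rho q t θ a) * rhoT q t θ a * rhoA q t θ a
    + -(mass q t γ (rho q t θ a)) / rho q t θ a ^ 2 * rhoTA q t θ a

/-- The second `a`-derivative of the potential. -/
def psiAA (q t : ℝ) (γ γθ γa : ℝ × ℝ → ℝ) (θ a : ℝ) : ℝ :=
  radialD2 q t γ γθ γa (rho q t θ a) * rhoA q t θ a * rhoA q t θ a
    + -(mass q t γ (rho q t θ a)) / rho q t θ a ^ 2 * rhoAA q t θ a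

theorem potential_eq (hq : 0 < q) (γ : L2) (t θ a : ℝ) :
    potential q γ t θ a = radialPotential q t γ (rho q t θ a) := by
  unfold potential radialPotential rhoZ
  simp only [rho_eq_R hq]

namespace StaticBound

theorem hasDerivAt_radialD (hb : StaticBound q t γ γθ γa S D) {r : ℝ} (hr : 0 < r) :
    HasDerivAt (fun r => -(mass q t γ r) / r ^ 2) (radialD2 q t γ γθ γa r) r := by
  refine ((hb.hasDerivAt_mass hr).neg.div (hasDerivAt_pow 2 r) (by positivity)).congr_deriv ?_
  unfold radialD2
  simp only [Pi.neg_apply]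
  field_simp
  norm_num
  ring

theorem hasDerivAt_radialPotential_theta (hb : StaticBound q t γ γθ γa S D) (ha : 0 < a) :
    HasDerivAt (fun θ => radialPotential q t γ (rho q t θ a)) (psiT q t γ θ a) θ :=
  HasDerivAt.comp (h₂ := radialPotential q t γ) θ
    (hb.hasDerivAt_radialPotential (rho_pos (t := t) (θ := θ) (a := a) hb.q_pos ha)) (hasDerivAt_rho_theta (t := t) hb.q_pos ha)

theorem hasDerivAt_radialPotential_action (hb : StaticBound q t γ γθ γa S D) (ha : 0 < a) :
    HasDerivAt (fun a => radialPotential q t γ (rho q t θ a)) (psiA q t γ θ a) a :=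
  (hb.hasDerivAt_radialPotential (rho_pos (t := t) (θ := θ) (a := a) hb.q_pos ha)).comp a (hasDerivAt_rho_action hb.q_pos ha)

theorem hasDerivAt_psiT_theta (hb : StaticBound q t γ γθ γa S D) (ha : 0 < a) :
    HasDerivAt (fun θ => psiT q t γ θ a) (psiTT q t γ γθ γa θ a) θ :=
  (HasDerivAt.comp (h₂ := fun r => -(mass q t γ r) / r ^ 2) θ
    (hb.hasDerivAt_radialD (rho_pos (t := t) (θ := θ) (a := a) hb.q_pos ha)) (hasDerivAt_rho_theta (t := t) hb.q_pos ha)).mul (hasDerivAt_rhoT_theta (q := q) (t := t) (θ := θ) (a := a))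

theorem hasDerivAt_psiT_action (hb : StaticBound q t γ γθ γa S D) (ha : 0 < a) :
    HasDerivAt (fun a => psiT q t γ θ a) (psiTA q t γ γθ γa θ a) a :=
  (((hb.hasDerivAt_radialD (rho_pos (t := t) (θ := θ) (a := a) hb.q_pos ha)).comp a
    (hasDerivAt_rho_action hb.q_pos ha)).mul (hasDerivAt_rhoT_action ha)).congr_deriv (by
      simp only [Function.comp_apply]; unfold psiTA; ring)

theorem hasDerivAt_psiA_theta (hb : StaticBound q t γ γθ γa S D) (ha : 0 < a) :
    HasDerivAt (fun θ => psiA q t γ θ a) (psiTA q t γ γθ γa θ a) θ :=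
  (HasDerivAt.comp (h₂ := fun r => -(mass q t γ r) / r ^ 2) θ
    (hb.hasDerivAt_radialD (rho_pos (t := t) (θ := θ) (a := a) hb.q_pos ha)) (hasDerivAt_rho_theta (t := t) hb.q_pos ha)).mul (hasDerivAt_rhoA_theta (t := t) hb.q_pos ha)

theorem hasDerivAt_psiA_action (hb : StaticBound q t γ γθ γa S D) (ha : 0 < a) :
    HasDerivAt (fun a => psiA q t γ θ a) (psiAA q t γ γθ γa θ a) a :=
  ((hb.hasDerivAt_radialD (rho_pos (t := t) (θ := θ) (a := a) hb.q_pos ha)).comp a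
    (hasDerivAt_rho_action hb.q_pos ha)).mul (hasDerivAt_rhoA_action ha)

theorem contDiffOn_mass (hb : StaticBound q t γ γθ γa S D) :
    ContDiffOn ℝ 1 (mass q t γ) (Ioi 0) := by
  rw [show (1 : WithTop ℕ∞) = 0 + 1 by norm_num, contDiffOn_succ_iff_deriv_of_isOpen isOpen_Ioi]
  refine ⟨fun r hr => (hb.hasDerivAt_mass hr).differentiableAt.differentiableWithinAt, by simp, ?_⟩
  rw [contDiffOn_zero]
  refine ContinuousOn.congr (f := massD q t γ γθ γa) (fun r _ =>
    (hb.continuousAt_massD r).continuousWithinAt) fun r hr => (hb.hasDerivAt_mass hr).deriv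

theorem contDiffOn_radialD (hb : StaticBound q t γ γθ γa S D) :
    ContDiffOn ℝ 1 (fun z => -(mass q t γ (rhoZ q t z)) / rhoZ q t z ^ 2) phaseSpace := by
  have h : ∀ z ∈ phaseSpace, 0 < rhoZ q t z := fun z hz => rho_pos hb.q_pos (mem_phaseSpace.1 hz)
  exact ((hb.contDiffOn_mass.comp contDiffOn_rhoZ h).neg).div (contDiffOn_rhoZ.pow 2)
    fun z hz => (pow_pos (h z hz) 2).ne'

theorem contDiffOn_psiT (hb : StaticBound q t γ γθ γa S D) :
    ContDiffOn ℝ 1 (fun z : ℝ × ℝ => psiT q t γ z.1 z.2) phaseSpace :=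
  hb.contDiffOn_radialD.mul contDiffOn_rhoT

theorem contDiffOn_psiA (hb : StaticBound q t γ γθ γa S D) :
    ContDiffOn ℝ 1 (fun z : ℝ × ℝ => psiA q t γ z.1 z.2) phaseSpace :=
  hb.contDiffOn_radialD.mul contDiffOn_rhoA

end StaticBound

/-- The constant in the bounds of the potential. -/
def potConst (q : ℝ) : ℝ := 120 * (decayConst q + massConst q) * (1 + 1 / q)

theorem potConst_nonneg (hq : 0 < q) : 0 ≤ potConst q := by
  have := decayConst_nonneg hq
  have := massConst_nonneg hq
  unfold potConst; positivity

/-- Interpolation: the geometric mean of a `τ^{-1}` and a `τ^{-2}` bound is of size `τ^{-3/2}`. This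
is how integrable decay is gained at the cost of half a power of `ρ`. -/
theorem le_of_sq_le_mul {x A B c k τ : ℝ} (hτ : 0 < τ) (hc : 0 ≤ c) (hk : 0 ≤ k)
    (hA : A ≤ c / τ) (hB : B ≤ c / τ ^ 2) (hB0 : 0 ≤ B)
    (h : x ^ 2 ≤ A * B * k ^ 2) : x ≤ c * k / (τ * √τ) := by
  refine le_trans (le_abs_self x) (abs_le_of_sq_le_sq ?_ (by positivity))
  refine h.trans ?_
  rw [div_pow, mul_pow τ, Real.sq_sqrt hτ.le]
  calc A * B * k ^ 2 ≤ c / τ * (c / τ ^ 2) * k ^ 2 := by gcongr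
    _ = _ := by field_simp

theorem inv_sq_le (hq : 0 < q) (ha : 0 < a) : (1 / a) ^ 2 ≤ rho q t θ a * (1 / q) := by
  have h := le_rho (t := t) (θ := θ) (a := a) hq
  calc (1 / a) ^ 2 = q / a ^ 2 * (1 / q) := by field_simp
    _ ≤ _ := by gcongr

theorem one_div_pow_le {τ : ℝ} (hτ : 1 ≤ τ) {k : ℕ} (hk : 2 ≤ k) : 1 / τ ^ k ≤ 1 / (τ * √τ) := by
  have h1 : √τ ≤ τ := by
    rw [Real.sqrt_le_left (by linarith)]
    nlinarith
  have h0 : 0 < √τ := Real.sqrt_pos.2 (by linarith)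
  refine one_div_le_one_div_of_le (by positivity) ?_
  calc τ * √τ ≤ τ * τ := by gcongr
    _ = τ ^ 2 := by ring
    _ ≤ τ ^ k := pow_le_pow_right₀ hτ hk

/-- The scalar inequalities behind the bounds of the potential. -/
structure RadialBound (q t c F ρ a m n : ℝ) : Prop where
  q_pos : 0 < q
  t_nonneg : 0 ≤ t
  c_nonneg : 0 ≤ c
  F_nonneg : 0 ≤ F
  rho_pos : 0 < ρ
  a_pos : 0 < a
  m_nonneg : 0 ≤ m
  n_nonneg : 0 ≤ n
  inv_sq_le : (1 / a) ^ 2 ≤ ρ * (1 / q)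
  inv_le : 1 / ρ ≤ a ^ 2 * (1 / q)
  m_le : ∀ k ≤ 3, m * (1 / ρ) ^ k ≤ c * F / (1 + t) ^ k
  n_le : ∀ k ≤ 2, n * (1 / ρ) ^ k ≤ c * F / (1 + t) ^ (k + 1)

namespace RadialBound
variable {c F ρ m n : ℝ}

theorem one_le_tau (h : RadialBound q t c F ρ a m n) : 1 ≤ 1 + t := by linarith [h.t_nonneg]

theorem inv_q_le (h : RadialBound q t c F ρ a m n) : 1 / q ≤ (1 + 1 / q) ^ 2 := by
  have : 0 < 1 / q := by have := h.q_pos; positivity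
  nlinarith

/-- In the square of `mρ^{-2}`, three powers of `1/ρ` are kept for the mass bounds and the fourth is
traded for `a²/q`. -/
theorem m_two_le (h : RadialBound q t c F ρ a m n) :
    m * (1 / ρ) ^ 2 ≤ c * F * (a * (1 + 1 / q)) / ((1 + t) * √(1 + t)) := by
  have h1 := h.one_le_tau
  have ha := h.a_pos; have hm := h.m_nonneg; have hρ := h.rho_pos; have hq := h.q_pos
  have hcF := mul_nonneg h.c_nonneg h.F_nonneg
  have m1 := h.m_le 1 (by norm_num)
  rw [pow_one, pow_one] at m1
  refine le_of_sq_le_mul (by linarith) hcF (by positivity) m1 (h.m_le 2 (by norm_num))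
    (by positivity) ?_
  calc (m * (1 / ρ) ^ 2) ^ 2 = m * (1 / ρ) * (m * (1 / ρ) ^ 2) * (1 / ρ) := by ring
    _ ≤ m * (1 / ρ) * (m * (1 / ρ) ^ 2) * (a ^ 2 * (1 / q)) := by gcongr; exact h.inv_le
    _ ≤ m * (1 / ρ) * (m * (1 / ρ) ^ 2) * (a ^ 2 * (1 + 1 / q) ^ 2) := by
        gcongr; exact h.inv_q_le
    _ = _ := by ring

/-- Conversely, `1/a² ≤ ρ/q` lets the singular factor `1/a` cost half a power of `1/ρ`. -/
theorem m_two_mul_le (h : RadialBound q t c F ρ a m n) :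
    m * (1 / ρ) ^ 2 * (1 / a) ≤ c * F * (1 + 1 / q) / ((1 + t) * √(1 + t)) := by
  have h1 := h.one_le_tau
  have ha := h.a_pos; have hm := h.m_nonneg; have hρ := h.rho_pos; have hq := h.q_pos
  have hcF := mul_nonneg h.c_nonneg h.F_nonneg
  have m1 := h.m_le 1 (by norm_num)
  rw [pow_one, pow_one] at m1
  refine le_of_sq_le_mul (by linarith) hcF (by positivity) m1 (h.m_le 2 (by norm_num))
    (by positivity) ?_
  calc (m * (1 / ρ) ^ 2 * (1 / a)) ^ 2 = m ^ 2 * (1 / ρ) ^ 4 * (1 / a) ^ 2 := by ring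
    _ ≤ m ^ 2 * (1 / ρ) ^ 4 * (ρ * (1 / q)) := by gcongr; exact h.inv_sq_le
    _ = m * (1 / ρ) * (m * (1 / ρ) ^ 2) * (1 / q) := by field_simp
    _ ≤ _ := by gcongr; exact h.inv_q_le

theorem n_one_mul_le (h : RadialBound q t c F ρ a m n) :
    n * (1 / ρ) * (1 / a) ≤ c * F * (1 + 1 / q) / ((1 + t) * √(1 + t)) := by
  have h1 := h.one_le_tau
  have ha := h.a_pos; have hn := h.n_nonneg; have hρ := h.rho_pos; have hq := h.q_pos
  have hcF := mul_nonneg h.c_nonneg h.F_nonneg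
  have m1 := h.n_le 0 (by norm_num)
  have m2 := h.n_le 1 (by norm_num)
  norm_num at m1 m2
  refine le_of_sq_le_mul (by linarith) hcF (by positivity) m1 m2
    (by positivity) ?_
  calc (n * (1 / ρ) * (1 / a)) ^ 2 = n ^ 2 * (1 / ρ) ^ 2 * (1 / a) ^ 2 := by ring
    _ ≤ n ^ 2 * (1 / ρ) ^ 2 * (ρ * (1 / q)) := by gcongr; exact h.inv_sq_le
    _ = n * (n * ρ⁻¹) * (1 / q) := by field_simp
    _ ≤ _ := by gcongr; exact h.inv_q_le

theorem mul_le_of_pow (h : RadialBound q t c F ρ a m n) {x : ℝ} {k : ℕ} (hk : 2 ≤ k)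
    (hx : x ≤ c * F / (1 + t) ^ k) : x ≤ c * F / ((1 + t) * √(1 + t)) := by
  refine hx.trans ?_
  have := one_div_pow_le h.one_le_tau hk
  have hcF := mul_nonneg h.c_nonneg h.F_nonneg
  rw [← mul_one_div, ← mul_one_div (c * F)]
  gcongr

theorem t_mul_le (h : RadialBound q t c F ρ a m n) {x : ℝ} {k : ℕ}
    (hx : x ≤ c * F / (1 + t) ^ (k + 1)) : t * x ≤ c * F / (1 + t) ^ k := by
  have h1 := h.one_le_tau
  have ht := h.t_nonneg
  have hcF := mul_nonneg h.c_nonneg h.F_nonneg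
  calc t * x ≤ t * (c * F / (1 + t) ^ (k + 1)) := by gcongr
    _ ≤ (1 + t) * (c * F / (1 + t) ^ (k + 1)) := by gcongr; linarith
    _ = _ := by rw [pow_succ]; field_simp

end RadialBound

namespace StaticBound

theorem radialBound (hb : StaticBound q t γ γθ γa S D) (ha : 0 < a) :
    RadialBound q t (decayConst q + massConst q) (S * (S + 2 * D)) (rho q t θ a) a
      (mass q t γ (rho q t θ a)) |massD q t γ γθ γa (rho q t θ a)| := by
  have hq := hb.q_pos
  have hr := rho_pos (t := t) (θ := θ) hq ha
  have hS := hb.S_nonneg; have hD := hb.D_nonneg; have ht := hb.t_nonneg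
  have c1 := decayConst_nonneg hq
  have c2 := massConst_nonneg hq
  refine ⟨hq, ht, by positivity, by positivity, hr, ha, mass_nonneg _, abs_nonneg _,
    inv_sq_le hq ha, ?_, fun k hk => (hb.mass_mul_le (by omega) hr).trans ?_,
    fun k hk => (hb.abs_massD_mul_le hk hr).trans ?_⟩
  · rw [mul_one_div]; exact inv_rho_le hq ha
  · rw [div_mul_eq_mul_div]
    gcongr <;> linarith
  · rw [div_mul_eq_mul_div]
    gcongr
    linarith

/-- Taking `0` in place of the derivative of the mass leaves a factor `S²` without `D`. First
derivatives of the potential thus do not see the possibly growing derivative norms. -/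
theorem radialBound_mass (hb : StaticBound q t γ γθ γa S D) (ha : 0 < a) :
    RadialBound q t (decayConst q + massConst q) (S * S) (rho q t θ a) a
      (mass q t γ (rho q t θ a)) 0 := by
  have hq := hb.q_pos
  have hr := rho_pos (t := t) (θ := θ) hq ha
  have hS := hb.S_nonneg; have ht := hb.t_nonneg
  have c1 := decayConst_nonneg hq
  have c2 := massConst_nonneg hq
  refine ⟨hq, ht, by positivity, by positivity, hr, ha, mass_nonneg _, le_rfl,
    inv_sq_le hq ha, ?_, fun k hk => (hb.mass_mul_le (by omega) hr).trans ?_,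
    fun k hk => by rw [zero_mul]; positivity⟩
  · rw [mul_one_div]; exact inv_rho_le hq ha
  · rw [div_mul_eq_mul_div]
    gcongr; linarith

theorem abs_mass_div (hq : 0 < q) (ha : 0 < a) :
    |(-(mass q t γ (rho q t θ a)) / rho q t θ a ^ 2)|
      = mass q t γ (rho q t θ a) * (1 / rho q t θ a) ^ 2 := by
  have hr := rho_pos (t := t) (θ := θ) hq ha
  rw [abs_div, abs_neg, abs_of_nonneg (mass_nonneg _), abs_of_pos (pow_pos hr 2), one_div, inv_pow,
    div_eq_mul_inv]

theorem abs_radialD2_le {r : ℝ} (hr : 0 < r) : |radialD2 q t γ γθ γa r|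
      ≤ |massD q t γ γθ γa r| * (1 / r) ^ 2 + 2 * (mass q t γ r * (1 / r) ^ 3) := by
  unfold radialD2
  refine (abs_add_le _ _).trans (le_of_eq ?_)
  rw [abs_div, abs_neg, abs_of_pos (pow_pos hr 2), abs_div, abs_of_pos (pow_pos hr 3), abs_mul,
    abs_two, abs_of_nonneg (mass_nonneg _)]
  field_simp

theorem abs_psiT_le (hb : StaticBound q t γ γθ γa S D) (ha : 0 < a) :
    |psiT q t γ θ a| ≤ potConst q * (S * S) / ((1 + t) * √(1 + t)) * a := by
  have h := hb.radialBound_mass (θ := θ) ha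
  unfold psiT
  rw [abs_mul, abs_mass_div hb.q_pos ha]
  have h1 := h.m_two_le
  have hm := h.m_nonneg; have hr := h.rho_pos; have hq := h.q_pos
  have ht := h.t_nonneg; have hc := h.c_nonneg; have hF := h.F_nonneg
  refine (mul_le_of_le_one_right (by positivity) abs_rhoT_le).trans (h1.trans ?_)
  unfold potConst
  have : 0 ≤ (decayConst q + massConst q) * (1 + 1 / q) * (S * S) / ((1 + t) * √(1 + t)) * a := by
    positivity
  calc _ = (decayConst q + massConst q) * (1 + 1 / q) * (S * S) / ((1 + t) * √(1 + t)) * a := by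
        ring
    _ ≤ 120 * ((decayConst q + massConst q) * (1 + 1 / q) * (S * S)
          / ((1 + t) * √(1 + t)) * a) := by linarith
    _ = _ := by ring

theorem base_le_potConst (hq : 0 < q) :
    120 * (decayConst q + massConst q) ≤ potConst q := by
  have := decayConst_nonneg hq
  have := massConst_nonneg hq
  unfold potConst
  refine le_mul_of_one_le_right (by positivity) ?_
  have : 0 < 1 / q := by positivity
  linarith

theorem abs_psiA_le (hb : StaticBound q t γ γθ γa S D) (ha : 0 < a) :
    |psiA q t γ θ a| ≤ potConst q * (S * S) / (1 + t) * (1 + 1 / a) := by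
  have h := hb.radialBound_mass (θ := θ) ha
  unfold psiA
  rw [abs_mul, abs_mass_div hb.q_pos ha]
  have hA := abs_rhoA_le (t := t) (θ := θ) hb.q_pos ha hb.t_nonneg
  have h1 := h.t_mul_le (h.m_le 2 (by norm_num))
  have h2 := h.m_le 1 (by norm_num)
  have hp := base_le_potConst hb.q_pos
  have hm := h.m_nonneg; have hr := h.rho_pos; have hq := h.q_pos
  have ht := h.t_nonneg; have hc := h.c_nonneg; have hF := h.F_nonneg
  rw [pow_one] at h1 h2
  rw [pow_one] at h2
  set ρ := rho q t θ a
  set m := mass q t γ ρ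
  calc m * (1 / ρ) ^ 2 * |rhoA q t θ a| ≤ m * (1 / ρ) ^ 2 * (t + 4 * (ρ / a)) := by gcongr
    _ = t * (m * (1 / ρ) ^ 2) + 4 * (m * (1 / ρ)) * (1 / a) := by field_simp
    _ ≤ (decayConst q + massConst q) * (S * S) / (1 + t)
        + 4 * ((decayConst q + massConst q) * (S * S) / (1 + t)) * (1 / a) := by gcongr
    _ ≤ (120 * (decayConst q + massConst q)) * (S * S) / (1 + t) * (1 + 1 / a) := by
        have : 0 ≤ (decayConst q + massConst q) * (S * S) / (1 + t) := by positivity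
        have h3 : 0 ≤ (decayConst q + massConst q) * (S * S) / (1 + t) * (1 / a) := by positivity
        calc _ ≤ 120 * ((decayConst q + massConst q) * (S * S) / (1 + t))
              + 120 * ((decayConst q + massConst q) * (S * S) / (1 + t) * (1 / a)) := by linarith
          _ = _ := by ring
    _ ≤ _ := by gcongr

theorem abs_psiTT_le_aux (hb : StaticBound q t γ γθ γa S D) (ha : 0 < a) :
    |psiTT q t γ γθ γa θ a| ≤ |massD q t γ γθ γa (rho q t θ a)| * (1 / rho q t θ a) ^ 2
      + 3 * (mass q t γ (rho q t θ a) * (1 / rho q t θ a) ^ 3) := by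
  have h := hb.radialBound (θ := θ) ha
  have hm := h.m_nonneg; have hr := h.rho_pos
  have h1 := abs_radialD2_le (q := q) (t := t) (γ := γ) (γθ := γθ) (γa := γa) hr
  have h2 : |rhoT q t θ a| ≤ 1 := abs_rhoT_le
  have h3 := rhoTT_le (t := t) (θ := θ) hb.q_pos ha
  have h4 := rhoTT_nonneg (t := t) (θ := θ) (a := a) hb.q_pos
  unfold psiTT
  refine (abs_add_le _ _).trans ?_
  rw [abs_mul, abs_mul, abs_mul, abs_mass_div hb.q_pos ha, abs_of_nonneg h4]
  calc _ ≤ (|massD q t γ γθ γa (rho q t θ a)| * (1 / rho q t θ a) ^ 2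
        + 2 * (mass q t γ (rho q t θ a) * (1 / rho q t θ a) ^ 3)) * 1 * 1
        + mass q t γ (rho q t θ a) * (1 / rho q t θ a) ^ 2 * (1 / (2 * rho q t θ a)) := by
        gcongr
    _ = |massD q t γ γθ γa (rho q t θ a)| * (1 / rho q t θ a) ^ 2
        + (5 / 2) * (mass q t γ (rho q t θ a) * (1 / rho q t θ a) ^ 3) := by
        field_simp; ring
    _ ≤ _ := by
        have : 0 ≤ mass q t γ (rho q t θ a) * (1 / rho q t θ a) ^ 3 := by positivity
        linarith

theorem abs_psiTT_le (hb : StaticBound q t γ γθ γa S D) (ha : 0 < a) :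
    |psiTT q t γ γθ γa θ a| ≤ potConst q * (S * (S + 2 * D)) / ((1 + t) * √(1 + t)) := by
  have h := hb.radialBound (θ := θ) ha
  refine (hb.abs_psiTT_le_aux ha).trans ?_
  have hp := base_le_potConst hb.q_pos
  have h1 := h.mul_le_of_pow (by norm_num) (h.n_le 2 le_rfl)
  have h2 := h.mul_le_of_pow (by norm_num) (h.m_le 3 le_rfl)
  have ht := h.t_nonneg; have hc := h.c_nonneg; have hF := h.F_nonneg
  set X := decayConst q + massConst q
  have h3 : 0 ≤ X * (S * (S + 2 * D)) / ((1 + t) * √(1 + t)) := by positivity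
  calc _ ≤ 120 * (X * (S * (S + 2 * D)) / ((1 + t) * √(1 + t))) := by linarith
    _ = 120 * X * (S * (S + 2 * D)) / ((1 + t) * √(1 + t)) := by ring
    _ ≤ _ := by gcongr

/-- A variant that trades the last power of `1/ρ` for `a²`; it compensates the factor `1/a` in the
weight of `∂_θγ` when `a` is small. -/
theorem abs_psiTT_le_mul (hb : StaticBound q t γ γθ γa S D) (ha : 0 < a) :
    |psiTT q t γ γθ γa θ a| ≤ potConst q * (S * (S + 2 * D)) / ((1 + t) * √(1 + t)) * a ^ 2 := by
  have h := hb.radialBound (θ := θ) ha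
  refine (hb.abs_psiTT_le_aux ha).trans ?_
  have h1 := h.mul_le_of_pow le_rfl (h.n_le 1 (by norm_num))
  have h2 := h.mul_le_of_pow le_rfl (h.m_le 2 (by norm_num))
  have ht := h.t_nonneg; have hc := h.c_nonneg; have hF := h.F_nonneg; have hi := h.inv_le
  have hr := h.rho_pos; have hn := h.n_nonneg; have hm := h.m_nonneg; have hq := h.q_pos
  rw [pow_one] at h1
  set X := decayConst q + massConst q with hX
  set ρ := rho q t θ a
  set m := mass q t γ ρ
  set n := |massD q t γ γθ γa ρ|
  have h3 : 0 ≤ X * (S * (S + 2 * D)) / ((1 + t) * √(1 + t)) := by positivity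
  calc n * (1 / ρ) ^ 2 + 3 * (m * (1 / ρ) ^ 3)
      = (n * (1 / ρ) + 3 * (m * (1 / ρ) ^ 2)) * (1 / ρ) := by ring
    _ ≤ (120 * (X * (S * (S + 2 * D)) / ((1 + t) * √(1 + t)))) * (a ^ 2 * (1 + 1 / q)) := by
        refine mul_le_mul (by linarith) (hi.trans ?_) (by positivity) (by positivity)
        gcongr; linarith
    _ = _ := by unfold potConst; ring

/-- The part `t` of `ρ_a` meets third-order terms decaying like `(1+t)^{-3}`, so it is harmless. The
part `ρ/a` leaves a factor `1/a`, which forces the interpolation and limits the decay to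
`(1+t)^{-3/2}`. -/
theorem abs_psiTA_le (hb : StaticBound q t γ γθ γa S D) (ha : 0 < a) :
    |psiTA q t γ γθ γa θ a| ≤ potConst q * (S * (S + 2 * D)) / ((1 + t) * √(1 + t)) := by
  have h := hb.radialBound (θ := θ) ha
  have g1 := h.mul_le_of_pow le_rfl (h.t_mul_le (h.n_le 2 le_rfl))
  have g2 := h.mul_le_of_pow le_rfl (h.t_mul_le (h.m_le 3 le_rfl))
  have g3 := h.n_one_mul_le
  have g4 := h.m_two_mul_le
  have ht := h.t_nonneg; have hc := h.c_nonneg; have hF := h.F_nonneg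
  have hr := h.rho_pos; have hn := h.n_nonneg; have hm := h.m_nonneg; have hq := h.q_pos
  have h1 := abs_radialD2_le (q := q) (t := t) (γ := γ) (γθ := γθ) (γa := γa) hr
  have h2 : |rhoT q t θ a| ≤ 1 := abs_rhoT_le
  have h3 := abs_rhoTA_le (t := t) (θ := θ) hb.q_pos ha ht
  have h4 := abs_rhoA_le (t := t) (θ := θ) hb.q_pos ha ht
  unfold psiTA
  refine (abs_add_le _ _).trans ?_
  rw [abs_mul, abs_mul, abs_mul, abs_mass_div hb.q_pos ha]
  set X := decayConst q + massConst q with hX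
  set ρ := rho q t θ a
  set m := mass q t γ ρ
  set n := |massD q t γ γθ γa ρ|
  have h5 : X * (S * (S + 2 * D)) / ((1 + t) * √(1 + t))
      ≤ X * (S * (S + 2 * D)) * (1 + 1 / q) / ((1 + t) * √(1 + t)) := by
    refine div_le_div_of_nonneg_right (le_mul_of_one_le_right (by positivity) ?_) (by positivity)
    have : 0 < 1 / q := by positivity
    linarith
  have h6 : 0 ≤ X * (S * (S + 2 * D)) / ((1 + t) * √(1 + t)) := by positivity
  calc _ ≤ (n * (1 / ρ) ^ 2 + 2 * (m * (1 / ρ) ^ 3)) * 1 * (t + 4 * (ρ / a))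
        + m * (1 / ρ) ^ 2 * (2 / a + t / (2 * ρ)) := by gcongr
    _ = t * (n * (1 / ρ) ^ 2) + (5 / 2) * (t * (m * (1 / ρ) ^ 3)) + 4 * (n * (1 / ρ) * (1 / a))
        + 10 * (m * (1 / ρ) ^ 2 * (1 / a)) := by field_simp; ring
    _ ≤ 120 * (X * (S * (S + 2 * D)) * (1 + 1 / q) / ((1 + t) * √(1 + t))) := by linarith
    _ = _ := by unfold potConst; ring

/-- Here `ρ_a` enters squared. The term `t²` consumes two powers of decay, and `(ρ/a)²` leaves `m'`
and `m/ρ`, each of size `(1+t)^{-1}`; the total decay is just not integrable. -/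
theorem abs_psiAA_le (hb : StaticBound q t γ γθ γa S D) (ha : 0 < a) :
    |psiAA q t γ γθ γa θ a| ≤ potConst q * (S * (S + 2 * D)) / (1 + t) * (1 + 1 / a ^ 2) := by
  have h := hb.radialBound (θ := θ) ha
  have g1 := h.t_mul_le (h.t_mul_le (h.n_le 2 le_rfl))
  have g2 := h.t_mul_le (h.t_mul_le (h.m_le 3 le_rfl))
  have g3 := h.n_le 0 (by norm_num)
  have g4 := h.m_le 1 (by norm_num)
  have ht := h.t_nonneg; have hc := h.c_nonneg; have hF := h.F_nonneg
  have hr := h.rho_pos; have hn := h.n_nonneg; have hm := h.m_nonneg; have hq := h.q_pos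
  have h1 := abs_radialD2_le (q := q) (t := t) (γ := γ) (γθ := γθ) (γa := γa) hr
  have h3 := abs_rhoAA_le (t := t) (θ := θ) hb.q_pos ha ht
  have h4 := abs_rhoA_le (t := t) (θ := θ) hb.q_pos ha ht
  have hp := base_le_potConst hb.q_pos
  unfold psiAA
  refine (abs_add_le _ _).trans ?_
  rw [abs_mul, abs_mul, abs_mul, abs_mass_div hb.q_pos ha, mul_assoc |radialD2 _ _ _ _ _ _|]
  simp only [pow_zero, mul_one, pow_one, zero_add] at g1 g2 g3 g4
  set X := decayConst q + massConst q with hX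
  set ρ := rho q t θ a
  set m := mass q t γ ρ
  set n := |massD q t γ γθ γa ρ|
  have h6 : 0 ≤ X * (S * (S + 2 * D)) / (1 + t) := by positivity
  have h7 : (t + 4 * (ρ / a)) * (t + 4 * (ρ / a)) ≤ 2 * t ^ 2 + 32 * (ρ / a) ^ 2 := by
    nlinarith [sq_nonneg (t - 4 * (ρ / a))]
  calc _ ≤ (n * (1 / ρ) ^ 2 + 2 * (m * (1 / ρ) ^ 3)) * ((t + 4 * (ρ / a)) * (t + 4 * (ρ / a)))
        + m * (1 / ρ) ^ 2 * (22 * (t ^ 2 / ρ + ρ / a ^ 2)) := by gcongr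
    _ ≤ (n * (1 / ρ) ^ 2 + 2 * (m * (1 / ρ) ^ 3)) * (2 * t ^ 2 + 32 * (ρ / a) ^ 2)
        + m * (1 / ρ) ^ 2 * (22 * (t ^ 2 / ρ + ρ / a ^ 2)) := by gcongr
    _ = 2 * (t * (t * (n * (1 / ρ) ^ 2))) + 26 * (t * (t * (m * (1 / ρ) ^ 3)))
        + (32 * n + 86 * (m * (1 / ρ))) * (1 / a ^ 2) := by field_simp; ring
    _ ≤ 120 * (X * (S * (S + 2 * D)) / (1 + t))
        + (120 * (X * (S * (S + 2 * D)) / (1 + t))) * (1 / a ^ 2) := by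
        gcongr <;> linarith
    _ = 120 * X * (S * (S + 2 * D)) / (1 + t) * (1 + 1 / a ^ 2) := by ring
    _ ≤ _ := by gcongr

end StaticBound

end

/-! ### Shifts -/

theorem add_mem_phaseSpace {v z : ℝ × ℝ} (hv : 0 ≤ v.2) (hz : z ∈ phaseSpace) :
    z + v ∈ phaseSpace := by
  rw [mem_phaseSpace] at hz ⊢
  exact add_pos_of_pos_of_nonneg hz hv

/-- A shift that does not lower `a` maps the half plane into itself, but not onto it, hence an
inequality of measures. All later difference quotients use such shifts only. -/
theorem map_add_phaseMeasure_le {v : ℝ × ℝ} (hv : 0 ≤ v.2) :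
    phaseMeasure.map (fun z => z + v) ≤ phaseMeasure := by
  have hm : Measurable fun z : ℝ × ℝ => z + v := measurable_add_const v
  refine Measure.le_iff.2 fun s hs => ?_
  unfold phaseMeasure
  rw [Measure.map_apply hm hs, Measure.restrict_apply (hm hs), Measure.restrict_apply hs,
    ← measure_preimage_add_right volume v (s ∩ phaseSpace)]
  exact measure_mono fun z hz => ⟨hz.1, add_mem_phaseSpace hv hz.2⟩

theorem ae_comp_add {v : ℝ × ℝ} (hv : 0 ≤ v.2) {p : ℝ × ℝ → Prop} (h : ∀ᵐ z ∂phaseMeasure, p z) :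
    ∀ᵐ z ∂phaseMeasure, p (z + v) :=
  ae_of_ae_map (measurable_add_const v).aemeasurable
    ((Measure.absolutelyContinuous_of_le (map_add_phaseMeasure_le hv)).ae_le h)

theorem memLp_comp_add {v : ℝ × ℝ} (hv : 0 ≤ v.2) {f : ℝ × ℝ → ℝ} (hf : MemLp f 2 phaseMeasure) :
    MemLp (fun z => f (z + v)) 2 phaseMeasure :=
  (hf.mono_measure (map_add_phaseMeasure_le hv)).comp_of_map (measurable_add_const v).aemeasurable

theorem eLpNorm_comp_add_le {v : ℝ × ℝ} (hv : 0 ≤ v.2) {f : ℝ × ℝ → ℝ}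
    (hf : AEStronglyMeasurable f phaseMeasure) :
    eLpNorm (fun z => f (z + v)) 2 phaseMeasure ≤ eLpNorm f 2 phaseMeasure := by
  have h := eLpNorm_map_measure (p := 2) (hf.mono_measure (map_add_phaseMeasure_le hv))
    (measurable_add_const v).aemeasurable
  exact h.symm.trans_le (eLpNorm_mono_measure f (map_add_phaseMeasure_le hv))

/-- Multiplying by a bounded weight and combining with a shift is a bounded operator on `L²`, so it
commutes with the time derivative of the curve. Its specialisations are multiplication by a weight
and the weighted difference quotient. -/
theorem exists_shiftOp {v : ℝ × ℝ} (hv : 0 ≤ v.2) {w : ℝ × ℝ → ℝ} (hw : Continuous w) {M : ℝ}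
    (hM : ∀ z, |w z| ≤ M) (c₁ c₂ : ℝ) : ∃ Λ : L2 →L[ℝ] L2, ∀ (f : L2) (g : ℝ × ℝ → ℝ),
      f =ᵐ[phaseMeasure] g →
        Λ f =ᵐ[phaseMeasure] fun z => w z * (c₁ * g (z + v) + c₂ * g z) := by
  have hM0 : 0 ≤ M := (abs_nonneg _).trans (hM 0)
  have hmem : ∀ f : L2, MemLp (fun z => w z * (c₁ * f (z + v) + c₂ * f z)) 2 phaseMeasure := by
    intro f
    have hf := Lp.memLp f
    have h1 := ((memLp_comp_add hv hf).const_mul c₁).add (hf.const_mul c₂)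
    refine ⟨hw.aestronglyMeasurable.mul h1.1, ?_⟩
    refine (eLpNorm_bounded_mul_le (Filter.Eventually.of_forall hM)).trans_lt ?_
    exact ENNReal.mul_lt_top ENNReal.ofReal_lt_top h1.2
  let A : L2 →ₗ[ℝ] L2 :=
    { toFun := fun f => (hmem f).toLp _
      map_add' := fun f g => by
        rw [← MemLp.toLp_add]
        refine MemLp.toLp_congr _ _ ?_
        filter_upwards [Lp.coeFn_add f g, ae_comp_add hv (Lp.coeFn_add f g)] with z h1 h2
        simp only [Pi.add_apply] at h1 h2 ⊢
        rw [h1, h2]; ring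
      map_smul' := fun r f => by
        rw [RingHom.id_apply, ← MemLp.toLp_const_smul]
        refine MemLp.toLp_congr _ _ ?_
        filter_upwards [Lp.coeFn_smul r f, ae_comp_add hv (Lp.coeFn_smul r f)] with z h1 h2
        simp only [Pi.smul_apply, smul_eq_mul] at h1 h2 ⊢
        rw [h1, h2]; ring }
  refine ⟨A.mkContinuous (M * (|c₁| + |c₂|)) fun f => ?_, fun f g hfg => ?_⟩
  · change ‖(hmem f).toLp _‖ ≤ _
    have hf := Lp.memLp f
    rw [Lp.norm_toLp]
    refine ENNReal.toReal_le_of_le_ofReal (by positivity) ?_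
    have e1 : eLpNorm f 2 phaseMeasure = ENNReal.ofReal ‖f‖ := by
      rw [Lp.norm_def, ENNReal.ofReal_toReal hf.2.ne]
    calc _ ≤ ENNReal.ofReal M * eLpNorm (fun z => c₁ * f (z + v) + c₂ * f z) 2 phaseMeasure :=
          eLpNorm_bounded_mul_le (Filter.Eventually.of_forall hM)
      _ ≤ ENNReal.ofReal M * (eLpNorm (fun z => c₁ * f (z + v)) 2 phaseMeasure
            + eLpNorm (fun z => c₂ * f z) 2 phaseMeasure) := by
          gcongr
          exact eLpNorm_add_le ((memLp_comp_add hv hf).const_mul c₁).1 (hf.const_mul c₂).1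
            (by norm_num)
      _ ≤ ENNReal.ofReal M * (ENNReal.ofReal |c₁| * eLpNorm f 2 phaseMeasure
            + ENNReal.ofReal |c₂| * eLpNorm f 2 phaseMeasure) := by
          gcongr
          · refine (eLpNorm_bounded_mul_le (v := fun _ => c₁) (f := fun z => f (z + v))
              (Filter.Eventually.of_forall fun _ => le_rfl)).trans ?_
            gcongr
            exact eLpNorm_comp_add_le hv hf.1
          · exact eLpNorm_bounded_mul_le (v := fun _ => c₂)
              (Filter.Eventually.of_forall fun _ => le_rfl)
      _ = _ := by
          rw [e1, ← ENNReal.ofReal_mul (abs_nonneg _), ← ENNReal.ofReal_mul (abs_nonneg _),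
            ← ENNReal.ofReal_add (by positivity) (by positivity), ← ENNReal.ofReal_mul hM0]
          ring_nf
  · change ((hmem f).toLp _ : ℝ × ℝ → ℝ) =ᵐ[phaseMeasure] _
    refine (MemLp.coeFn_toLp (hmem f)).trans ?_
    filter_upwards [hfg, ae_comp_add hv hfg] with z h1 h2
    rw [h1, h2]

theorem integrable_mul_of_locallyIntegrableOn {f φ : ℝ × ℝ → ℝ}
    (hf : LocallyIntegrableOn f phaseSpace volume) (hφ : Continuous φ) (hc : HasCompactSupport φ)
    (hs : tsupport φ ⊆ phaseSpace) : Integrable (fun z => f z * φ z) volume := by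
  have h1 : IntegrableOn (fun z => f z * φ z) (tsupport φ) volume :=
    (hf.integrableOn_compact_subset hs hc).mul_continuousOn hφ.continuousOn hc
  refine (integrableOn_iff_integrable_of_support_subset ?_).1 h1
  exact fun z hz => subset_tsupport φ (right_ne_zero_of_mul hz)

theorem tsupport_fderiv_apply_subset' {φ : ℝ × ℝ → ℝ} {e : ℝ × ℝ} :
    tsupport (fun z => fderiv ℝ φ z e) ⊆ tsupport φ :=
  closure_minimal (tsupport_fderiv_apply_subset φ e) (isClosed_tsupport _)

theorem integral_phase_eq_volume {f φ : ℝ × ℝ → ℝ} (hs : tsupport φ ⊆ phaseSpace) :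
    ∫ z, f z * φ z ∂phaseMeasure = ∫ z, f z * φ z :=
  integral_phaseMeasure_eq fun _ hz => hs (subset_tsupport φ (right_ne_zero_of_mul hz))

theorem LocallyIntegrableOn.comp_add {f : ℝ × ℝ → ℝ} {v : ℝ × ℝ} (hv : 0 ≤ v.2)
    (hf : LocallyIntegrableOn f phaseSpace volume) :
    LocallyIntegrableOn (fun z => f (z + v)) phaseSpace volume := by
  rw [locallyIntegrableOn_iff isOpen_phaseSpace.isLocallyClosed] at hf ⊢
  intro C hCs hC
  have h1 := hf ((fun z => z + v) '' C) (by rintro _ ⟨z, hz, rfl⟩; exact add_mem_phaseSpace hv (hCs hz))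
    (hC.image (continuous_add_const v))
  have h2 := ((measurePreserving_add_right volume v).integrableOn_comp_preimage
    (measurableEmbedding_addRight v)).2 h1
  rwa [preimage_image_eq _ (add_left_injective v)] at h2

theorem LocL2.comp_add {f : ℝ × ℝ → ℝ} {v : ℝ × ℝ} (hv : 0 ≤ v.2) (hf : LocL2 f) :
    LocL2 (fun z => f (z + v)) := by
  intro C hC hCs
  have h1 := hf ((fun z => z + v) '' C) (hC.image (continuous_add_const v))
    (by rintro _ ⟨z, hz, rfl⟩; exact add_mem_phaseSpace hv (hCs hz))
  have h2 := (measurePreserving_add_right volume v).restrict_preimage_emb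
    (measurableEmbedding_addRight v) ((fun z => z + v) '' C)
  rw [preimage_image_eq _ (add_left_injective v)] at h2
  exact h1.comp_measurePreserving h2

/-- The shift is transferred to the test function, whose support moves towards larger `a` and so
stays in the phase space. -/
theorem HasWeakPartial.comp_add {d : ℝ × ℝ} {f g : ℝ × ℝ → ℝ} (h : HasWeakPartial d f g)
    {v : ℝ × ℝ} (hv : 0 ≤ v.2) :
    HasWeakPartial d (fun z => f (z + v)) (fun z => g (z + v)) := by
  refine ⟨LocallyIntegrableOn.comp_add hv h.1, LocallyIntegrableOn.comp_add hv h.2.1,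
    fun φ hφ hc hs => ?_⟩
  have hsub : tsupport (fun z => φ (z - v)) ⊆ phaseSpace := by
    have h1 : tsupport (fun z => φ (z - v)) ⊆ (fun z => z - v) ⁻¹' tsupport φ :=
      closure_minimal (fun z hz => subset_tsupport φ hz)
        ((isClosed_tsupport φ).preimage (continuous_sub_right v))
    intro z hz
    have := add_mem_phaseSpace hv (hs (h1 hz))
    rwa [sub_add_cancel] at this
  have hcc : HasCompactSupport fun z => φ (z - v) :=
    hc.comp_homeomorph (Homeomorph.subRight v)
  have key := h.2.2 (fun z => φ (z - v)) (hφ.comp (contDiff_id.sub contDiff_const)) hcc hsub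
  have hd : ∀ z, fderiv ℝ (fun z => φ (z - v)) z d = fderiv ℝ φ (z - v) d := fun z => by
    rw [fderiv_comp_sub (f := φ)]
  rw [integral_phase_eq_volume (tsupport_fderiv_apply_subset'.trans hsub),
    integral_phase_eq_volume hsub] at key
  rw [integral_phase_eq_volume (tsupport_fderiv_apply_subset'.trans hs),
    integral_phase_eq_volume hs]
  rw [← integral_sub_right_eq_self (fun z => f (z + v) * fderiv ℝ φ z d) v,
    ← integral_sub_right_eq_self (fun z => g (z + v) * φ z) v]
  simpa only [sub_add_cancel, hd] using key

theorem HasWeakPartial.const_mul_add {d : ℝ × ℝ} {f₁ g₁ f₂ g₂ : ℝ × ℝ → ℝ}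
    (h₁ : HasWeakPartial d f₁ g₁) (h₂ : HasWeakPartial d f₂ g₂) (c₁ c₂ : ℝ) :
    HasWeakPartial d (fun z => c₁ * f₁ z + c₂ * f₂ z) (fun z => c₁ * g₁ z + c₂ * g₂ z) := by
  refine ⟨(h₁.1.smul c₁).add (h₂.1.smul c₂), (h₁.2.1.smul c₁).add (h₂.2.1.smul c₂),
    fun φ hφ hc hs => ?_⟩
  have hφd : Continuous fun z => fderiv ℝ φ z d :=
    (hφ.continuous_fderiv (by norm_num)).clm_apply continuous_const
  have hs' : tsupport (fun z => fderiv ℝ φ z d) ⊆ phaseSpace :=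
    tsupport_fderiv_apply_subset'.trans hs
  have hcd : HasCompactSupport fun z => fderiv ℝ φ z d := hc.fderiv_apply ℝ d
  have i : ∀ {f φ : ℝ × ℝ → ℝ}, LocallyIntegrableOn f phaseSpace volume → Continuous φ →
      HasCompactSupport φ → tsupport φ ⊆ phaseSpace →
      Integrable (fun z => f z * φ z) phaseMeasure := fun a b c d =>
    (integrable_mul_of_locallyIntegrableOn a b c d).mono_measure Measure.restrict_le_self
  simp only [add_mul, mul_assoc]
  rw [integral_add ((i h₁.1 hφd hcd hs').const_mul _) ((i h₂.1 hφd hcd hs').const_mul _),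
    integral_add ((i h₁.2.1 hφ.continuous hc hs).const_mul _)
      ((i h₂.2.1 hφ.continuous hc hs).const_mul _), integral_const_mul, integral_const_mul,
    integral_const_mul, integral_const_mul, h₁.2.2 φ hφ hc hs, h₂.2.2 φ hφ hc hs]
  ring

theorem dq_eq (e : ℝ × ℝ) (h : ℝ) (f : ℝ × ℝ → ℝ) :
    dq e h f = fun z => 1 / h * f (z + h • e) + (-1 / h) * f z := by
  ext z; unfold dq; ring

theorem smul_snd_nonneg {e : ℝ × ℝ} (he : 0 ≤ e.2) {h : ℝ} (hh : 0 ≤ h) : 0 ≤ (h • e).2 :=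
  mul_nonneg hh he

theorem HasWeakPartial.dq {d e : ℝ × ℝ} {f g : ℝ × ℝ → ℝ} (hf : HasWeakPartial d f g)
    (he : 0 ≤ e.2) {h : ℝ} (hh : 0 ≤ h) :
    HasWeakPartial d (dq e h f) (dq e h g) := by
  rw [dq_eq, dq_eq]
  exact (hf.comp_add (smul_snd_nonneg he hh)).const_mul_add hf _ _

theorem LocL2.dq {e : ℝ × ℝ} {f : ℝ × ℝ → ℝ} (hf : LocL2 f) (he : 0 ≤ e.2) {h : ℝ} (hh : 0 ≤ h) :
    LocL2 (dq e h f) := by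
  rw [dq_eq]
  exact fun C hC hCs => (((hf.comp_add (smul_snd_nonneg he hh)) C hC hCs).const_mul _).add
    ((hf C hC hCs).const_mul _)

/-- The difference quotient is no farther from the derivative than the worst translate of the
derivative by a step up to `h`; continuity of translations in `L²` makes this small. -/
theorem tendsto_eLpNorm_mul_dq_sub {e : ℝ × ℝ} (he : 0 ≤ e.2) {f g u : ℝ × ℝ → ℝ}
    (hw : HasWeakPartial e f g) (hf : LocL2 f) (hg : LocL2 g) (hu : Continuous u)
    (hc : HasCompactSupport u) (hs : tsupport u ⊆ phaseSpace) :
    Filter.Tendsto (fun n : ℕ => eLpNorm (fun z => u z * (dq e (1 / (n + 1 : ℝ)) f z - g z)) 2 volume)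
      Filter.atTop (nhds 0) := by
  obtain ⟨M, hM⟩ := hu.bounded_above_of_compact_support hc
  obtain ⟨δ, hδ, hKs⟩ := hc.exists_cthickening_subset_open isOpen_phaseSpace hs
  have hK : IsCompact (Metric.cthickening δ (tsupport u)) := hc.cthickening
  set C := Metric.cthickening δ (tsupport u)
  have hF : MemLp (C.indicator g) 2 volume :=
    (memLp_indicator_iff_restrict hK.measurableSet).2 (hg C hK hKs)
  rw [ENNReal.tendsto_nhds_zero]
  intro ε hε
  have hM0 : 0 ≤ M := (norm_nonneg _).trans (hM 0)
  obtain ⟨ε', hε', hle⟩ : ∃ ε' : ℝ≥0∞, ε' ≠ 0 ∧ ENNReal.ofReal M * ε' ≤ ε := by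
    refine ⟨ε / ENNReal.ofReal (M + 1), ENNReal.div_ne_zero.2 ⟨hε.ne', ENNReal.ofReal_ne_top⟩, ?_⟩
    calc _ ≤ ENNReal.ofReal (M + 1) * (ε / ENNReal.ofReal (M + 1)) := by
          gcongr; linarith
      _ ≤ ε := ENNReal.mul_div_le
  obtain ⟨r, hr, hrle⟩ := exists_eLpNorm_translate_le hF hε'
  have hev : ∀ᶠ n : ℕ in Filter.atTop, 1 / (n + 1 : ℝ) * ‖e‖ < min r δ := by
    have h0 := (tendsto_one_div_add_atTop_nhds_zero_nat (𝕜 := ℝ)).mul_const ‖e‖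
    rw [zero_mul] at h0
    exact h0.eventually_lt_const (lt_min hr hδ)
  filter_upwards [hev] with n hn
  refine eLpNorm_mul_dq_sub_le he hw hf hg hu hc hs hg Nat.one_div_pos_of_nat fun s hs' => ?_
  have hse : ‖s • e‖ < min r δ := by
    rw [norm_smul, Real.norm_of_nonneg hs'.1]
    exact (mul_le_mul_of_nonneg_right hs'.2 (norm_nonneg _)).trans_lt hn
  have hsm := hrle (-(s • e)) (by rw [norm_neg]; exact hse.trans_le (min_le_left _ _))
  refine le_trans ?_ ((mul_le_mul_right hsm (ENNReal.ofReal M)).trans hle)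
  refine (eLpNorm_mono fun z => ?_).trans
    (eLpNorm_bounded_mul_le (v := u) (f := fun z => C.indicator g (z - -(s • e)) - C.indicator g z)
      (Filter.Eventually.of_forall hM))
  by_cases hz : u z = 0
  · simp [hz]
  have hz1 : z ∈ tsupport u := subset_tsupport u hz
  have h1 : z ∈ C := Metric.self_subset_cthickening _ hz1
  have h2 : z + s • e ∈ C := by
    refine Metric.mem_cthickening_of_dist_le _ z _ _ hz1 ?_
    rw [dist_eq_norm, add_sub_cancel_left]
    exact (hse.trans_le (min_le_right _ _)).le
  rw [sub_neg_eq_add, indicator_of_mem h1, indicator_of_mem h2]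

/-! ### A differential inequality in a Hilbert space -/

/-- Formally `‖Γ‖' ≤ B' + η`. The norm is not differentiable at zero, so the comparison is made for
`√(‖Γ‖² + κ²)` and `κ` is then sent to zero. -/
theorem norm_le_of_inner_le {E : Type*} [NormedAddCommGroup E] [InnerProductSpace ℝ E] {T η : ℝ}
    {Γ Γ' : ℝ → E} {B B' : ℝ → ℝ} (hη : 0 ≤ η)
    (hΓ : ∀ t ∈ Icc 0 T, HasDerivWithinAt Γ (Γ' t) (Icc 0 T) t)
    (hB : ∀ t ∈ Icc 0 T, HasDerivAt B (B' t) t) (hB0 : ∀ t ∈ Icc 0 T, 0 ≤ B' t)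
    (h : ∀ t ∈ Icc 0 T, inner ℝ (Γ t) (Γ' t) ≤ ‖Γ t‖ * (B' t + η)) :
    ∀ t ∈ Icc 0 T, ‖Γ t‖ ≤ ‖Γ 0‖ + (B t - B 0) + η * t := by
  intro t ht
  refine le_of_forall_pos_le_add fun κ hκ => ?_
  have hpos : ∀ t, 0 < ‖Γ t‖ ^ 2 + κ ^ 2 := fun t => by positivity
  have hle : ∀ t, ‖Γ t‖ ≤ √(‖Γ t‖ ^ 2 + κ ^ 2) := fun t =>
    Real.le_sqrt_of_sq_le (by nlinarith)
  have hd : ∀ t ∈ Icc 0 T, HasDerivWithinAt (fun t => √(‖Γ t‖ ^ 2 + κ ^ 2))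
      ((2 * inner ℝ (Γ t) (Γ' t)) / (2 * √(‖Γ t‖ ^ 2 + κ ^ 2))) (Icc 0 T) t := fun t ht =>
    (((hΓ t ht).norm_sq).add_const (κ ^ 2)).sqrt (hpos t).ne'
  have hBd : ∀ t ∈ Icc 0 T, HasDerivWithinAt (fun t => √(‖Γ 0‖ ^ 2 + κ ^ 2) + (B t - B 0) + η * t)
      (B' t + η) (Icc 0 T) t := fun t ht => by
    have := ((((hB t ht).sub_const (B 0)).const_add (√(‖Γ 0‖ ^ 2 + κ ^ 2))).add
      ((hasDerivAt_id t).const_mul η)).hasDerivWithinAt (s := Icc 0 T)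
    rwa [mul_one] at this
  have key := image_le_of_deriv_right_le_deriv_boundary (f := fun t => √(‖Γ t‖ ^ 2 + κ ^ 2))
    (f' := fun t => (2 * inner ℝ (Γ t) (Γ' t)) / (2 * √(‖Γ t‖ ^ 2 + κ ^ 2)))
    (B := fun t => √(‖Γ 0‖ ^ 2 + κ ^ 2) + (B t - B 0) + η * t) (B' := fun t => B' t + η)
    (a := 0) (b := T) (fun t ht => (hd t ht).continuousWithinAt)
    (fun t ht => (hd t (Ico_subset_Icc_self ht)).mono_of_mem_nhdsWithin
      (Icc_mem_nhdsGE_of_mem ht))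
    (by simp) (fun t ht => (hBd t ht).continuousWithinAt)
    (fun t ht => (hBd t (Ico_subset_Icc_self ht)).mono_of_mem_nhdsWithin
      (Icc_mem_nhdsGE_of_mem ht))
    (fun t ht => by
      have ht' := Ico_subset_Icc_self ht
      have hs := Real.sqrt_pos.2 (hpos t)
      rw [mul_div_mul_left _ _ two_ne_zero, div_le_iff₀ hs, mul_comm]
      refine (h t ht').trans ?_
      have := hB0 t ht'
      gcongr
      exact hle t)
    ht
  have h0 : √(‖Γ 0‖ ^ 2 + κ ^ 2) ≤ ‖Γ 0‖ + κ := by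
    rw [Real.sqrt_le_left (by positivity)]
    nlinarith [norm_nonneg (Γ 0)]
  have := hle t
  linarith

/-! ### Energy estimates at a fixed time -/

theorem eLpNorm_le_of_abs_le {X : Type*} [MeasurableSpace X] {ν : Measure X} {F f₁ f₂ f₃ : X → ℝ}
    (h₁ : AEStronglyMeasurable f₁ ν) (h₂ : AEStronglyMeasurable f₂ ν)
    (h₃ : AEStronglyMeasurable f₃ ν) {c₁ c₂ c₃ v₁ v₂ v₃ : ℝ} (hc₁ : 0 ≤ c₁) (hc₂ : 0 ≤ c₂)
    (hc₃ : 0 ≤ c₃) (hv₁ : 0 ≤ v₁) (hv₂ : 0 ≤ v₂) (hv₃ : 0 ≤ v₃)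
    (n₁ : eLpNorm f₁ 2 ν ≤ ENNReal.ofReal v₁) (n₂ : eLpNorm f₂ 2 ν ≤ ENNReal.ofReal v₂)
    (n₃ : eLpNorm f₃ 2 ν ≤ ENNReal.ofReal v₃)
    (h : ∀ᵐ x ∂ν, |F x| ≤ c₁ * |f₁ x| + c₂ * |f₂ x| + c₃ * |f₃ x|) :
    eLpNorm F 2 ν ≤ ENNReal.ofReal (c₁ * v₁ + c₂ * v₂ + c₃ * v₃) := by
  have e : ∀ {f : X → ℝ} {c v : ℝ}, 0 ≤ c → eLpNorm f 2 ν ≤ ENNReal.ofReal v →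
      eLpNorm (fun x => c * |f x|) 2 ν ≤ ENNReal.ofReal (c * v) := by
    intro f c v hc hn
    refine (eLpNorm_bounded_mul_le (v := fun _ => c) (f := fun x => |f x|) (M := c)
      (Filter.Eventually.of_forall fun _ => (abs_of_nonneg hc).le)).trans ?_
    rw [ENNReal.ofReal_mul hc]
    gcongr
    exact (eLpNorm_norm f).trans_le hn
  have m : ∀ {f : X → ℝ} {c : ℝ}, AEStronglyMeasurable f ν →
      AEStronglyMeasurable (fun x => c * |f x|) ν := fun hf => hf.norm.const_mul _
  have h1 : eLpNorm F 2 ν ≤ eLpNorm (fun x => c₁ * |f₁ x| + c₂ * |f₂ x| + c₃ * |f₃ x|) 2 ν := by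
    refine eLpNorm_mono_ae ?_
    filter_upwards [h] with x hx
    exact hx.trans (le_abs_self _)
  refine h1.trans ?_
  refine (eLpNorm_add_le ((m h₁).add (m h₂)) (m h₃) (by norm_num)).trans ?_
  rw [ENNReal.ofReal_add (by positivity) (by positivity), ENNReal.ofReal_add (by positivity)
    (by positivity)]
  exact add_le_add ((eLpNorm_add_le (m h₁) (m h₂) (by norm_num)).trans
    (add_le_add (e hc₁ n₁) (e hc₂ n₂))) (e hc₃ n₃)

theorem abs_integral_le_of_integral_abs_le {X : Type*} [MeasurableSpace X] {ν : Measure X}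
    {F : X → ℝ} {c : ℝ} (h : ∫ x, |F x| ∂ν ≤ c) : |∫ x, F x ∂ν| ≤ c :=
  (norm_integral_le_integral_norm F).trans h

theorem LocL2.mul {f g : ℝ × ℝ → ℝ} (hf : LocL2 f) (hg : LocL2 g) :
    LocallyIntegrableOn (fun z => f z * g z) phaseSpace volume := by
  rw [locallyIntegrableOn_iff isOpen_phaseSpace.isLocallyClosed]
  exact fun C hCs hC => (hf C hC hCs).integrable_mul (hg C hC hCs)

theorem integrable_mul_mul {f g u : ℝ × ℝ → ℝ} (hf : LocL2 f) (hg : LocL2 g) (hu : Continuous u)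
    (hc : HasCompactSupport u) (hs : tsupport u ⊆ phaseSpace) :
    Integrable (fun z => u z * (f z * g z)) phaseMeasure := by
  refine ((integrable_mul_of_locallyIntegrableOn (hf.mul hg) hu hc hs).mono_measure
    Measure.restrict_le_self).congr ?_
  exact Filter.Eventually.of_forall fun z => mul_comm _ _

theorem LocL2.aestronglyMeasurable {f : ℝ × ℝ → ℝ} (hf : LocL2 f) :
    AEStronglyMeasurable f phaseMeasure := by
  have h := hf.mul (g := fun _ => 1) fun C hC _ => by
    have : IsFiniteMeasure (volume.restrict C) := ⟨by
      rw [Measure.restrict_apply_univ]; exact hC.measure_lt_top⟩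
    exact memLp_const 1
  have h' : AEStronglyMeasurable (fun z => f z * 1) phaseMeasure := h.aestronglyMeasurable
  exact h'.congr (Filter.Eventually.of_forall fun z => mul_one _)

/-! ### Transport, commutators with weights, and forcing -/

section
variable {q t S D : ℝ} {γ γθ γa : ℝ × ℝ → ℝ}

namespace StaticBound

/-- The field `(Ψ_a, -Ψ_θ)` is divergence free because both mixed derivatives equal `psiTA`.
Integrating by parts against `w²` therefore leaves only derivatives of the weight. -/
theorem transport_integral (hb : StaticBound q t γ γθ γa S D) {f fθ fa : ℝ × ℝ → ℝ}
    (wθ : HasWeakPartial (1, 0) f fθ) (wa : HasWeakPartial (0, 1) f fa) (lf : LocL2 f)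
    (lθ : LocL2 fθ) (la : LocL2 fa) {w : ℝ × ℝ → ℝ} (hw : ContDiff ℝ 1 w)
    (hc : HasCompactSupport w) (hs : tsupport w ⊆ phaseSpace) :
    Integrable (fun z => (w z * f z) * (w z * (psiA q t γ z.1 z.2 * fθ z
        - psiT q t γ z.1 z.2 * fa z))) phaseMeasure ∧
    ∫ z, (w z * f z) * (w z * (psiA q t γ z.1 z.2 * fθ z - psiT q t γ z.1 z.2 * fa z))
      ∂phaseMeasure = -∫ z, (w z * f z) * (f z * (psiA q t γ z.1 z.2 * fderiv ℝ w z (1, 0)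
        - psiT q t γ z.1 z.2 * fderiv ℝ w z (0, 1))) ∂phaseMeasure := by
  have build : ∀ Y : ℝ × ℝ → ℝ, ContDiffOn ℝ 1 Y phaseSpace →
      tsupport (fun z => w z * (w z * Y z)) ⊆ phaseSpace ∧
      HasCompactSupport (fun z => w z * (w z * Y z)) ∧
      ContDiff ℝ 1 (fun z => w z * (w z * Y z)) := by
    intro Y hY
    have h1 : tsupport (fun z => w z * (w z * Y z)) ⊆ phaseSpace :=
      (tsupport_mul_subset_left (f := w)).trans hs
    exact ⟨h1, hc.mul_right, contDiff_of_contDiffOn_mul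
      (hw.contDiffOn.mul (hw.contDiffOn.mul hY)) h1⟩
  obtain ⟨s1, c1, d1⟩ := build _ hb.contDiffOn_psiA
  obtain ⟨s2, c2, d2⟩ := build _ hb.contDiffOn_psiT
  set u1 := fun z : ℝ × ℝ => w z * (w z * psiA q t γ z.1 z.2) with hu1
  set u2 := fun z : ℝ × ℝ => w z * (w z * psiT q t γ z.1 z.2) with hu2
  have i1 := integral_fderiv_mul_sq wθ lf lθ d1 c1 s1
  have i2 := integral_fderiv_mul_sq wa lf la d2 c2 s2
  have j1 := integrable_mul_mul lf lθ d1.continuous c1 s1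
  have j2 := integrable_mul_mul lf la d2.continuous c2 s2
  have k : ∀ {u : ℝ × ℝ → ℝ}, ContDiff ℝ 1 u → HasCompactSupport u → tsupport u ⊆ phaseSpace →
      ∀ e, Integrable (fun z => fderiv ℝ u z e * f z ^ 2) phaseMeasure := by
    intro u hu huc hus e
    have := integrable_mul_mul lf lf ((hu.continuous_fderiv (by norm_num)).clm_apply
      (continuous_const (y := e))) (huc.fderiv_apply ℝ e) (tsupport_fderiv_apply_subset'.trans hus)
    simpa only [sq] using this
  have k1 := k d1 c1 s1 (1, 0)
  have k2 := k d2 c2 s2 (0, 1)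
  have e0 : (fun z => (w z * f z) * (w z * (psiA q t γ z.1 z.2 * fθ z
        - psiT q t γ z.1 z.2 * fa z))) = fun z => u1 z * (f z * fθ z) - u2 z * (f z * fa z) := by
    ext z; simp only [hu1, hu2]; ring
  rw [e0]
  refine ⟨j1.sub j2, ?_⟩
  rw [integral_sub j1 j2]
  have h1 : ∫ z, (w z * f z) * (f z * (psiA q t γ z.1 z.2 * fderiv ℝ w z (1, 0)
        - psiT q t γ z.1 z.2 * fderiv ℝ w z (0, 1))) ∂phaseMeasure
      = ∫ z, (1 / 2 * (fderiv ℝ u1 z (1, 0) * f z ^ 2)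
        - 1 / 2 * (fderiv ℝ u2 z (0, 1) * f z ^ 2)) ∂phaseMeasure := by
    refine integral_congr_ae ?_
    filter_upwards [ae_mem_phaseSpace] with z hz
    have ha := mem_phaseSpace.1 hz
    have hwd := hw.differentiable (by norm_num) z
    have e1 := hasDerivAt_unique_fderiv_theta (z := z) d1
      ((hasDerivAt_of_contDiff_theta hwd).mul ((hasDerivAt_of_contDiff_theta hwd).mul
        (hb.hasDerivAt_psiA_theta (θ := z.1) ha)))
    have e2 := hasDerivAt_unique_fderiv_action (z := z) d2
      ((hasDerivAt_of_contDiff_action hwd).mul ((hasDerivAt_of_contDiff_action hwd).mul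
        (hb.hasDerivAt_psiT_action (θ := z.1) ha)))
    simp only at e1 e2
    rw [e1, e2]
    ring
  rw [h1, integral_sub (k1.const_mul _) (k2.const_mul _), integral_const_mul, integral_const_mul,
    i1, i2]
  ring

theorem abs_inner_le (hb : StaticBound q t γ γθ γa S D) {f fθ fa F : ℝ × ℝ → ℝ}
    (wθ : HasWeakPartial (1, 0) f fθ) (wa : HasWeakPartial (0, 1) f fa) (lf : LocL2 f)
    (lθ : LocL2 fθ) (la : LocL2 fa) {w : ℝ × ℝ → ℝ} (hw : ContDiff ℝ 1 w)
    (hc : HasCompactSupport w) (hs : tsupport w ⊆ phaseSpace)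
    (hF : AEStronglyMeasurable F phaseMeasure) {N A X : ℝ} (hN0 : 0 ≤ N) (hA0 : 0 ≤ A)
    (hX0 : 0 ≤ X) (hN : eLpNorm (fun z => w z * f z) 2 phaseMeasure ≤ ENNReal.ofReal N)
    (hA : eLpNorm (fun z => f z * (psiA q t γ z.1 z.2 * fderiv ℝ w z (1, 0)
        - psiT q t γ z.1 z.2 * fderiv ℝ w z (0, 1))) 2 phaseMeasure ≤ ENNReal.ofReal A)
    (hX : eLpNorm (fun z => w z * F z) 2 phaseMeasure ≤ ENNReal.ofReal X) :
    |∫ z, (w z * f z) * (w z * (psiA q t γ z.1 z.2 * fθ z - psiT q t γ z.1 z.2 * fa z + F z))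
      ∂phaseMeasure| ≤ N * (A + X) := by
  obtain ⟨i0, e0⟩ := hb.transport_integral wθ wa lf lθ la hw hc hs
  have mw : AEStronglyMeasurable w phaseMeasure := hw.continuous.aestronglyMeasurable
  have mf := lf.aestronglyMeasurable
  have m1 := aestronglyMeasurable_of_contDiffOn hb.contDiffOn_psiA
  have m2 := aestronglyMeasurable_of_contDiffOn hb.contDiffOn_psiT
  have m5 : ∀ e, AEStronglyMeasurable (fun z => fderiv ℝ w z e) phaseMeasure := fun e =>
      ((hw.continuous_fderiv (by norm_num)).clm_apply continuous_const).aestronglyMeasurable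
  have m3 := mf.mul ((m1.mul (m5 (1, 0))).sub (m2.mul (m5 (0, 1))))
  have h1 := integrable_of_le_mul (c := 1) ((mw.mul mf).mul m3) (mw.mul mf) m3 hN0 hA0 zero_le_one
    hN hA (Filter.Eventually.of_forall fun z => by
      rw [one_mul, Pi.mul_apply, abs_mul])
  have h2 := integrable_of_le_mul (c := 1) ((mw.mul mf).mul (mw.mul hF)) (mw.mul mf) (mw.mul hF) hN0
    hX0 zero_le_one hN hX (Filter.Eventually.of_forall fun z => by
      rw [one_mul, Pi.mul_apply, abs_mul])
  have e1 : ∀ z, (w z * f z) * (w z * (psiA q t γ z.1 z.2 * fθ z - psiT q t γ z.1 z.2 * fa z + F z))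
      = (w z * f z) * (w z * (psiA q t γ z.1 z.2 * fθ z - psiT q t γ z.1 z.2 * fa z))
        + (w z * f z) * (w z * F z) := fun z => by ring
  simp_rw [e1]
  have e2 := integral_add i0 h2.1
  simp only [Pi.mul_apply] at e2
  rw [e2, e0]
  refine (abs_add_le _ _).trans ?_
  rw [abs_neg, mul_add]
  rw [one_mul] at h1 h2
  exact add_le_add (abs_integral_le_of_integral_abs_le h1.2)
    (abs_integral_le_of_integral_abs_le h2.2)

end StaticBound

/-- A weight `W` whose logarithmic action derivative is bounded, with `V = (1 + 1/a) ∂_θ W`. -/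
structure IsWeight (W V : ℝ × ℝ → ℝ) (c : ℝ) : Prop where
  contDiffOn : ContDiffOn ℝ 1 W phaseSpace
  contDiffOn_theta : ContDiffOn ℝ 1 V phaseSpace
  const_nonneg : 0 ≤ c
  action_le : ∀ z ∈ phaseSpace, |fderiv ℝ W z (0, 1)| * z.2 ≤ c * |W z|
  theta_le : ∀ z ∈ phaseSpace, |fderiv ℝ W z (1, 0)| * (1 + 1 / z.2) ≤ |V z|

/-- A smooth compactly supported cutoff with small logarithmic derivatives. -/
structure IsCutoff (ζ : ℝ × ℝ → ℝ) (κ : ℝ) : Prop where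
  contDiff : ContDiff ℝ 1 ζ
  compact : HasCompactSupport ζ
  support : tsupport ζ ⊆ phaseSpace
  nonneg : ∀ z, 0 ≤ ζ z
  le_one : ∀ z, ζ z ≤ 1
  const_nonneg : 0 ≤ κ
  theta_le : ∀ z ∈ phaseSpace, |fderiv ℝ ζ z (1, 0)| * (1 + 1 / z.2) ≤ κ
  action_le : ∀ z ∈ phaseSpace, |fderiv ℝ ζ z (0, 1)| * z.2 ≤ κ

namespace IsCutoff
variable {ζ W V : ℝ × ℝ → ℝ} {κ c : ℝ}

theorem tsupport_mul (hζ : IsCutoff ζ κ) (W : ℝ × ℝ → ℝ) :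
    tsupport (fun z => ζ z * W z) ⊆ phaseSpace :=
  (tsupport_mul_subset_left (f := ζ)).trans hζ.support

theorem contDiff_mul (hζ : IsCutoff ζ κ) (hW : ContDiffOn ℝ 1 W phaseSpace) :
    ContDiff ℝ 1 (fun z => ζ z * W z) :=
  contDiff_of_contDiffOn_mul (hζ.contDiff.contDiffOn.mul hW) (hζ.tsupport_mul W)

theorem abs_le_one (hζ : IsCutoff ζ κ) (z : ℝ × ℝ) : |ζ z| ≤ 1 :=
  abs_le.2 ⟨by linarith [hζ.nonneg z], hζ.le_one z⟩

theorem fderiv_mul (hζ : IsCutoff ζ κ) (hW : ContDiffOn ℝ 1 W phaseSpace) {z : ℝ × ℝ}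
    (hz : z ∈ phaseSpace) (e : ℝ × ℝ) : fderiv ℝ (fun z => ζ z * (ζ z * W z)) z e
      = 2 * (ζ z * W z * fderiv ℝ ζ z e) + ζ z * ζ z * fderiv ℝ W z e := by
  have h1 := (hζ.contDiff.differentiable (by norm_num) z).hasFDerivAt
  have h2 : HasFDerivAt W (fderiv ℝ W z) z :=
    ((hW.contDiffAt (isOpen_phaseSpace.mem_nhds hz)).differentiableAt (by norm_num)).hasFDerivAt
  have h3 : HasFDerivAt (fun z => ζ z * (ζ z * W z)) _ z := h1.mul (h1.mul h2)
  rw [h3.fderiv]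
  simp only [smul_eq_mul, add_apply, smul_apply]
  ring

end IsCutoff

theorem inv_mul_sqrt_le {τ : ℝ} (hτ : 1 ≤ τ) : 1 / (τ * √τ) ≤ 1 / τ := by
  have h1 : 1 ≤ √τ := Real.one_le_sqrt.2 hτ
  exact one_div_le_one_div_of_le (by linarith) (le_mul_of_one_le_right (by linarith) h1)

/-- The `θ`-derivative of the weight is paired with `Ψ_a ≲ (1+1/a)/(1+t)` and the `a`-derivative
with `Ψ_θ ≲ a/(1+t)^{3/2}`. The cutoff enters squared, so that after one factor is differentiated a
compactly supported weight `ζW` still multiplies `f`. -/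
theorem StaticBound.eLpNorm_transport_le (hb : StaticBound q t γ γθ γa S D) {f ζ W V : ℝ × ℝ → ℝ}
    {κ c : ℝ} (lf : LocL2 f) (hζ : IsCutoff ζ κ) (hW : IsWeight W V c) {x y v : ℝ} (hx0 : 0 ≤ x)
    (hy0 : 0 ≤ y) (hv0 : 0 ≤ v)
    (hv : eLpNorm (fun z => (ζ z * (ζ z * V z)) * f z) 2 phaseMeasure ≤ ENNReal.ofReal v)
    (hy : eLpNorm (fun z => (ζ z * (ζ z * W z)) * f z) 2 phaseMeasure ≤ ENNReal.ofReal y)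
    (hx : eLpNorm (fun z => (ζ z * W z) * f z) 2 phaseMeasure ≤ ENNReal.ofReal x) :
    eLpNorm (fun z => f z * (psiA q t γ z.1 z.2 * fderiv ℝ (fun z => ζ z * (ζ z * W z)) z (1, 0)
        - psiT q t γ z.1 z.2 * fderiv ℝ (fun z => ζ z * (ζ z * W z)) z (0, 1))) 2 phaseMeasure
      ≤ ENNReal.ofReal (potConst q * (S * S) / (1 + t) * v
        + potConst q * (S * S) / ((1 + t) * √(1 + t)) * c * y
        + potConst q * (S * S) / (1 + t) * (4 * κ) * x) := by
  have ht := hb.t_nonneg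
  have hS := hb.S_nonneg
  have hP := potConst_nonneg hb.q_pos
  have hc := hW.const_nonneg
  have hκ := hζ.const_nonneg
  have mζ : AEStronglyMeasurable ζ phaseMeasure := hζ.contDiff.continuous.aestronglyMeasurable
  have mW := aestronglyMeasurable_of_contDiffOn hW.contDiffOn
  have mV := aestronglyMeasurable_of_contDiffOn hW.contDiffOn_theta
  have mf := lf.aestronglyMeasurable
  refine eLpNorm_le_of_abs_le ((mζ.mul (mζ.mul mV)).mul mf) ((mζ.mul (mζ.mul mW)).mul mf)
    ((mζ.mul mW).mul mf) (by positivity) (by positivity) (by positivity) hv0 hy0 hx0 hv hy hx ?_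
  filter_upwards [ae_mem_phaseSpace] with z hz
  have ha := mem_phaseSpace.1 hz
  have p1 := hb.abs_psiA_le (θ := z.1) ha
  have p2 := hb.abs_psiT_le (θ := z.1) ha
  have z0 := hζ.nonneg z
  have z1 := hζ.theta_le z hz
  have z2 := hζ.action_le z hz
  have w1 := hW.theta_le z hz
  have w2 := hW.action_le z hz
  have hi : 0 < 1 / z.2 := by positivity
  set Q := potConst q * (S * S) / (1 + t) with hQ
  set Q' := potConst q * (S * S) / ((1 + t) * √(1 + t)) with hQ'
  have hQ0 : 0 ≤ Q := by positivity
  have hQ'0 : 0 ≤ Q' := by positivity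
  have hQQ : Q' ≤ Q := by
    rw [hQ, hQ', ← mul_one_div, ← mul_one_div (potConst q * (S * S))]
    have := inv_mul_sqrt_le (τ := 1 + t) (by linarith)
    gcongr
  have key : ∀ {Ψ : ℝ} {e : ℝ × ℝ} {A B b : ℝ}, 0 ≤ A → |Ψ| ≤ A * b → 0 ≤ b →
      |fderiv ℝ ζ z e| * b ≤ κ → |fderiv ℝ W z e| * b ≤ B →
      |Ψ * fderiv ℝ (fun z => ζ z * (ζ z * W z)) z e|
        ≤ A * (ζ z * ζ z * B) + A * (2 * κ) * |ζ z * W z| := by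
    intro Ψ e A B b hA hΨ hb0 h1 h2
    rw [hζ.fderiv_mul hW.contDiffOn hz, abs_mul]
    have h3 : |2 * (ζ z * W z * fderiv ℝ ζ z e) + ζ z * ζ z * fderiv ℝ W z e|
        ≤ 2 * (|ζ z * W z| * |fderiv ℝ ζ z e|) + ζ z * ζ z * |fderiv ℝ W z e| := by
      refine (abs_add_le _ _).trans (le_of_eq ?_)
      rw [abs_mul, abs_two, abs_mul (ζ z * W z), abs_mul (ζ z * ζ z),
        abs_of_nonneg (mul_nonneg z0 z0)]
    calc _ ≤ (A * b) * (2 * (|ζ z * W z| * |fderiv ℝ ζ z e|) + ζ z * ζ z * |fderiv ℝ W z e|) := by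
          gcongr
      _ = A * (ζ z * ζ z * (|fderiv ℝ W z e| * b))
          + A * (2 * (|fderiv ℝ ζ z e| * b)) * |ζ z * W z| := by ring
      _ ≤ _ := by gcongr
  have k1 := key hQ0 p1 (by positivity) z1 w1
  have k2 := key hQ'0 p2 ha.le z2 w2
  simp only [Pi.mul_apply]
  rw [abs_mul (f z)]
  have e1 : |ζ z * (ζ z * V z) * f z| = ζ z * ζ z * |V z| * |f z| := by
    rw [abs_mul, abs_mul, abs_mul, abs_of_nonneg z0]; ring
  have e2 : |ζ z * (ζ z * W z) * f z| = ζ z * ζ z * |W z| * |f z| := by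
    rw [abs_mul, abs_mul, abs_mul, abs_of_nonneg z0]; ring
  rw [e1, e2, abs_mul (ζ z * W z)]
  have k3 : |psiA q t γ z.1 z.2 * fderiv ℝ (fun z => ζ z * (ζ z * W z)) z (1, 0)
        - psiT q t γ z.1 z.2 * fderiv ℝ (fun z => ζ z * (ζ z * W z)) z (0, 1)|
      ≤ Q * (ζ z * ζ z * |V z|) + Q' * (ζ z * ζ z * (c * |W z|)) + Q * (4 * κ) * |ζ z * W z| := by
    refine (abs_sub _ _).trans ?_
    have : Q' * (2 * κ) * |ζ z * W z| ≤ Q * (2 * κ) * |ζ z * W z| := by gcongr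
    linarith
  calc _ ≤ |f z| * (Q * (ζ z * ζ z * |V z|) + Q' * (ζ z * ζ z * (c * |W z|))
        + Q * (4 * κ) * |ζ z * W z|) := by gcongr
    _ = _ := by ring

/-- The forcing term in the equation for difference quotients. -/
def forcing (q t : ℝ) (γ γθ γa : ℝ × ℝ → ℝ) (e : ℝ × ℝ) (h : ℝ) (z : ℝ × ℝ) : ℝ :=
  dq e h (fun z => psiA q t γ z.1 z.2) z * γθ (z + h • e)
    - dq e h (fun z => psiT q t γ z.1 z.2) z * γa (z + h • e)

/-- The discrete Leibniz rule with the shift put on `γθ` and `γa`: no second derivative of `γ`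
appears, and the coefficients enter the forcing only through their own difference quotients. -/
theorem dq_bracket (q t : ℝ) (γ γθ γa : ℝ × ℝ → ℝ) (e : ℝ × ℝ) (h : ℝ) (z : ℝ × ℝ) :
    dq e h (fun z => psiA q t γ z.1 z.2 * γθ z - psiT q t γ z.1 z.2 * γa z) z
      = psiA q t γ z.1 z.2 * dq e h γθ z - psiT q t γ z.1 z.2 * dq e h γa z
        + forcing q t γ γθ γa e h z := by
  unfold forcing dq
  ring

theorem StaticBound.aesm_forcing (hb : StaticBound q t γ γθ γa S D) {e : ℝ × ℝ} (he : 0 ≤ e.2)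
    {h : ℝ} (hh : 0 ≤ h) : AEStronglyMeasurable (forcing q t γ γθ γa e h) phaseMeasure := by
  have sh : ∀ {k : ℝ × ℝ → ℝ}, AEStronglyMeasurable k phaseMeasure →
      AEStronglyMeasurable (fun z => k (z + h • e)) phaseMeasure := fun hk =>
    (hk.mono_measure (map_add_phaseMeasure_le (smul_snd_nonneg he hh))).comp_measurable
      (measurable_add_const _)
  have d : ∀ {k : ℝ × ℝ → ℝ}, AEStronglyMeasurable k phaseMeasure →
      AEStronglyMeasurable (PointCharge.dq e h k) phaseMeasure := fun hk => by
    rw [dq_eq]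
    exact ((sh hk).const_mul _).add (hk.const_mul _)
  exact ((d (aestronglyMeasurable_of_contDiffOn hb.contDiffOn_psiA)).mul (sh hb.aesm_theta)).sub
    ((d (aestronglyMeasurable_of_contDiffOn hb.contDiffOn_psiT)).mul (sh hb.aesm_action))

theorem StaticBound.eLpNorm_forcing_le (hb : StaticBound q t γ γθ γa S D) {e : ℝ × ℝ}
    (he : 0 ≤ e.2) {h : ℝ} (hh : 0 ≤ h) {ζ W U₁ U₂ : ℝ × ℝ → ℝ} {κ : ℝ} (hζ : IsCutoff ζ κ)
    (hU₁ : ContDiffOn ℝ 1 U₁ phaseSpace) (hU₂ : ContDiffOn ℝ 1 U₂ phaseSpace)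
    {β₁ β₂ x₁ x₂ : ℝ} (hβ₁ : 0 ≤ β₁) (hβ₂ : 0 ≤ β₂) (hx₁ : 0 ≤ x₁) (hx₂ : 0 ≤ x₂)
    (h₁ : ∀ z ∈ phaseSpace, |W z| * |dq e h (fun z => psiA q t γ z.1 z.2) z| ≤ β₁ * |U₁ z|)
    (h₂ : ∀ z ∈ phaseSpace, |W z| * |dq e h (fun z => psiT q t γ z.1 z.2) z| ≤ β₂ * |U₂ z|)
    (n₁ : eLpNorm (fun z => (ζ z * (ζ z * U₁ z)) * γθ (z + h • e)) 2 phaseMeasure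
      ≤ ENNReal.ofReal x₁)
    (n₂ : eLpNorm (fun z => (ζ z * (ζ z * U₂ z)) * γa (z + h • e)) 2 phaseMeasure
      ≤ ENNReal.ofReal x₂) :
    eLpNorm (fun z => (ζ z * (ζ z * W z)) * forcing q t γ γθ γa e h z) 2 phaseMeasure
      ≤ ENNReal.ofReal (β₁ * x₁ + β₂ * x₂) := by
  have sh : ∀ {k : ℝ × ℝ → ℝ}, AEStronglyMeasurable k phaseMeasure →
      AEStronglyMeasurable (fun z => k (z + h • e)) phaseMeasure := fun hk =>
    (hk.mono_measure (map_add_phaseMeasure_le (smul_snd_nonneg he hh))).comp_measurable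
      (measurable_add_const _)
  have mζ : AEStronglyMeasurable ζ phaseMeasure := hζ.contDiff.continuous.aestronglyMeasurable
  have h := eLpNorm_le_of_abs_le (F := fun z => (ζ z * (ζ z * W z)) * forcing q t γ γθ γa e h z)
    ((mζ.mul (mζ.mul (aestronglyMeasurable_of_contDiffOn hU₁))).mul (sh hb.aesm_theta))
    ((mζ.mul (mζ.mul (aestronglyMeasurable_of_contDiffOn hU₂))).mul (sh hb.aesm_action))
    (aestronglyMeasurable_const (b := (0 : ℝ))) hβ₁ hβ₂ le_rfl hx₁ hx₂ le_rfl n₁ n₂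
    (v₃ := 0) (by simp) (by
      filter_upwards [ae_mem_phaseSpace] with z hz
      have z0 := hζ.nonneg z
      simp only [Pi.mul_apply, mul_zero, abs_zero, add_zero]
      unfold forcing
      rw [mul_sub]
      refine (abs_sub _ _).trans (add_le_add ?_ ?_)
      · rw [abs_mul, abs_mul, abs_mul, abs_mul, abs_mul, abs_mul (ζ z), abs_mul (ζ z),
          abs_of_nonneg z0]
        calc _ = ζ z * ζ z * (|W z| * |dq e h (fun z => psiA q t γ z.1 z.2) z|)
              * |γθ (z + h • e)| := by ring
          _ ≤ ζ z * ζ z * (β₁ * |U₁ z|) * |γθ (z + h • e)| := by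
              exact mul_le_mul_of_nonneg_right (mul_le_mul_of_nonneg_left (h₁ z hz)
                (mul_nonneg z0 z0)) (abs_nonneg _)
          _ = _ := by ring
      · rw [abs_mul, abs_mul, abs_mul, abs_mul, abs_mul, abs_mul (ζ z), abs_mul (ζ z),
          abs_of_nonneg z0]
        calc _ = ζ z * ζ z * (|W z| * |dq e h (fun z => psiT q t γ z.1 z.2) z|)
              * |γa (z + h • e)| := by ring
          _ ≤ ζ z * ζ z * (β₂ * |U₂ z|) * |γa (z + h • e)| := by
              exact mul_le_mul_of_nonneg_right (mul_le_mul_of_nonneg_left (h₂ z hz)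
                (mul_nonneg z0 z0)) (abs_nonneg _)
          _ = _ := by ring)
  simpa using h

end

/-! ### Energy estimates for solutions -/

theorem exists_isCutoff_seq : ∃ (c : ℝ) (ζ : ℕ → ℝ × ℝ → ℝ),
    (∀ n, IsCutoff (ζ n) (c / (n + 1))) ∧
      ∀ z ∈ phaseSpace, ∀ᶠ n in Filter.atTop, ζ n z = 1 := by
  obtain ⟨c, ζ, hc, h1, h2, h3, h4, h5, h6, h7, h8⟩ := exists_cutoff_seq
  exact ⟨c, ζ, fun n => ⟨h1 n, h2 n, h3 n, h4 n, h5 n, by positivity, h7 n, h8 n⟩, h6⟩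

theorem tendsto_div_succ (c : ℝ) :
    Filter.Tendsto (fun n : ℕ => c / (n + 1 : ℝ)) Filter.atTop (nhds 0) := by
  have := (tendsto_one_div_add_atTop_nhds_zero_nat (𝕜 := ℝ)).const_mul c
  simpa [mul_one_div, div_eq_mul_inv] using this

theorem tendsto_ofReal_add {u : ℕ → ℝ} (hu : Filter.Tendsto u Filter.atTop (nhds 0)) (a : ℝ) :
    Filter.Tendsto (fun n => ENNReal.ofReal (a + u n)) Filter.atTop (nhds (ENNReal.ofReal a)) := by
  have := ENNReal.tendsto_ofReal (hu.const_add a)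
  rwa [add_zero] at this

/-- Fatou's lemma: the cutoffs become one pointwise and the error `K/(n+1)` disappears, without
assuming finiteness of the limit norm. -/
theorem eLpNorm_le_of_cutoff {F : ℝ × ℝ → ℝ} (hF : AEStronglyMeasurable F phaseMeasure)
    {ζ : ℕ → ℝ × ℝ → ℝ} (hζ : ∀ n, Continuous (ζ n))
    (h1 : ∀ z ∈ phaseSpace, ∀ᶠ n in Filter.atTop, ζ n z = 1) {A : ℝ≥0∞} {a K : ℝ}
    (h : ∀ n : ℕ, eLpNorm (fun z => (ζ n z * ζ n z) * F z) 2 phaseMeasure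
      ≤ A + ENNReal.ofReal (a + K / (n + 1))) : eLpNorm F 2 phaseMeasure ≤ A + ENNReal.ofReal a := by
  have hm : ∀ n, AEStronglyMeasurable (fun z => (ζ n z * ζ n z) * F z) phaseMeasure := fun n =>
    ((hζ n).mul (hζ n)).aestronglyMeasurable.mul hF
  refine (Lp.eLpNorm_lim_le_liminf_eLpNorm hm F ?_).trans ?_
  · filter_upwards [ae_mem_phaseSpace] with z hz
    refine tendsto_const_nhds.congr' ((h1 z hz).mono fun n hn => ?_)
    simp only [hn]; ring
  · have hlim : Filter.Tendsto (fun n : ℕ => A + ENNReal.ofReal (a + K / (n + 1))) Filter.atTop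
        (nhds (A + ENNReal.ofReal a)) :=
      (tendsto_ofReal_add (tendsto_div_succ K) a).const_add A
    rw [← hlim.liminf_eq]
    exact Filter.liminf_le_liminf (Filter.Eventually.of_forall h)

theorem energy_le {T : ℝ} {γ D : ℝ → L2}
    (hd : ∀ t ∈ Icc 0 T, HasDerivWithinAt γ (D t) (Icc 0 T) t) (Λ : L2 →L[ℝ] L2)
    {p r : ℝ → ℝ × ℝ → ℝ} (hp : ∀ t ∈ Icc 0 T, Λ (γ t) =ᵐ[phaseMeasure] p t)
    (hr : ∀ t ∈ Icc 0 T, Λ (D t) =ᵐ[phaseMeasure] r t) {B B' : ℝ → ℝ} {η : ℝ} (hη : 0 ≤ η)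
    (hB : ∀ t ∈ Icc 0 T, HasDerivAt B (B' t) t) (hB0 : ∀ t ∈ Icc 0 T, 0 ≤ B' t)
    (h : ∀ t ∈ Icc 0 T, ∀ N : ℝ, 0 ≤ N → eLpNorm (p t) 2 phaseMeasure ≤ ENNReal.ofReal N →
      |∫ z, p t z * r t z ∂phaseMeasure| ≤ N * (B' t + η)) :
    ∀ t ∈ Icc 0 T, eLpNorm (p t) 2 phaseMeasure
      ≤ eLpNorm (p 0) 2 phaseMeasure + ENNReal.ofReal ((B t - B 0) + η * t) := by
  have e : ∀ t ∈ Icc 0 T, eLpNorm (p t) 2 phaseMeasure = ENNReal.ofReal ‖Λ (γ t)‖ := by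
    intro t ht
    rw [← eLpNorm_congr_ae (hp t ht), Lp.norm_def,
      ENNReal.ofReal_toReal (Lp.memLp (Λ (γ t))).2.ne]
  have key := norm_le_of_inner_le (Γ := fun t => Λ (γ t)) (Γ' := fun t => Λ (D t)) hη
    (fun t ht => Λ.hasFDerivAt.comp_hasDerivWithinAt t (hd t ht)) hB hB0 (fun t ht => by
      refine le_trans ?_ ((le_abs_self _).trans (h t ht ‖Λ (γ t)‖ (norm_nonneg _) (e t ht).le))
      rw [L2.inner_def]
      refine le_of_eq (integral_congr_ae ?_)
      filter_upwards [hp t ht, hr t ht] with z h1 h2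
      rw [h1, h2, RCLike.inner_apply, conj_trivial, mul_comm])
  intro t ht
  have h0 : (0 : ℝ) ∈ Icc 0 T := ⟨le_rfl, ht.1.trans ht.2⟩
  rw [e t ht, e 0 h0]
  refine (ENNReal.ofReal_le_ofReal (key t ht)).trans ?_
  rw [add_assoc]
  exact ENNReal.ofReal_add_le

/-- A solution with bounds at every time. -/
structure SolutionBound (q lam T : ℝ) (γ : ℝ → L2) (γθ γa : ℝ → ℝ × ℝ → ℝ) (S D : ℝ → ℝ)
    (M : ℝ) : Prop where
  isSolution : IsSolution q lam T γ γθ γa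
  static : ∀ t ∈ Icc 0 T, StaticBound q t (γ t) (γθ t) (γa t) (S t) (D t)
  S_le : ∀ t ∈ Icc 0 T, S t ≤ M
  D_le : ∀ t ∈ Icc 0 T, D t ≤ M

theorem StaticBound.bracket_eq {q t S D : ℝ} {γ : L2} {γθ γa : ℝ × ℝ → ℝ}
    (hb : StaticBound q t γ γθ γa S D) {z : ℝ × ℝ} (hz : z ∈ phaseSpace) :
    bracket q γ γθ γa t z = psiA q t γ z.1 z.2 * γθ z - psiT q t γ z.1 z.2 * γa z := by
  have ha := mem_phaseSpace.1 hz
  unfold bracket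
  simp only [potential_eq hb.q_pos]
  rw [(hb.hasDerivAt_radialPotential_theta ha).deriv,
    (hb.hasDerivAt_radialPotential_action ha).deriv]

/-! ### Energy estimates for moments -/

section
variable {q lam T M : ℝ} {γ : ℝ → L2} {γθ γa : ℝ → ℝ × ℝ → ℝ} {S D : ℝ → ℝ}

namespace SolutionBound

theorem exists_deriv (hs : SolutionBound q lam T γ γθ γa S D M) : ∃ G : ℝ → L2,
    ∀ t ∈ Icc 0 T, HasDerivWithinAt γ (G t) (Icc 0 T) t ∧
      (G t =ᵐ[phaseMeasure] fun z => lam * (psiA q t (γ t) z.1 z.2 * γθ t z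
        - psiT q t (γ t) z.1 z.2 * γa t z)) := by
  have h : ∀ t, ∃ G : L2, t ∈ Icc 0 T → HasDerivWithinAt γ G (Icc 0 T) t ∧
      (G =ᵐ[phaseMeasure] fun z => lam * (psiA q t (γ t) z.1 z.2 * γθ t z
        - psiT q t (γ t) z.1 z.2 * γa t z)) := by
    intro t
    by_cases ht : t ∈ Icc 0 T
    · obtain ⟨G, h1, h2⟩ := hs.isSolution.evolution t ht
      refine ⟨G, fun _ => ⟨h2, ?_⟩⟩
      filter_upwards [h1, ae_mem_phaseSpace] with z hz hz'
      rw [hz, (hs.static t ht).bracket_eq hz']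
    · exact ⟨0, fun h => absurd h ht⟩
  choose G hG using h
  exact ⟨G, hG⟩

theorem const_nonneg (hs : SolutionBound q lam T γ γθ γa S D M) {t : ℝ} (ht : t ∈ Icc 0 T) :
    0 ≤ M := (hs.static t ht).S_nonneg.trans (hs.S_le t ht)

theorem potConst_div_le (hs : SolutionBound q lam T γ γθ γa S D M) {t : ℝ} (ht : t ∈ Icc 0 T) :
    potConst q * (S t * S t) / (1 + t) ≤ potConst q * M ^ 2 := by
  have h := hs.static t ht
  have hP := potConst_nonneg h.q_pos
  have h0 := h.S_nonneg
  have h1 := hs.S_le t ht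
  have hM := hs.const_nonneg ht
  have ht0 := ht.1
  refine (div_le_self (by positivity) (by linarith)).trans ?_
  rw [sq]; gcongr

theorem potConst_div_sqrt_le (hs : SolutionBound q lam T γ γθ γa S D M) {t : ℝ}
    (ht : t ∈ Icc 0 T) : potConst q * (S t * S t) / ((1 + t) * √(1 + t)) ≤ potConst q * M ^ 2 := by
  have h := hs.static t ht
  have hP := potConst_nonneg h.q_pos
  have h0 := h.S_nonneg
  have ht0 := ht.1
  refine le_trans ?_ (hs.potConst_div_le ht)
  rw [← mul_one_div, ← mul_one_div (potConst q * _)]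
  have := inv_mul_sqrt_le (τ := 1 + t) (by linarith)
  gcongr

theorem moment_energy_cutoff (hs : SolutionBound q lam T γ γθ γa S D M) {W V ζ : ℝ × ℝ → ℝ}
    {c κ : ℝ} (hW : IsWeight W V c) (hζ : IsCutoff ζ κ) {y v B B' : ℝ → ℝ}
    (hy0 : ∀ t ∈ Icc 0 T, 0 ≤ y t) (hv0 : ∀ t ∈ Icc 0 T, 0 ≤ v t) (hyM : ∀ t ∈ Icc 0 T, y t ≤ M)
    (hy : ∀ t ∈ Icc 0 T, eLpNorm (fun z => W z * γ t z) 2 phaseMeasure ≤ ENNReal.ofReal (y t))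
    (hv : ∀ t ∈ Icc 0 T, eLpNorm (fun z => V z * γ t z) 2 phaseMeasure ≤ ENNReal.ofReal (v t))
    (hB : ∀ t ∈ Icc 0 T, HasDerivAt B (B' t) t)
    (hb : ∀ t ∈ Icc 0 T, |lam| * (potConst q * (S t * S t) / (1 + t) * v t
      + potConst q * (S t * S t) / ((1 + t) * √(1 + t)) * c * y t) ≤ B' t) :
    ∀ t ∈ Icc 0 T, eLpNorm (fun z => (ζ z * (ζ z * W z)) * γ t z) 2 phaseMeasure
      ≤ eLpNorm (fun z => (ζ z * (ζ z * W z)) * γ 0 z) 2 phaseMeasure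
        + ENNReal.ofReal ((B t - B 0) + |lam| * (4 * κ * (potConst q * M ^ 3)) * t) := by
  intro t ht
  have hM := hs.const_nonneg ht
  obtain ⟨G, hG⟩ := hs.exists_deriv
  have hκ := hζ.const_nonneg
  have hw : ContDiff ℝ 1 (fun z => ζ z * (ζ z * W z)) :=
    hζ.contDiff.mul (hζ.contDiff_mul hW.contDiffOn)
  have hwc : HasCompactSupport (fun z => ζ z * (ζ z * W z)) := hζ.compact.mul_right
  have hws : tsupport (fun z => ζ z * (ζ z * W z)) ⊆ phaseSpace := hζ.tsupport_mul _
  obtain ⟨Mw, hMw⟩ := hw.continuous.bounded_above_of_compact_support hwc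
  -- With zero shift and coefficients `0`, `1` the shift operator is multiplication by the cut
  -- weight.
  obtain ⟨Λ, hΛ⟩ := exists_shiftOp (v := 0) le_rfl hw.continuous hMw 0 1
  have hP := potConst_nonneg (hs.static t ht).q_pos
  have hcut : ∀ X : ℝ × ℝ → ℝ, ∀ f : ℝ × ℝ → ℝ,
      eLpNorm (fun z => (ζ z * (ζ z * X z)) * f z) 2 phaseMeasure
        ≤ eLpNorm (fun z => X z * f z) 2 phaseMeasure := by
    intro X f
    refine eLpNorm_mono fun z => ?_
    rw [Real.norm_eq_abs, Real.norm_eq_abs, abs_mul, abs_mul, abs_mul, abs_mul (X z)]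
    have h1 := hζ.abs_le_one z
    gcongr
    calc |ζ z| * (|ζ z| * |X z|) ≤ 1 * (1 * |X z|) := by gcongr
      _ = |X z| := by ring
  have hcut1 : ∀ X : ℝ × ℝ → ℝ, ∀ f : ℝ × ℝ → ℝ,
      eLpNorm (fun z => (ζ z * X z) * f z) 2 phaseMeasure
        ≤ eLpNorm (fun z => X z * f z) 2 phaseMeasure := by
    intro X f
    refine eLpNorm_mono fun z => ?_
    rw [Real.norm_eq_abs, Real.norm_eq_abs, abs_mul, abs_mul, abs_mul (X z)]
    gcongr
    exact mul_le_of_le_one_left (abs_nonneg _) (hζ.abs_le_one z)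
  refine energy_le (fun t ht => (hG t ht).1) Λ
    (p := fun t z => (ζ z * (ζ z * W z)) * γ t z)
    (r := fun t z => lam * ((ζ z * (ζ z * W z)) * (psiA q t (γ t) z.1 z.2 * γθ t z
        - psiT q t (γ t) z.1 z.2 * γa t z + 0))) ?_ ?_ (by positivity) hB ?_ ?_ t ht
  · intro t ht
    filter_upwards [hΛ (γ t) (γ t) Filter.EventuallyEq.rfl] with z hz
    rw [hz]; ring
  · intro t ht
    filter_upwards [hΛ (G t) _ (hG t ht).2] with z hz
    rw [hz]; ring
  · intro t ht
    refine le_trans ?_ (hb t ht)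
    have h := hs.static t ht
    have := hy0 t ht; have := hv0 t ht; have := ht.1; have := hW.const_nonneg
    have := h.S_nonneg
    positivity
  · intro t ht N hN0 hN
    have h := hs.static t ht
    have hSt := h.S_nonneg
    have ht0 := ht.1
    have hc := hW.const_nonneg
    have y0 := hy0 t ht; have v0 := hv0 t ht
    have hA := h.eLpNorm_transport_le (locL2_of_memLp h.memLp) hζ hW y0 y0 v0
      ((hcut V _).trans (hv t ht)) ((hcut W _).trans (hy t ht)) ((hcut1 W _).trans (hy t ht))
    have h1 := h.abs_inner_le (F := fun _ => 0) h.weak_theta h.weak_action (locL2_of_memLp h.memLp)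
      (locL2_of_memLp h.memLp_theta) h.locL2_action hw hwc hws aestronglyMeasurable_const hN0
      (by positivity) le_rfl hN hA (by simp)
    have e1 : ∀ z, (ζ z * (ζ z * W z)) * γ t z * (lam * ((ζ z * (ζ z * W z))
        * (psiA q t (γ t) z.1 z.2 * γθ t z - psiT q t (γ t) z.1 z.2 * γa t z + 0)))
        = lam * ((ζ z * (ζ z * W z)) * γ t z * ((ζ z * (ζ z * W z))
        * (psiA q t (γ t) z.1 z.2 * γθ t z - psiT q t (γ t) z.1 z.2 * γa t z + 0))) :=
      fun z => by ring
    simp_rw [e1]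
    rw [integral_const_mul, abs_mul]
    refine (mul_le_mul_of_nonneg_left h1 (abs_nonneg lam)).trans ?_
    have h2 := hb t ht
    have h3 := hs.potConst_div_le ht
    have h4 : potConst q * (S t * S t) / (1 + t) * (4 * κ) * y t
        ≤ 4 * κ * (potConst q * M ^ 3) := by
      calc _ ≤ potConst q * M ^ 2 * (4 * κ) * M := by
            have := hyM t ht
            gcongr
        _ = _ := by ring
    have h5 := mul_le_mul_of_nonneg_left h4 (abs_nonneg lam)
    rw [mul_left_comm]
    refine mul_le_mul_of_nonneg_left ?_ hN0
    linarith

/-- The cutoff contributes an error proportional to `κ t`, with `κ` of order `1/n`, which vanishes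
at each fixed time. Therefore `M` may depend on `T` without entering the final bound. -/
theorem moment_energy (hs : SolutionBound q lam T γ γθ γa S D M) {W V : ℝ × ℝ → ℝ}
    {c : ℝ} (hW : IsWeight W V c) {y v B B' : ℝ → ℝ}
    (hy0 : ∀ t ∈ Icc 0 T, 0 ≤ y t) (hv0 : ∀ t ∈ Icc 0 T, 0 ≤ v t) (hyM : ∀ t ∈ Icc 0 T, y t ≤ M)
    (hy : ∀ t ∈ Icc 0 T, eLpNorm (fun z => W z * γ t z) 2 phaseMeasure ≤ ENNReal.ofReal (y t))
    (hv : ∀ t ∈ Icc 0 T, eLpNorm (fun z => V z * γ t z) 2 phaseMeasure ≤ ENNReal.ofReal (v t))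
    (hB : ∀ t ∈ Icc 0 T, HasDerivAt B (B' t) t)
    (hb : ∀ t ∈ Icc 0 T, |lam| * (potConst q * (S t * S t) / (1 + t) * v t
      + potConst q * (S t * S t) / ((1 + t) * √(1 + t)) * c * y t) ≤ B' t) :
    ∀ t ∈ Icc 0 T, eLpNorm (fun z => W z * γ t z) 2 phaseMeasure
      ≤ eLpNorm (fun z => W z * γ 0 z) 2 phaseMeasure + ENNReal.ofReal (B t - B 0) := by
  intro t ht
  obtain ⟨cζ, ζ, hζ, h1⟩ := exists_isCutoff_seq
  have h := hs.static t ht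
  refine eLpNorm_le_of_cutoff (ζ := ζ)
    (K := |lam| * (4 * cζ * (potConst q * M ^ 3)) * t)
    ((aestronglyMeasurable_of_contDiffOn hW.contDiffOn).mul h.aesm)
    (fun n => (hζ n).contDiff.continuous) h1 fun n => ?_
  have h2 := hs.moment_energy_cutoff hW (hζ n) hy0 hv0 hyM hy hv hB hb t ht
  calc _ = eLpNorm (fun z => (ζ n z * (ζ n z * W z)) * γ t z) 2 phaseMeasure := by
        congr 1; ext z; simp only [Pi.mul_apply]; ring
    _ ≤ _ := h2
    _ ≤ _ := by
        refine add_le_add (eLpNorm_mono fun z => ?_) (le_of_eq ?_)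
        · rw [Real.norm_eq_abs, Real.norm_eq_abs, abs_mul, abs_mul, abs_mul, abs_mul (W z)]
          have := (hζ n).abs_le_one z
          gcongr
          calc |ζ n z| * (|ζ n z| * |W z|) ≤ 1 * (1 * |W z|) := by gcongr
            _ = |W z| := by ring
        · congr 1; ring

end SolutionBound
end

/-! ### Energy estimates for first derivatives through difference quotients -/

section

/-- The effect of a shift on norms with a smooth compactly supported weight. -/
theorem exists_shift_const {e : ℝ × ℝ} (he : 0 ≤ e.2) {u : ℝ × ℝ → ℝ} (hu : ContDiff ℝ 1 u)
    (hc : HasCompactSupport u) (hs : tsupport u ⊆ phaseSpace) :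
    ∃ C, 0 ≤ C ∧ ∀ C' : ℝ, C ≤ C' → ∀ h : ℝ, 0 ≤ h → ∀ (k : ℝ × ℝ → ℝ) (x M : ℝ), 0 ≤ x → 0 ≤ M →
      AEStronglyMeasurable k phaseMeasure →
      eLpNorm (fun z => u z * k z) 2 phaseMeasure ≤ ENNReal.ofReal x →
      eLpNorm (fun z => z.2 * k z) 2 phaseMeasure ≤ ENNReal.ofReal M →
      ∀ s ∈ Icc 0 h, eLpNorm (fun z => u z * k (z + s • e)) 2 volume
        ≤ ENNReal.ofReal (x + C' * h * M) := by
  obtain ⟨c, hc0, hsh⟩ := exists_shift_bound he hu hc hs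
  refine ⟨c, hc0, fun C' hC' h hh k x M hx hM hk hu1 hk1 s hs' => ?_⟩
  have hC0 := hc0.trans hC'
  refine (eLpNorm_mul_shift_le hu.continuous hs hC0 hh he hs'.1 (fun z hz => ?_) hk).trans ?_
  · refine (hsh h s hs'.1 hs'.2 z hz).trans ?_
    have := mem_phaseSpace.1 hz
    gcongr
  · rw [ENNReal.ofReal_add hx (by positivity), ENNReal.ofReal_mul (p := C' * h) (by positivity)]
    gcongr

variable {q lam T M : ℝ} {γ : ℝ → L2} {γθ γa : ℝ → ℝ × ℝ → ℝ} {S D : ℝ → ℝ}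

/-- The data for the energy estimate of a derivative `γe` of the density in the direction `e`. -/
structure DerivativeBound (q lam T : ℝ) (γ : ℝ → L2) (γθ γa : ℝ → ℝ × ℝ → ℝ) (S D : ℝ → ℝ) (M : ℝ)
    (e : ℝ × ℝ) (γe : ℝ → ℝ × ℝ → ℝ) (W V U₁ U₂ : ℝ × ℝ → ℝ) (c : ℝ)
    (y v x₁ x₂ β₁ β₂ B B' : ℝ → ℝ) : Prop where
  sol : SolutionBound q lam T γ γθ γa S D M
  dir_nonneg : 0 ≤ e.2
  weak : ∀ t ∈ Icc 0 T, HasWeakPartial e (γ t) (γe t)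
  loc : ∀ t ∈ Icc 0 T, LocL2 (γe t)
  norm_le : ∀ t ∈ Icc 0 T, eLpNorm (fun z => z.2 * γe t z) 2 phaseMeasure ≤ ENNReal.ofReal M
  weight : IsWeight W V c
  contDiff₁ : ContDiffOn ℝ 1 U₁ phaseSpace
  contDiff₂ : ContDiffOn ℝ 1 U₂ phaseSpace
  y_nonneg : ∀ t ∈ Icc 0 T, 0 ≤ y t
  v_nonneg : ∀ t ∈ Icc 0 T, 0 ≤ v t
  x₁_nonneg : ∀ t ∈ Icc 0 T, 0 ≤ x₁ t
  x₂_nonneg : ∀ t ∈ Icc 0 T, 0 ≤ x₂ t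
  β₁_nonneg : ∀ t ∈ Icc 0 T, 0 ≤ β₁ t
  β₂_nonneg : ∀ t ∈ Icc 0 T, 0 ≤ β₂ t
  y_le : ∀ t ∈ Icc 0 T, y t ≤ M
  β₁_le : ∀ t ∈ Icc 0 T, β₁ t ≤ M
  β₂_le : ∀ t ∈ Icc 0 T, β₂ t ≤ M
  norm_y : ∀ t ∈ Icc 0 T, eLpNorm (fun z => W z * γe t z) 2 phaseMeasure ≤ ENNReal.ofReal (y t)
  norm_v : ∀ t ∈ Icc 0 T, eLpNorm (fun z => V z * γe t z) 2 phaseMeasure ≤ ENNReal.ofReal (v t)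
  norm_x₁ : ∀ t ∈ Icc 0 T, eLpNorm (fun z => U₁ z * γθ t z) 2 phaseMeasure ≤ ENNReal.ofReal (x₁ t)
  norm_x₂ : ∀ t ∈ Icc 0 T, eLpNorm (fun z => U₂ z * γa t z) 2 phaseMeasure ≤ ENNReal.ofReal (x₂ t)
  dq_psiA : ∀ t ∈ Icc 0 T, ∀ h, 0 < h → ∀ z ∈ phaseSpace,
    |W z| * |dq e h (fun z => psiA q t (γ t) z.1 z.2) z| ≤ β₁ t * |U₁ z|
  dq_psiT : ∀ t ∈ Icc 0 T, ∀ h, 0 < h → ∀ z ∈ phaseSpace,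
    |W z| * |dq e h (fun z => psiT q t (γ t) z.1 z.2) z| ≤ β₂ t * |U₂ z|
  hasDerivAt : ∀ t ∈ Icc 0 T, HasDerivAt B (B' t) t
  rate_le : ∀ t ∈ Icc 0 T, |lam| * (potConst q * (S t * S t) / (1 + t) * v t
      + potConst q * (S t * S t) / ((1 + t) * √(1 + t)) * c * y t + β₁ t * x₁ t + β₂ t * x₂ t)
      ≤ B' t

namespace DerivativeBound
variable {e : ℝ × ℝ} {γe : ℝ → ℝ × ℝ → ℝ} {W V U₁ U₂ ζ : ℝ × ℝ → ℝ} {c κ : ℝ}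
  {y v x₁ x₂ β₁ β₂ B B' : ℝ → ℝ}

/-- The derivative `γe` is not known to be differentiable in time, but the difference quotient is a
bounded operator applied to `γ`. With a cut weight, all its norms are those of `γe` up to errors of
order `h`; the constant may depend on cutoff and time, but not on `h`. -/
theorem exists_energy_dq_le
    (hd : DerivativeBound q lam T γ γθ γa S D M e γe W V U₁ U₂ c y v x₁ x₂ β₁ β₂ B B')
    (hζ : IsCutoff ζ κ) {t : ℝ} (ht : t ∈ Icc 0 T) : ∃ K, ∀ h : ℝ, 0 < h →
      eLpNorm (fun z => (ζ z * (ζ z * W z)) * dq e h (γ t) z) 2 phaseMeasure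
        ≤ ENNReal.ofReal K * ENNReal.ofReal h
          + eLpNorm (fun z => W z * γe 0 z) 2 phaseMeasure
          + ENNReal.ofReal ((B t - B 0) + |lam| * (4 * κ * (potConst q * M ^ 3)) * t
            + K * h) := by
  have hs := hd.sol
  have h0T : (0 : ℝ) ∈ Icc 0 T := ⟨le_rfl, ht.1.trans ht.2⟩
  have hM := hs.const_nonneg ht
  obtain ⟨G, hG⟩ := hs.exists_deriv
  have hκ := hζ.const_nonneg
  have he := hd.dir_nonneg
  have hW := hd.weight
  have hP := potConst_nonneg (hs.static t ht).q_pos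
  have hc := hW.const_nonneg
  have cut : ∀ X, ContDiffOn ℝ 1 X phaseSpace → ContDiff ℝ 1 (fun z => ζ z * (ζ z * X z)) :=
    fun X hX => hζ.contDiff.mul (hζ.contDiff_mul hX)
  have cutc : ∀ X : ℝ × ℝ → ℝ, HasCompactSupport (fun z => ζ z * (ζ z * X z)) :=
    fun X => hζ.compact.mul_right
  have cuts : ∀ X : ℝ × ℝ → ℝ, tsupport (fun z => ζ z * (ζ z * X z)) ⊆ phaseSpace :=
    fun X => hζ.tsupport_mul _
  have hw := cut W hW.contDiffOn
  have hwc := cutc W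
  have hws := cuts W
  obtain ⟨C1, g1, f1⟩ := exists_shift_const he hw hwc hws
  obtain ⟨C2, g2, f2⟩ := exists_shift_const he (cut V hW.contDiffOn_theta) (cutc V) (cuts V)
  obtain ⟨C3, g3, f3⟩ := exists_shift_const he (cut U₁ hd.contDiff₁) (cutc U₁) (cuts U₁)
  obtain ⟨C4, g4, f4⟩ := exists_shift_const he (cut U₂ hd.contDiff₂) (cutc U₂) (cuts U₂)
  obtain ⟨C5, g5, f5⟩ := exists_shift_const he (hζ.contDiff_mul hW.contDiffOn)
    (hζ.compact.mul_right (f' := W)) (hζ.tsupport_mul W)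
  set C := C1 + C2 + C3 + C4 + C5 with hC
  have hC0 : 0 ≤ C := by positivity
  replace f1 := f1 C (by linarith)
  replace f2 := f2 C (by linarith)
  replace f3 := f3 C (by linarith)
  replace f4 := f4 C (by linarith)
  replace f5 := f5 C (by linarith)
  have hcut1 : ∀ X : ℝ × ℝ → ℝ, ∀ f : ℝ × ℝ → ℝ,
      eLpNorm (fun z => (ζ z * X z) * f z) 2 phaseMeasure
        ≤ eLpNorm (fun z => X z * f z) 2 phaseMeasure := by
    intro X f
    refine eLpNorm_mono fun z => ?_
    rw [Real.norm_eq_abs, Real.norm_eq_abs, abs_mul, abs_mul, abs_mul (X z)]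
    gcongr
    exact mul_le_of_le_one_left (abs_nonneg _) (hζ.abs_le_one z)
  have hcut : ∀ X : ℝ × ℝ → ℝ, ∀ f : ℝ × ℝ → ℝ,
      eLpNorm (fun z => (ζ z * (ζ z * X z)) * f z) 2 phaseMeasure
        ≤ eLpNorm (fun z => X z * f z) 2 phaseMeasure := fun X f =>
    (hcut1 (fun z => ζ z * X z) f).trans (hcut1 X f)
  -- bounds for the difference quotient
  have hdq : ∀ t ∈ Icc 0 T, ∀ h, 0 < h → ∀ (u : ℝ × ℝ → ℝ) (A : ℝ≥0∞), Continuous u →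
      HasCompactSupport u → tsupport u ⊆ phaseSpace →
      (∀ s ∈ Icc 0 h, eLpNorm (fun z => u z * γe t (z + s • e)) 2 volume ≤ A) →
      eLpNorm (fun z => u z * dq e h (γ t) z) 2 phaseMeasure ≤ A := by
    intro t ht h hh u A hu huc hus hA
    have := eLpNorm_mul_dq_sub_le he (hd.weak t ht) (locL2_of_memLp (hs.static t ht).memLp)
      (hd.loc t ht) hu huc hus (k := fun _ => 0) (locL2_of_memLp (MemLp.zero (ε := ℝ))) hh (M := A)
      (by simpa using hA)
    simp only [sub_zero] at this
    rwa [eLpNorm_phaseMeasure_eq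
      (fun z hz => hus (subset_tsupport u (left_ne_zero_of_mul hz)))]
  obtain ⟨Mw, hMw⟩ := hw.continuous.bounded_above_of_compact_support hwc
  set K := |lam| * (C * M * (potConst q * M ^ 2 * (1 + c + 4 * κ) + 2 * M)) with hK
  have hK0 : 0 ≤ K := by positivity
  -- The part `C M` bounds the shift error in the initial data and `K t` the shift errors
  -- accumulated in the rate.
  refine ⟨C * M + K * t, fun h hh => ?_⟩
  have hv2 := smul_snd_nonneg he hh.le
  -- The coefficients `1/h` and `-1/h` turn the shift operator into the weighted difference
  -- quotient.
  obtain ⟨Λ, hΛ⟩ := exists_shiftOp hv2 hw.continuous hMw (1 / h) (-1 / h)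
  have h0 : eLpNorm (fun z => (ζ z * (ζ z * W z)) * dq e h (γ 0) z) 2 phaseMeasure
      ≤ eLpNorm (fun z => W z * γe 0 z) 2 phaseMeasure + ENNReal.ofReal (C * h * M) := by
    have hlt : eLpNorm (fun z => W z * γe 0 z) 2 phaseMeasure ≠ ⊤ :=
      ((hd.norm_y 0 h0T).trans_lt ENNReal.ofReal_lt_top).ne
    refine hdq 0 h0T h hh _ _ hw.continuous hwc hws fun s hs' => ?_
    refine (f1 h hh.le (γe 0) _ M ENNReal.toReal_nonneg hM (hd.loc 0 h0T).aestronglyMeasurable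
      ((hcut W _).trans (ENNReal.ofReal_toReal hlt).ge) (hd.norm_le 0 h0T) s hs').trans ?_
    rw [ENNReal.ofReal_add ENNReal.toReal_nonneg (by positivity), ENNReal.ofReal_toReal hlt]
  have key := energy_le (fun t ht => (hG t ht).1) Λ
    (p := fun t z => (ζ z * (ζ z * W z)) * dq e h (γ t) z)
    (r := fun t z => lam * ((ζ z * (ζ z * W z)) * (psiA q t (γ t) z.1 z.2 * dq e h (γθ t) z
        - psiT q t (γ t) z.1 z.2 * dq e h (γa t) z + forcing q t (γ t) (γθ t) (γa t) e h z)))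
    (η := |lam| * (4 * κ * (potConst q * M ^ 3)) + K * h) ?_ ?_ (by positivity) hd.hasDerivAt ?_ ?_
    t ht
  · refine key.trans ?_
    have hKt : 0 ≤ K * t := mul_nonneg hK0 ht.1
    refine (add_le_add_left h0 _).trans ?_
    rw [add_comm (eLpNorm _ _ _) (ENNReal.ofReal _),
      ← ENNReal.ofReal_mul (by positivity)]
    refine add_le_add (add_le_add (ENNReal.ofReal_le_ofReal ?_) le_rfl)
      (ENNReal.ofReal_le_ofReal ?_)
    · nlinarith [mul_nonneg hKt hh.le]
    · nlinarith [mul_nonneg (mul_nonneg hC0 hM) hh.le]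
  · intro t ht
    filter_upwards [hΛ (γ t) (γ t) Filter.EventuallyEq.rfl] with z hz
    rw [hz, dq_eq]
  · intro t ht
    filter_upwards [hΛ (G t) _ (hG t ht).2] with z hz
    rw [hz, ← dq_bracket]
    unfold dq
    ring
  · intro t ht
    refine le_trans ?_ (hd.rate_le t ht)
    have h := hs.static t ht
    have := hd.y_nonneg t ht; have := hd.v_nonneg t ht; have := ht.1; have := h.S_nonneg
    have := hd.x₁_nonneg t ht; have := hd.x₂_nonneg t ht; have := hd.β₁_nonneg t ht
    have := hd.β₂_nonneg t ht
    positivity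
  · intro t ht N hN0 hN
    have hb := hs.static t ht
    have hSt := hb.S_nonneg
    have ht0 := ht.1
    have y0 := hd.y_nonneg t ht; have v0 := hd.v_nonneg t ht
    have x10 := hd.x₁_nonneg t ht; have x20 := hd.x₂_nonneg t ht
    have b10 := hd.β₁_nonneg t ht; have b20 := hd.β₂_nonneg t ht
    have me := (hd.loc t ht).aestronglyMeasurable
    have hhI : h ∈ Icc 0 h := ⟨hh.le, le_rfl⟩
    have hChM : 0 ≤ C * h * M := by positivity
    have nv := hdq t ht h hh _ _ (cut V hW.contDiffOn_theta).continuous (cutc V) (cuts V)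
      (f2 h hh.le (γe t) (v t) M v0 hM me ((hcut V _).trans (hd.norm_v t ht)) (hd.norm_le t ht))
    have ny := hdq t ht h hh _ _ hw.continuous hwc hws
      (f1 h hh.le (γe t) (y t) M y0 hM me ((hcut W _).trans (hd.norm_y t ht)) (hd.norm_le t ht))
    have nx := hdq t ht h hh _ _ (hζ.contDiff_mul hW.contDiffOn).continuous
      (hζ.compact.mul_right (f' := W)) (hζ.tsupport_mul W)
      (f5 h hh.le (γe t) (y t) M y0 hM me ((hcut1 W _).trans (hd.norm_y t ht)) (hd.norm_le t ht))
    have hD := hs.D_le t ht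
    have nθ : eLpNorm (fun z => z.2 * γθ t z) 2 phaseMeasure ≤ ENNReal.ofReal M := by
      refine (eLpNorm_mono_ae ?_).trans (hb.norm_theta.trans (ENNReal.ofReal_le_ofReal hD))
      filter_upwards [ae_mem_phaseSpace] with z hz
      have ha := mem_phaseSpace.1 hz
      rw [norm_mul, norm_mul, Real.norm_of_nonneg ha.le, Real.norm_of_nonneg (by positivity : 0 ≤ z.2 + z.2⁻¹)]
      gcongr
      exact le_add_of_nonneg_right (by positivity : 0 ≤ z.2⁻¹)
    have na : eLpNorm (fun z => z.2 * γa t z) 2 phaseMeasure ≤ ENNReal.ofReal M :=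
      hb.norm_action.trans (ENNReal.ofReal_le_ofReal hD)
    have n1 := (eLpNorm_phaseMeasure_eq (fun z hz => cuts U₁ (subset_tsupport _
      (left_ne_zero_of_mul hz)))).trans_le (f3 h hh.le (γθ t) (x₁ t) M x10 hM hb.aesm_theta
      ((hcut U₁ _).trans (hd.norm_x₁ t ht)) nθ h hhI)
    have n2 := (eLpNorm_phaseMeasure_eq (fun z hz => cuts U₂ (subset_tsupport _
      (left_ne_zero_of_mul hz)))).trans_le (f4 h hh.le (γa t) (x₂ t) M x20 hM hb.aesm_action
      ((hcut U₂ _).trans (hd.norm_x₂ t ht)) na h hhI)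
    have lγ := (locL2_of_memLp hb.memLp).dq he hh.le
    have hA := hb.eLpNorm_transport_le lγ hζ hW (add_nonneg y0 hChM)
      (add_nonneg y0 hChM) (add_nonneg v0 hChM) nv ny nx
    have hX := hb.eLpNorm_forcing_le he hh.le hζ hd.contDiff₁ hd.contDiff₂ b10 b20
      (add_nonneg x10 hChM) (add_nonneg x20 hChM) (hd.dq_psiA t ht h hh) (hd.dq_psiT t ht h hh) n1 n2
    have i1 := fun p₁ p₂ => hb.abs_inner_le (hb.weak_theta.dq he hh.le) (hb.weak_action.dq he hh.le) lγ
      ((locL2_of_memLp hb.memLp_theta).dq he hh.le) (hb.locL2_action.dq he hh.le) hw hwc hws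
      (hb.aesm_forcing he hh.le) hN0 p₁ p₂ hN hA hX
    replace i1 := i1 (by positivity) (by positivity)
    have e1 : ∀ z, (ζ z * (ζ z * W z)) * dq e h (γ t) z * (lam * ((ζ z * (ζ z * W z))
        * (psiA q t (γ t) z.1 z.2 * dq e h (γθ t) z - psiT q t (γ t) z.1 z.2 * dq e h (γa t) z
          + forcing q t (γ t) (γθ t) (γa t) e h z)))
        = lam * ((ζ z * (ζ z * W z)) * dq e h (γ t) z * ((ζ z * (ζ z * W z))
        * (psiA q t (γ t) z.1 z.2 * dq e h (γθ t) z - psiT q t (γ t) z.1 z.2 * dq e h (γa t) z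
          + forcing q t (γ t) (γθ t) (γa t) e h z))) :=
      fun z => by ring
    simp_rw [e1]
    rw [integral_const_mul, abs_mul]
    refine (mul_le_mul_of_nonneg_left i1 (abs_nonneg lam)).trans ?_
    have r1 := hs.potConst_div_le ht
    have r2 := hs.potConst_div_sqrt_le ht
    have r3 := hd.y_le t ht
    have r4 := hd.β₁_le t ht
    have r5 := hd.β₂_le t ht
    rw [mul_left_comm]
    refine mul_le_mul_of_nonneg_left ?_ hN0
    set Q := potConst q * (S t * S t) / (1 + t)
    set Q' := potConst q * (S t * S t) / ((1 + t) * √(1 + t))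
    have hQ : 0 ≤ Q := by positivity
    have hQ' : 0 ≤ Q' := by positivity
    have main : Q * (v t + C * h * M) + Q' * c * (y t + C * h * M)
        + Q * (4 * κ) * (y t + C * h * M) + (β₁ t * (x₁ t + C * h * M) + β₂ t * (x₂ t + C * h * M))
        ≤ (Q * v t + Q' * c * y t + β₁ t * x₁ t + β₂ t * x₂ t)
          + 4 * κ * (potConst q * M ^ 3)
          + C * M * (potConst q * M ^ 2 * (1 + c + 4 * κ) + 2 * M) * h := by
      have s1 : Q * (C * h * M) ≤ potConst q * M ^ 2 * (C * h * M) := by gcongr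
      have s2 : Q' * c * (C * h * M) ≤ potConst q * M ^ 2 * c * (C * h * M) := by gcongr
      have s3 : Q * (4 * κ) * (y t + C * h * M)
          ≤ potConst q * M ^ 2 * (4 * κ) * (M + C * h * M) := by gcongr
      have s4 : β₁ t * (C * h * M) ≤ M * (C * h * M) := by gcongr
      have s5 : β₂ t * (C * h * M) ≤ M * (C * h * M) := by gcongr
      linear_combination s1 + s2 + s3 + s4 + s5
    have := mul_le_mul_of_nonneg_left main (abs_nonneg lam)
    have h2 := hd.rate_le t ht
    calc _ ≤ _ := this
      _ = |lam| * (Q * v t + Q' * c * y t + β₁ t * x₁ t + β₂ t * x₂ t)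
          + (|lam| * (4 * κ * (potConst q * M ^ 3)) + K * h) := by rw [hK]; ring
      _ ≤ _ := add_le_add h2 le_rfl

/-- The step tends to zero while the cutoff is fixed, because the constant of the previous estimate
is not uniform in the cutoff. The surviving error is proportional to `κ`. -/
theorem energy_cutoff_le
    (hd : DerivativeBound q lam T γ γθ γa S D M e γe W V U₁ U₂ c y v x₁ x₂ β₁ β₂ B B')
    (hζ : IsCutoff ζ κ) {t : ℝ} (ht : t ∈ Icc 0 T) :
    eLpNorm (fun z => (ζ z * (ζ z * W z)) * γe t z) 2 phaseMeasure
      ≤ eLpNorm (fun z => W z * γe 0 z) 2 phaseMeasure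
        + ENNReal.ofReal ((B t - B 0) + |lam| * (4 * κ * (potConst q * M ^ 3)) * t) := by
  obtain ⟨K, hK⟩ := hd.exists_energy_dq_le hζ ht
  have hb := hd.sol.static t ht
  have hw : ContDiff ℝ 1 (fun z => ζ z * (ζ z * W z)) :=
    hζ.contDiff.mul (hζ.contDiff_mul hd.weight.contDiffOn)
  have hwc : HasCompactSupport (fun z => ζ z * (ζ z * W z)) := hζ.compact.mul_right
  have hws : tsupport (fun z => ζ z * (ζ z * W z)) ⊆ phaseSpace := hζ.tsupport_mul _
  have l1 := tendsto_eLpNorm_mul_dq_sub hd.dir_nonneg (hd.weak t ht) (locL2_of_memLp hb.memLp)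
    (hd.loc t ht) hw.continuous hwc hws
  have l2 : Filter.Tendsto (fun n : ℕ => ENNReal.ofReal K * ENNReal.ofReal (1 / (n + 1 : ℝ)))
      Filter.atTop (nhds 0) := by
    have := ENNReal.Tendsto.const_mul (a := ENNReal.ofReal K)
      (ENNReal.tendsto_ofReal (tendsto_div_succ 1)) (Or.inr ENNReal.ofReal_ne_top)
    simpa using this
  have l3 := tendsto_ofReal_add (tendsto_div_succ K)
    ((B t - B 0) + |lam| * (4 * κ * (potConst q * M ^ 3)) * t)
  have l4 := l1.add ((l2.add_const (eLpNorm (fun z => W z * γe 0 z) 2 phaseMeasure)).add l3)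
  rw [zero_add, zero_add] at l4
  refine ge_of_tendsto l4 (Filter.Eventually.of_forall fun n => ?_)
  have h1 := hK (1 / (n + 1 : ℝ)) Nat.one_div_pos_of_nat
  rw [mul_one_div] at h1
  refine le_trans ?_ (add_le_add le_rfl h1)
  have hsupp : ∀ f : ℝ × ℝ → ℝ, Function.support (fun z => (ζ z * (ζ z * W z)) * f z) ⊆ phaseSpace :=
    fun f z hz => hws (subset_tsupport _ (left_ne_zero_of_mul hz))
  rw [← eLpNorm_phaseMeasure_eq (hsupp _)]
  have m1 := hw.continuous.aestronglyMeasurable (μ := phaseMeasure)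
  have m2 := ((locL2_of_memLp hb.memLp).dq hd.dir_nonneg
    (Nat.one_div_pos_of_nat (α := ℝ) (n := n)).le).aestronglyMeasurable
  have m3 := (hd.loc t ht).aestronglyMeasurable
  have h2 := eLpNorm_sub_le (p := 2) (μ := phaseMeasure) (m1.mul m2) (m1.mul (m2.sub m3))
    (by norm_num)
  rw [add_comm]
  refine le_trans (le_of_eq ?_) h2
  congr 1
  ext z
  simp only [Pi.sub_apply, Pi.mul_apply]
  ring

theorem energy_le
    (hd : DerivativeBound q lam T γ γθ γa S D M e γe W V U₁ U₂ c y v x₁ x₂ β₁ β₂ B B')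
    {t : ℝ} (ht : t ∈ Icc 0 T) :
    eLpNorm (fun z => W z * γe t z) 2 phaseMeasure
      ≤ eLpNorm (fun z => W z * γe 0 z) 2 phaseMeasure + ENNReal.ofReal (B t - B 0) := by
  obtain ⟨cζ, ζ, hζ, h1⟩ := exists_isCutoff_seq
  refine eLpNorm_le_of_cutoff (ζ := ζ)
    (K := |lam| * (4 * cζ * (potConst q * M ^ 3)) * t)
    ((aestronglyMeasurable_of_contDiffOn hd.weight.contDiffOn).mul
      (hd.loc t ht).aestronglyMeasurable)
    (fun n => (hζ n).contDiff.continuous) h1 fun n => ?_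
  refine le_trans (le_of_eq ?_) ((hd.energy_cutoff_le (hζ n) ht).trans (le_of_eq ?_))
  · congr 1; ext z; simp only [Pi.mul_apply]; ring
  · congr 2; ring

end DerivativeBound

end

/-! ### Moments of solutions -/

theorem IsWeight.of_hasDerivAt {W V dT dA : ℝ × ℝ → ℝ} {c : ℝ} (hW : ContDiffOn ℝ 1 W phaseSpace)
    (hV : ContDiffOn ℝ 1 V phaseSpace) (hc : 0 ≤ c)
    (hT : ∀ z ∈ phaseSpace, HasDerivAt (fun θ => W (θ, z.2)) (dT z) z.1)
    (hA : ∀ z ∈ phaseSpace, HasDerivAt (fun a => W (z.1, a)) (dA z) z.2)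
    (hT' : ∀ z ∈ phaseSpace, |dT z| * (1 + 1 / z.2) ≤ |V z|)
    (hA' : ∀ z ∈ phaseSpace, |dA z| * z.2 ≤ c * |W z|) : IsWeight W V c := by
  have hd : ∀ z ∈ phaseSpace, DifferentiableAt ℝ W z := fun z hz =>
    (hW.contDiffAt (isOpen_phaseSpace.mem_nhds hz)).differentiableAt (by norm_num)
  refine ⟨hW, hV, hc, fun z hz => ?_, fun z hz => ?_⟩
  · rw [(hasDerivAt_of_contDiff_action (hd z hz)).unique (hA z hz)]
    exact hA' z hz
  · rw [(hasDerivAt_of_contDiff_theta (hd z hz)).unique (hT z hz)]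
    exact hT' z hz

/-- The weight is independent of `θ`, so the slowly decaying `Ψ_a` never acts on it; and `a ∂_a W =
20(a^20 - a^{-20})`. -/
theorem isWeight_actionWeight :
    IsWeight (fun z => actionWeight z.2) (fun _ => 0) 20 := by
  have h20 : ∀ z ∈ phaseSpace, (z : ℝ × ℝ).2 ≠ 0 := fun z hz => (mem_phaseSpace.1 hz).ne'
  have e : ∀ a : ℝ, actionWeight a = 1 / a ^ 20 + a ^ 20 := fun a => by
    unfold actionWeight; rw [zpow_neg, one_div]; norm_cast
  refine IsWeight.of_hasDerivAt (dT := fun _ => 0)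
    (dA := fun z => (-20 : ℤ) * z.2 ^ (-20 - 1 : ℤ) + 20 * z.2 ^ 19) ?_ contDiffOn_const
    (by norm_num) (fun z _ => hasDerivAt_const z.1 (actionWeight z.2)) (fun z hz => ?_)
    (fun z _ => by simp)
    fun z hz => ?_
  · simp only [e]
    exact (contDiffOn_div_pow 1 20).add (contDiff_snd.pow 20).contDiffOn
  · refine (hasDerivAt_zpow (-20) z.2 (Or.inl (h20 z hz))).add ?_
    simpa using hasDerivAt_pow 20 z.2
  · have ha := mem_phaseSpace.1 hz
    have h1 : (((-20 : ℤ) : ℝ) * z.2 ^ (-20 - 1 : ℤ) + 20 * z.2 ^ 19) * z.2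
        = 20 * (z.2 ^ 20 - z.2 ^ (-20 : ℤ)) := by
      rw [zpow_sub_one₀ ha.ne']
      push_cast
      field_simp
      ring
    have h2 : 0 < z.2 ^ (-20 : ℤ) := by positivity
    have h3 : 0 < z.2 ^ 20 := by positivity
    calc _ = |(((-20 : ℤ) : ℝ) * z.2 ^ (-20 - 1 : ℤ) + 20 * z.2 ^ 19) * z.2| := by
          rw [abs_mul, abs_of_pos ha]
      _ = 20 * |z.2 ^ 20 - z.2 ^ (-20 : ℤ)| := by rw [h1, abs_mul]; norm_num
      _ ≤ 20 * |actionWeight z.2| := by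
          unfold actionWeight
          rw [abs_of_pos (add_pos h2 h3)]
          gcongr
          rw [abs_le]; constructor <;> linarith

theorem isWeight_theta_pow :
    IsWeight (fun z => z.1 ^ 20) (fun z => 20 * z.1 ^ 19 * (1 + 1 / z.2)) 0 := by
  refine IsWeight.of_hasDerivAt (dT := fun z => 20 * z.1 ^ 19) (dA := fun _ => 0)
    (contDiff_fst.pow 20).contDiffOn ?_ le_rfl (fun z _ => by simpa using hasDerivAt_pow 20 z.1)
    (fun z _ => hasDerivAt_const z.2 (z.1 ^ 20)) (fun z hz => ?_) (fun z _ => by simp)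
  · refine ContDiffOn.mul (ContDiff.contDiffOn (by fun_prop)) (contDiffOn_const.add ?_)
    simpa using contDiffOn_div_pow 1 1
  · have ha := mem_phaseSpace.1 hz
    have : 0 < 1 + 1 / z.2 := by positivity
    rw [abs_mul (20 * z.1 ^ 19), abs_of_pos this]

theorem wNorm_mono {w w' : ℝ → ℝ → ℝ} {f : ℝ × ℝ → ℝ}
    (h : ∀ z ∈ phaseSpace, |w z.1 z.2| ≤ |w' z.1 z.2|) : wNorm w f ≤ wNorm w' f := by
  refine eLpNorm_mono_ae ?_
  filter_upwards [ae_mem_phaseSpace] with z hz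
  rw [norm_mul, norm_mul]
  exact mul_le_mul_of_nonneg_right (h z hz) (norm_nonneg _)

theorem wNorm_le_of_abs_le {w w' : ℝ → ℝ → ℝ} {f : ℝ × ℝ → ℝ} {c A : ℝ} (hc : 0 ≤ c)
    (h : ∀ z ∈ phaseSpace, |w z.1 z.2| ≤ c * |w' z.1 z.2|) (hA : wNorm w' f ≤ ENNReal.ofReal A) :
    wNorm w f ≤ ENNReal.ofReal (c * A) := by
  rw [ENNReal.ofReal_mul hc]
  refine le_trans ?_ (mul_le_mul_right hA _)
  refine le_trans (eLpNorm_mono_ae (g := fun z => c * (w' z.1 z.2 * f z)) ?_)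
    (eLpNorm_bounded_mul_le (v := fun _ => c) (f := fun z => w' z.1 z.2 * f z) (M := c)
      (Filter.Eventually.of_forall fun _ => (abs_of_nonneg hc).le))
  filter_upwards [ae_mem_phaseSpace] with z hz
  rw [Real.norm_eq_abs, Real.norm_eq_abs, abs_mul, abs_mul, abs_mul, abs_of_nonneg hc, ← mul_assoc]
  exact mul_le_mul_of_nonneg_right (h z hz) (abs_nonneg _)

theorem actionWeight_le_momentWeight {a : ℝ} (θ : ℝ) : actionWeight a ≤ momentWeight θ a := by
  have : 0 ≤ θ ^ 20 := Even.pow_nonneg (by decide) θ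
  unfold actionWeight momentWeight; linarith

theorem hasDerivAt_one_add_rpow (K : ℝ) {κ t : ℝ} (hκ : κ ≠ 0) (ht : 0 ≤ t) :
    HasDerivAt (fun t => K * ((1 + t) ^ κ / κ)) (K * (1 + t) ^ (κ - 1)) t := by
  have h := ((((hasDerivAt_id t).const_add 1).rpow_const (p := κ)
    (Or.inl (by simp only [id_eq]; positivity))).div_const κ).const_mul K
  refine h.congr_deriv ?_
  simp only [id_eq]
  field_simp

/-- The bootstrap assumptions on a solution. -/
structure Bootstrap (q lam T : ℝ) (γ : ℝ → L2) (γθ γa : ℝ → ℝ × ℝ → ℝ) (ε δ : ℝ) : Prop where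
  q_pos : 0 < q
  T_nonneg : 0 ≤ T
  isSolution : IsSolution q lam T γ γθ γa
  ε_pos : 0 < ε
  ε_le : ε ≤ δ
  δ_le : δ ≤ 1 / 12
  moment_zero : wNorm momentWeight (γ 0) ≤ ENNReal.ofReal ε
  moment : ∀ t ∈ Icc 0 T, wNorm momentWeight (γ t) ≤ ENNReal.ofReal (ε * (1 + t) ^ δ)
  theta : ∀ t ∈ Icc 0 T, wNorm (fun _ a => a + a⁻¹) (γθ t) ≤ ENNReal.ofReal (ε * (1 + t) ^ δ)
  action : ∀ t ∈ Icc 0 T, wNorm (fun _ a => a) (γa t) ≤ ENNReal.ofReal (ε * (1 + t) ^ δ)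

/-- The constant in the improved bound of the decay norm. -/
def decayGain (q lam : ℝ) : ℝ := 2 + 320 * (|lam| * potConst q)

theorem two_le_decayGain {q : ℝ} (hq : 0 < q) (lam : ℝ) : 2 ≤ decayGain q lam := by
  have := potConst_nonneg hq
  unfold decayGain
  have : 0 ≤ 320 * (|lam| * potConst q) := by positivity
  linarith

section
variable {q lam T ε δ : ℝ} {γ : ℝ → L2} {γθ γa : ℝ → ℝ × ℝ → ℝ}

namespace Bootstrap

theorem δ_pos (hb : Bootstrap q lam T γ γθ γa ε δ) : 0 < δ := hb.ε_pos.trans_le hb.ε_le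

theorem ε_le_one (hb : Bootstrap q lam T γ γθ γa ε δ) : ε ≤ 1 := by
  linarith [hb.ε_le, hb.δ_le]

theorem one_le_rpow {t κ : ℝ} (ht : 0 ≤ t) (hκ : 0 ≤ κ) : 1 ≤ (1 + t) ^ κ :=
  Real.one_le_rpow (by linarith) hκ

theorem rpow_le_of_mem {t κ : ℝ} (ht : t ∈ Icc 0 T) (hκ : 0 ≤ κ) : (1 + t) ^ κ ≤ (1 + T) ^ κ :=
  Real.rpow_le_rpow (by linarith [ht.1]) (by linarith [ht.2]) hκ

/-- A first pass with a decay norm that may still grow like `(1+t)^δ`, obtained by bounding both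
parts of the decay weight by the full moment weight. -/
theorem staticBound_rough (hb : Bootstrap q lam T γ γθ γa ε δ) {t : ℝ} (ht : t ∈ Icc 0 T) :
    StaticBound q t (γ t) (γθ t) (γa t) (2 * (ε * (1 + t) ^ δ)) (ε * (1 + t) ^ δ) := by
  have ht0 := ht.1
  have hε := hb.ε_pos
  refine ⟨hb.q_pos, ht0, by positivity, by positivity, Lp.memLp _, hb.isSolution.weak_theta t ht,
    hb.isSolution.weak_action t ht, ?_, hb.theta t ht, hb.action t ht⟩
  refine wNorm_le_of_abs_le (by norm_num) (fun z hz => ?_) (hb.moment t ht)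
  have ha := mem_phaseSpace.1 hz
  have h1 := actionWeight_le_momentWeight (a := z.2) z.1
  have h2 := momentWeight_nonneg (θ := z.1) ha
  have h3 := one_le_decayWeight (θ := z.1) ha ht0
  have h4 : momentWeight z.1 z.2 / (1 + t) ≤ momentWeight z.1 z.2 :=
    div_le_self h2 (by linarith)
  rw [abs_of_nonneg (by linarith), abs_of_nonneg h2]
  unfold decayWeight; linarith

theorem solutionBound_rough (hb : Bootstrap q lam T γ γθ γa ε δ) :
    SolutionBound q lam T γ γθ γa (fun t => 2 * (ε * (1 + t) ^ δ)) (fun t => ε * (1 + t) ^ δ)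
      (2 * (ε * (1 + T) ^ δ)) := by
  have hε := hb.ε_pos
  have hT := hb.T_nonneg
  refine ⟨hb.isSolution, fun t ht => hb.staticBound_rough ht, fun t ht => ?_, fun t ht => ?_⟩
  · have := rpow_le_of_mem ht hb.δ_pos.le
    gcongr
  · have := rpow_le_of_mem ht hb.δ_pos.le
    have h0 : 0 ≤ ε * (1 + T) ^ δ := by positivity
    have : ε * (1 + t) ^ δ ≤ ε * (1 + T) ^ δ := by gcongr
    linarith

/-- With `δ ≤ 1/12` the exponent `3δ - 3/2` is at most `-5/4`, so three growing factors still leave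
an integrable rate. -/
theorem rpow_decay {t : ℝ} (ht : 0 ≤ t) (hδ : δ ≤ 1 / 12) :
    ((1 + t) ^ δ) ^ 3 / ((1 + t) * √(1 + t)) ≤ (1 + t) ^ (-(1 / 4) - 1 : ℝ) := by
  have hτ : 0 < 1 + t := by linarith
  have e1 : (1 + t) * √(1 + t) = (1 + t) ^ (3 / 2 : ℝ) := by
    rw [Real.sqrt_eq_rpow]
    nth_rewrite 1 [← Real.rpow_one (1 + t)]
    rw [← Real.rpow_add hτ]; norm_num
  rw [e1, ← Real.rpow_natCast, ← Real.rpow_mul hτ.le, ← Real.rpow_sub hτ]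
  refine Real.rpow_le_rpow_of_exponent_le (by linarith) ?_
  push_cast; linarith

/-- Only `Ψ_θ` acts on this weight, giving the integrable rate `80|lam| potConst q ε³ (1+t)^{-5/4}`,
where `80 = 4·20` from `S² = 4ε²(1+t)^{2δ}` and the weight constant. Integration produces the factor
`4`. -/
theorem actionWeight_le (hb : Bootstrap q lam T γ γθ γa ε δ) {t : ℝ} (ht : t ∈ Icc 0 T) :
    wNorm (fun _ a => actionWeight a) (γ t) ≤ wNorm (fun _ a => actionWeight a) (γ 0)
      + ENNReal.ofReal (320 * (|lam| * potConst q) * ε ^ 3) := by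
  have hε := hb.ε_pos
  have hP := potConst_nonneg hb.q_pos
  have hs := hb.solutionBound_rough
  have hy : ∀ t ∈ Icc 0 T, eLpNorm (fun z => actionWeight z.2 * γ t z) 2 phaseMeasure
      ≤ ENNReal.ofReal (ε * (1 + t) ^ δ) := fun t ht => by
    refine le_trans (wNorm_mono (w := fun _ a => actionWeight a) fun z hz => ?_) (hb.moment t ht)
    have ha := mem_phaseSpace.1 hz
    exact abs_le_abs_of_nonneg (actionWeight_nonneg ha) (actionWeight_le_momentWeight _)
  have h := hs.moment_energy isWeight_actionWeight (y := fun t => ε * (1 + t) ^ δ)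
    (v := fun _ => 0) (B := fun t => 80 * (|lam| * potConst q) * ε ^ 3
      * ((1 + t) ^ (-(1 / 4) : ℝ) / (-(1 / 4))))
    (B' := fun t => 80 * (|lam| * potConst q) * ε ^ 3 * (1 + t) ^ (-(1 / 4) - 1 : ℝ))
    (fun t ht => by have := ht.1; positivity) (fun _ _ => le_rfl)
    (fun t ht => by
      have := hs.D_le t ht
      exact this) hy (fun t _ => by simp)
    (fun t ht => hasDerivAt_one_add_rpow _ (by norm_num) ht.1)
    (fun t ht => by
      have ht0 := ht.1
      have := rpow_decay ht0 hb.δ_le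
      calc _ = 80 * (|lam| * potConst q) * ε ^ 3 * (((1 + t) ^ δ) ^ 3 / ((1 + t) * √(1 + t))) := by
            ring
        _ ≤ _ := by gcongr) t ht
  refine h.trans (add_le_add le_rfl (ENNReal.ofReal_le_ofReal ?_))
  have h1 : 0 < (1 + t) ^ (-(1 / 4) : ℝ) := Real.rpow_pos_of_pos (by linarith [ht.1]) _
  have h2 : 0 ≤ 80 * (|lam| * potConst q) * ε ^ 3 := by positivity
  simp only [add_zero, Real.one_rpow]
  nlinarith [mul_nonneg h2 h1.le]

/-- The action moments are now bounded, and the full moment, though growing like `(1+t)^δ`, is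
divided by `1+t` in the decay weight. Thus `S` no longer depends on time. -/
theorem staticBound (hb : Bootstrap q lam T γ γθ γa ε δ) {t : ℝ} (ht : t ∈ Icc 0 T) :
    StaticBound q t (γ t) (γθ t) (γa t) (decayGain q lam * ε) (ε * (1 + t) ^ δ) := by
  have ht0 := ht.1
  have hε := hb.ε_pos
  have hA := two_le_decayGain hb.q_pos lam
  have hP := potConst_nonneg hb.q_pos
  have h := hb.staticBound_rough ht
  refine ⟨hb.q_pos, ht0, by positivity, by positivity, Lp.memLp _, hb.isSolution.weak_theta t ht,
    hb.isSolution.weak_action t ht, ?_, hb.theta t ht, hb.action t ht⟩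
  have m : ∀ {w : ℝ × ℝ → ℝ}, Measurable w →
      AEStronglyMeasurable (fun z => w z * γ t z) phaseMeasure := fun hw =>
    hw.aestronglyMeasurable.mul h.aesm
  have n1 : eLpNorm (fun z => actionWeight z.2 * γ t z) 2 phaseMeasure
      ≤ ENNReal.ofReal (ε + 320 * (|lam| * potConst q) * ε ^ 3) := by
    refine (hb.actionWeight_le ht).trans ?_
    rw [ENNReal.ofReal_add hε.le (by positivity)]
    refine add_le_add (le_trans (wNorm_mono fun z hz => ?_) hb.moment_zero) le_rfl
    have ha := mem_phaseSpace.1 hz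
    exact abs_le_abs_of_nonneg (actionWeight_nonneg ha) (actionWeight_le_momentWeight _)
  have h3 := eLpNorm_le_of_abs_le (F := fun z => decayWeight t z.1 z.2 * γ t z)
    (f₁ := fun z => actionWeight z.2 * γ t z) (f₂ := fun z => momentWeight z.1 z.2 * γ t z)
    (f₃ := fun _ => 0) (c₁ := 1) (c₂ := 1 / (1 + t)) (c₃ := 0)
    (m (by unfold actionWeight; fun_prop)) (m (by unfold momentWeight; fun_prop))
    aestronglyMeasurable_const (by norm_num) (by positivity) le_rfl (by positivity)
    (v₂ := ε * (1 + t) ^ δ) (by positivity) (v₃ := 0) le_rfl n1 (hb.moment t ht) (by simp) (by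
      filter_upwards [ae_mem_phaseSpace] with z hz
      have ha := mem_phaseSpace.1 hz
      have h1 := actionWeight_nonneg ha
      have h2 := momentWeight_nonneg (θ := z.1) ha
      have h3 := one_le_decayWeight (θ := z.1) ha ht0
      rw [abs_mul, abs_mul, abs_mul, abs_of_nonneg h1, abs_of_nonneg h2,
        abs_of_nonneg (zero_le_one.trans h3)]
      unfold decayWeight
      apply le_of_eq; ring)
  refine h3.trans (ENNReal.ofReal_le_ofReal ?_)
  have h4 : (1 + t) ^ δ ≤ 1 + t := by
    conv_rhs => rw [← Real.rpow_one (1 + t)]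
    exact Real.rpow_le_rpow_of_exponent_le (by linarith) (by linarith [hb.δ_le])
  have h5 : 1 / (1 + t) * (ε * (1 + t) ^ δ) ≤ ε := by
    rw [one_div, inv_mul_le_iff₀ (by linarith), mul_comm]
    gcongr
  have h6 : ε ^ 3 ≤ ε := pow_le_of_le_one hε.le hb.ε_le_one (by norm_num)
  have h7 : 320 * (|lam| * potConst q) * ε ^ 3 ≤ 320 * (|lam| * potConst q) * ε := by gcongr
  unfold decayGain
  linarith

theorem solutionBound (hb : Bootstrap q lam T γ γθ γa ε δ) {M : ℝ} (hM : decayGain q lam * ε ≤ M)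
    (hM' : ε * (1 + T) ^ δ ≤ M) :
    SolutionBound q lam T γ γθ γa (fun _ => decayGain q lam * ε) (fun t => ε * (1 + t) ^ δ) M := by
  have hε := hb.ε_pos
  refine ⟨hb.isSolution, fun t ht => hb.staticBound ht, fun t ht => hM, fun t ht => ?_⟩
  refine le_trans ?_ hM'
  have := rpow_le_of_mem ht hb.δ_pos.le
  gcongr

theorem abs_pow_mul_le_momentWeight {θ a : ℝ} (ha : 0 < a) :
    |20 * θ ^ 19 * (1 + 1 / a)| ≤ 40 * momentWeight θ a := by
  have h1 := one_le_size (θ := θ) ha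
  have h2 := inv_le_size (θ := θ) (a := a)
  have h3 := abs_le_size (θ := θ) (a := a)
  have h4 := size_pow_le (θ := θ) ha (le_refl 20)
  have hi : 0 < 1 / a := by positivity
  rw [abs_mul, abs_mul, abs_pow, abs_of_pos (by positivity : 0 < 1 + 1 / a)]
  norm_num only [abs_of_pos]
  rw [← one_div] at h2
  calc 20 * |θ| ^ 19 * (1 + 1 / a) ≤ 20 * size θ a ^ 19 * (size θ a + size θ a) := by gcongr
    _ = 40 * size θ a ^ 20 := by ring
    _ ≤ _ := by gcongr

/-- Now `Ψ_a` acts on the weight and the rate is `ε³(1+t)^{δ-1}`, whose integral is `ε³((1+t)^δ -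
1)/δ`. The condition `ε ≤ δ` turns `ε³/δ` into `ε²`, so the slow growth is exactly affordable. -/
theorem theta_pow_le (hb : Bootstrap q lam T γ γθ γa ε δ) {t : ℝ} (ht : t ∈ Icc 0 T) :
    wNorm (fun θ _ => θ ^ 20) (γ t) ≤ wNorm (fun θ _ => θ ^ 20) (γ 0)
      + ENNReal.ofReal (40 * (|lam| * potConst q) * decayGain q lam ^ 2 * ε ^ 2
        * ((1 + t) ^ δ - 1)) := by
  have hε := hb.ε_pos
  have hδ := hb.δ_pos
  have hT := hb.T_nonneg
  have hA := two_le_decayGain hb.q_pos lam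
  have hP := potConst_nonneg hb.q_pos
  have hM0 : 0 ≤ ε * (1 + T) ^ δ := by positivity
  have hAε : 0 ≤ decayGain q lam * ε := by positivity
  have hs := hb.solutionBound (M := decayGain q lam * ε + ε * (1 + T) ^ δ) (by linarith)
    (by linarith)
  set K := 40 * (|lam| * potConst q) * decayGain q lam ^ 2 * ε ^ 3 with hK
  have h := hs.moment_energy isWeight_theta_pow (y := fun t => ε * (1 + t) ^ δ)
    (v := fun t => 40 * (ε * (1 + t) ^ δ)) (B := fun t => K * ((1 + t) ^ δ / δ))
    (B' := fun t => K * (1 + t) ^ (δ - 1))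
    (fun t ht => by have := ht.1; positivity) (fun t ht => by have := ht.1; positivity)
    (fun t ht => hs.D_le t ht)
    (fun t ht => by
      refine le_trans (wNorm_mono (w := fun θ _ => θ ^ 20) fun z hz => ?_) (hb.moment t ht)
      have ha := mem_phaseSpace.1 hz
      have h1 : 0 ≤ z.1 ^ 20 := Even.pow_nonneg (by decide) _
      refine abs_le_abs_of_nonneg h1 ?_
      have h2 : 0 < z.2 ^ (-20 : ℤ) := by positivity
      have h3 : 0 < z.2 ^ 20 := by positivity
      unfold momentWeight; linarith)
    (fun t ht => wNorm_le_of_abs_le (w := fun θ a => 20 * θ ^ 19 * (1 + 1 / a)) (by norm_num)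
      (fun z hz => by
        have ha := mem_phaseSpace.1 hz
        rw [abs_of_nonneg (momentWeight_nonneg ha)]
        exact abs_pow_mul_le_momentWeight ha) (hb.moment t ht))
    (fun t ht => hasDerivAt_one_add_rpow _ hδ.ne' ht.1)
    (fun t ht => by
      have hτ : 0 < 1 + t := by linarith [ht.1]
      rw [Real.rpow_sub_one hτ.ne', hK]
      apply le_of_eq; ring) t ht
  refine h.trans (add_le_add le_rfl (ENNReal.ofReal_le_ofReal ?_))
  have h1 := one_le_rpow ht.1 hδ.le
  simp only [add_zero, Real.one_rpow]
  have h2 : ε ^ 3 / δ ≤ ε ^ 2 := by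
    rw [div_le_iff₀ hδ, pow_succ]
    gcongr
    exact hb.ε_le
  calc _ = 40 * (|lam| * potConst q) * decayGain q lam ^ 2 * (ε ^ 3 / δ) * ((1 + t) ^ δ - 1) := by
        rw [hK]; ring
    _ ≤ _ := by
        have : 0 ≤ (1 + t) ^ δ - 1 := by linarith
        gcongr

end Bootstrap
end

/-! ### Derivatives of solutions -/

theorem abs_dq_theta_le {f : ℝ × ℝ → ℝ} {f' : ℝ → ℝ} {K h : ℝ} (hh : 0 < h) {z : ℝ × ℝ}
    (hf : ∀ θ, HasDerivAt (fun θ => f (θ, z.2)) (f' θ) θ) (hK : ∀ θ, |f' θ| ≤ K) :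
    |dq (1, 0) h f z| ≤ K := by
  have h1 := convex_univ.norm_image_sub_le_of_norm_hasDerivWithin_le
    (f := fun θ => f (θ, z.2)) (x := z.1) (y := z.1 + h)
    (fun θ _ => (hf θ).hasDerivWithinAt) (fun θ _ => hK θ) (mem_univ _) (mem_univ _)
  have e : z + h • ((1, 0) : ℝ × ℝ) = (z.1 + h, z.2) := by ext <;> simp
  unfold dq
  rw [e, abs_div, abs_of_pos hh, div_le_iff₀ hh]
  simpa [abs_of_pos hh] using h1

theorem abs_dq_action_le {f : ℝ × ℝ → ℝ} {f' : ℝ → ℝ} {K h : ℝ} (hh : 0 < h) {z : ℝ × ℝ}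
    (hf : ∀ a, z.2 ≤ a → HasDerivAt (fun a => f (z.1, a)) (f' a) a)
    (hK : ∀ a, z.2 ≤ a → |f' a| ≤ K) : |dq (0, 1) h f z| ≤ K := by
  have h1 := (convex_Ici z.2).norm_image_sub_le_of_norm_hasDerivWithin_le
    (f := fun a => f (z.1, a)) (x := z.2) (y := z.2 + h)
    (fun a ha => (hf a ha).hasDerivWithinAt) (fun a ha => hK a ha) self_mem_Ici
    (mem_Ici.2 (by linarith))
  have e : z + h • ((0, 1) : ℝ × ℝ) = (z.1, z.2 + h) := by ext <;> simp
  unfold dq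
  rw [e, abs_div, abs_of_pos hh, div_le_iff₀ hh]
  simpa [abs_of_pos hh] using h1

theorem contDiffOn_rpow_snd (s : ℝ) : ContDiffOn ℝ 1 (fun z : ℝ × ℝ => z.2 ^ s) phaseSpace :=
  contDiff_snd.contDiffOn.rpow_const_of_ne fun _ hz => (mem_phaseSpace.1 hz).ne'

theorem isWeight_mul_omega {g g' : ℝ → ℝ} (hg : ContDiffOn ℝ 1 (fun z : ℝ × ℝ => g z.2) phaseSpace)
    (hd : ∀ a, 0 < a → HasDerivAt g (g' a) a) (hle : ∀ a, 0 < a → |g' a| * a ≤ |g a|) (p : ℕ)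
    (s : ℝ) : IsWeight (fun z => g z.2 * omega p s z.1 z.2)
      (fun z => g z.2 * (p * z.1 ^ (p - 1) * z.2 ^ s) * (1 + 1 / z.2)) (|s| + 1) := by
  refine IsWeight.of_hasDerivAt (dT := fun z => g z.2 * (p * z.1 ^ (p - 1) * z.2 ^ s))
    (dA := fun z => g' z.2 * omega p s z.1 z.2
      + g z.2 * (z.1 ^ p * (s * z.2 ^ (s - 1)))) ?_ ?_ (by positivity) (fun z hz => ?_)
    (fun z hz => ?_) (fun z hz => ?_) fun z hz => ?_
  · exact hg.mul ((contDiff_fst.pow p).contDiffOn.mul (contDiffOn_rpow_snd s))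
  · refine (hg.mul (ContDiffOn.mul ?_ (contDiffOn_rpow_snd s))).mul (contDiffOn_const.add ?_)
    · exact (contDiff_const.mul (contDiff_fst.pow (p - 1))).contDiffOn
    · simpa using contDiffOn_div_pow 1 1
  · exact ((hasDerivAt_pow p z.1).mul_const (z.2 ^ s)).const_mul (g z.2)
  · have ha := mem_phaseSpace.1 hz
    exact (hd z.2 ha).mul ((Real.hasDerivAt_rpow_const (Or.inl ha.ne')).const_mul (z.1 ^ p))
  · have ha := mem_phaseSpace.1 hz
    have : 0 < 1 + 1 / z.2 := by positivity
    rw [abs_mul _ (1 + 1 / z.2), abs_of_pos this]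
  · have ha := mem_phaseSpace.1 hz
    have e : g z.2 * (z.1 ^ p * (s * z.2 ^ (s - 1))) * z.2 = s * (g z.2 * omega p s z.1 z.2) := by
      rw [Real.rpow_sub_one ha.ne']; unfold omega; field_simp
    calc _ = |g' z.2 * z.2 * omega p s z.1 z.2 + s * (g z.2 * omega p s z.1 z.2)| := by
          rw [← abs_of_pos ha, ← abs_mul, abs_of_pos ha, add_mul, e]; ring_nf
      _ ≤ |g' z.2| * z.2 * |omega p s z.1 z.2| + |s| * |g z.2 * omega p s z.1 z.2| := by
          refine (abs_add_le _ _).trans (le_of_eq ?_)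
          rw [abs_mul, abs_mul, abs_mul s, abs_of_pos ha]
      _ ≤ |g z.2| * |omega p s z.1 z.2| + |s| * |g z.2 * omega p s z.1 z.2| := by
          gcongr
          exact hle _ ha
      _ = _ := by rw [abs_mul]; ring

theorem contDiffOn_add_inv : ContDiffOn ℝ 1 (fun z : ℝ × ℝ => z.2 + z.2⁻¹) phaseSpace := by
  simpa using contDiff_snd.contDiffOn.add (contDiffOn_div_pow 1 1)

theorem isWeight_omegaOne (p : ℕ) (s : ℝ) : IsWeight (fun z => omegaOne p s z.1 z.2)
    (fun z => (z.2 + z.2⁻¹) * (p * z.1 ^ (p - 1) * z.2 ^ s) * (1 + 1 / z.2)) (|s| + 1) := by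
  refine isWeight_mul_omega (g := fun a => a + a⁻¹) (g' := fun a => 1 + -(a ^ 2)⁻¹)
    contDiffOn_add_inv (fun a ha => (hasDerivAt_id a).add (hasDerivAt_inv ha.ne'))
    (fun a ha => ?_) p s
  have h : (1 + -(a ^ 2)⁻¹) * a = a - a⁻¹ := by field_simp; ring
  have hi : 0 < a⁻¹ := by positivity
  conv_lhs => rw [← abs_of_pos ha, ← abs_mul, abs_of_pos ha]
  rw [h, abs_of_pos (add_pos ha hi), abs_le]
  constructor <;> linarith

theorem isWeight_omegaTwo (p : ℕ) (s : ℝ) : IsWeight (fun z => omegaTwo p s z.1 z.2)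
    (fun z => z.2 * (p * z.1 ^ (p - 1) * z.2 ^ s) * (1 + 1 / z.2)) (|s| + 1) :=
  isWeight_mul_omega (g := fun a => a) (g' := fun _ => 1) contDiff_snd.contDiffOn
    (fun a _ => hasDerivAt_id a) (fun a ha => by simp [abs_of_pos ha]) p s

/-- The loss of one power of `θ` is absorbed by the weights with exponents `s` and `s - 3`. -/
theorem eLpNorm_lower_weight_le {g : ℝ → ℝ} (hg : Measurable g) {f : ℝ × ℝ → ℝ}
    (hf : AEStronglyMeasurable f phaseMeasure) {p : ℕ} {s A : ℝ} (hA : 0 ≤ A)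
    (h : ∀ r, r = s ∨ r = s - 3 →
      wNorm (fun θ a => g a * omega p r θ a) f ≤ ENNReal.ofReal A) :
    eLpNorm (fun z => g z.2 * (((p + 1 : ℕ) : ℝ) * z.1 ^ (p + 1 - 1) * z.2 ^ s) * (1 + 1 / z.2)
      * f z) 2 phaseMeasure ≤ ENNReal.ofReal (3 * (p + 1 : ℕ) * A) := by
  have m : ∀ r, AEStronglyMeasurable (fun z : ℝ × ℝ => g z.2 * omega p r z.1 z.2 * f z)
      phaseMeasure := fun r =>
    (Measurable.aestronglyMeasurable (by unfold omega; fun_prop)).mul hf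
  refine (eLpNorm_le_of_abs_le (m s) (m (s - 3)) (f₃ := fun _ => 0) aestronglyMeasurable_const
    (c₁ := 2 * (p + 1 : ℕ)) (c₂ := (p + 1 : ℕ)) (c₃ := 0) (by positivity) (by positivity) le_rfl
    hA hA (v₃ := 0) le_rfl (h s (Or.inl rfl)) (h (s - 3) (Or.inr rfl)) (by simp) ?_).trans
    (ENNReal.ofReal_le_ofReal (by linarith))
  filter_upwards [ae_mem_phaseSpace] with z hz
  have ha := mem_phaseSpace.1 hz
  have hr : 0 < z.2 ^ (s - 3) := Real.rpow_pos_of_pos ha _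
  have e : z.2 ^ s = z.2 ^ (s - 3) * z.2 ^ 3 := by
    rw [← Real.rpow_natCast z.2 3, ← Real.rpow_add ha]; norm_num
  -- The loss `1 + 1/a` becomes `a³ + a²` after extracting `a^{s-3}`; since `a² ≤ a³ + 1`, the
  -- exponents `s` and `s-3` suffice. This is where the form of compatibility comes from.
  have key : z.2 ^ 3 * (1 + 1 / z.2) ≤ 2 * z.2 ^ 3 + 1 := by
    have : z.2 ^ 3 * (1 + 1 / z.2) = z.2 ^ 3 + z.2 ^ 2 := by field_simp
    rw [this]
    rcases le_total 1 z.2 with h1 | h1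
    · nlinarith [pow_le_pow_right₀ h1 (show 2 ≤ 3 by norm_num)]
    · nlinarith [pow_le_one₀ (n := 2) ha.le h1, pow_pos ha 3]
  have hp : (0 : ℝ) ≤ (p + 1 : ℕ) := by positivity
  have h3 : 0 < z.2 ^ 3 := by positivity
  have h4 : 0 < 1 + 1 / z.2 := by positivity
  unfold omega
  simp only [abs_mul, add_tsub_cancel_right, e, abs_of_nonneg hp, abs_of_pos hr, abs_of_pos h3,
    abs_of_pos h4, mul_zero, abs_zero, add_zero]
  have := mul_le_mul_of_nonneg_left key
    (by positivity : 0 ≤ |g z.2| * ((p + 1 : ℕ) : ℝ) * |z.1 ^ p| * z.2 ^ (s - 3) * |f z|)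
  calc _ = |g z.2| * ((p + 1 : ℕ) : ℝ) * |z.1 ^ p| * z.2 ^ (s - 3) * |f z|
        * (z.2 ^ 3 * (1 + 1 / z.2)) := by ring
    _ ≤ _ := this
    _ = _ := by ring

/-! ### Difference quotients of the gradient of the potential -/

section
variable {q t S D : ℝ} {γ γθ γa : ℝ × ℝ → ℝ}

theorem StaticBound.dq_theta_psiA_le (hb : StaticBound q t γ γθ γa S D) {h : ℝ} (hh : 0 < h)
    {z : ℝ × ℝ} (hz : z ∈ phaseSpace) : |dq (1, 0) h (fun z => psiA q t γ z.1 z.2) z|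
      ≤ potConst q * (S * (S + 2 * D)) / ((1 + t) * √(1 + t)) :=
  have ha := mem_phaseSpace.1 hz
  abs_dq_theta_le hh (fun _ => hb.hasDerivAt_psiA_theta ha) fun _ => hb.abs_psiTA_le ha

theorem StaticBound.dq_action_psiT_le (hb : StaticBound q t γ γθ γa S D) {h : ℝ} (hh : 0 < h)
    {z : ℝ × ℝ} (hz : z ∈ phaseSpace) : |dq (0, 1) h (fun z => psiT q t γ z.1 z.2) z|
      ≤ potConst q * (S * (S + 2 * D)) / ((1 + t) * √(1 + t)) :=
  have ha := mem_phaseSpace.1 hz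
  abs_dq_action_le hh (fun _ h => hb.hasDerivAt_psiT_action (ha.trans_le h))
    fun _ h => hb.abs_psiTA_le (ha.trans_le h)

/-- For `a ≥ 1` the unweighted bound of `Ψ_θθ` suffices, as `1/a ≤ a`. For `a ≤ 1` the bound with
`a²` cancels the `1/a` of the weight. Either way the forcing is measured by `a ∂_aγ`. -/
theorem StaticBound.dq_theta_psiT_le (hb : StaticBound q t γ γθ γa S D) {h : ℝ} (hh : 0 < h)
    {z : ℝ × ℝ} (hz : z ∈ phaseSpace) :
    (z.2 + z.2⁻¹) * |dq (1, 0) h (fun z => psiT q t γ z.1 z.2) z|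
      ≤ potConst q * (S * (S + 2 * D)) / ((1 + t) * √(1 + t)) * (2 * z.2) := by
  have ha := mem_phaseSpace.1 hz
  have ht := hb.t_nonneg; have hS := hb.S_nonneg; have hD := hb.D_nonneg
  have hP := potConst_nonneg hb.q_pos
  have h1 := abs_dq_theta_le hh (z := z) (f := fun z => psiT q t γ z.1 z.2)
    (fun θ => hb.hasDerivAt_psiT_theta (θ := θ) ha) fun _ => hb.abs_psiTT_le ha
  have h2 := abs_dq_theta_le hh (z := z) (f := fun z => psiT q t γ z.1 z.2)
    (fun θ => hb.hasDerivAt_psiT_theta (θ := θ) ha) fun _ => hb.abs_psiTT_le_mul ha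
  set b := potConst q * (S * (S + 2 * D)) / ((1 + t) * √(1 + t))
  have hb0 : 0 ≤ b := by positivity
  rcases le_total 1 z.2 with h3 | h3
  · have : z.2⁻¹ ≤ z.2 := (inv_le_one_of_one_le₀ h3).trans h3
    calc _ ≤ (z.2 + z.2) * b := by gcongr
      _ = _ := by ring
  · have : z.2 ^ 3 ≤ z.2 := pow_le_of_le_one ha.le h3 (by norm_num)
    calc _ ≤ (z.2 + z.2⁻¹) * (b * z.2 ^ 2) := by gcongr
      _ = b * (z.2 ^ 3 + z.2) := by field_simp
      _ ≤ b * (z.2 + z.2) := by gcongr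
      _ = _ := by ring

theorem StaticBound.dq_action_psiA_le (hb : StaticBound q t γ γθ γa S D) {h : ℝ} (hh : 0 < h)
    {z : ℝ × ℝ} (hz : z ∈ phaseSpace) :
    z.2 * |dq (0, 1) h (fun z => psiA q t γ z.1 z.2) z|
      ≤ potConst q * (S * (S + 2 * D)) / (1 + t) * (z.2 + z.2⁻¹) := by
  have ha := mem_phaseSpace.1 hz
  have ht := hb.t_nonneg; have hS := hb.S_nonneg; have hD := hb.D_nonneg
  have hP := potConst_nonneg hb.q_pos
  have h1 := abs_dq_action_le hh (z := z) (f := fun z => psiA q t γ z.1 z.2)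
    (K := potConst q * (S * (S + 2 * D)) / (1 + t) * (1 + 1 / z.2 ^ 2))
    (fun a h => hb.hasDerivAt_psiA_action (a := a) (ha.trans_le h)) fun a h => by
      refine (hb.abs_psiAA_le (ha.trans_le h)).trans ?_
      gcongr
  calc _ ≤ z.2 * (potConst q * (S * (S + 2 * D)) / (1 + t) * (1 + 1 / z.2 ^ 2)) := by gcongr
    _ = _ := by field_simp

end

/-! ### Propagation of the bounds for derivatives -/

/-- The constant in the improved bound of `∂_θ`. -/
def thetaGain (q lam : ℝ) (p : ℕ) (s : ℝ) : ℝ :=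
  4 * (|lam| * (potConst q * decayGain q lam ^ 2) * (3 * p + (|s| + 1) + 6))

/-- The constant in the improved bound of `∂_a`. -/
def actionGain (q lam : ℝ) (p : ℕ) (s : ℝ) : ℝ :=
  |lam| * (potConst q * decayGain q lam ^ 2) * (3 * p + (|s| + 1) + 2 * (1 + thetaGain q lam p s) + 2)

theorem thetaGain_nonneg {q : ℝ} (hq : 0 < q) (lam : ℝ) (p : ℕ) (s : ℝ) :
    0 ≤ thetaGain q lam p s := by
  have := potConst_nonneg hq
  unfold thetaGain; positivity

theorem actionGain_nonneg {q : ℝ} (hq : 0 < q) (lam : ℝ) (p : ℕ) (s : ℝ) :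
    0 ≤ actionGain q lam p s := by
  have := potConst_nonneg hq
  have := thetaGain_nonneg hq lam p s
  unfold actionGain; positivity

/-- The bootstrap assumptions together with those on the derivatives with weight `ω_{p,s}` and the
weights below it. -/
structure WeightedBootstrap (q lam T : ℝ) (γ : ℝ → L2) (γθ γa : ℝ → ℝ × ℝ → ℝ) (ε δ : ℝ) (p : ℕ)
    (s : ℝ) : Prop extends Bootstrap q lam T γ γθ γa ε δ where
  omegaOne_zero : wNorm (omegaOne p s) (γθ 0) ≤ ENNReal.ofReal ε
  omegaOne_le : ∀ t ∈ Icc 0 T,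
    wNorm (omegaOne p s) (γθ t) ≤ ENNReal.ofReal (ε * (1 + t) ^ ((p + 1 : ℝ) * δ))
  omegaTwo_le : ∀ t ∈ Icc 0 T,
    wNorm (omegaTwo p s) (γa t) ≤ ENNReal.ofReal (ε * (1 + t) ^ ((p + 1 : ℝ) * δ))
  lower_omegaOne : ∀ p', p = p' + 1 → ∀ t ∈ Icc 0 T, ∀ r, r = s ∨ r = s - 3 →
    wNorm (omegaOne p' r) (γθ t) ≤ ENNReal.ofReal (ε * (1 + t) ^ (p * δ))
  lower_omegaTwo : ∀ p', p = p' + 1 → ∀ t ∈ Icc 0 T, ∀ r, r = s ∨ r = s - 3 →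
    wNorm (omegaTwo p' r) (γa t) ≤ ENNReal.ofReal (ε * (1 + t) ^ (p * δ))

/-- The decay exponent of the rate of change of `∂_θγ` with weight `ω_{p,s}`. -/
def rateExponent (p : ℕ) (δ : ℝ) : ℝ := if p = 0 then -(1 / 4) else p * δ

theorem rateExponent_ne_zero {p : ℕ} {δ : ℝ} (hδ : 0 < δ) : rateExponent p δ ≠ 0 := by
  unfold rateExponent
  split_ifs with h
  · norm_num
  · have : (p : ℝ) ≠ 0 := by exact_mod_cast h
    positivity

/-- The case `p = 0` gives a bounded integral, the case `p ≥ 1` growth `(1+t)^{pδ}`. A factor `1/δ`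
is allowed in both because a spare `ε ≤ δ` will absorb it. -/
theorem rpow_sub_one_div_le {p : ℕ} {δ t : ℝ} (ht : 0 ≤ t) (hδ : 0 < δ) (hδ1 : δ ≤ 1) :
    ((1 + t) ^ rateExponent p δ - 1) / rateExponent p δ ≤ 4 / δ * (1 + t) ^ (p * δ) := by
  have h1 : (1:ℝ) ≤ 1 / δ := by rw [le_div_iff₀ hδ]; linarith
  unfold rateExponent
  split_ifs with h
  · subst h
    have : 0 < (1 + t) ^ (-(1 / 4) : ℝ) := Real.rpow_pos_of_pos (by linarith) _
    simp only [Nat.cast_zero, zero_mul, Real.rpow_zero]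
    have e : 4 / δ = 4 * (1 / δ) := by ring
    rw [div_neg, e]
    linarith
  · have hp : (1 : ℝ) ≤ p := by exact_mod_cast Nat.one_le_iff_ne_zero.2 h
    have h2 : 0 < (1 + t) ^ (p * δ) := Real.rpow_pos_of_pos (by linarith) _
    have h3 : δ ≤ p * δ := le_mul_of_one_le_left hδ.le hp
    calc _ ≤ (1 + t) ^ (p * δ) / (p * δ) := by gcongr; linarith
      _ ≤ (1 + t) ^ (p * δ) / δ := by gcongr
      _ ≤ 4 * ((1 + t) ^ (p * δ) / δ) := le_mul_of_one_le_left (by positivity) (by norm_num)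
      _ = _ := by ring

/-- The extra half power of decay exceeds the loss `2δ`; for `p = 0` it still leaves an integrable
rate. No smallness of `pδ` is needed. -/
theorem rpow_mul_decay_le {p : ℕ} {δ t : ℝ} (ht : 0 ≤ t) (hδ1 : δ ≤ 1 / 12) :
    (1 + t) ^ δ * (1 + t) ^ ((p + 1 : ℝ) * δ) / ((1 + t) * √(1 + t))
      ≤ (1 + t) ^ (rateExponent p δ - 1) := by
  have hτ : 0 < 1 + t := by linarith
  have e1 : (1 + t) * √(1 + t) = (1 + t) ^ (3 / 2 : ℝ) := by
    rw [Real.sqrt_eq_rpow]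
    nth_rewrite 1 [← Real.rpow_one (1 + t)]
    rw [← Real.rpow_add hτ]; norm_num
  rw [e1, ← Real.rpow_add hτ, ← Real.rpow_sub hτ]
  refine Real.rpow_le_rpow_of_exponent_le (by linarith) ?_
  unfold rateExponent
  split_ifs with h
  · subst h; push_cast; linarith
  · linarith

/-! ### Weighted energy estimates for the derivatives -/

section
variable {q lam T ε δ s : ℝ} {γ : ℝ → L2} {γθ γa : ℝ → ℝ × ℝ → ℝ} {p : ℕ}

namespace WeightedBootstrap

/-- The derivative norm occurs linearly in the bounds of second derivatives of the potential, so the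
coupling grows by a single factor `(1+t)^δ`. -/
theorem coupling_le (hb : Bootstrap q lam T γ γθ γa ε δ) {t : ℝ} (ht : 0 ≤ t) :
    potConst q * (decayGain q lam * ε * (decayGain q lam * ε + 2 * (ε * (1 + t) ^ δ)))
      ≤ 2 * (potConst q * decayGain q lam ^ 2) * ε ^ 2 * (1 + t) ^ δ := by
  have hε := hb.ε_pos
  have hA := two_le_decayGain hb.q_pos lam
  have hP := potConst_nonneg hb.q_pos
  have h1 := Bootstrap.one_le_rpow ht hb.δ_pos.le
  set A := decayGain q lam
  calc _ ≤ potConst q * (A * ε * (A * ε * (1 + t) ^ δ + A * (ε * (1 + t) ^ δ))) := by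
        have h2 : A * ε ≤ A * ε * (1 + t) ^ δ := le_mul_of_one_le_right (by positivity) h1
        have h3 : 2 * (ε * (1 + t) ^ δ) ≤ A * (ε * (1 + t) ^ δ) := by gcongr
        gcongr
    _ = _ := by ring

/-- A bound for all quantities in the energy estimates. -/
def bigConst (q lam ε δ T : ℝ) (p : ℕ) : ℝ :=
  decayGain q lam * ε + ε * (1 + T) ^ δ + ε * (1 + T) ^ ((p + 1 : ℝ) * δ)
    + 2 * (potConst q * decayGain q lam ^ 2) * ε ^ 2 * (1 + T) ^ δ

theorem le_bigConst (hb : Bootstrap q lam T γ γθ γa ε δ) (p : ℕ) :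
    decayGain q lam * ε ≤ bigConst q lam ε δ T p ∧ ε * (1 + T) ^ δ ≤ bigConst q lam ε δ T p ∧
    ε * (1 + T) ^ ((p + 1 : ℝ) * δ) ≤ bigConst q lam ε δ T p ∧
    2 * (potConst q * decayGain q lam ^ 2) * ε ^ 2 * (1 + T) ^ δ ≤ bigConst q lam ε δ T p := by
  have hε := hb.ε_pos
  have hT := hb.T_nonneg
  have hA := two_le_decayGain hb.q_pos lam
  have hP := potConst_nonneg hb.q_pos
  have h1 : 0 ≤ decayGain q lam * ε := by positivity
  have h2 : 0 ≤ ε * (1 + T) ^ δ := by positivity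
  have h3 : 0 ≤ ε * (1 + T) ^ ((p + 1 : ℝ) * δ) := by positivity
  have h4 : 0 ≤ 2 * (potConst q * decayGain q lam ^ 2) * ε ^ 2 * (1 + T) ^ δ := by positivity
  unfold bigConst
  refine ⟨?_, ?_, ?_, ?_⟩ <;> linarith

theorem coupling_div_le_bigConst (hb : Bootstrap q lam T γ γθ γa ε δ) (p : ℕ) {t d : ℝ}
    (ht : t ∈ Icc 0 T) (hd : 1 ≤ d) :
    2 * (potConst q * decayGain q lam ^ 2) * ε ^ 2 * (1 + t) ^ δ / d ≤ bigConst q lam ε δ T p := by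
  have ht0 := ht.1
  have hP := potConst_nonneg hb.q_pos
  refine (div_le_self (by positivity) hd).trans (le_trans ?_ (le_bigConst hb p).2.2.2)
  have := Bootstrap.rpow_le_of_mem ht hb.δ_pos.le
  gcongr

theorem one_le_mul_sqrt {t : ℝ} (ht : 0 ≤ t) : 1 ≤ (1 + t) * √(1 + t) :=
  one_le_mul_of_one_le_of_one_le (by linarith) (Real.one_le_sqrt.2 (by linarith))

/-- The forcing comes from `Ψ_θa` and `Ψ_θθ`, both with decay `(1+t)^{-3/2}`. The only rate of order
`1/(1+t)` arises when the weight itself is differentiated in `θ`; it is absent for `p = 0`, and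
otherwise involves the lower weights with growth `(1+t)^{pδ}`. -/
theorem derivativeBound_theta (hb : WeightedBootstrap q lam T γ γθ γa ε δ p s) :
    DerivativeBound q lam T γ γθ γa (fun _ => decayGain q lam * ε) (fun t => ε * (1 + t) ^ δ)
      (bigConst q lam ε δ T p) (1, 0) γθ (fun z => omegaOne p s z.1 z.2)
      (fun z => (z.2 + z.2⁻¹) * (p * z.1 ^ (p - 1) * z.2 ^ s) * (1 + 1 / z.2))
      (fun z => omegaOne p s z.1 z.2) (fun z => 2 * omegaTwo p s z.1 z.2) (|s| + 1)
      (fun t => ε * (1 + t) ^ ((p + 1 : ℝ) * δ)) (fun t => 3 * p * (ε * (1 + t) ^ (p * δ)))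
      (fun t => ε * (1 + t) ^ ((p + 1 : ℝ) * δ)) (fun t => 2 * (ε * (1 + t) ^ ((p + 1 : ℝ) * δ)))
      (fun t => 2 * (potConst q * decayGain q lam ^ 2) * ε ^ 2 * (1 + t) ^ δ
        / ((1 + t) * √(1 + t)))
      (fun t => 2 * (potConst q * decayGain q lam ^ 2) * ε ^ 2 * (1 + t) ^ δ
        / ((1 + t) * √(1 + t)))
      (fun t => thetaGain q lam p s / 4 * ε ^ 3
        * ((1 + t) ^ rateExponent p δ / rateExponent p δ))
      (fun t => thetaGain q lam p s / 4 * ε ^ 3 * (1 + t) ^ (rateExponent p δ - 1)) := by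
  have hε := hb.ε_pos
  have hδ := hb.δ_pos
  have hT := hb.T_nonneg
  have hA := two_le_decayGain hb.q_pos lam
  have hP := potConst_nonneg hb.q_pos
  obtain ⟨m1, m2, m3, -⟩ := le_bigConst hb.toBootstrap p
  have hst := fun t ht => hb.staticBound (t := t) ht
  have hκ : 0 ≤ (p + 1 : ℝ) * δ := by positivity
  have hβ : ∀ t ∈ Icc 0 T, potConst q * (decayGain q lam * ε * (decayGain q lam * ε
      + 2 * (ε * (1 + t) ^ δ))) / ((1 + t) * √(1 + t))
      ≤ 2 * (potConst q * decayGain q lam ^ 2) * ε ^ 2 * (1 + t) ^ δ / ((1 + t) * √(1 + t)) := by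
    intro t ht
    have ht0 := ht.1
    have := coupling_le hb.toBootstrap ht.1
    gcongr
  have hy : ∀ t ∈ Icc 0 T, 0 ≤ ε * (1 + t) ^ ((p + 1 : ℝ) * δ) := fun t ht => by
    have := ht.1; positivity
  exact {
    sol := hb.solutionBound m1 m2
    dir_nonneg := le_rfl
    weak := hb.isSolution.weak_theta
    loc := fun t ht => locL2_of_memLp (hst t ht).memLp_theta
    norm_le := fun t ht => by
      refine (wNorm_mono (w := fun _ a => a) (w' := fun _ a => a + a⁻¹) fun z hz => ?_).trans
        ((hb.theta t ht).trans (ENNReal.ofReal_le_ofReal ?_))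
      · have ha := mem_phaseSpace.1 hz
        have hi : 0 < z.2⁻¹ := by positivity
        exact abs_le_abs_of_nonneg ha.le (by linarith)
      · have := Bootstrap.rpow_le_of_mem ht hδ.le
        exact le_trans (by gcongr) m2
    weight := isWeight_omegaOne p s
    contDiff₁ := (isWeight_omegaOne p s).contDiffOn
    contDiff₂ := contDiffOn_const.mul (isWeight_omegaTwo p s).contDiffOn
    y_nonneg := hy
    v_nonneg := fun t ht => by have := ht.1; positivity
    x₁_nonneg := hy
    x₂_nonneg := fun t ht => by have := ht.1; positivity
    β₁_nonneg := fun t ht => by have := ht.1; positivity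
    β₂_nonneg := fun t ht => by have := ht.1; positivity
    y_le := fun t ht => by
      have := Bootstrap.rpow_le_of_mem ht hκ
      exact le_trans (by gcongr) m3
    β₁_le := fun t ht => coupling_div_le_bigConst hb.toBootstrap p ht (one_le_mul_sqrt ht.1)
    β₂_le := fun t ht => coupling_div_le_bigConst hb.toBootstrap p ht (one_le_mul_sqrt ht.1)
    norm_y := hb.omegaOne_le
    norm_v := fun t ht => by
      have ht0 := ht.1
      -- For `p = 0` the coefficient `p` kills the weight `V`; otherwise the bounds for the weights
      -- with exponent `p - 1` apply.
      rcases Nat.eq_zero_or_eq_succ_pred p with h | h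
      · subst h; simp
      · have := eLpNorm_lower_weight_le (g := fun a => a + a⁻¹) (by fun_prop) (hst t ht).aesm_theta
          (p := p.pred) (s := s) (by positivity : 0 ≤ ε * (1 + t) ^ (p * δ))
          fun r hr => hb.lower_omegaOne _ h t ht r hr
        rwa [← Nat.succ_eq_add_one, ← h] at this
    norm_x₁ := hb.omegaOne_le
    norm_x₂ := fun t ht => wNorm_le_of_abs_le (w := fun θ a => 2 * omegaTwo p s θ a) (by norm_num)
      (fun z _ => by rw [abs_mul, abs_two]) (hb.omegaTwo_le t ht)
    dq_psiA := fun t ht h hh z hz => by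
      rw [mul_comm]
      exact mul_le_mul_of_nonneg_right (((hst t ht).dq_theta_psiA_le hh hz).trans (hβ t ht))
        (abs_nonneg _)
    dq_psiT := fun t ht h hh z hz => by
      have ha := mem_phaseSpace.1 hz
      have hi : 0 < z.2 + z.2⁻¹ := by positivity
      have h1 := (hst t ht).dq_theta_psiT_le hh hz
      have h2 := mul_le_mul_of_nonneg_right (h1.trans (mul_le_mul_of_nonneg_right (hβ t ht)
        (by positivity))) (abs_nonneg (omega p s z.1 z.2))
      unfold omegaOne omegaTwo
      rw [abs_mul, abs_mul 2, abs_mul z.2, abs_of_pos hi, abs_of_pos ha, abs_two]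
      refine le_trans (le_of_eq (by ring)) (h2.trans (le_of_eq (by ring)))
    hasDerivAt := fun t ht => hasDerivAt_one_add_rpow _ (rateExponent_ne_zero hδ) ht.1
    rate_le := fun t ht => by
      have ht0 := ht.1
      have hτ : 0 < 1 + t := by linarith
      have h1 := rpow_mul_decay_le (p := p) ht0 hb.δ_le
      have h2 := Bootstrap.one_le_rpow ht0 hδ.le
      have h3 : (p : ℝ) * ((1 + t) ^ (p * δ) / (1 + t)) ≤ p * (1 + t) ^ (rateExponent p δ - 1) := by
        rcases eq_or_ne p 0 with h | h
        · simp [h]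
        · rw [Real.rpow_sub_one hτ.ne', rateExponent, if_neg h]
      have h4 : (1 + t) ^ ((p + 1 : ℝ) * δ) / ((1 + t) * √(1 + t))
          ≤ (1 + t) ^ (rateExponent p δ - 1) := by
        refine le_trans ?_ h1
        gcongr
        exact le_mul_of_one_le_left (by positivity) h2
      set Q := potConst q * decayGain q lam ^ 2 with hQ
      have hQ0 : 0 ≤ Q := by positivity
      set E := (1 + t) ^ (rateExponent p δ - 1)
      have g3 := mul_le_mul_of_nonneg_left h3 (by positivity : 0 ≤ 3 * Q * ε ^ 3)
      have g4 := mul_le_mul_of_nonneg_left h4 (by positivity : 0 ≤ Q * ε ^ 3 * (|s| + 1))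
      have g1 := mul_le_mul_of_nonneg_left h1 (by positivity : 0 ≤ 6 * Q * ε ^ 3)
      -- The summands are `3p` from the `θ`-derivative of the weight, `|s| + 1` from its
      -- `a`-derivative, and `6 = 2 + 4` from the two forcing terms.
      calc _ ≤ |lam| * (Q * (3 * p + (|s| + 1) + 6) * ε ^ 3 * E) := by
            refine mul_le_mul_of_nonneg_left ?_ (abs_nonneg _)
            refine le_trans (le_of_eq ?_) ((add_le_add (add_le_add g3 g4) g1).trans
              (le_of_eq (by ring)))
            rw [hQ]; ring
        _ = _ := by unfold thetaGain; ring }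

theorem omegaOne_improved (hb : WeightedBootstrap q lam T γ γθ γa ε δ p s) {t : ℝ}
    (ht : t ∈ Icc 0 T) : wNorm (omegaOne p s) (γθ t) ≤ wNorm (omegaOne p s) (γθ 0)
      + ENNReal.ofReal (thetaGain q lam p s * ε ^ 2 * (1 + t) ^ (p * δ)) := by
  have hε := hb.ε_pos
  have hδ := hb.δ_pos
  have ht0 := ht.1
  have hC := thetaGain_nonneg hb.q_pos lam p s
  refine (hb.derivativeBound_theta.energy_le ht).trans
    (add_le_add le_rfl (ENNReal.ofReal_le_ofReal ?_))
  have h1 := rpow_sub_one_div_le (p := p) ht0 hδ (by linarith [hb.δ_le])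
  have h2 : ε / δ ≤ 1 := (div_le_one hδ).2 hb.ε_le
  simp only [add_zero, Real.one_rpow]
  calc _ = thetaGain q lam p s / 4 * ε ^ 3
        * (((1 + t) ^ rateExponent p δ - 1) / rateExponent p δ) := by ring
    _ ≤ thetaGain q lam p s / 4 * ε ^ 3 * (4 / δ * (1 + t) ^ (p * δ)) := by gcongr
    _ = thetaGain q lam p s * ε ^ 2 * (1 + t) ^ (p * δ) * (ε / δ) := by ring
    _ ≤ _ := mul_le_of_le_one_right (by positivity) h2

/-- Compared with the bootstrap assumption one power `(1+t)^δ` is gained. It offsets the growing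
coupling in the equation for `∂_aγ`. -/
theorem omegaOne_rough (hb : WeightedBootstrap q lam T γ γθ γa ε δ p s) {t : ℝ}
    (ht : t ∈ Icc 0 T) : wNorm (omegaOne p s) (γθ t)
      ≤ ENNReal.ofReal ((1 + thetaGain q lam p s) * (ε * (1 + t) ^ (p * δ))) := by
  have hε := hb.ε_pos
  have hδ := hb.δ_pos
  have ht0 := ht.1
  have hC := thetaGain_nonneg hb.q_pos lam p s
  have h1 := Bootstrap.one_le_rpow ht0 (by positivity : 0 ≤ p * δ)
  have h2 : ε ^ 2 ≤ ε := pow_le_of_le_one hε.le hb.ε_le_one (by norm_num)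
  refine (hb.omegaOne_improved ht).trans ((add_le_add hb.omegaOne_zero le_rfl).trans ?_)
  rw [← ENNReal.ofReal_add hε.le (by positivity)]
  refine ENNReal.ofReal_le_ofReal ?_
  calc _ ≤ ε * (1 + t) ^ (p * δ) + thetaGain q lam p s * ε * (1 + t) ^ (p * δ) := by
        gcongr
        exact le_mul_of_one_le_right hε.le h1
    _ = _ := by ring

/-- The critical term is `Ψ_aa ∂_θγ`, with decay only `1/(1+t)` and a coupling growing like
`(1+t)^δ`. The improved bound `(1+t)^{pδ}` for `∂_θγ` keeps the product at `(1+t)^{(p+1)δ-1}`; the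
old one would lose another `δ`. -/
theorem derivativeBound_action (hb : WeightedBootstrap q lam T γ γθ γa ε δ p s) :
    DerivativeBound q lam T γ γθ γa (fun _ => decayGain q lam * ε) (fun t => ε * (1 + t) ^ δ)
      (bigConst q lam ε δ T p) (0, 1) γa (fun z => omegaTwo p s z.1 z.2)
      (fun z => z.2 * (p * z.1 ^ (p - 1) * z.2 ^ s) * (1 + 1 / z.2))
      (fun z => omegaOne p s z.1 z.2) (fun z => omegaTwo p s z.1 z.2) (|s| + 1)
      (fun t => ε * (1 + t) ^ ((p + 1 : ℝ) * δ)) (fun t => 3 * p * (ε * (1 + t) ^ (p * δ)))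
      (fun t => (1 + thetaGain q lam p s) * (ε * (1 + t) ^ (p * δ)))
      (fun t => ε * (1 + t) ^ ((p + 1 : ℝ) * δ))
      (fun t => 2 * (potConst q * decayGain q lam ^ 2) * ε ^ 2 * (1 + t) ^ δ / (1 + t))
      (fun t => 2 * (potConst q * decayGain q lam ^ 2) * ε ^ 2 * (1 + t) ^ δ
        / ((1 + t) * √(1 + t)))
      (fun t => actionGain q lam p s * ε ^ 3
        * ((1 + t) ^ ((p + 1 : ℝ) * δ) / ((p + 1 : ℝ) * δ)))
      (fun t => actionGain q lam p s * ε ^ 3 * (1 + t) ^ ((p + 1 : ℝ) * δ - 1)) := by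
  have hε := hb.ε_pos
  have hδ := hb.δ_pos
  have hT := hb.T_nonneg
  have hA := two_le_decayGain hb.q_pos lam
  have hP := potConst_nonneg hb.q_pos
  have hC := thetaGain_nonneg hb.q_pos lam p s
  obtain ⟨m1, m2, m3, -⟩ := le_bigConst hb.toBootstrap p
  have hst := fun t ht => hb.staticBound (t := t) ht
  have hκ : 0 ≤ (p + 1 : ℝ) * δ := by positivity
  have hy : ∀ t ∈ Icc 0 T, 0 ≤ ε * (1 + t) ^ ((p + 1 : ℝ) * δ) := fun t ht => by
    have := ht.1; positivity
  have hβ := fun t (ht : t ∈ Icc 0 T) => coupling_le hb.toBootstrap ht.1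
  exact {
    sol := hb.solutionBound m1 m2
    dir_nonneg := zero_le_one
    weak := hb.isSolution.weak_action
    loc := fun t ht => (hst t ht).locL2_action
    norm_le := fun t ht => by
      refine (hb.action t ht).trans (ENNReal.ofReal_le_ofReal ?_)
      have := Bootstrap.rpow_le_of_mem ht hδ.le
      exact le_trans (by gcongr) m2
    weight := isWeight_omegaTwo p s
    contDiff₁ := (isWeight_omegaOne p s).contDiffOn
    contDiff₂ := (isWeight_omegaTwo p s).contDiffOn
    y_nonneg := hy
    v_nonneg := fun t ht => by have := ht.1; positivity
    x₁_nonneg := fun t ht => by have := ht.1; positivity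
    x₂_nonneg := hy
    β₁_nonneg := fun t ht => by have := ht.1; positivity
    β₂_nonneg := fun t ht => by have := ht.1; positivity
    y_le := fun t ht => by
      have := Bootstrap.rpow_le_of_mem ht hκ
      exact le_trans (by gcongr) m3
    β₁_le := fun t ht => coupling_div_le_bigConst hb.toBootstrap p ht (by linarith [ht.1])
    β₂_le := fun t ht => coupling_div_le_bigConst hb.toBootstrap p ht (one_le_mul_sqrt ht.1)
    norm_y := hb.omegaTwo_le
    norm_v := fun t ht => by
      have ht0 := ht.1
      rcases Nat.eq_zero_or_eq_succ_pred p with h | h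
      · subst h; simp
      · have := eLpNorm_lower_weight_le (g := fun a => a) measurable_id (hst t ht).aesm_action
          (p := p.pred) (s := s) (by positivity : 0 ≤ ε * (1 + t) ^ (p * δ))
          fun r hr => hb.lower_omegaTwo _ h t ht r hr
        rwa [← Nat.succ_eq_add_one, ← h] at this
    norm_x₁ := fun t ht => hb.omegaOne_rough ht
    norm_x₂ := hb.omegaTwo_le
    dq_psiA := fun t ht h hh z hz => by
      have ha := mem_phaseSpace.1 hz
      have ht0 := ht.1
      have hi : 0 < z.2 + z.2⁻¹ := by positivity
      have h1 := ((hst t ht).dq_action_psiA_le hh hz).trans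
        (mul_le_mul_of_nonneg_right (div_le_div_of_nonneg_right (hβ t ht) (by linarith)) hi.le)
      have h2 := mul_le_mul_of_nonneg_right h1 (abs_nonneg (omega p s z.1 z.2))
      unfold omegaOne omegaTwo
      rw [abs_mul, abs_mul (z.2 + z.2⁻¹), abs_of_pos hi, abs_of_pos ha]
      refine le_trans (le_of_eq (by ring)) (h2.trans (le_of_eq (by ring)))
    dq_psiT := fun t ht h hh z hz => by
      have ht0 := ht.1
      rw [mul_comm]
      exact mul_le_mul_of_nonneg_right (((hst t ht).dq_action_psiT_le hh hz).trans
        (div_le_div_of_nonneg_right (hβ t ht) (by positivity))) (abs_nonneg _)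
    hasDerivAt := fun t ht => hasDerivAt_one_add_rpow _ (by positivity) ht.1
    rate_le := fun t ht => by
      have ht0 := ht.1
      have hτ : 0 < 1 + t := by linarith
      have h1 : 1 ≤ √(1 + t) := Real.one_le_sqrt.2 (by linarith)
      -- In the `Ψ_θa` term the spare root of `1+t` pays for the growth of the coupling.
      have h2 : (1 + t) ^ δ ≤ √(1 + t) := by
        rw [Real.sqrt_eq_rpow]
        exact Real.rpow_le_rpow_of_exponent_le (by linarith) (by linarith [hb.δ_le])
      have e1 : (1 + t) ^ ((p + 1 : ℝ) * δ) = (1 + t) ^ δ * (1 + t) ^ (p * δ) := by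
        rw [← Real.rpow_add hτ]; ring_nf
      have h3 : (1 + t) ^ (p * δ) ≤ (1 + t) ^ ((p + 1 : ℝ) * δ) := by
        rw [e1]
        exact le_mul_of_one_le_left (by positivity) (Bootstrap.one_le_rpow ht0 hδ.le)
      set Q := potConst q * decayGain q lam ^ 2 with hQ
      have hQ0 : 0 ≤ Q := by positivity
      set Y := (1 + t) ^ ((p + 1 : ℝ) * δ) with hY
      have hY0 : 0 ≤ Y := by positivity
      set Z := (1 + t) ^ (p * δ)
      have h4 : Y / ((1 + t) * √(1 + t)) ≤ Y / (1 + t) := by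
        gcongr
        exact le_mul_of_one_le_right hτ.le h1
      have h5 : (1 + t) ^ δ * Y / ((1 + t) * √(1 + t)) ≤ Y / (1 + t) := by
        rw [div_le_div_iff₀ (by positivity) hτ]
        calc _ ≤ √(1 + t) * Y * (1 + t) := by gcongr
          _ = _ := by ring
      have h6 : Z / (1 + t) ≤ Y / (1 + t) := by gcongr
      have g6 := mul_le_mul_of_nonneg_left h6 (by positivity : 0 ≤ 3 * p * Q * ε ^ 3)
      have g4 := mul_le_mul_of_nonneg_left h4 (by positivity : 0 ≤ Q * ε ^ 3 * (|s| + 1))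
      have g5 := mul_le_mul_of_nonneg_left h5 (by positivity : 0 ≤ 2 * Q * ε ^ 3)
      calc _ ≤ |lam| * (Q * (3 * p + (|s| + 1) + 2 * (1 + thetaGain q lam p s) + 2) * ε ^ 3
              * (Y / (1 + t))) := by
            refine mul_le_mul_of_nonneg_left ?_ (abs_nonneg _)
            refine le_trans (le_of_eq ?_) ((add_le_add_left (add_le_add (add_le_add g6 g4) g5)
              (2 * (1 + thetaGain q lam p s) * Q * ε ^ 3 * (Y / (1 + t)))).trans
              (le_of_eq (by ring)))
            rw [hQ, e1]; ring
        _ = _ := by rw [Real.rpow_sub_one hτ.ne', ← hY]; unfold actionGain; ring }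

/-- Integrating the rate gives `1/((p+1)δ)`, absorbed by one factor `ε`. The difference with `1` is
retained, since for `p = 0` it becomes a bound by `t^δ`. -/
theorem omegaTwo_improved (hb : WeightedBootstrap q lam T γ γθ γa ε δ p s) {t : ℝ}
    (ht : t ∈ Icc 0 T) : wNorm (omegaTwo p s) (γa t) ≤ wNorm (omegaTwo p s) (γa 0)
      + ENNReal.ofReal (actionGain q lam p s * ε ^ 2 * ((1 + t) ^ ((p + 1 : ℝ) * δ) - 1)) := by
  have hε := hb.ε_pos
  have hδ := hb.δ_pos
  have ht0 := ht.1
  have hC := actionGain_nonneg hb.q_pos lam p s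
  refine (hb.derivativeBound_action.energy_le ht).trans
    (add_le_add le_rfl (ENNReal.ofReal_le_ofReal ?_))
  have hp : δ ≤ (p + 1 : ℝ) * δ := le_mul_of_one_le_left hδ.le (by simp)
  have hκ : 0 < (p + 1 : ℝ) * δ := hδ.trans_le hp
  have h1 := Bootstrap.one_le_rpow ht0 hκ.le
  have h2 : ε / ((p + 1 : ℝ) * δ) ≤ 1 := (div_le_one hκ).2 (hb.ε_le.trans hp)
  simp only [add_zero, Real.one_rpow]
  have h3 : 0 ≤ (1 + t) ^ ((p + 1 : ℝ) * δ) - 1 := by linarith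
  calc _ = actionGain q lam p s * ε ^ 2 * ((1 + t) ^ ((p + 1 : ℝ) * δ) - 1)
        * (ε / ((p + 1 : ℝ) * δ)) := by ring
    _ ≤ _ := mul_le_of_le_one_right (by positivity) h2

end WeightedBootstrap
end

/-! ### Closing the bootstrap -/

theorem one_le_japanese (t : ℝ) : 1 ≤ japanese t :=
  Real.one_le_sqrt.2 (by linarith [sq_nonneg t])

theorem japanese_le {t : ℝ} (ht : 0 ≤ t) : japanese t ≤ 1 + t :=
  Real.sqrt_le_iff.2 ⟨by linarith, by nlinarith⟩

theorem one_add_le_two_mul_japanese (t : ℝ) : 1 + t ≤ 2 * japanese t := by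
  have h1 := one_le_japanese t
  have h2 : t ≤ japanese t := Real.le_sqrt_of_sq_le (by linarith)
  linarith

theorem japanese_rpow_le {t κ : ℝ} (ht : 0 ≤ t) (hκ : 0 ≤ κ) :
    japanese t ^ κ ≤ (1 + t) ^ κ :=
  Real.rpow_le_rpow (zero_le_one.trans (one_le_japanese t)) (japanese_le ht) hκ

theorem one_add_rpow_le {t δ : ℝ} (ht : 0 ≤ t) (hδ : 0 ≤ δ) (hδ1 : δ ≤ 1) (n : ℕ) :
    (1 + t) ^ (n * δ) ≤ 2 ^ n * japanese t ^ (n * δ) := by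
  have hj : 0 ≤ japanese t := zero_le_one.trans (one_le_japanese t)
  refine (Real.rpow_le_rpow (by linarith) (one_add_le_two_mul_japanese t)
    (by positivity : 0 ≤ n * δ)).trans ?_
  rw [Real.mul_rpow (by norm_num) hj, ← Real.rpow_natCast 2 n]
  gcongr
  · norm_num
  · exact mul_le_of_le_one_right (by positivity) hδ1

theorem sq_le_rpow {ε : ℝ} (hε : 0 < ε) (hε1 : ε ≤ 1) : ε ^ 2 ≤ ε ^ (3 / 2 : ℝ) := by
  rw [← Real.rpow_natCast]
  exact Real.rpow_le_rpow_of_exponent_ge hε hε1 (by norm_num)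

/-- Write `ε² = √ε · ε^{3/2}`; smallness of `ε` makes `√ε` beat the constant. -/
theorem mul_sq_le_rpow {ε K : ℝ} (hε : 0 < ε) (hK : 0 < K) (h : ε ≤ 1 / K ^ 2) :
    K * ε ^ 2 ≤ ε ^ (3 / 2 : ℝ) := by
  have e : ε ^ 2 = √ε * ε ^ (3 / 2 : ℝ) := by
    rw [Real.sqrt_eq_rpow, ← Real.rpow_add hε, ← Real.rpow_natCast]; norm_num
  have h1 : √ε ≤ 1 / K := Real.sqrt_le_iff.2 ⟨by positivity, by simpa using h⟩
  rw [e, ← mul_assoc]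
  refine mul_le_of_le_one_left (by positivity) ?_
  rwa [le_div_iff₀ hK, mul_comm] at h1

/-- The two initial norms are bounded by their sum, so adding the two estimates keeps coefficient
one in front of `ε`. -/
theorem add_le_ofReal_add {a b a₀ b₀ : ℝ≥0∞} {ε x y w : ℝ} (hε : 0 ≤ ε) (hx : 0 ≤ x) (hy : 0 ≤ y)
    (h₀ : a₀ + b₀ ≤ ENNReal.ofReal ε) (ha : a ≤ a₀ + ENNReal.ofReal x)
    (hb : b ≤ b₀ + ENNReal.ofReal y) (hw : x + y ≤ w) : a + b ≤ ENNReal.ofReal (ε + w) := by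
  refine (add_le_add ha hb).trans ?_
  rw [add_add_add_comm, ← ENNReal.ofReal_add hx hy]
  refine (add_le_add h₀ le_rfl).trans ?_
  rw [← ENNReal.ofReal_add hε (by positivity)]
  exact ENNReal.ofReal_le_ofReal (by linarith)

theorem omegaOne_zero_zero : omegaOne 0 0 = fun _ a => a + a⁻¹ := by
  ext θ a; simp [omegaOne, omega]

theorem omegaTwo_zero_zero : omegaTwo 0 0 = fun _ a => a := by
  ext θ a; simp [omegaTwo, omega]

/-! ### Return to the weights `⟨t⟩` and the smallness of the data -/

section
variable {q lam T ε δ : ℝ} {γ : ℝ → L2} {γθ γa : ℝ → ℝ × ℝ → ℝ}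

theorem Bootstrap.of_japanese (hq : 0 < q) (hT : 0 ≤ T) (hs : IsSolution q lam T γ γθ γa)
    (hε : 0 < ε) (hεδ : ε ≤ δ) (hδ : δ ≤ 1 / 12)
    (h₀ : wNorm momentWeight (γ 0) ≤ ENNReal.ofReal ε)
    (h₁ : ∀ t ∈ Icc 0 T, wNorm momentWeight (γ t) ≤ ENNReal.ofReal (ε * japanese t ^ δ))
    (h₂ : ∀ t ∈ Icc 0 T, wNorm (fun _ a => a + a⁻¹) (γθ t)
      + wNorm (fun _ a => a) (γa t) ≤ ENNReal.ofReal (ε * japanese t ^ δ)) :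
    Bootstrap q lam T γ γθ γa ε δ := by
  have hj : ∀ t ∈ Icc 0 T, ENNReal.ofReal (ε * japanese t ^ δ)
      ≤ ENNReal.ofReal (ε * (1 + t) ^ δ) := fun t ht => by
    have := japanese_rpow_le ht.1 (hε.trans_le hεδ).le
    gcongr
  exact ⟨hq, hT, hs, hε, hεδ, hδ, h₀, fun t ht => (h₁ t ht).trans (hj t ht),
    fun t ht => le_self_add.trans ((h₂ t ht).trans (hj t ht)),
    fun t ht => le_add_self.trans ((h₂ t ht).trans (hj t ht))⟩

theorem Bootstrap.weighted_zero (hb : Bootstrap q lam T γ γθ γa ε δ)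
    (h₀ : wNorm (fun _ a => a + a⁻¹) (γθ 0) ≤ ENNReal.ofReal ε) :
    WeightedBootstrap q lam T γ γθ γa ε δ 0 0 where
  toBootstrap := hb
  omegaOne_zero := by rwa [omegaOne_zero_zero]
  omegaOne_le := by simpa [omegaOne_zero_zero] using hb.theta
  omegaTwo_le := by simpa [omegaTwo_zero_zero] using hb.action
  lower_omegaOne := fun p' h => by simp at h
  lower_omegaTwo := fun p' h => by simp at h

/-- The constant in the unweighted estimates. -/
def bootstrapConst (q lam : ℝ) : ℝ :=
  1 + 320 * (|lam| * potConst q) + thetaGain q lam 0 0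
    + 40 * (|lam| * potConst q) * decayGain q lam ^ 2 + actionGain q lam 0 0

theorem bootstrapConst_pos (hq : 0 < q) (lam : ℝ) : 0 < bootstrapConst q lam := by
  have := potConst_nonneg hq
  have := thetaGain_nonneg hq lam 0 0
  have := actionGain_nonneg hq lam 0 0
  unfold bootstrapConst
  positivity

theorem Bootstrap.improved (hb : Bootstrap q lam T γ γθ γa ε δ) {ε₀ : ℝ} (hε₀ : 0 ≤ ε₀)
    (hle : ε₀ ≤ ε) (hsmall : ε ≤ 1 / bootstrapConst q lam ^ 2)
    (h₀ : wNorm momentWeight (γ 0) + wNorm (fun _ a => a + a⁻¹) (γθ 0)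
      + wNorm (fun _ a => a) (γa 0) ≤ ENNReal.ofReal ε₀) {t : ℝ} (ht : t ∈ Icc 0 T) :
    wNorm (fun _ a => a ^ (-20 : ℤ) + a ^ 20) (γ t) + wNorm (fun _ a => a + a⁻¹) (γθ t)
        ≤ ENNReal.ofReal (ε₀ + ε ^ (3 / 2 : ℝ)) ∧
      wNorm (fun θ _ => θ ^ 20) (γ t) + wNorm (fun _ a => a) (γa t)
        ≤ ENNReal.ofReal (ε₀ + ε ^ (3 / 2 : ℝ) * t ^ δ) := by
  have hε := hb.ε_pos
  have hδ := hb.δ_pos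
  have ht0 := ht.1
  have hP := potConst_nonneg hb.q_pos
  have hθ := thetaGain_nonneg hb.q_pos lam 0 0
  have ha := actionGain_nonneg hb.q_pos lam 0 0
  have hw := hb.weighted_zero ((le_add_self.trans le_self_add).trans
    (h₀.trans (ENNReal.ofReal_le_ofReal hle)))
  have hX : 0 ≤ |lam| * potConst q := by positivity
  have hY : 0 ≤ |lam| * potConst q * decayGain q lam ^ 2 := by positivity
  have small := mul_sq_le_rpow hε (bootstrapConst_pos hb.q_pos lam) hsmall
  have h1 := hb.actionWeight_le ht
  have h2 := hb.theta_pow_le ht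
  have h3 := hw.omegaOne_improved ht
  have h4 := hw.omegaTwo_improved ht
  rw [omegaOne_zero_zero] at h3
  rw [omegaTwo_zero_zero] at h4
  simp only [Nat.cast_zero, zero_mul, Real.rpow_zero, mul_one, zero_add, one_mul] at h3 h4
  have e3 : ε ^ 3 ≤ ε ^ 2 := pow_le_pow_of_le_one hε.le hb.ε_le_one (by norm_num)
  have hg := Bootstrap.one_le_rpow ht0 hδ.le
  have hsq : 0 < ε ^ 2 := by positivity
  have n : 0 ≤ (1 + t) ^ δ - 1 := by linarith
  constructor
  · refine add_le_ofReal_add hε₀ (by positivity) (by positivity) (le_trans ?_ h₀) h1 h3 ?_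
    · refine le_trans (add_le_add (wNorm_mono fun z hz => ?_) le_rfl) le_self_add
      exact abs_le_abs_of_nonneg (actionWeight_nonneg (mem_phaseSpace.1 hz))
        (actionWeight_le_momentWeight _)
    · refine le_trans ?_ small
      unfold bootstrapConst
      nlinarith [mul_le_mul_of_nonneg_left e3 hX, mul_nonneg hY hsq.le, mul_nonneg ha hsq.le]
  -- Subadditivity of `x ↦ x^δ` for `δ ≤ 1` turns the increment into `t^δ`, which vanishes at time
  -- zero, rather than `⟨t⟩^δ`.
  · have hsub : (1 + t) ^ δ - 1 ≤ t ^ δ := by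
      have := Real.rpow_add_le_add_rpow zero_le_one ht0 hδ.le (by linarith [hb.δ_le])
      rw [Real.one_rpow] at this
      linarith
    refine add_le_ofReal_add hε₀ (by positivity) (by positivity) (le_trans ?_ h₀) h2 h4 ?_
    · refine add_le_add ((wNorm_mono fun z hz => ?_).trans le_self_add) le_rfl
      have ha := mem_phaseSpace.1 hz
      have h1 : 0 ≤ z.1 ^ 20 := Even.pow_nonneg (by decide) _
      have h2 := actionWeight_nonneg ha
      refine abs_le_abs_of_nonneg h1 ?_
      unfold actionWeight at h2
      unfold momentWeight; linarith
    · calc _ = (40 * (|lam| * potConst q) * decayGain q lam ^ 2 + actionGain q lam 0 0) * ε ^ 2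
            * ((1 + t) ^ δ - 1) := by ring
        _ ≤ bootstrapConst q lam * ε ^ 2 * ((1 + t) ^ δ - 1) := by
            gcongr
            unfold bootstrapConst
            linarith
        _ ≤ ε ^ (3 / 2 : ℝ) * t ^ δ := by gcongr

/-- The constant in the weighted estimates. -/
def weightedConst (q lam : ℝ) (p : ℕ) (s : ℝ) : ℝ :=
  1 + thetaGain q lam p s * 2 ^ p + actionGain q lam p s * 2 ^ (p + 1)

theorem weightedConst_pos (hq : 0 < q) (lam : ℝ) (p : ℕ) (s : ℝ) : 0 < weightedConst q lam p s := by
  have := thetaGain_nonneg hq lam p s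
  have := actionGain_nonneg hq lam p s
  unfold weightedConst
  positivity

/-- A multiplicative constant is allowed here, so `ε² ≤ ε^{3/2}` suffices, and `1 + t ≤ 2⟨t⟩` costs
only the factor `2^n`. -/
theorem le_ofReal_weighted {a a₀ : ℝ≥0∞} {ε₀ K C x : ℝ} (hε : 0 < ε) (hε1 : ε ≤ 1) (hε₀ : 0 ≤ ε₀)
    (hδ : 0 ≤ δ) (hδ1 : δ ≤ 1) (hK : 0 ≤ K) {t : ℝ} (ht : 0 ≤ t) {n : ℕ} (hC : 1 ≤ C)
    (hKC : K * 2 ^ n ≤ C) (h₀ : a₀ ≤ ENNReal.ofReal ε₀) (hx : x ≤ (1 + t) ^ (n * δ))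
    (ha : a ≤ a₀ + ENNReal.ofReal (K * ε ^ 2 * x)) :
    a ≤ ENNReal.ofReal (C * (ε₀ + ε ^ (3 / 2 : ℝ) * japanese t ^ (n * δ))) := by
  have h1 := sq_le_rpow hε hε1
  have h2 := one_add_rpow_le ht hδ hδ1 n
  have hj : 0 ≤ japanese t := zero_le_one.trans (one_le_japanese t)
  have h3 : K * ε ^ 2 * x ≤ C * (ε ^ (3 / 2 : ℝ) * japanese t ^ (n * δ)) := by
    calc _ ≤ K * ε ^ 2 * (2 ^ n * japanese t ^ (n * δ)) := by
          have := hx.trans h2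
          gcongr
      _ ≤ K * ε ^ (3 / 2 : ℝ) * (2 ^ n * japanese t ^ (n * δ)) := by gcongr
      _ = K * 2 ^ n * (ε ^ (3 / 2 : ℝ) * japanese t ^ (n * δ)) := by ring
      _ ≤ _ := by gcongr
  refine ha.trans ((add_le_add (h₀.trans (ENNReal.ofReal_le_ofReal
    (le_mul_of_one_le_left hε₀ hC))) (ENNReal.ofReal_le_ofReal h3)).trans ?_)
  rw [← ENNReal.ofReal_add (by positivity) (by positivity), mul_add]

theorem WeightedBootstrap.improved {p : ℕ} {s : ℝ}
    (hb : WeightedBootstrap q lam T γ γθ γa ε δ p s) {ε₀ : ℝ} (hε₀ : 0 ≤ ε₀)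
    (h₁ : wNorm (omegaOne p s) (γθ 0) ≤ ENNReal.ofReal ε₀)
    (h₂ : wNorm (omegaTwo p s) (γa 0) ≤ ENNReal.ofReal ε₀) {t : ℝ} (ht : t ∈ Icc 0 T) :
    wNorm (omegaOne p s) (γθ t) ≤ ENNReal.ofReal
        (weightedConst q lam p s * (ε₀ + ε ^ (3 / 2 : ℝ) * japanese t ^ ((p : ℝ) * δ))) ∧
      wNorm (omegaTwo p s) (γa t) ≤ ENNReal.ofReal
        (weightedConst q lam p s * (ε₀ + ε ^ (3 / 2 : ℝ) * japanese t ^ ((p + 1 : ℝ) * δ))) := by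
  have hθ := thetaGain_nonneg hb.q_pos lam p s
  have ha := actionGain_nonneg hb.q_pos lam p s
  have hθ' : 0 ≤ thetaGain q lam p s * 2 ^ p := by positivity
  have ha' : 0 ≤ actionGain q lam p s * 2 ^ (p + 1) := by positivity
  have hδ1 : δ ≤ 1 := by linarith [hb.δ_le]
  constructor
  · exact le_ofReal_weighted hb.ε_pos hb.ε_le_one hε₀ hb.δ_pos.le hδ1 hθ ht.1
      (by unfold weightedConst; linarith) (by unfold weightedConst; linarith) h₁ le_rfl
      (hb.omegaOne_improved ht)
  · have := le_ofReal_weighted (n := p + 1) hb.ε_pos hb.ε_le_one hε₀ hb.δ_pos.le hδ1 ha ht.1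
      (C := weightedConst q lam p s)
      (by unfold weightedConst; linarith) (by unfold weightedConst; linarith) h₂
      (by push_cast; linarith) (hb.omegaTwo_improved ht)
    simpa only [Nat.cast_add, Nat.cast_one] using this

end

end PointCharge

end

theorem proposition1p2 (q : ℝ) (hq : 0 < q) (lam : ℝ) :
    (∃ εstar : ℝ, 0 < εstar ∧
      ∀ ε₀ ε₁ δ : ℝ, 0 < ε₀ → ε₀ ≤ ε₁ → ε₁ ≤ δ → δ < εstar →
      ∀ (T : ℝ) (γ : ℝ → PointCharge.L2) (γθ γa : ℝ → ℝ × ℝ → ℝ), 0 ≤ T →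
        PointCharge.IsSolution q lam T γ γθ γa →
        PointCharge.wNorm PointCharge.momentWeight (γ 0)
            + PointCharge.wNorm (fun _ a => a + a⁻¹) (γθ 0)
            + PointCharge.wNorm (fun _ a => a) (γa 0) ≤ ENNReal.ofReal ε₀ →
        (∀ t ∈ Set.Icc 0 T,
          PointCharge.wNorm PointCharge.momentWeight (γ t)
            + PointCharge.wNorm (fun _ a => a + a⁻¹) (γθ t)
            + PointCharge.wNorm (fun _ a => a) (γa t)
              ≤ ENNReal.ofReal (ε₁ * PointCharge.japanese t ^ δ)) →
        ∀ t ∈ Set.Icc 0 T,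
          PointCharge.wNorm (fun _ a => a ^ (-20 : ℤ) + a ^ 20) (γ t)
              + PointCharge.wNorm (fun _ a => a + a⁻¹) (γθ t)
                ≤ ENNReal.ofReal (ε₀ + ε₁ ^ (3 / 2 : ℝ)) ∧
          PointCharge.wNorm (fun θ _ => θ ^ 20) (γ t)
              + PointCharge.wNorm (fun _ a => a) (γa t)
                ≤ ENNReal.ofReal (ε₀ + ε₁ ^ (3 / 2 : ℝ) * t ^ δ)) ∧
    (∀ (p : ℕ) (s : ℝ), ∃ εstar C : ℝ, 0 < εstar ∧ 0 < C ∧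
      ∀ I : Set (ℕ × ℝ), PointCharge.IsCompatible I → (0, 0) ∈ I → (p, s) ∈ I →
      ∀ ε₀ ε₁ δ : ℝ, 0 < ε₀ → ε₀ ≤ ε₁ → ε₁ ≤ δ → δ < εstar →
      ∀ (T : ℝ) (γ : ℝ → PointCharge.L2) (γθ γa : ℝ → ℝ × ℝ → ℝ), 0 ≤ T →
        PointCharge.IsSolution q lam T γ γθ γa →
        (∀ i ∈ I,
          PointCharge.wNorm (PointCharge.omegaOne i.1 i.2) (γθ 0)
            + PointCharge.wNorm (PointCharge.omegaTwo i.1 i.2) (γa 0)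
            + PointCharge.wNorm PointCharge.momentWeight (γ 0) ≤ ENNReal.ofReal ε₀) →
        (∀ t ∈ Set.Icc 0 T,
          PointCharge.wNorm PointCharge.momentWeight (γ t)
            ≤ ENNReal.ofReal (ε₁ * PointCharge.japanese t ^ δ)) →
        (∀ i ∈ I, ∀ t ∈ Set.Icc 0 T,
          PointCharge.wNorm (PointCharge.omegaOne i.1 i.2) (γθ t)
            + PointCharge.wNorm (PointCharge.omegaTwo i.1 i.2) (γa t)
              ≤ ENNReal.ofReal (ε₁ * PointCharge.japanese t ^ ((i.1 + 1 : ℝ) * δ))) →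
        ∀ t ∈ Set.Icc 0 T,
          PointCharge.wNorm (PointCharge.omegaOne p s) (γθ t)
            ≤ ENNReal.ofReal
                (C * (ε₀ + ε₁ ^ (3 / 2 : ℝ) * PointCharge.japanese t ^ ((p : ℝ) * δ))) ∧
          PointCharge.wNorm (PointCharge.omegaTwo p s) (γa t)
            ≤ ENNReal.ofReal
                (C * (ε₀ + ε₁ ^ (3 / 2 : ℝ) * PointCharge.japanese t ^ ((p + 1 : ℝ) * δ)))) := by
  -- The threshold `1/12` keeps the rates integrable despite the growing norms. In (A) the second
  -- threshold lets `ε^{3/2}` absorb the constant; in (B) the constant is kept.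
  refine ⟨⟨min (1 / 12) (1 / PointCharge.bootstrapConst q lam ^ 2), ?_, ?_⟩, fun p s =>
    ⟨1 / 12, PointCharge.weightedConst q lam p s, by norm_num,
      PointCharge.weightedConst_pos hq lam p s, ?_⟩⟩
  · have := PointCharge.bootstrapConst_pos hq lam
    positivity
  · intro ε₀ ε₁ δ h0 h01 h1δ hδ T γ γθ γa hT hs hi hbd t ht
    have h1 : 0 < ε₁ := h0.trans_le h01
    rw [lt_min_iff] at hδ
    have hb : PointCharge.Bootstrap q lam T γ γθ γa ε₁ δ :=
      .of_japanese hq hT hs h1 h1δ hδ.1.le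
        ((le_self_add.trans le_self_add).trans (hi.trans (ENNReal.ofReal_le_ofReal h01)))
        (fun t ht => (le_self_add.trans le_self_add).trans (hbd t ht))
        (fun t ht => by
          refine le_trans ?_ (hbd t ht)
          rw [add_assoc]
          exact le_add_self)
    exact hb.improved h0.le h01 (h1δ.trans hδ.2.le) hi ht
  · intro I hI h00 hps ε₀ ε₁ δ h0 h01 h1δ hδ T γ γθ γa hT hs hi hm hbd t ht
    have h1 : 0 < ε₁ := h0.trans_le h01
    have hδ0 : 0 < δ := h1.trans_le h1δ
    have hle := ENNReal.ofReal_le_ofReal h01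
    -- The weight `1` in the family supplies the unweighted derivative bounds that control the
    -- potential.
    have hb : PointCharge.Bootstrap q lam T γ γθ γa ε₁ δ :=
      .of_japanese hq hT hs h1 h1δ hδ.le (le_add_self.trans ((hi _ h00).trans hle)) hm
        (by simpa [PointCharge.omegaOne_zero_zero, PointCharge.omegaTwo_zero_zero]
          using hbd _ h00)
    have hj : ∀ t ∈ Set.Icc 0 T, ∀ n : ℕ,
        ENNReal.ofReal (ε₁ * PointCharge.japanese t ^ ((n + 1 : ℝ) * δ))
          ≤ ENNReal.ofReal (ε₁ * (1 + t) ^ ((n + 1 : ℝ) * δ)) := fun t ht n => by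
      have := PointCharge.japanese_rpow_le ht.1 (by positivity : 0 ≤ (n + 1 : ℝ) * δ)
      gcongr
    -- Compatibility supplies exactly the two lower weights produced when `ω_{p,s}` is
    -- differentiated in `θ`.
    have hlow : ∀ p', p = p' + 1 → ∀ r, r = s ∨ r = s - 3 → (p', r) ∈ I := by
      rintro p' rfl r (rfl | rfl)
      · exact (hI p' _ hps).2
      · exact (hI p' _ hps).1
    have hi_ps : PointCharge.wNorm (PointCharge.omegaOne p s) (γθ 0)
        + PointCharge.wNorm (PointCharge.omegaTwo p s) (γa 0)
        + PointCharge.wNorm PointCharge.momentWeight (γ 0) ≤ ENNReal.ofReal ε₀ := hi (p, s) hps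
    have hw : PointCharge.WeightedBootstrap q lam T γ γθ γa ε₁ δ p s :=
      { toBootstrap := hb
        omegaOne_zero := le_trans (le_self_add.trans le_self_add) (hi_ps.trans hle)
        omegaOne_le := fun t ht => le_self_add.trans ((hbd (p, s) hps t ht).trans (hj t ht p))
        omegaTwo_le := fun t ht => le_add_self.trans ((hbd (p, s) hps t ht).trans (hj t ht p))
        lower_omegaOne := fun p' h t ht r hr => by
          have := le_self_add.trans ((hbd (p', r) (hlow p' h r hr) t ht).trans (hj t ht p'))
          simpa [h] using this
        lower_omegaTwo := fun p' h t ht r hr => by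
          have := le_add_self.trans ((hbd (p', r) (hlow p' h r hr) t ht).trans (hj t ht p'))
          simpa [h] using this }
    exact hw.improved h0.le (le_trans (le_self_add.trans le_self_add) hi_ps)
      (le_trans (le_add_self.trans le_self_add) hi_ps) ht
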